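/- **Setting.** Let $\tfrac12<s<1$, let $\delta>0$ satisfy $\tfrac12+\delta<s$, and work on $\mathbb R^5$ with real-valued functions. Let $\chi\in C_c^\infty(\mathbb R^5)$ be real and even with $\chi=1$ on $|\eta|\le1$ and $\operatorname{supp}\chi\subset\{|\eta|\le2\}$, and let $P_{\le N}$ be the Fourier multiplier with symbol $\chi(\eta/N)$. Let $\psi\in\mathcal S(\mathbb R^5)$ be real and even with $\operatorname{supp}\psi\subset[-1,1]^5$ and $\sum_{n\in\mathbb Z^5}\psi(\eta-n)=1$ for all $\eta$; $\psi(D-n)$ is the multiplier with symbol $\psi(\eta-n)$. On a probability space let $(\beta_k)_{k\in\mathbb N}$ be independent real Brownian motions, $(e_k)$ an orthonormal basis of $L^2(\mathbb R^5)$, and $\phi\in \mathrm{HS}(L^2(\mathbb R^5);H^1(\mathbb R^5))$. Let $(u_0,u_1)\in H^s(\mathbb R^5)\times H^{s-1}(\mathbb R^5)$. Let $g_{n,j}$ ($n\in\mathbb Z^5$, $j=0,1$) be complex mean-zero random variables with $g_{-n,j}=\overline{g_{n,j}}$ such that the real random variables $g_{0,j},\operatorname{Re}g_{n,j},\operatorname{Im}g_{n,j}$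 ($j=0,1$, $n$ in the half lattice $\bigcup_{k=0}^{4}\mathbb Z^k\times\mathbb Z_{>0}\times\{0\}^{4-k}$) are independent, are independent of the $\beta_k$, and each such variable $X$ satisfies $\mathbb E\,e^{\gamma X}\le e^{c\gamma^2}$ for all $\gamma\in\mathbb R$ with a common $c>0$. For dyadic $N=2^k\ge1$ put $u_{j,N}^\omega=\sum_{n}g_{n,j}(\omega)P_{\le N}\psi(D-n)u_j$, $Q(t)=\frac{\sin(t|\nabla|)}{|\nabla|}$, $S(t)(f_0,f_1)=\cos(t|\nabla|)f_0+Q(t)f_1$, and $$\widetilde z_N(t)=-\tfrac{|\nabla|}{\langle\nabla\rangle}\sin(t|\nabla|)u^\omega_{0,N}+\tfrac{\cos(t|\nabla|)}{\langle\nabla\rangle}u^\omega_{1,N},\qquad \Psi_N(t)=\sum_k\int_0^tQ(t-t')P_{\le N}\phi e_k\,d\beta_k(t'),$$ $\widetilde\Psi_N(t)=S(t)(u_{0,N}^\omega,u_{1,N}^\omega)+\Psi_N(t)$, where $\Psi_N$ is taken in its version with paths that are continuously differentiable with values in $L^2$. Put $$\|f\|_{Y(T)}=\|f\|_{L^{10}_tL^{10/3}_x}^{10}+\|\langle\nabla\rangle^{s-\delta}f\|_{L^\infty_tL^5_x},\qquad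 \|f\|_{Z(T)}=\|f\|_{L^6_tL^{30/7}_x}^6+\|f\|_{L^\infty_tL^{10/3}_x}^{10}+\|f\|_{L^\infty_tL^5_x}^2,$$ all norms over $[0,T]\times\mathbb R^5$, and $$E(v,\partial_tv)=\frac12\int_{\mathbb R^5}\big(|\partial_tv|^2+|\nabla v|^2\big)dx+\frac14\iint_{\mathbb R^5\times\mathbb R^5}\frac{|v(x)|^2|v(y)|^2}{|x-y|^4}\,dx\,dy.$$ A solution $v_N$ on $[0,T]$ of $$\partial_t^2v_N-\Delta v_N+\mathcal N(v_N+\widetilde\Psi_N)=0,\quad (v_N,\partial_tv_N)|_{t=0}=(0,0),\qquad \mathcal N(u)=(|\cdot|^{-4}*|u|^2)u,$$ is a real-valued function with $(v_N,\partial_tv_N)\in C([0,T];H^1\times L^2)$ and $\mathcal N(v_N+\widetilde\Psi_N)\in L^1([0,T];L^2)$ that satisfies $v_N(t)=-\int_0^tQ(t-t')\mathcal N(v_N+\widetilde\Psi_N)(t')\,dt'$; the smooth solutions are of this kind. **Proposition 4.6 (D-bound).** Let $s$ and $\delta$ be as above. There are constants $C(K,T)>0$, depending only on $K$ and $T$ (and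 on $s,\delta$), such that in every setting as above and for every dyadic $N\ge1$ the following holds almost surely. Whenever $K,T>0$ and $$\|\widetilde\Psi_N\|_{Z(T)}<K,\qquad \|\widetilde z_N\|_{Y(T)}<K,\qquad \|\partial_t\Psi_N\|_{L^{10}_tL^{10/3}_x([0,T]\times\mathbb R^5)}<K,$$ every solution $v_N$ on $[0,T]$ satisfies $$E(v_N(t),\partial_tv_N(t))\le C(K,T)\quad\text{for all }t\in[0,T],\qquad \sup_{t\in[0,T]}\|(v_N(t),\partial_tv_N(t))\|_{H^1\times L^2}^2\le C(K,T).$$ In particular the bounds are uniform in $N$. -/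

import Mathlib

open MeasureTheory ProbabilityTheory Filter Topology FourierTransform
open scoped ENNReal NNReal SchwartzMap

noncomputable section

namespace HartreeWave

/-- The physical space `ℝ⁵`. -/
abbrev E5 : Type := EuclideanSpace ℝ (Fin 5)

/-- Complex `L²(ℝ⁵)`. -/
abbrev L2 : Type := Lp ℂ 2 (volume : Measure E5)

/-- Real `L²(ℝ⁵)`, the space on which the noise lives. -/
abbrev L2R : Type := Lp ℝ 2 (volume : Measure E5)

/-- A real square integrable function, regarded as a complex valued one. -/
def complexify (f : L2R) : L2 := Complex.ofRealCLM.compLp f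

/-! ### Fourier multipliers

Symbols are written in the angular frequency variable `η`, so that `∇` has symbol `i η`.
With Mathlib's normalisation `𝓕 f(ξ) = ∫ exp(-2πi x·ξ) f(x) dx` this is `η = 2π ξ`. -/

/-- The Fourier multiplier with symbol `m` on `L²(ℝ⁵)`, defined on those `f` for which `m · f̂` is
square integrable (and `0` elsewhere). -/
def mult (m : E5 → ℝ) (f : L2) : L2 :=
  open Classical in
  if h : MemLp (fun ξ : E5 ↦ ((m ((2 * Real.pi) • ξ) : ℝ) : ℂ) * (𝓕 f : L2) ξ) 2 volume then
    𝓕⁻ (h.toLp _) else 0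

/-- The symbol `(1 + |η|²)^(σ/2)` of `⟨∇⟩^σ`. -/
def japanese (σ : ℝ) (η : E5) : ℝ := (1 + ‖η‖ ^ 2) ^ (σ / 2)

/-- `Q(t) = sin(t|∇|)/|∇|` (the value of the symbol at the single frequency `0` is immaterial). -/
def Q (t : ℝ) : L2 → L2 := mult fun η ↦ Real.sin (t * ‖η‖) / ‖η‖

/-- `S(t)(f₀, f₁) = cos(t|∇|) f₀ + Q(t) f₁`, the linear wave propagator. -/
def S (t : ℝ) (f₀ f₁ : L2) : L2 := mult (fun η ↦ Real.cos (t * ‖η‖)) f₀ + Q t f₁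

/-- `S̃(t)(f₀, f₁) = -(|∇|/⟨∇⟩) sin(t|∇|) f₀ + (cos(t|∇|)/⟨∇⟩) f₁`, so that `∂ₜ S = ⟨∇⟩ S̃`. -/
def Stilde (t : ℝ) (f₀ f₁ : L2) : L2 :=
  mult (fun η ↦ -(‖η‖ / japanese 1 η * Real.sin (t * ‖η‖))) f₀ +
    mult (fun η ↦ Real.cos (t * ‖η‖) / japanese 1 η) f₁

/-- The cutoff `χ` used for the Littlewood–Paley projections: smooth, even (so that the projections
preserve real valued functions), equal to `1` for `|η| ≤ 1` and supported in `|η| ≤ 2`. -/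
structure IsCutoff (χ : E5 → ℝ) : Prop where
  smooth : ContDiff ℝ (⊤ : ℕ∞) χ
  even : ∀ η, χ (-η) = χ η
  eq_one : ∀ η, ‖η‖ ≤ 1 → χ η = 1
  eq_zero : ∀ η, 2 < ‖η‖ → χ η = 0

/-- The Littlewood–Paley projection `P_{≤ N}` on `L²`. -/
def lowFreq (χ : E5 → ℝ) (N : ℝ) : L2 → L2 := mult fun η ↦ χ (N⁻¹ • η)

/-! ### Norms and energy -/

/-- The square of the norm of `f` in `H^σ(ℝ⁵)`; it is `∞` if `f ∉ H^σ`. -/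
def sobolevNormSq (σ : ℝ) (f : L2) : ℝ≥0∞ :=
  ∫⁻ ξ : E5, ENNReal.ofReal (japanese σ ((2 * Real.pi) • ξ) ^ 2) * ‖(𝓕 f : L2) ξ‖ₑ ^ 2

/-- `∫ |∇f|² dx`, by Plancherel; it is `∞` if `f` is not in `H¹`. -/
def gradNormSq (f : L2) : ℝ≥0∞ :=
  ∫⁻ ξ : E5, ENNReal.ofReal (‖(2 * Real.pi) • ξ‖ ^ 2) * ‖(𝓕 f : L2) ξ‖ₑ ^ 2

/-- The energy
`E(f, g) = ½ ∫ (|g|² + |∇f|²) dx + ¼ ∬ |f(x)|² |f(y)|² / |x - y|⁴ dx dy`. -/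
def energy (f g : L2) : ℝ≥0∞ :=
  ((∫⁻ x : E5, ‖g x‖ₑ ^ 2) + gradNormSq f) / 2 +
    (∫⁻ x : E5, ∫⁻ y : E5, ‖f x‖ₑ ^ 2 * ‖f y‖ₑ ^ 2 / ‖x - y‖ₑ ^ 4) / 4

/-- The square of the norm of `(f, g)` in `H¹(ℝ⁵) × L²(ℝ⁵)`. -/
def energySpaceNormSq (f g : L2) : ℝ≥0∞ := sobolevNormSq 1 f + ∫⁻ x : E5, ‖g x‖ₑ ^ 2

/-- The norm of `f` in `L^q_t L^r_x([0,T] × ℝ⁵)`. -/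
def mixedNorm (q r : ℝ≥0∞) (T : ℝ) (f : ℝ → L2) : ℝ≥0∞ :=
  eLpNorm (fun t ↦ eLpNorm (f t) r (volume : Measure E5)) q (volume.restrict (Set.Icc 0 T))

/-- `‖f‖_{Y(T)}`, with parameters `s` and `δ`. -/
def normY (s δ T : ℝ) (f : ℝ → L2) : ℝ≥0∞ :=
  mixedNorm 10 (10 / 3) T f ^ 10 + mixedNorm ∞ 5 T fun t ↦ mult (japanese (s - δ)) (f t)

/-- `‖f‖_{Z(T)}`. -/
def normZ (T : ℝ) (f : ℝ → L2) : ℝ≥0∞ :=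
  mixedNorm 6 (30 / 7) T f ^ 6 + mixedNorm ∞ (10 / 3) T f ^ 10 + mixedNorm ∞ 5 T f ^ 2

/-! ### Wiener randomisation of the initial data -/

/-- The point of `ℝ⁵` with integer coordinates `n`. -/
def latticePoint (n : Fin 5 → ℤ) : E5 := WithLp.toLp 2 fun i ↦ (n i : ℝ)

/-- The bump function `ψ` of the uniform decomposition of frequency space. -/
structure IsUniformBump (ψ : 𝓢(E5, ℝ)) : Prop where
  supp : ∀ η, ψ η ≠ 0 → ∀ i, |η i| ≤ 1
  even : ∀ η, ψ (-η) = ψ η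
  partition : ∀ η, HasSum (fun n : Fin 5 → ℤ ↦ ψ (η - latticePoint n)) 1

/-- The half lattice `⋃ₖ ℤᵏ × ℤ_{>0} × {0}^(4-k)`. -/
def halfLattice : Set (Fin 5 → ℤ) := {n | ∃ k, 0 < n k ∧ ∀ j, k < j → n j = 0}

variable {Ω : Type*} [MeasurableSpace Ω]

/-- The family of real random variables `g_{0,j}`, `Re g_{n,j}`, `Im g_{n,j}`, where `n` runs
through the half lattice and `j = 0, 1`. -/
def realCoords (g : (Fin 5 → ℤ) → Fin 2 → Ω → ℂ) :
    Fin 2 × Option (halfLattice × Bool) → Ω → ℝ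
  | (j, none) => fun ω ↦ (g 0 j ω).re
  | (j, some (n, false)) => fun ω ↦ (g n j ω).re
  | (j, some (n, true)) => fun ω ↦ (g n j ω).im

/-- The random coefficients of the Wiener randomisation: mean zero, `g_{-n,j} = conj g_{n,j}`,
independent apart from this relation, with uniformly sub-Gaussian real and imaginary parts, and
independent of the noise (given by the Brownian motions `β`). -/
structure IsRandomCoeff (P : Measure Ω) (β : ℕ → ℝ≥0 → Ω → ℝ)
    (g : (Fin 5 → ℤ) → Fin 2 → Ω → ℂ) : Prop where
  measurable : ∀ n j, Measurable (g n j)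
  conj : ∀ n j ω, g (-n) j ω = starRingEnd ℂ (g n j ω)
  mean_zero : ∀ n j, ∫ ω, g n j ω ∂P = 0
  indep : iIndepFun (realCoords g) P
  subgaussian : ∃ c : ℝ≥0, ∀ i, HasSubgaussianMGF (realCoords g i) c P
  indep_noise : IndepFun (fun ω i ↦ realCoords g i ω)
    (fun ω (p : ℕ × ℝ≥0) ↦ β p.1 p.2 ω) P

/-- A tempered distribution is real if it is real on real test functions. -/
def IsRealDistribution (u : 𝓢'(E5, ℂ)) : Prop :=
  ∀ f : 𝓢(E5, ℂ), (∀ x, (f x).im = 0) → (u f).im = 0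

/-- The square integrable function which represents a tempered distribution (`0` if there is
none). -/
def l2Rep (u : 𝓢'(E5, ℂ)) : L2 :=
  open Classical in
  if h : ∃ f : L2, u = (f : 𝓢'(E5, ℂ)) then h.choose else 0

/-- The truncated randomised datum `∑ₙ gₙ P_{≤ N} ψ(D - n) u`, where only finitely many terms do not
vanish. For `u` in some `H^σ` it is a square integrable function. -/
def truncatedDatum (χ : E5 → ℝ) (ψ : 𝓢(E5, ℝ)) (N : ℝ) (g : (Fin 5 → ℤ) → ℂ)
    (u : 𝓢'(E5, ℂ)) : L2 :=
  l2Rep (∑ᶠ n : Fin 5 → ℤ, g n • TemperedDistribution.fourierMultiplierCLM ℂ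
    (fun ξ : E5 ↦ ((χ (N⁻¹ • (2 * Real.pi) • ξ) *
      ψ ((2 * Real.pi) • ξ - latticePoint n) : ℝ) : ℂ)) u)

/-! ### The stochastic convolution -/

/-- `I = ∫₀ᵗ G(t') dB(t')`, the Wiener integral of the (continuous, deterministic) `L²`-valued
function `G`: the limit in `L²(Ω; L²(ℝ⁵))` of the left Riemann sums. -/
def IsWienerIntegral (P : Measure Ω) (B : ℝ≥0 → Ω → ℝ) (G : ℝ → L2) (t : ℝ) (I : Ω → L2) : Prop :=
  AEStronglyMeasurable I P ∧
  Tendsto (fun n : ℕ ↦ eLpNorm (fun ω ↦ I ω - ∑ i ∈ Finset.range n,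
      (B (t * (i + 1) / n).toNNReal ω - B (t * i / n).toNNReal ω) • G (t * i / n)) 2 P)
    atTop (𝓝 0)

/-- `Ψ` is the stochastic convolution
`Ψ(t) = ∑ₖ ∫₀ᵗ Q(t - t') hₖ dβₖ(t')`, in its version with continuously differentiable paths
in `L²(ℝ⁵)`, and `Ψ'` is its time derivative. The integrals are Wiener integrals and
the series converges in `L²(Ω; L²(ℝ⁵))`. -/
structure IsStochasticConvolution (P : Measure Ω) (β : ℕ → ℝ≥0 → Ω → ℝ) (h : ℕ → L2)
    (Ψ Ψ' : ℝ → Ω → L2) : Prop where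
  measurable : ∀ t, 0 ≤ t → AEStronglyMeasurable (Ψ t) P
  series : ∃ I : ℕ → ℝ → Ω → L2,
    (∀ k t, 0 ≤ t → IsWienerIntegral P (β k) (fun t' ↦ Q (t - t') (h k)) t (I k t)) ∧
    ∀ t, 0 ≤ t → Tendsto (fun n : ℕ ↦
      eLpNorm (fun ω ↦ Ψ t ω - ∑ k ∈ Finset.range n, I k t ω) 2 P) atTop (𝓝 0)
  paths : ∀ᵐ ω ∂P, (∀ t, 0 ≤ t → HasDerivWithinAt (fun t ↦ Ψ t ω) (Ψ' t ω) (Set.Ici 0) t) ∧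
    ContinuousOn (fun t ↦ Ψ' t ω) (Set.Ici 0)

/-- `φ` (real operator on `L²(ℝ⁵)`) is a Hilbert–Schmidt operator from `L²` to `H¹`. -/
def IsHilbertSchmidtH1 (e : HilbertBasis ℕ ℝ L2R) (φ : L2R →L[ℝ] L2R) : Prop :=
  ∑' k, sobolevNormSq 1 (complexify (φ (e k))) < ∞

/-- Independent real Brownian motions `β₀, β₁, …`; with an orthonormal basis `e` of `L²(ℝ⁵)` they
give the cylindrical Wiener process `W = ∑ₖ βₖ eₖ`. -/
structure IsBrownianFamily (P : Measure Ω) (β : ℕ → ℝ≥0 → Ω → ℝ) : Prop where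
  brownian : ∀ k, IsBrownianReal (β k) P
  indep : iIndepFun (fun k ω t ↦ β k t ω) P

/-! ### The perturbed equation -/

/-- The Hartree nonlinearity `𝒩(u) = (|·|⁻⁴ ∗ |u|²) u`. -/
def hartree (u : E5 → ℂ) (x : E5) : ℂ := ((∫ y, ‖u y‖ ^ 2 / ‖x - y‖ ^ 4 : ℝ) : ℂ) * u x

/-- `𝒩(u)` as an element of `L²` (`0` if it is not square integrable). -/
def hartreeL2 (u : L2) : L2 :=
  open Classical in
  if h : MemLp (hartree u) 2 (volume : Measure E5) then h.toLp _ else 0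

/-- `v`, with time derivative `v'`, is a real valued solution on `[0,T]` of
`∂ₜ² v - Δ v + 𝒩(v + f) = 0`, `(v, ∂ₜ v)(0) = (0, 0)`, in the sense of Duhamel's formula
`v(t) = - ∫₀ᵗ Q(t - t') 𝒩(v + f)(t') dt'`, with `(v, ∂ₜ v) ∈ C([0,T]; H¹ × L²)` and
`𝒩(v + f) ∈ L¹([0,T]; L²)`. -/
structure IsSolution (T : ℝ) (f v v' : ℝ → L2) : Prop where
  real : ∀ t ∈ Set.Icc 0 T, ∀ᵐ x : E5, (v t x).im = 0
  mem_H1 : ∀ t ∈ Set.Icc 0 T, sobolevNormSq 1 (v t) < ∞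
  continuous_H1 : ∀ t₀ ∈ Set.Icc 0 T,
    Tendsto (fun t ↦ sobolevNormSq 1 (v t - v t₀)) (𝓝[Set.Icc 0 T] t₀) (𝓝 0)
  hasDeriv : ∀ t ∈ Set.Icc 0 T, HasDerivWithinAt v (v' t) (Set.Icc 0 T) t
  continuous_deriv : ContinuousOn v' (Set.Icc 0 T)
  initial : v 0 = 0 ∧ v' 0 = 0
  memLp_nonlinearity : ∀ᵐ t ∂(volume.restrict (Set.Icc 0 T)),
    MemLp (hartree (v t + f t : L2)) 2 (volume : Measure E5)
  integrable_nonlinearity :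
    IntegrableOn (fun t ↦ hartreeL2 (v t + f t)) (Set.Icc 0 T) volume
  duhamel : ∀ t ∈ Set.Icc 0 T, v t = -∫ t' in (0 : ℝ)..t, Q (t - t') (hartreeL2 (v t' + f t'))

end HartreeWave

end

open HartreeWave

noncomputable section

namespace HartreeWave

/-! ### Riesz kernels on `ℝ⁵` -/

/-! Fix the random parameter, let v be the solution, Ψ the full perturbation, and Q(a,b,c,d) the
form `quad`, so that ⟨w, 𝒩(u)⟩ = Q(w,u,u,u) and the potential energy is Q(v,v,v,v)/4. Formally the
energy E changes at the rate -⟨∂ₜv, 𝒩(v+Ψ) - 𝒩(v)⟩, and expanding gives terms with one, two or three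
factors Ψ. Those with two or three are at most linear in E, by the Hardy–Littlewood–Sobolev
inequality (`coul_le`) and the Sobolev inequality (`exists_sobolev`).

The terms with a single Ψ would need ‖Ψ‖₁₀, which the assumed norms do not control. They are,
however, exactly the part of d/dt Q(v,Ψ,v,v) in which the derivative falls on v. Integration in time
replaces them by the boundary term Q(v,Ψ,v,v), of order E^{3/4}‖v‖₂^{1/2}‖Ψ‖₅ and hence absorbable,
and by the integral of Q(v,∂ₜΨ,v,v). Here ∂ₜΨ = ⟨∇⟩^α w + ∂ₜΨ_N with w = ⟨∇⟩^{s-δ} z̃ bounded in L⁵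
and α = 1-(s-δ) < 1/2. The second summand is harmless. For the first, the derivative has to be moved
to 𝒩(v).

This works because 𝒩(v) has half a derivative in L^{5/4}, in the sense of difference quotients, at
the cost of energy quantities only (`exists_hartree_translation_le`). Indeed |x|⁻⁴ is a multiple of
the convolution square of |x|^{-9/2}. This makes the Coulomb pairing positive definite and bounds
the potential |x|⁻⁴ ∗ |v|² in L^{5/2}, as well as its increments in L² by |h|^{1/2}, with the square
root of the potential energy as factor. The increments of v itself in L^{5/2} follow by
interpolation. Writing ⟨∇⟩^α as a superposition of identity minus damped translations turns such
increments into the bound for ⟨𝒩(v), ⟨∇⟩^α w⟩ (`exists_norm_integral_conj_mul_mult_japanese_le`); it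
converges at small scales because α < 1/2. Grönwall's inequality for E + ‖v‖₂² concludes; the L²
norm is included because the energy does not control it.

The frequency truncation makes Ψ band limited, so Ψ is a C¹ curve in every L^p with 2 ≤ p < ∞. This
justifies limits and differentiations; constants depending on the band never enter the final bound,
which is why that bound is uniform in N. For solutions of mere energy regularity the energy balance
is obtained in two halves: the kinetic part as an identity from Duhamel's formula with a source in
L¹L² (`linear_energy_identity`), the potential part as an inequality from convexity of the potential
energy along difference quotients (`potential_le`). Probability enters only through the almost sure
band limitation and regularity of the stochastic convolution. -/

lemma lintegral_comp_smul {c : ℝ} (hc : 0 < c) (f : E5 → ℝ≥0∞) :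
    ∫⁻ x, f (c • x) = ENNReal.ofReal (c ^ (-5 : ℝ)) * ∫⁻ x, f x := by
  have h := lintegral_map_equiv (μ := (volume : Measure E5)) f
    (Homeomorph.smulOfNeZero c hc.ne').toMeasurableEquiv
  have h2 : Measure.map (Homeomorph.smulOfNeZero c hc.ne').toMeasurableEquiv (volume : Measure E5)
      = ENNReal.ofReal |(c ^ Module.finrank ℝ E5)⁻¹| • volume :=
    Measure.map_addHaar_smul volume hc.ne'
  rw [h2, lintegral_smul_measure] at h
  have h3 : |(c ^ Module.finrank ℝ E5)⁻¹| = c ^ (-5 : ℝ) := by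
    rw [abs_of_pos (by positivity), Real.rpow_neg hc.le]
    simp only [finrank_euclideanSpace, Fintype.card_fin]
    norm_cast
  rw [h3] at h
  exact h.symm

lemma enorm_smul_rpow {c : ℝ} (hc : 0 < c) (p : ℝ) (x : E5) :
    ‖c • x‖ₑ ^ p = ENNReal.ofReal (c ^ p) * ‖x‖ₑ ^ p := by
  have h0 : ‖c‖ₑ = ENNReal.ofReal c := by
    rw [← ofReal_norm, Real.norm_of_nonneg hc.le]
  rw [enorm_smul, h0, ← ENNReal.ofReal_rpow_of_pos hc]
  by_cases hx : ‖x‖ₑ = 0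
  · rw [hx]
    rcases lt_trichotomy p 0 with hp | hp | hp
    · simp [ENNReal.zero_rpow_of_neg hp, hc, ENNReal.mul_top, ENNReal.rpow_eq_zero_iff]
    · simp [hp]
    · simp [ENNReal.zero_rpow_of_pos hp]
  · exact ENNReal.mul_rpow_of_ne_zero (by simpa using hc) hx p

lemma ofReal_norm_rpow {x : E5} (hx : x ≠ 0) (p : ℝ) :
    ENNReal.ofReal (‖x‖ ^ p) = ‖x‖ₑ ^ p := by
  rw [← ENNReal.ofReal_rpow_of_pos (norm_pos_iff.2 hx), ofReal_norm]

lemma ae_ne (a : E5) : ∀ᵐ x : E5, x ≠ a := by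
  simp [ae_iff, measure_singleton]

lemma measurable_riesz (p : ℝ) : Measurable fun x : E5 ↦ ‖x‖ₑ ^ p := by fun_prop

/-- Polar coordinates: the Jacobian r⁴ in dimension five turns |x|^(-p) into r^(4-p). -/
lemma lintegral_riesz_lt_top {p : ℝ} (s : Set ℝ) (hs : MeasurableSet s)
    (h : IntegrableOn (fun r : ℝ ↦ r ^ (4 - p)) (s ∩ Set.Ioi 0)) :
    ∫⁻ x : E5, Set.indicator {x | ‖x‖ ∈ s} (fun x ↦ ‖x‖ₑ ^ (-p)) x < ∞ := by
  have key : Integrable (fun x : E5 ↦ s.indicator (fun r ↦ r ^ (-p)) ‖x‖) := by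
    rw [integrable_fun_norm_addHaar (volume : Measure E5) (f := s.indicator fun r ↦ r ^ (-p))]
    have : IntegrableOn (s.indicator fun r : ℝ ↦ r ^ (4 - p)) (Set.Ioi 0) := by
      rw [integrableOn_indicator_iff hs]; exact h
    refine this.congr_fun ?_ measurableSet_Ioi
    intro y hy
    have hy : (0 : ℝ) < y := hy
    by_cases hys : y ∈ s
    · simp only [finrank_euclideanSpace, Fintype.card_fin, Set.indicator_of_mem hys, smul_eq_mul]
      rw [← Real.rpow_natCast, ← Real.rpow_add hy]
      norm_num [sub_eq_add_neg]
    · simp [Set.indicator_of_notMem hys]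
  have := key.hasFiniteIntegral
  rw [hasFiniteIntegral_iff_enorm] at this
  refine lt_of_le_of_lt (lintegral_mono_ae ?_) this
  filter_upwards [ae_ne 0] with x hx
  by_cases hxs : ‖x‖ ∈ s
  · rw [Set.indicator_of_mem (by exact hxs), Set.indicator_of_mem hxs,
      ← ofReal_norm_rpow hx, Real.enorm_of_nonneg (by positivity)]
  · rw [Set.indicator_of_notMem (by exact hxs)]; exact zero_le

/-- Homogeneity of the kernel; it reduces balls and their complements to radius one. -/
lemma riesz_scale (s : Set ℝ) (p : ℝ) {R : ℝ} (hR : 0 < R) :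
    ∫⁻ x : E5, Set.indicator {x | R⁻¹ * ‖x‖ ∈ s} (fun x ↦ ‖x‖ₑ ^ (-p)) x =
      ENNReal.ofReal (R ^ (5 - p)) *
        ∫⁻ x : E5, Set.indicator {x | ‖x‖ ∈ s} (fun x ↦ ‖x‖ₑ ^ (-p)) x := by
  have h := lintegral_comp_smul (inv_pos.2 hR)
    (fun x : E5 ↦ Set.indicator {x | ‖x‖ ∈ s} (fun x ↦ ‖x‖ₑ ^ (-p)) x)
  have h1 : ∀ x : E5, Set.indicator {x : E5 | ‖x‖ ∈ s} (fun x ↦ ‖x‖ₑ ^ (-p)) (R⁻¹ • x) =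
      ENNReal.ofReal (R ^ p) *
        Set.indicator {x | R⁻¹ * ‖x‖ ∈ s} (fun x ↦ ‖x‖ₑ ^ (-p)) x := by
    intro x
    have hn : ‖R⁻¹ • x‖ = R⁻¹ * ‖x‖ := by
      rw [norm_smul, Real.norm_of_nonneg (by positivity)]
    by_cases hx : R⁻¹ * ‖x‖ ∈ s
    · rw [Set.indicator_of_mem (by simpa [hn] using hx), Set.indicator_of_mem (by exact hx),
        enorm_smul_rpow (by positivity), Real.inv_rpow hR.le, Real.rpow_neg hR.le, inv_inv]
    · rw [Set.indicator_of_notMem (by simpa [hn] using hx), Set.indicator_of_notMem (by exact hx),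
        mul_zero]
  simp_rw [h1] at h
  rw [lintegral_const_mul' _ _ ENNReal.ofReal_ne_top] at h
  have h2 : ENNReal.ofReal (R ^ (-p)) * ENNReal.ofReal (R ^ p) = 1 := by
    rw [← ENNReal.ofReal_mul (by positivity), ← Real.rpow_add hR]; simp
  rw [← one_mul (∫⁻ x : E5, Set.indicator {x | R⁻¹ * ‖x‖ ∈ s} _ x), ← h2, mul_assoc, h, ← mul_assoc,
    ← ENNReal.ofReal_mul (by positivity), Real.inv_rpow hR.le, ← Real.rpow_neg hR.le, neg_neg,
    ← Real.rpow_add hR]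
  congr 3
  ring

lemma riesz_ball {p : ℝ} (hp : p < 5) : ∃ C : ℝ≥0, ∀ R : ℝ, 0 < R →
    ∫⁻ x : E5 in Metric.ball 0 R, ‖x‖ₑ ^ (-p) ≤ C * ENNReal.ofReal (R ^ (5 - p)) := by
  have h1 := lintegral_riesz_lt_top (p := p) (Set.Iio 1) measurableSet_Iio (by
    have : Set.Iio (1 : ℝ) ∩ Set.Ioi 0 = Set.Ioo 0 1 := by ext; simp [and_comm]
    rw [this, intervalIntegral.integrableOn_Ioo_rpow_iff one_pos]; linarith)
  refine ⟨(∫⁻ x : E5, Set.indicator {x | ‖x‖ ∈ Set.Iio 1} (fun x ↦ ‖x‖ₑ ^ (-p)) x).toNNReal,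
    fun R hR ↦ ?_⟩
  rw [ENNReal.coe_toNNReal h1.ne, mul_comm, ← riesz_scale _ _ hR,
    ← lintegral_indicator measurableSet_ball]
  refine le_of_eq (lintegral_congr fun x ↦ ?_)
  congr 1
  ext x
  simp [inv_mul_lt_iff₀ hR]

lemma riesz_compl_ball {p : ℝ} (hp : 5 < p) : ∃ C : ℝ≥0, ∀ R : ℝ, 0 < R →
    ∫⁻ x : E5 in (Metric.ball 0 R)ᶜ, ‖x‖ₑ ^ (-p) ≤ C * ENNReal.ofReal (R ^ (5 - p)) := by
  have h1 := lintegral_riesz_lt_top (p := p) (Set.Ici 1) measurableSet_Ici (by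
    have : Set.Ici (1 : ℝ) ∩ Set.Ioi 0 = Set.Ici 1 := by
      ext x; simp only [Set.mem_inter_iff, Set.mem_Ici, Set.mem_Ioi]; constructor
      · exact fun h ↦ h.1
      · exact fun h ↦ ⟨h, by linarith⟩
    rw [this, integrableOn_Ici_iff_integrableOn_Ioi, integrableOn_Ioi_rpow_iff one_pos]; linarith)
  refine ⟨(∫⁻ x : E5, Set.indicator {x | ‖x‖ ∈ Set.Ici 1} (fun x ↦ ‖x‖ₑ ^ (-p)) x).toNNReal,
    fun R hR ↦ ?_⟩
  rw [ENNReal.coe_toNNReal h1.ne, mul_comm, ← riesz_scale _ _ hR,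
    ← lintegral_indicator measurableSet_ball.compl]
  refine le_of_eq (lintegral_congr fun x ↦ ?_)
  congr 1
  ext x
  simp [le_inv_mul_iff₀ hR]

/-! ### The Hardy–Littlewood–Sobolev inequality by layer cake decomposition -/

/-- The Coulomb-type pairing `∬ f(x) g(y) |x - y|⁻⁴`. -/
def coul (f g : E5 → ℝ≥0∞) : ℝ≥0∞ := ∫⁻ x, ∫⁻ y, f x * g y * ‖x - y‖ₑ ^ (-4 : ℝ)

/-- Bathtub argument: the kernel is largest near x, so up to a constant the ball of the same volume
is the worst set. This is the Hardy–Littlewood–Sobolev inequality for indicator functions. -/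
lemma lintegral_riesz_le_volume : ∃ C : ℝ≥0, ∀ (x : E5) (B : Set E5), MeasurableSet B →
    ∫⁻ y in B, ‖x - y‖ₑ ^ (-4 : ℝ) ≤ C * volume B ^ (1 / 5 : ℝ) := by
  obtain ⟨C, hC⟩ := riesz_ball (p := 4) (by norm_num)
  refine ⟨C + 1, fun x B hB ↦ ?_⟩
  rcases eq_or_ne (volume B) 0 with h0 | h0
  · rw [setLIntegral_measure_zero _ _ h0]; exact zero_le
  rcases eq_or_ne (volume B) ∞ with ht | ht
  · rw [ht, ENNReal.top_rpow_of_pos (by norm_num), ENNReal.mul_top (by simp)]; exact le_top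
  -- With this radius the inner part (integral of |y|⁻⁴ over a ball) and the outer part (at most R⁻⁴
  -- · |B|) are both of size R.
  set R : ℝ := (volume B).toReal ^ (1 / 5 : ℝ) with hRdef
  have hBr : 0 < (volume B).toReal := ENNReal.toReal_pos h0 ht
  have hR : 0 < R := Real.rpow_pos_of_pos hBr _
  have hRB : ENNReal.ofReal R = volume B ^ (1 / 5 : ℝ) := by
    rw [hRdef, ← ENNReal.ofReal_rpow_of_pos hBr, ENNReal.ofReal_toReal ht]
  have hball : ∫⁻ y in Metric.ball x R, ‖x - y‖ₑ ^ (-4 : ℝ) ≤ C * ENNReal.ofReal R := by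
    have := hC R hR
    rw [← lintegral_indicator measurableSet_ball] at this ⊢
    rw [← lintegral_sub_left_eq_self _ x] at this
    norm_num at this
    refine le_trans (le_of_eq (lintegral_congr fun y ↦ ?_)) this
    by_cases hy : y ∈ Metric.ball x R
    · rw [Set.indicator_of_mem hy, Set.indicator_of_mem
        (by simpa [dist_eq_norm, norm_sub_rev] using hy)]
    · rw [Set.indicator_of_notMem hy, Set.indicator_of_notMem
        (by simpa [dist_eq_norm, norm_sub_rev] using hy)]
  have hout : ∫⁻ y in B \ Metric.ball x R, ‖x - y‖ₑ ^ (-4 : ℝ) ≤ ENNReal.ofReal R := by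
    calc ∫⁻ y in B \ Metric.ball x R, ‖x - y‖ₑ ^ (-4 : ℝ)
        ≤ ∫⁻ y in B \ Metric.ball x R, ENNReal.ofReal R ^ (-4 : ℝ) := by
          refine setLIntegral_mono measurable_const fun y hy ↦ ?_
          rw [ENNReal.rpow_neg, ENNReal.rpow_neg]
          refine ENNReal.inv_le_inv.2 (ENNReal.rpow_le_rpow ?_ (by norm_num))
          rw [← ofReal_norm]
          refine ENNReal.ofReal_le_ofReal ?_
          have := hy.2
          simpa [dist_eq_norm, norm_sub_rev] using this
      _ ≤ ENNReal.ofReal R ^ (-4 : ℝ) * volume B := by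
          rw [setLIntegral_const]; gcongr; exact Set.sdiff_subset
      _ = ENNReal.ofReal R := by
          rw [hRB, ← ENNReal.rpow_mul]
          conv_lhs => rw [← ENNReal.rpow_one (volume B), ← ENNReal.rpow_mul]
          rw [← ENNReal.rpow_add _ _ h0 ht]; norm_num
  calc ∫⁻ y in B, ‖x - y‖ₑ ^ (-4 : ℝ)
      ≤ ∫⁻ y in Metric.ball x R ∪ (B \ Metric.ball x R), ‖x - y‖ₑ ^ (-4 : ℝ) :=
        lintegral_mono_set (by intro y hy; by_cases h : y ∈ Metric.ball x R <;> simp_all)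
    _ ≤ _ := lintegral_union_le _ _ _
    _ ≤ C * ENNReal.ofReal R + ENNReal.ofReal R := add_le_add hball hout
    _ = _ := by rw [hRB]; push_cast; ring

lemma coul_comm {f g : E5 → ℝ≥0∞} (hf : Measurable f) (hg : Measurable g) :
    coul f g = coul g f := by
  unfold coul
  rw [lintegral_lintegral_swap (by fun_prop)]
  refine lintegral_congr fun x ↦ lintegral_congr fun y ↦ ?_
  rw [mul_comm (f y), enorm_sub_rev]

lemma coul_eq {f g : E5 → ℝ≥0∞} (hg : Measurable g) :
    coul f g = ∫⁻ x, f x * ∫⁻ y, g y * ‖x - y‖ₑ ^ (-4 : ℝ) := by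
  unfold coul
  refine lintegral_congr fun x ↦ ?_
  rw [← lintegral_const_mul _ (by fun_prop)]
  simp_rw [mul_assoc]

lemma coul_mono {f f' g g' : E5 → ℝ≥0∞} (hf : ∀ x, f x ≤ f' x) (hg : ∀ x, g x ≤ g' x) :
    coul f g ≤ coul f' g' :=
  lintegral_mono fun x ↦ lintegral_mono fun y ↦ by gcongr <;> solve_by_elim

/-- Layer cake formula for powers of a point of `[0, ∞]`. -/
lemma rpow_eq_lintegral {p : ℝ} (hp : 0 < p) (t : ℝ≥0∞) :
    t ^ p = ∫⁻ a in Set.Ioi (0 : ℝ), ENNReal.ofReal (p * a ^ (p - 1)) *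
      Set.indicator {a : ℝ | ENNReal.ofReal a < t} 1 a := by
  have hm : MeasurableSet {a : ℝ | ENNReal.ofReal a < t} :=
    measurableSet_lt (by fun_prop) measurable_const
  have real_case : ∀ r : ℝ, 0 < r →
      ∫⁻ a in Set.Ioo (0 : ℝ) r, ENNReal.ofReal (p * a ^ (p - 1)) = ENNReal.ofReal r ^ p := by
    intro r hr
    have hi : IntegrableOn (fun a : ℝ ↦ p * a ^ (p - 1)) (Set.Ioo 0 r) :=
      ((intervalIntegral.integrableOn_Ioo_rpow_iff hr).2 (by linarith)).const_mul p
    rw [← ofReal_integral_eq_lintegral_ofReal hi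
      ((ae_restrict_iff' measurableSet_Ioo).2 (.of_forall fun a ha ↦ by
        have := ha.1; simp only [Pi.zero_apply]; positivity)),
      ← integral_Ioc_eq_integral_Ioo, ← intervalIntegral.integral_of_le hr.le,
      intervalIntegral.integral_const_mul, integral_rpow (Or.inl (by linarith)),
      ENNReal.ofReal_rpow_of_pos hr]
    congr 1
    rw [sub_add_cancel, Real.zero_rpow hp.ne']
    field_simp
    simp
  have hind : ∀ s : Set ℝ, MeasurableSet s → ∫⁻ a in Set.Ioi (0 : ℝ),
      ENNReal.ofReal (p * a ^ (p - 1)) * s.indicator 1 a =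
      ∫⁻ a in s ∩ Set.Ioi 0, ENNReal.ofReal (p * a ^ (p - 1)) := by
    intro s hs
    rw [← Measure.restrict_restrict hs, ← lintegral_indicator hs]
    refine lintegral_congr fun a ↦ ?_
    by_cases ha : a ∈ s <;> simp [ha]
  rw [hind _ hm]
  induction t with
  | top =>
    -- For t = ∞ the integral runs over the whole half line; it exceeds every r by comparison with
    -- the interval whose end has p-th power r + 1.
    rw [ENNReal.top_rpow_of_pos hp, eq_comm]
    refine ENNReal.eq_top_of_forall_nnreal_le fun r ↦ ?_
    have hr0 : (0 : ℝ) < (r : ℝ) + 1 := by positivity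
    have h1 := real_case (((r : ℝ) + 1) ^ p⁻¹) (by positivity)
    rw [ENNReal.ofReal_rpow_of_pos (by positivity), ← Real.rpow_mul hr0.le,
      inv_mul_cancel₀ hp.ne', Real.rpow_one] at h1
    calc (r : ℝ≥0∞) ≤ ENNReal.ofReal ((r : ℝ) + 1) := by
          rw [← ENNReal.ofReal_coe_nnreal]
          exact ENNReal.ofReal_le_ofReal (by linarith)
      _ = _ := h1.symm
      _ ≤ _ := lintegral_mono_set (by intro a ha; simpa using ha.1)
  | coe r =>
    rcases eq_or_ne r 0 with rfl | hr
    · simp [hp]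
    have hr' : (0 : ℝ) < r := by positivity
    have : {a : ℝ | ENNReal.ofReal a < (r : ℝ≥0∞)} ∩ Set.Ioi 0 = Set.Ioo 0 (r : ℝ) := by
      ext a
      simp only [Set.mem_inter_iff, Set.mem_ofPred_eq, Set.mem_Ioi, Set.mem_Ioo]
      rw [← ENNReal.ofReal_coe_nnreal, ENNReal.ofReal_lt_ofReal_iff hr']
      exact and_comm
    rw [this, real_case _ hr', ENNReal.ofReal_coe_nnreal]

/-- The indicator of the superlevel set `{f > a}`. -/
def superlevel (f : E5 → ℝ≥0∞) (a : ℝ) : E5 → ℝ≥0∞ :=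
  Set.indicator {x | ENNReal.ofReal a < f x} 1

/-- The distribution function of `f`. -/
def distrib (f : E5 → ℝ≥0∞) (a : ℝ) : ℝ≥0∞ := volume {x | ENNReal.ofReal a < f x}

lemma superlevel_eq (f : E5 → ℝ≥0∞) (a : ℝ) (x : E5) :
    superlevel f a x = Set.indicator {a : ℝ | ENNReal.ofReal a < f x} 1 a := by
  unfold superlevel
  by_cases h : ENNReal.ofReal a < f x <;> simp [h]

lemma measurable_superlevel_uncurry {f : E5 → ℝ≥0∞} (hf : Measurable f) :
    Measurable fun q : ℝ × E5 ↦ superlevel f q.1 q.2 := by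
  have : (fun q : ℝ × E5 ↦ superlevel f q.1 q.2) =
      Set.indicator {q : ℝ × E5 | ENNReal.ofReal q.1 < f q.2} 1 := by
    ext q
    unfold superlevel
    by_cases h : ENNReal.ofReal q.1 < f q.2 <;> simp [h]
  rw [this]
  exact measurable_one.indicator (measurableSet_lt (by fun_prop) (by fun_prop))

lemma measurable_superlevel {f : E5 → ℝ≥0∞} (hf : Measurable f) (a : ℝ) :
    Measurable (superlevel f a) :=
  (measurable_superlevel_uncurry hf).comp (measurable_const.prodMk measurable_id)

lemma lintegral_superlevel {f : E5 → ℝ≥0∞} (hf : Measurable f) (a : ℝ) :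
    ∫⁻ x, superlevel f a x = distrib f a := by
  unfold superlevel distrib
  rw [lintegral_indicator_one (measurableSet_lt measurable_const hf)]

lemma measurable_distrib {f : E5 → ℝ≥0∞} (hf : Measurable f) : Measurable (distrib f) := by
  have : distrib f = fun a ↦ ∫⁻ x, superlevel f a x := by
    ext a; rw [lintegral_superlevel hf]
  rw [this]
  exact (measurable_superlevel_uncurry hf).lintegral_prod_right'

lemma layercake_rpow {f : E5 → ℝ≥0∞} (hf : Measurable f) {p : ℝ} (hp : 0 < p) :
    ∫⁻ x, f x ^ p =
      ∫⁻ a in Set.Ioi (0 : ℝ), ENNReal.ofReal (p * a ^ (p - 1)) * distrib f a := by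
  simp_rw [fun x ↦ rpow_eq_lintegral hp (f x), ← superlevel_eq]
  rw [lintegral_lintegral_swap]
  · refine lintegral_congr fun a ↦ ?_
    rw [lintegral_const_mul _ (measurable_superlevel hf a), lintegral_superlevel hf]
  · refine Measurable.aemeasurable ?_
    exact (by fun_prop : Measurable fun q : E5 × ℝ ↦ ENNReal.ofReal (p * q.2 ^ (p - 1))).mul
      ((measurable_superlevel_uncurry hf).comp measurable_swap)

lemma coul_layercake_left {f g : E5 → ℝ≥0∞} (hf : Measurable f) (hg : Measurable g) :
    coul f g = ∫⁻ a in Set.Ioi (0 : ℝ), coul (superlevel f a) g := by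
  simp_rw [coul_eq hg]
  have h1 : ∀ x, f x = ∫⁻ a in Set.Ioi (0 : ℝ), superlevel f a x := by
    intro x
    have := rpow_eq_lintegral one_pos (f x)
    simpa [superlevel_eq] using this
  have hV : Measurable fun x ↦ ∫⁻ y, g y * ‖x - y‖ₑ ^ (-4 : ℝ) :=
    Measurable.lintegral_prod_right' (f := fun q : E5 × E5 ↦ g q.2 * ‖q.1 - q.2‖ₑ ^ (-4 : ℝ))
      (by fun_prop)
  have h2 : ∀ x, f x * ∫⁻ y, g y * ‖x - y‖ₑ ^ (-4 : ℝ) = ∫⁻ a in Set.Ioi (0 : ℝ),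
      superlevel f a x * ∫⁻ y, g y * ‖x - y‖ₑ ^ (-4 : ℝ) := by
    intro x
    have hm : Measurable fun a ↦ superlevel f a x :=
      (measurable_superlevel_uncurry hf).comp (measurable_id.prodMk measurable_const)
    rw [lintegral_mul_const _ hm, ← h1 x]
  simp_rw [h2]
  rw [lintegral_lintegral_swap]
  exact (((measurable_superlevel_uncurry hf).comp measurable_swap).mul
    (hV.comp measurable_fst)).aemeasurable

lemma coul_layercake {f g : E5 → ℝ≥0∞} (hf : Measurable f) (hg : Measurable g) :
    coul f g = ∫⁻ a in Set.Ioi (0 : ℝ), ∫⁻ b in Set.Ioi (0 : ℝ),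
      coul (superlevel f a) (superlevel g b) := by
  rw [coul_layercake_left hf hg]
  refine lintegral_congr fun a ↦ ?_
  rw [coul_comm (measurable_superlevel hf a) hg,
    coul_layercake_left hg (measurable_superlevel hf a)]
  refine lintegral_congr fun b ↦ ?_
  rw [coul_comm (measurable_superlevel hg b) (measurable_superlevel hf a)]

/-- The potential of a set is bounded by the fifth root of its volume; integrate this over the other
set. The asymmetry is deliberate: by symmetry of the pairing the root can be put on either factor.
-/
lemma coul_superlevel_le : ∃ C : ℝ≥0, ∀ f g : E5 → ℝ≥0∞, Measurable f → Measurable g →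
    ∀ a b, coul (superlevel f a) (superlevel g b) ≤
      C * (distrib f a * distrib g b ^ (1 / 5 : ℝ)) := by
  obtain ⟨C, hC⟩ := lintegral_riesz_le_volume
  refine ⟨C, fun f g hf hg a b ↦ ?_⟩
  rw [coul_eq (measurable_superlevel hg b)]
  calc ∫⁻ x, superlevel f a x * ∫⁻ y, superlevel g b y * ‖x - y‖ₑ ^ (-4 : ℝ)
      ≤ ∫⁻ x, superlevel f a x * (C * distrib g b ^ (1 / 5 : ℝ)) := by
        refine lintegral_mono fun x ↦ ?_
        gcongr
        refine le_trans (le_of_eq ?_) (hC x _ (measurableSet_lt measurable_const hg))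
        rw [← lintegral_indicator (measurableSet_lt measurable_const hg)]
        refine lintegral_congr fun y ↦ ?_
        unfold superlevel
        by_cases h : ENNReal.ofReal b < g y <;> simp [h]
    _ = _ := by
        rw [lintegral_mul_const _ (measurable_superlevel hf a), lintegral_superlevel hf]; ring

/-- The one-dimensional Hölder estimate behind the Hardy–Littlewood–Sobolev inequality. -/
lemma lintegral_rpow_fifth_le {r : ℝ} (hr5 : r < 5) {w : ℝ → ℝ≥0∞} (hw : Measurable w) {A : ℝ}
    (hA : 0 < A) :
    ∫⁻ b in Set.Ioo 0 A, w b ^ (1 / 5 : ℝ) ≤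
      ENNReal.ofReal ((4 / (5 - r)) ^ (4 / 5 : ℝ)) *
      (∫⁻ b in Set.Ioi 0, ENNReal.ofReal (b ^ (r - 1)) * w b) ^ (1 / 5 : ℝ) *
        ENNReal.ofReal (A ^ ((5 - r) / 5)) := by
  -- Hölder with exponents 5 and 5/4 after inserting b^((r-1)/5) and its inverse. The second factor
  -- becomes the integral of b^(-(r-1)/4), finite at 0 because r < 5.
  have hol := ENNReal.lintegral_mul_le_Lp_mul_Lq (volume.restrict (Set.Ioo 0 A))
    (p := 5) (q := 5 / 4) ⟨by norm_num, by norm_num, by norm_num⟩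
    (f := fun b ↦ ENNReal.ofReal (b ^ ((r - 1) / 5)) * w b ^ (1 / 5 : ℝ))
    (g := fun b ↦ ENNReal.ofReal (b ^ (-((r - 1) / 5)))) (by fun_prop) (by fun_prop)
  have e1 : ∫⁻ b in Set.Ioo 0 A, w b ^ (1 / 5 : ℝ) = ∫⁻ b in Set.Ioo 0 A,
      ((fun b ↦ ENNReal.ofReal (b ^ ((r - 1) / 5)) * w b ^ (1 / 5 : ℝ)) *
        (fun b ↦ ENNReal.ofReal (b ^ (-((r - 1) / 5))))) b := by
    refine setLIntegral_congr_fun measurableSet_Ioo fun b hb ↦ ?_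
    have hb0 := hb.1
    simp only [Pi.mul_apply]
    rw [mul_right_comm, ← ENNReal.ofReal_mul (by positivity), ← Real.rpow_add hb0]
    simp
  have e2 : ∫⁻ b in Set.Ioo 0 A, (ENNReal.ofReal (b ^ ((r - 1) / 5)) * w b ^ (1 / 5 : ℝ)) ^ (5 : ℝ)
      ≤ ∫⁻ b in Set.Ioi 0, ENNReal.ofReal (b ^ (r - 1)) * w b := by
    refine le_trans (le_of_eq ?_) (lintegral_mono_set (s := Set.Ioo 0 A) fun b hb ↦ hb.1)
    refine setLIntegral_congr_fun measurableSet_Ioo fun b hb ↦ ?_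
    have hb0 := hb.1
    rw [ENNReal.mul_rpow_of_nonneg _ _ (by norm_num), ← ENNReal.rpow_mul,
      ENNReal.ofReal_rpow_of_pos (by positivity), ← Real.rpow_mul hb0.le]
    norm_num
  have e3 : ∫⁻ b in Set.Ioo 0 A, ENNReal.ofReal (b ^ (-((r - 1) / 5))) ^ (5 / 4 : ℝ) =
      ENNReal.ofReal (4 / (5 - r) * A ^ ((5 - r) / 4)) := by
    have : ∫⁻ b in Set.Ioo 0 A, ENNReal.ofReal (b ^ (-((r - 1) / 5))) ^ (5 / 4 : ℝ) =
        ∫⁻ b in Set.Ioo 0 A, ENNReal.ofReal (b ^ (-((r - 1) / 4))) := by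
      refine setLIntegral_congr_fun measurableSet_Ioo fun b hb ↦ ?_
      have hb0 := hb.1
      rw [ENNReal.ofReal_rpow_of_pos (by positivity), ← Real.rpow_mul hb0.le]
      congr 2; ring
    rw [this, ← ofReal_integral_eq_lintegral_ofReal
      ((intervalIntegral.integrableOn_Ioo_rpow_iff hA).2 (by linarith))
      ((ae_restrict_iff' measurableSet_Ioo).2 (.of_forall fun a ha ↦ by
        have := ha.1; simp only [Pi.zero_apply]; positivity)),
      ← integral_Ioc_eq_integral_Ioo, ← intervalIntegral.integral_of_le hA.le,
      integral_rpow (Or.inl (by linarith))]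
    have h5 : (5 - r) ≠ 0 := by linarith
    have : -((r - 1) / 4) + 1 = (5 - r) / 4 := by ring
    rw [this, Real.zero_rpow (by intro h; apply h5; linarith)]
    congr 1
    field_simp
    simp
  rw [e1]
  refine hol.trans ?_
  have e4 : ENNReal.ofReal (4 / (5 - r) * A ^ ((5 - r) / 4)) ^ (1 / (5 / 4) : ℝ) =
      ENNReal.ofReal ((4 / (5 - r)) ^ (4 / 5 : ℝ)) * ENNReal.ofReal (A ^ ((5 - r) / 5)) := by
    have h5 : 0 < 5 - r := by linarith
    rw [ENNReal.ofReal_rpow_of_pos (by positivity), Real.mul_rpow (by positivity) (by positivity),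
      ← Real.rpow_mul hA.le, ENNReal.ofReal_mul (by positivity)]
    congr 3
    · norm_num
    · ring
  rw [e3, e4]
  calc _ ≤ (∫⁻ b in Set.Ioi 0, ENNReal.ofReal (b ^ (r - 1)) * w b) ^ (1 / 5 : ℝ) *
        (ENNReal.ofReal ((4 / (5 - r)) ^ (4 / 5 : ℝ)) * ENNReal.ofReal (A ^ ((5 - r) / 5))) := by
        gcongr
    _ = _ := by ring

/-- Half of the double integral in the Hardy–Littlewood–Sobolev inequality. -/
lemma lintegral_distrib_half {p r : ℝ} (hp : 1 < p) (hr : 1 < r) (hpr : 1 / p + 1 / r = 6 / 5)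
    {u w : ℝ → ℝ≥0∞} (hu : Measurable u) (hw : Measurable w) :
    ∫⁻ a in Set.Ioi 0, ∫⁻ b in Set.Ioo 0 (a ^ (p / r)), u a * w b ^ (1 / 5 : ℝ) ≤
      ENNReal.ofReal ((4 / (5 - r)) ^ (4 / 5 : ℝ)) *
      (∫⁻ b in Set.Ioi 0, ENNReal.ofReal (b ^ (r - 1)) * w b) ^ (1 / 5 : ℝ) *
        ∫⁻ a in Set.Ioi 0, ENNReal.ofReal (a ^ (p - 1)) * u a := by
  have hr5 : r < 5 := by
    have h1 : 1 / p < 1 := by rw [div_lt_one (by linarith)]; exact hp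
    have h2 : 1 / 5 < 1 / r := by linarith
    exact (one_div_lt_one_div (by norm_num) (by linarith)).1 h2
  rw [← lintegral_const_mul _ (by fun_prop)]
  refine setLIntegral_mono (by fun_prop) fun a ha ↦ ?_
  have ha : (0 : ℝ) < a := ha
  rw [lintegral_const_mul _ (by fun_prop)]
  have := lintegral_rpow_fifth_le hr5 hw (Real.rpow_pos_of_pos ha (p / r))
  -- This equality of exponents is precisely the scaling relation 1/p + 1/r = 6/5.
  have he : (a ^ (p / r)) ^ ((5 - r) / 5) = a ^ (p - 1) := by
    rw [← Real.rpow_mul ha.le]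
    congr 1
    have hp0 : p ≠ 0 := by linarith
    have hr0 : r ≠ 0 := by linarith
    field_simp at hpr ⊢
    linarith
  rw [he] at this
  calc _ ≤ u a * _ := mul_le_mul_right this _
    _ = _ := by ring

/-- Decompose both functions into superlevel sets and split the (a, b) quadrant along the curve b^r
= a^p. Below the curve the fifth root is taken on the distribution function of g, above it on that
of f. The normalization makes this curve the right one without any constant. -/
lemma coul_le_of_normalized {p r : ℝ} (hp : 1 < p) (hr : 1 < r) (hpr : 1 / p + 1 / r = 6 / 5) :
    ∃ C : ℝ≥0, ∀ f g : E5 → ℝ≥0∞, Measurable f → Measurable g → ∫⁻ x, f x ^ p ≤ 1 →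
      ∫⁻ x, g x ^ r ≤ 1 → coul f g ≤ C := by
  obtain ⟨C, hC⟩ := coul_superlevel_le
  set c₁ := (4 / (5 - r)) ^ (4 / 5 : ℝ)
  set c₂ := (4 / (5 - p)) ^ (4 / 5 : ℝ)
  refine ⟨C * (c₁.toNNReal + c₂.toNNReal), fun f g hf hg hF hG ↦ ?_⟩
  have hp0 : 0 < p := by linarith
  have hr0 : 0 < r := by linarith
  have hu := measurable_distrib hf
  have hw := measurable_distrib hg
  -- The layer cake formula carries an extra factor q ≥ 1, which is dropped.
  have bound : ∀ q : ℝ, 1 < q → ∀ h : E5 → ℝ≥0∞, Measurable h → ∫⁻ x, h x ^ q ≤ 1 →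
      ∫⁻ b in Set.Ioi (0 : ℝ), ENNReal.ofReal (b ^ (q - 1)) * distrib h b ≤ 1 := by
    intro q hq h hh hle
    refine le_trans ?_ hle
    rw [layercake_rpow hh (by linarith)]
    refine setLIntegral_mono' measurableSet_Ioi fun b hb ↦ ?_
    have hb : (0 : ℝ) < b := hb
    gcongr
    exact le_mul_of_one_le_left (by positivity) hq.le
  have h1 := lintegral_distrib_half hp hr hpr hu hw
  have h2 := lintegral_distrib_half hr hp (by rw [add_comm]; exact hpr) hw hu
  have h1' : ∫⁻ a in Set.Ioi 0, ∫⁻ b in Set.Ioo 0 (a ^ (p / r)),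
      distrib f a * distrib g b ^ (1 / 5 : ℝ) ≤ ENNReal.ofReal c₁ := by
    refine h1.trans ?_
    calc _ ≤ ENNReal.ofReal c₁ * 1 ^ (1 / 5 : ℝ) * 1 := by
          gcongr
          · exact bound r hr g hg hG
          · exact bound p hp f hf hF
      _ = _ := by simp
  have h2' : ∫⁻ b in Set.Ioi 0, ∫⁻ a in Set.Ioo 0 (b ^ (r / p)),
      distrib g b * distrib f a ^ (1 / 5 : ℝ) ≤ ENNReal.ofReal c₂ := by
    refine h2.trans ?_
    calc _ ≤ ENNReal.ofReal c₂ * 1 ^ (1 / 5 : ℝ) * 1 := by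
          gcongr
          · exact bound p hp f hf hF
          · exact bound r hr g hg hG
      _ = _ := by simp
  set k₁ : ℝ → ℝ → ℝ≥0∞ := fun a b ↦ Set.indicator {q : ℝ × ℝ | q.2 < q.1 ^ (p / r)}
    (fun q ↦ distrib f q.1 * distrib g q.2 ^ (1 / 5 : ℝ)) (a, b) with hk₁
  set k₂ : ℝ → ℝ → ℝ≥0∞ := fun a b ↦ Set.indicator {q : ℝ × ℝ | q.1 ^ (p / r) ≤ q.2}
    (fun q ↦ distrib g q.2 * distrib f q.1 ^ (1 / 5 : ℝ)) (a, b) with hk₂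
  have mk₁ : Measurable fun q : ℝ × ℝ ↦ k₁ q.1 q.2 :=
    Measurable.indicator (by fun_prop) (measurableSet_lt (by fun_prop) (by fun_prop))
  have mk₂ : Measurable fun q : ℝ × ℝ ↦ k₂ q.1 q.2 :=
    Measurable.indicator (by fun_prop) (measurableSet_le (by fun_prop) (by fun_prop))
  have main : coul f g ≤ ∫⁻ a in Set.Ioi (0 : ℝ), ∫⁻ b in Set.Ioi (0 : ℝ),
      C * (k₁ a b + k₂ a b) := by
    rw [coul_layercake hf hg]
    refine lintegral_mono fun a ↦ lintegral_mono fun b ↦ ?_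
    by_cases hab : b < a ^ (p / r)
    · refine (hC f g hf hg a b).trans ?_
      gcongr
      simp [hk₁, hk₂, hab]
    · rw [coul_comm (measurable_superlevel hf a) (measurable_superlevel hg b)]
      refine (hC g f hg hf b a).trans ?_
      gcongr
      simp [hk₁, hk₂, hab, not_lt.1 hab]
  refine main.trans ?_
  have s1 : ∫⁻ a in Set.Ioi (0 : ℝ), ∫⁻ b in Set.Ioi (0 : ℝ), k₁ a b ≤ ENNReal.ofReal c₁ := by
    refine le_trans (le_of_eq ?_) h1'
    refine setLIntegral_congr_fun measurableSet_Ioi fun a ha ↦ ?_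
    have : Set.Ioo (0 : ℝ) (a ^ (p / r)) = Set.Iio (a ^ (p / r)) ∩ Set.Ioi 0 := by
      ext; simp [and_comm]
    rw [this, ← Measure.restrict_restrict measurableSet_Iio, ← lintegral_indicator measurableSet_Iio]
    refine lintegral_congr fun b ↦ ?_
    by_cases hab : b < a ^ (p / r) <;> simp [hk₁, hab]
  have s2 : ∫⁻ a in Set.Ioi (0 : ℝ), ∫⁻ b in Set.Ioi (0 : ℝ), k₂ a b ≤ ENNReal.ofReal c₂ := by
    rw [lintegral_lintegral_swap mk₂.aemeasurable]
    refine le_trans ?_ h2'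
    refine setLIntegral_mono' measurableSet_Ioi fun b hb ↦ ?_
    have hb : (0 : ℝ) < b := hb
    have e : Set.Ioc (0 : ℝ) (b ^ (r / p)) = Set.Iic (b ^ (r / p)) ∩ Set.Ioi 0 := by
      ext; simp [and_comm]
    rw [← setLIntegral_congr (Ioo_ae_eq_Ioc (μ := (volume : Measure ℝ))).symm, e,
      ← Measure.restrict_restrict measurableSet_Iic, ← lintegral_indicator measurableSet_Iic]
    refine setLIntegral_mono' measurableSet_Ioi fun a ha ↦ ?_
    have ha : (0 : ℝ) < a := ha
    by_cases hab : a ^ (p / r) ≤ b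
    · have : a ≤ b ^ (r / p) := by
        calc a = (a ^ (p / r)) ^ (r / p) := by
              rw [← Real.rpow_mul ha.le]; field_simp; simp
          _ ≤ _ := Real.rpow_le_rpow (by positivity) hab (by positivity)
      simp [hk₂, hab, this]
    · simp [hk₂, hab]
  have hinner : ∀ a, Measurable (k₁ a) := fun a ↦ mk₁.comp (measurable_const.prodMk measurable_id)
  have hinner2 : ∀ a, Measurable (k₂ a) := fun a ↦ mk₂.comp (measurable_const.prodMk measurable_id)
  calc _ = C * (∫⁻ a in Set.Ioi (0 : ℝ), ((∫⁻ b in Set.Ioi (0 : ℝ), k₁ a b) +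
        ∫⁻ b in Set.Ioi (0 : ℝ), k₂ a b)) := by
        rw [← lintegral_const_mul' _ _ ENNReal.coe_ne_top]
        refine lintegral_congr fun a ↦ ?_
        rw [lintegral_const_mul' _ _ ENNReal.coe_ne_top, lintegral_add_left (hinner a)]
    _ = C * ((∫⁻ a in Set.Ioi (0 : ℝ), ∫⁻ b in Set.Ioi (0 : ℝ), k₁ a b) +
        ∫⁻ a in Set.Ioi (0 : ℝ), ∫⁻ b in Set.Ioi (0 : ℝ), k₂ a b) := by
        rw [lintegral_add_left mk₁.lintegral_prod_right']
    _ ≤ C * (ENNReal.ofReal c₁ + ENNReal.ofReal c₂) := by gcongr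
    _ = _ := by push_cast; rfl

lemma coul_const_mul {f g : E5 → ℝ≥0∞} {a b : ℝ≥0∞} (ha : a ≠ ∞) (hb : b ≠ ∞) :
    coul (fun x ↦ a * f x) (fun x ↦ b * g x) = a * b * coul f g := by
  unfold coul
  rw [← lintegral_const_mul' _ _ (ENNReal.mul_ne_top ha hb)]
  refine lintegral_congr fun x ↦ ?_
  rw [← lintegral_const_mul' _ _ (ENNReal.mul_ne_top ha hb)]
  refine lintegral_congr fun y ↦ ?_
  ring

lemma coul_congr_ae {f f' g g' : E5 → ℝ≥0∞} (hf : f =ᵐ[volume] f') (hg : g =ᵐ[volume] g') :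
    coul f g = coul f' g' := by
  unfold coul
  refine lintegral_congr_ae (hf.mono fun x hx ↦ lintegral_congr_ae (hg.mono fun y hy ↦ ?_))
  simp only [hx, hy]

/-- The Hardy–Littlewood–Sobolev inequality for the kernel `|x - y|⁻⁴` on `ℝ⁵`. -/
theorem coul_le {p r : ℝ} (hp : 1 < p) (hr : 1 < r) (hpr : 1 / p + 1 / r = 6 / 5) :
    ∃ C : ℝ≥0, ∀ f g : E5 → ℝ≥0∞, AEMeasurable f → AEMeasurable g →
      coul f g ≤ C * (∫⁻ x, f x ^ p) ^ (1 / p) * (∫⁻ x, g x ^ r) ^ (1 / r) := by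
  have hp0 : 0 < p := by linarith
  have hr0 : 0 < r := by linarith
  obtain ⟨C, hC⟩ := coul_le_of_normalized hp hr hpr
  -- The constant must be nonzero so that the right side is ∞ when one norm is infinite and the
  -- other is not zero.
  refine ⟨C + 1, fun f g hf hg ↦ ?_⟩
  wlog hm : Measurable f ∧ Measurable g generalizing f g
  · have := this (hf.mk f) (hg.mk g) hf.measurable_mk.aemeasurable hg.measurable_mk.aemeasurable
      ⟨hf.measurable_mk, hg.measurable_mk⟩
    rw [coul_congr_ae hf.ae_eq_mk hg.ae_eq_mk]
    rwa [lintegral_congr_ae (hf.ae_eq_mk.mono fun x hx ↦ by simp only [hx] :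
      (fun x ↦ f x ^ p) =ᵐ[volume] fun x ↦ hf.mk f x ^ p),
      lintegral_congr_ae (hg.ae_eq_mk.mono fun x hx ↦ by simp only [hx] :
      (fun x ↦ g x ^ r) =ᵐ[volume] fun x ↦ hg.mk g x ^ r)]
  obtain ⟨mf, mg⟩ := hm
  set F := (∫⁻ x, f x ^ p) ^ (1 / p) with hF
  set G := (∫⁻ x, g x ^ r) ^ (1 / r) with hG
  have zero_case : ∀ (h : E5 → ℝ≥0∞), Measurable h → ∀ q : ℝ, 0 < q →
      (∫⁻ x, h x ^ q) ^ (1 / q) = 0 → h =ᵐ[volume] 0 := by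
    intro h mh q hq h0
    have : ∫⁻ x, h x ^ q = 0 := by
      rcases ENNReal.rpow_eq_zero_iff.1 h0 with h | h
      · exact h.1
      · have := h.2; have : 0 < 1 / q := by positivity
        linarith
    rw [lintegral_eq_zero_iff (by fun_prop)] at this
    filter_upwards [this] with x hx
    simpa [hq, hq.not_gt] using hx
  rcases eq_or_ne F 0 with hF0 | hF0
  · rw [coul_congr_ae (zero_case f mf p hp0 hF0) (ae_eq_refl g)]
    simp [coul]
  rcases eq_or_ne G 0 with hG0 | hG0
  · rw [coul_congr_ae (ae_eq_refl f) (zero_case g mg r hr0 hG0)]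
    simp [coul]
  rcases eq_or_ne F ∞ with hFt | hFt
  · rw [hFt, ENNReal.mul_top (by simp), ENNReal.top_mul hG0]; exact le_top
  rcases eq_or_ne G ∞ with hGt | hGt
  · rw [hGt, ENNReal.mul_top (mul_ne_zero (by simp) hF0)]; exact le_top
  have norm_case : ∀ (h : E5 → ℝ≥0∞), Measurable h → ∀ q : ℝ, 0 < q → ∀ H : ℝ≥0∞,
      H = (∫⁻ x, h x ^ q) ^ (1 / q) → H ≠ 0 → H ≠ ∞ → ∫⁻ x, (H⁻¹ * h x) ^ q ≤ 1 := by
    intro h mh q hq H hH hH0 hHt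
    simp_rw [ENNReal.mul_rpow_of_nonneg _ _ hq.le]
    rw [lintegral_const_mul _ (by fun_prop)]
    have : ∫⁻ x, h x ^ q = H ^ q := by
      rw [hH, ← ENNReal.rpow_mul, one_div_mul_cancel hq.ne', ENNReal.rpow_one]
    rw [this, ← ENNReal.mul_rpow_of_nonneg _ _ hq.le, ENNReal.inv_mul_cancel hH0 hHt,
      ENNReal.one_rpow]
  have := hC (fun x ↦ F⁻¹ * f x) (fun x ↦ G⁻¹ * g x) (by fun_prop) (by fun_prop)
    (norm_case f mf p hp0 F hF hF0 hFt) (norm_case g mg r hr0 G hG hG0 hGt)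
  rw [coul_const_mul (by simpa) (by simpa)] at this
  calc coul f g = F * G * (F⁻¹ * G⁻¹ * coul f g) := by
        have h1 := ENNReal.mul_inv_cancel hF0 hFt
        have h2 := ENNReal.mul_inv_cancel hG0 hGt
        calc coul f g = (F * F⁻¹) * (G * G⁻¹) * coul f g := by rw [h1, h2]; simp
          _ = _ := by ring
    _ ≤ F * G * C := by gcongr
    _ ≤ F * G * (C + 1 : ℝ≥0) := by gcongr; simp
    _ = _ := by ring

/-! ### Composition of Riesz kernels and positivity of the Coulomb pairing -/

/-- The kernel `|x|^(-9/2)`, whose convolution square is a multiple of `|x|⁻⁴`. -/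
def halfKer (x : E5) : ℝ≥0∞ := ‖x‖ₑ ^ (-(9 / 2) : ℝ)

@[fun_prop]
lemma measurable_halfKer : Measurable halfKer := measurable_riesz _

/-- The convolution square of `halfKer`. -/
def halfKerSq (w : E5) : ℝ≥0∞ := ∫⁻ z, halfKer (w + z) * halfKer z

lemma halfKerSq_map (L : E5 ≃ₗᵢ[ℝ] E5) (w : E5) : halfKerSq (L w) = halfKerSq w := by
  unfold halfKerSq
  rw [← (L.measurePreserving).lintegral_comp (by fun_prop)]
  refine lintegral_congr fun z ↦ ?_
  rw [← map_add]
  have : ∀ z, halfKer (L z) = halfKer z := fun z ↦ by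
    simp only [halfKer, LinearIsometryEquiv.enorm_map]
  rw [this, this]

/-- Two points of equal norm are exchanged by a reflection, and the convolution square is invariant
under isometries. -/
lemma halfKerSq_eq_of_norm_eq {w w' : E5} (h : ‖w‖ = ‖w'‖) : halfKerSq w = halfKerSq w' := by
  rw [← Submodule.reflection_sub h, halfKerSq_map]

/-- Homogeneity: the two kernels give c^(-9), the volume element c⁵. -/
lemma halfKerSq_smul {c : ℝ} (hc : 0 < c) (w : E5) :
    halfKerSq (c • w) = ENNReal.ofReal (c ^ (-4 : ℝ)) * halfKerSq w := by
  unfold halfKerSq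
  have h := lintegral_comp_smul hc (fun z ↦ halfKer (c • w + z) * halfKer z)
  have h1 : ∀ z : E5, halfKer (c • w + c • z) * halfKer (c • z) =
      ENNReal.ofReal (c ^ (-9 : ℝ)) * (halfKer (w + z) * halfKer z) := by
    intro z
    rw [← smul_add]
    unfold halfKer
    rw [enorm_smul_rpow hc, enorm_smul_rpow hc, mul_mul_mul_comm,
      ← ENNReal.ofReal_mul (by positivity), ← Real.rpow_add hc]
    norm_num
  simp_rw [h1] at h
  rw [lintegral_const_mul' _ _ ENNReal.ofReal_ne_top] at h
  have h2 : ENNReal.ofReal (c ^ (5 : ℝ)) * ENNReal.ofReal (c ^ (-5 : ℝ)) = 1 := by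
    rw [← ENNReal.ofReal_mul (by positivity), ← Real.rpow_add hc]; simp
  have h3 : ENNReal.ofReal (c ^ (-4 : ℝ)) =
      ENNReal.ofReal (c ^ (5 : ℝ)) * ENNReal.ofReal (c ^ (-9 : ℝ)) := by
    rw [← ENNReal.ofReal_mul (by positivity), ← Real.rpow_add hc]; norm_num
  rw [h3, mul_assoc, h, ← mul_assoc, h2, one_mul]

/-- The singularities at 0 and -e are integrable since 9/2 < 5, and the tail |z|⁻⁹ is integrable
since 9 > 5. The function P collects both kinds of contributions, and the product of the kernels is
dominated by P(e + z) + P(z). -/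
lemma halfKerSq_lt_top {e : E5} (he : ‖e‖ = 1) : halfKerSq e < ∞ := by
  obtain ⟨C₁, hC₁⟩ := riesz_ball (p := 9 / 2) (by norm_num)
  obtain ⟨C₂, hC₂⟩ := riesz_compl_ball (p := 9) (by norm_num)
  set M : ℝ≥0∞ := ENNReal.ofReal ((1 / 2) ^ (-(9 / 2) : ℝ))
  set P : E5 → ℝ≥0∞ := fun z ↦ (Metric.ball 0 (1 / 2)).indicator (fun z ↦ M * halfKer z) z +
    (Metric.ball 0 (1 / 2))ᶜ.indicator (fun z ↦ ‖z‖ₑ ^ (-9 : ℝ)) z with hP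
  have hPm : Measurable P :=
    ((measurable_const.mul measurable_halfKer).indicator measurableSet_ball).add
      ((measurable_riesz _).indicator measurableSet_ball.compl)
  have hPf : ∫⁻ z, P z < ∞ := by
    have mk : Measurable fun z ↦ M * halfKer z := by fun_prop
    rw [hP, lintegral_add_left (mk.indicator measurableSet_ball),
      lintegral_indicator measurableSet_ball, lintegral_indicator measurableSet_ball.compl,
      lintegral_const_mul _ (by fun_prop)]
    refine ENNReal.add_lt_top.2 ⟨ENNReal.mul_lt_top ENNReal.ofReal_lt_top
      ((hC₁ (1 / 2) (by norm_num)).trans_lt ?_), ((hC₂ (1 / 2) (by norm_num)).trans_lt ?_)⟩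
    · exact ENNReal.mul_lt_top ENNReal.coe_lt_top ENNReal.ofReal_lt_top
    · exact ENNReal.mul_lt_top ENNReal.coe_lt_top ENNReal.ofReal_lt_top
  have far : ∀ z : E5, z ∉ Metric.ball (0 : E5) (1 / 2) → halfKer z ≤ M := by
    intro z hz
    have hz : 1 / 2 ≤ ‖z‖ := by simpa using hz
    have hz0 : z ≠ 0 := norm_pos_iff.1 (by linarith)
    unfold halfKer
    rw [← ofReal_norm_rpow hz0]
    exact ENNReal.ofReal_le_ofReal (Real.rpow_le_rpow_of_nonpos (by norm_num) hz (by norm_num))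
  have sq : ∀ z : E5, halfKer z * halfKer z = ‖z‖ₑ ^ (-9 : ℝ) := by
    intro z
    unfold halfKer
    by_cases hz : z = 0
    · simp [hz, ENNReal.zero_rpow_of_neg]
    rw [← ENNReal.rpow_add _ _ (by simpa using hz) (by simp)]
    norm_num
  have hle : ∀ z, halfKer (e + z) * halfKer z ≤ P (e + z) + P z := by
    intro z
    by_cases h1 : e + z ∈ Metric.ball (0 : E5) (1 / 2) <;>
      by_cases h2 : z ∈ Metric.ball (0 : E5) (1 / 2)
    -- No point is within distance 1/2 of both singularities, as these are at distance 1.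
    · exfalso
      have h1 : ‖e + z‖ < 1 / 2 := by simpa using h1
      have h2 : ‖z‖ < 1 / 2 := by simpa using h2
      have := norm_sub_le (e + z) z
      rw [add_sub_cancel_right, he] at this
      linarith
    · refine le_trans ?_ le_self_add
      simp only [hP, Set.indicator_of_mem h1]
      refine le_trans ?_ le_self_add
      rw [mul_comm]
      gcongr
      exact far z h2
    · refine le_trans ?_ le_add_self
      simp only [hP, Set.indicator_of_mem h2]
      refine le_trans ?_ le_self_add
      gcongr
      exact far _ h1
    · have k1 : P (e + z) = ‖e + z‖ₑ ^ (-9 : ℝ) := by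
        simp only [hP]
        rw [Set.indicator_of_notMem h1, Set.indicator_of_mem (by exact h1), zero_add]
      have k2 : P z = ‖z‖ₑ ^ (-9 : ℝ) := by
        simp only [hP]
        rw [Set.indicator_of_notMem h2, Set.indicator_of_mem (by exact h2), zero_add]
      rw [k1, k2, ← sq, ← sq]
      rcases le_total (halfKer (e + z)) (halfKer z) with h | h
      · exact le_trans (by gcongr) le_add_self
      · exact le_trans (by gcongr) le_self_add
  calc halfKerSq e ≤ ∫⁻ z, (P (e + z) + P z) := lintegral_mono hle
    _ = (∫⁻ z, P z) + ∫⁻ z, P z := by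
        rw [lintegral_add_right _ hPm, lintegral_add_left_eq_self P e]
    _ < ∞ := ENNReal.add_lt_top.2 ⟨hPf, hPf⟩

lemma halfKerSq_ne_zero (e : E5) : halfKerSq e ≠ 0 := by
  intro h
  rw [halfKerSq, lintegral_eq_zero_iff (by fun_prop)] at h
  obtain ⟨z, hz⟩ := h.exists
  norm_num [halfKer, ENNReal.rpow_eq_zero_iff] at hz

/-- The convolution square of `|x|^(-9/2)` is a multiple of `|x|⁻⁴`. -/
lemma exists_halfKer_comp : ∃ c : ℝ≥0∞, c ≠ 0 ∧ c ≠ ∞ ∧ ∀ x y : E5, x ≠ y →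
    ∫⁻ z, halfKer (x - z) * halfKer (y - z) = c * ‖x - y‖ₑ ^ (-4 : ℝ) := by
  obtain ⟨e, he⟩ : ∃ e : E5, ‖e‖ = 1 := exists_norm_eq E5 zero_le_one
  refine ⟨halfKerSq e, halfKerSq_ne_zero e, (halfKerSq_lt_top he).ne, fun x y hxy ↦ ?_⟩
  have h1 : ∫⁻ z, halfKer (x - z) * halfKer (y - z) = halfKerSq (x - y) := by
    rw [halfKerSq, ← lintegral_sub_left_eq_self (fun z ↦ halfKer (x - y + z) * halfKer z) y]
    refine lintegral_congr fun z ↦ ?_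
    rw [show x - y + (y - z) = x - z by abel]
  have hn : 0 < ‖x - y‖ := norm_pos_iff.2 (sub_ne_zero.2 hxy)
  -- Rotation invariance replaces x - y by a multiple of the unit vector e, homogeneity of degree -4
  -- then extracts the length.
  rw [h1, halfKerSq_eq_of_norm_eq (w' := ‖x - y‖ • e) (by simp [norm_smul, he]),
    halfKerSq_smul hn, ofReal_norm_rpow (sub_ne_zero.2 hxy), mul_comm]

/-- Convolution with `halfKer`. -/
def halfPot (f : E5 → ℝ≥0∞) (z : E5) : ℝ≥0∞ := ∫⁻ y, f y * halfKer (y - z)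

/-- The potential `|x|⁻⁴ ∗ f`. -/
def pot (f : E5 → ℝ≥0∞) (x : E5) : ℝ≥0∞ := ∫⁻ y, f y * ‖x - y‖ₑ ^ (-4 : ℝ)

lemma measurable_halfPot {f : E5 → ℝ≥0∞} (hf : Measurable f) : Measurable (halfPot f) :=
  Measurable.lintegral_prod_right' (f := fun q : E5 × E5 ↦ f q.2 * halfKer (q.2 - q.1))
    (by fun_prop)

lemma measurable_pot {f : E5 → ℝ≥0∞} (hf : Measurable f) : Measurable (pot f) :=
  Measurable.lintegral_prod_right' (f := fun q : E5 × E5 ↦ f q.2 * ‖q.1 - q.2‖ₑ ^ (-4 : ℝ))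
    (by fun_prop)

lemma coul_eq_pot {f g : E5 → ℝ≥0∞} (hg : Measurable g) : coul f g = ∫⁻ x, f x * pot g x :=
  coul_eq hg

/-- Tonelli's theorem for the factorization of |x|⁻⁴. The Coulomb pairing becomes the L² pairing of
half potentials. Convexity of the potential energy, the Cauchy–Schwarz inequality and the Hölder
continuity of potentials all rest on this. -/
lemma exists_halfPot_comp : ∃ c : ℝ≥0∞, c ≠ 0 ∧ c ≠ ∞ ∧ ∀ f : E5 → ℝ≥0∞, Measurable f →
    (∀ x, ∫⁻ z, halfKer (x - z) * halfPot f z = c * pot f x) ∧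
    ∀ g, Measurable g → ∫⁻ z, halfPot f z * halfPot g z = c * coul f g := by
  obtain ⟨c, hc0, hct, hc⟩ := exists_halfKer_comp
  have first : ∀ f : E5 → ℝ≥0∞, Measurable f →
      ∀ x, ∫⁻ z, halfKer (x - z) * halfPot f z = c * pot f x := by
    intro f hf x
    unfold halfPot pot
    rw [lintegral_congr fun z ↦ (lintegral_const_mul (halfKer (x - z))
      (by fun_prop : Measurable fun y ↦ f y * halfKer (y - z))).symm,
      lintegral_lintegral_swap (by fun_prop), ← lintegral_const_mul' _ _ hct]
    refine lintegral_congr_ae ?_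
    filter_upwards [ae_ne x] with y hy
    calc ∫⁻ z, halfKer (x - z) * (f y * halfKer (y - z))
        = ∫⁻ z, f y * (halfKer (x - z) * halfKer (y - z)) :=
          lintegral_congr fun z ↦ by ring
      _ = f y * (c * ‖x - y‖ₑ ^ (-4 : ℝ)) := by
          rw [lintegral_const_mul _ (by fun_prop), hc x y hy.symm]
      _ = _ := by ring
  refine ⟨c, hc0, hct, fun f hf ↦ ⟨first f hf, fun g hg ↦ ?_⟩⟩
  rw [coul_eq_pot hg, ← lintegral_const_mul' _ _ hct]
  have hg' := measurable_halfPot hg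
  calc ∫⁻ z, halfPot f z * halfPot g z = ∫⁻ z, ∫⁻ x, f x * halfKer (x - z) * halfPot g z := by
        refine lintegral_congr fun z ↦ ?_
        rw [lintegral_mul_const _ (by fun_prop)]; rfl
    _ = ∫⁻ x, ∫⁻ z, f x * halfKer (x - z) * halfPot g z := by
        rw [lintegral_lintegral_swap (by fun_prop)]
    _ = _ := by
        refine lintegral_congr fun x ↦ ?_
        simp_rw [mul_assoc]
        rw [lintegral_const_mul _ (by fun_prop), first g hg x]
        ring

lemma two_mul_le_sq_add_sq (a b : ℝ≥0∞) : 2 * (a * b) ≤ a * a + b * b := by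
  rcases eq_or_ne a ∞ with rfl | ha
  · simp
  rcases eq_or_ne b ∞ with rfl | hb
  · simp
  lift a to ℝ≥0 using ha
  lift b to ℝ≥0 using hb
  norm_cast
  rw [← NNReal.coe_le_coe]
  push_cast
  nlinarith [sq_nonneg ((a : ℝ) - b)]

/-- Positivity of the pairing at f - g, written without subtraction: 2ab ≤ a² + b² is integrated for
the half potentials. -/
lemma two_mul_coul_le {f g : E5 → ℝ≥0∞} (hf : Measurable f) (hg : Measurable g) :
    2 * coul f g ≤ coul f f + coul g g := by
  obtain ⟨c, hc0, hct, hc⟩ := exists_halfPot_comp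
  have hf' := measurable_halfPot hf
  have hg' := measurable_halfPot hg
  rw [← ENNReal.mul_le_mul_iff_right hc0 hct, mul_left_comm, mul_add, ← (hc f hf).2 g hg,
    ← (hc f hf).2 f hf, ← (hc g hg).2 g hg, ← lintegral_add_left (by fun_prop),
    ← lintegral_const_mul' _ _ (by simp)]
  exact lintegral_mono fun z ↦ two_mul_le_sq_add_sq _ _

/-- The Cauchy–Schwarz inequality for the (positive definite) Coulomb pairing. -/
lemma coul_le_sqrt_mul_sqrt {f g : E5 → ℝ≥0∞} (hf : Measurable f) (hg : Measurable g) :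
    coul f g ≤ coul f f ^ (1 / 2 : ℝ) * coul g g ^ (1 / 2 : ℝ) := by
  obtain ⟨c, hc0, hct, hc⟩ := exists_halfPot_comp
  have hf' := measurable_halfPot hf
  have hg' := measurable_halfPot hg
  have hol := ENNReal.lintegral_mul_le_Lp_mul_Lq volume (p := 2) (q := 2)
    ⟨by norm_num, by norm_num, by norm_num⟩ hf'.aemeasurable hg'.aemeasurable
  have sq : ∀ h : E5 → ℝ≥0∞, Measurable h → ∫⁻ z, halfPot h z ^ (2 : ℝ) = c * coul h h := by
    intro h hh
    rw [← (hc h hh).2 h hh]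
    refine lintegral_congr fun z ↦ ?_
    rw [ENNReal.rpow_two, sq]
  simp only [Pi.mul_apply] at hol
  rw [sq f hf, sq g hg, (hc f hf).2 g hg, ENNReal.mul_rpow_of_nonneg _ _ (by norm_num),
    ENNReal.mul_rpow_of_nonneg _ _ (by norm_num), mul_mul_mul_comm,
    ← ENNReal.rpow_add _ _ hc0 hct] at hol
  norm_num at hol
  rw [ENNReal.mul_le_mul_iff_right hc0 hct] at hol
  exact_mod_cast hol

/-- Duality: an `L^p` bound from the pairing with nonnegative functions in `L^q`. -/
lemma lintegral_rpow_le_of_forall_pairing {p q : ℝ} (hpq : p.HolderConjugate q) {F : E5 → ℝ≥0∞}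
    (hF : Measurable F) {A : ℝ≥0∞} (hA : ∀ h : E5 → ℝ≥0∞, Measurable h →
      ∫⁻ x, F x * h x ≤ A * (∫⁻ x, h x ^ q) ^ (1 / q)) :
    (∫⁻ x, F x ^ p) ^ (1 / p) ≤ A := by
  have hp := hpq.pos
  have hq := hpq.symm.pos
  have hp1 := hpq.lt
  -- The extremal test function is F^(p-1). Truncation in height and space makes its norm finite, so
  -- that one can divide by it; monotone convergence removes the truncation.
  set m : ℕ → E5 → ℝ≥0∞ := fun n ↦ (Metric.ball 0 (n : ℝ)).indicator fun x ↦ min (F x) n with hm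
  have hmm : ∀ n, Measurable (m n) := fun n ↦
    (hF.min measurable_const).indicator measurableSet_ball
  have hmF : ∀ n x, m n x ≤ F x := by
    intro n x
    by_cases hx : x ∈ Metric.ball (0 : E5) n
    · simp [hm, Set.indicator_of_mem hx]
    · simp [hm, Set.indicator_of_notMem hx]
  have hfin : ∀ n, ∫⁻ x, m n x ^ p < ∞ := by
    intro n
    have : ∀ x, m n x ^ p ≤ (Metric.ball (0 : E5) (n : ℝ)).indicator (fun _ ↦ (n : ℝ≥0∞) ^ p) x := by
      intro x
      by_cases hx : x ∈ Metric.ball (0 : E5) n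
      · simp only [hm, Set.indicator_of_mem hx]
        gcongr
        exact min_le_right _ _
      · simp only [hm, Set.indicator_of_notMem hx]
        simp [hp]
    refine (lintegral_mono this).trans_lt ?_
    rw [lintegral_indicator measurableSet_ball, setLIntegral_const]
    exact ENNReal.mul_lt_top (ENNReal.rpow_lt_top_of_nonneg hp.le (by simp)) measure_ball_lt_top
  have bound : ∀ n, ∫⁻ x, m n x ^ p ≤ A ^ p := by
    intro n
    have h1 := hA (fun x ↦ m n x ^ (p - 1)) (by fun_prop)
    have h2 : ∀ x, m n x ^ p ≤ F x * m n x ^ (p - 1) := by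
      intro x
      calc m n x ^ p = m n x * m n x ^ (p - 1) := by
            conv_lhs => rw [show p = 1 + (p - 1) by ring]
            rw [ENNReal.rpow_add_of_nonneg _ _ zero_le_one (by linarith), ENNReal.rpow_one]
        _ ≤ _ := by gcongr; exact hmF n x
    have h3 : ∀ x, (m n x ^ (p - 1)) ^ q = m n x ^ p := by
      intro x
      rw [← ENNReal.rpow_mul]
      congr 1
      exact hpq.sub_one_mul_conj
    simp_rw [h3] at h1
    have h4 := (lintegral_mono h2).trans h1
    rcases eq_or_ne (∫⁻ x, m n x ^ p) 0 with h0 | h0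
    · rw [h0]; exact zero_le
    set I := ∫⁻ x, m n x ^ p with hI
    have h5 : I = I ^ (1 / p) * I ^ (1 / q) := by
      rw [← ENNReal.rpow_add _ _ h0 (hfin n).ne, one_div, one_div, hpq.inv_add_inv_eq_one,
        ENNReal.rpow_one]
    have h6 : I ^ (1 / q) ≠ 0 := by
      simp [ENNReal.rpow_eq_zero_iff, h0, hq.le]
    have h7 : I ^ (1 / q) ≠ ∞ := ENNReal.rpow_ne_top_of_nonneg (by positivity) (hfin n).ne
    have h8 : I ^ (1 / p) ≤ A := by
      rw [← ENNReal.mul_le_mul_iff_left h6 h7, ← h5]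
      exact h4
    calc I = (I ^ (1 / p)) ^ p := by
          rw [← ENNReal.rpow_mul, one_div_mul_cancel hp.ne', ENNReal.rpow_one]
      _ ≤ A ^ p := by gcongr
  have lim : ∫⁻ x, F x ^ p ≤ A ^ p := by
    have hmono : Monotone m := by
      intro i j hij x
      by_cases hx : x ∈ Metric.ball (0 : E5) i
      · have hxj : x ∈ Metric.ball (0 : E5) j :=
          Metric.ball_subset_ball (by exact_mod_cast hij) hx
        simp only [hm, Set.indicator_of_mem hx, Set.indicator_of_mem hxj]
        gcongr
      · simp [hm, Set.indicator_of_notMem hx]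
    have hlim : ∀ x, Tendsto (fun n ↦ m n x) atTop (𝓝 (F x)) := by
      intro x
      have h1 : Tendsto (fun n : ℕ ↦ min (F x) (n : ℝ≥0∞)) atTop (𝓝 (min (F x) ∞)) :=
        tendsto_const_nhds.min ENNReal.tendsto_nat_nhds_top
      rw [min_eq_left le_top] at h1
      refine h1.congr' ?_
      obtain ⟨N, hN⟩ := exists_nat_gt ‖x‖
      filter_upwards [eventually_ge_atTop N] with n hn
      have hx : x ∈ Metric.ball (0 : E5) n := by
        simp only [Metric.mem_ball, dist_zero_right]
        exact hN.trans_le (by exact_mod_cast hn)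
      simp only [hm, Set.indicator_of_mem hx]
    refine le_of_tendsto' (lintegral_tendsto_of_tendsto_of_monotone
      (f := fun n x ↦ m n x ^ p) (fun n ↦ by fun_prop)
      (.of_forall fun x i j hij ↦ by
        simp only
        gcongr
        exact hmono hij x)
      (.of_forall fun x ↦ (ENNReal.continuous_rpow_const.tendsto _).comp (hlim x))) bound
  calc (∫⁻ x, F x ^ p) ^ (1 / p) ≤ (A ^ p) ^ (1 / p) := by gcongr
    _ = A := by rw [← ENNReal.rpow_mul, mul_one_div_cancel hp.ne', ENNReal.rpow_one]

/-- The `L^{5/2}` norm of the potential is controlled by the Coulomb energy. -/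
lemma exists_pot_le : ∃ C : ℝ≥0, ∀ f : E5 → ℝ≥0∞, Measurable f →
    (∫⁻ x, pot f x ^ (5 / 2 : ℝ)) ^ (2 / 5 : ℝ) ≤ C * coul f f ^ (1 / 2 : ℝ) := by
  -- The dual of L^(5/2) is L^(5/3), on which the Coulomb energy is finite. Cauchy–Schwarz for the
  -- pairing with a test function h splits off the energy of f.
  obtain ⟨C, hC⟩ := coul_le (p := 5 / 3) (r := 5 / 3) (by norm_num) (by norm_num) (by norm_num)
  refine ⟨C ^ (1 / 2 : ℝ), fun f hf ↦ ?_⟩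
  have key := lintegral_rpow_le_of_forall_pairing (p := 5 / 2) (q := 5 / 3)
    ⟨by norm_num, by norm_num, by norm_num⟩ (measurable_pot hf)
    (A := (C ^ (1 / 2 : ℝ) : ℝ≥0) * coul f f ^ (1 / 2 : ℝ)) (by
      intro h hh
      have e1 : ∫⁻ x, pot f x * h x = coul h f := by
        rw [coul_eq_pot hf]; simp_rw [mul_comm]
      rw [e1]
      have e2 := hC h h hh.aemeasurable hh.aemeasurable
      calc coul h f ≤ coul h h ^ (1 / 2 : ℝ) * coul f f ^ (1 / 2 : ℝ) :=
            coul_le_sqrt_mul_sqrt hh hf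
        _ ≤ (C * (∫⁻ x, h x ^ (5 / 3 : ℝ)) ^ (1 / (5 / 3) : ℝ) *
            (∫⁻ x, h x ^ (5 / 3 : ℝ)) ^ (1 / (5 / 3) : ℝ)) ^ (1 / 2 : ℝ) *
              coul f f ^ (1 / 2 : ℝ) := by gcongr
        _ = _ := by
            rw [mul_assoc (C : ℝ≥0∞), ← sq, ENNReal.mul_rpow_of_nonneg _ _ (by norm_num),
              ← ENNReal.rpow_natCast, ← ENNReal.rpow_mul _ _ (1 / 2),
              ENNReal.coe_rpow_of_nonneg _ (by norm_num)]
            norm_num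
            ring)
  norm_num at key ⊢
  exact key

/-! ### Translation estimate for potentials -/

/-- The modulus of the difference of `halfKer` and its translate. -/
def halfKerDiff (h z : E5) : ℝ≥0∞ :=
  ENNReal.ofReal |‖z + h‖ ^ (-(9 / 2) : ℝ) - ‖z‖ ^ (-(9 / 2) : ℝ)|

lemma measurable_halfKerDiff (h : E5) : Measurable (halfKerDiff h) := by
  unfold halfKerDiff; fun_prop

lemma halfKer_eq {z : E5} (hz : z ≠ 0) : halfKer z = ENNReal.ofReal (‖z‖ ^ (-(9 / 2) : ℝ)) :=
  (ofReal_norm_rpow hz _).symm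

lemma halfKer_le_add_halfKerDiff {h z : E5} (hz : z ≠ 0) (hzh : z + h ≠ 0) :
    halfKer (z + h) ≤ halfKer z + halfKerDiff h z ∧
      halfKer z ≤ halfKer (z + h) + halfKerDiff h z := by
  rw [halfKer_eq hz, halfKer_eq hzh, halfKerDiff, ← ENNReal.ofReal_add (by positivity)
    (by positivity), ← ENNReal.ofReal_add (by positivity) (by positivity)]
  constructor
  · refine ENNReal.ofReal_le_ofReal ?_
    linarith [le_abs_self (‖z + h‖ ^ (-(9 / 2) : ℝ) - ‖z‖ ^ (-(9 / 2) : ℝ))]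
  · refine ENNReal.ofReal_le_ofReal ?_
    linarith [neg_abs_le (‖z + h‖ ^ (-(9 / 2) : ℝ) - ‖z‖ ^ (-(9 / 2) : ℝ))]

lemma abs_rpow_sub_rpow_le {m a b : ℝ} (hm : 0 < m) (ha : m ≤ a) (hb : m ≤ b) :
    |a ^ (-(9 / 2) : ℝ) - b ^ (-(9 / 2) : ℝ)| ≤ 9 / 2 * m ^ (-(11 / 2) : ℝ) * |a - b| := by
  have := Convex.norm_image_sub_le_of_norm_hasDerivWithin_le (s := Set.Ici m)
    (f := fun x : ℝ ↦ x ^ (-(9 / 2) : ℝ))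
    (f' := fun x ↦ (-(9 / 2) : ℝ) * x ^ ((-(9 / 2) : ℝ) - 1)) (C := 9 / 2 * m ^ (-(11 / 2) : ℝ))
    (x := b) (y := a)
    (fun x hx ↦ (Real.hasDerivAt_rpow_const (Or.inl (hm.trans_le hx).ne')).hasDerivWithinAt)
    (fun x hx ↦ by
      have hx0 : 0 < x := hm.trans_le hx
      rw [Real.norm_eq_abs, abs_mul, abs_of_pos (Real.rpow_pos_of_pos hx0 _)]
      norm_num
      exact Real.rpow_le_rpow_of_nonpos hm hx (by norm_num))
    (convex_Ici m) hb ha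
  simpa using this

/-- The L¹ modulus of continuity of |z|^(-9/2). For |z| ≲ |h| the two kernels are integrated
separately and give |h|^(5-9/2). For larger z the mean value theorem gives |h| |z|^(-11/2), whose
integral is of order |h| · |h|^(-1/2). -/
lemma exists_lintegral_halfKerDiff_le : ∃ C : ℝ≥0, ∀ h : E5,
    ∫⁻ z, halfKerDiff h z ≤ C * ENNReal.ofReal (‖h‖ ^ (1 / 2 : ℝ)) := by
  obtain ⟨C₁, hC₁⟩ := riesz_ball (p := 9 / 2) (by norm_num)
  obtain ⟨C₂, hC₂⟩ := riesz_compl_ball (p := 11 / 2) (by norm_num)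
  set κ : ℝ := 9 / 2 * 2 ^ (11 / 2 : ℝ) with hκ
  refine ⟨C₁ * 3 + C₁ * 3 + κ.toNNReal * C₂, fun h ↦ ?_⟩
  by_cases hh : h = 0
  · simp [hh, halfKerDiff]
  have hpos : 0 < ‖h‖ := norm_pos_iff.2 hh
  -- Outside radius 2|h| one has |z + h| ≥ |z|/2; inside it both z and z + h lie in the ball of
  -- radius 3|h|.
  set D := Metric.ball (0 : E5) (3 * ‖h‖)
  set D' := (Metric.ball (0 : E5) (2 * ‖h‖))ᶜ
  have hDm : Measurable (D.indicator halfKer) := measurable_halfKer.indicator measurableSet_ball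
  have hDm' : Measurable (D'.indicator fun z : E5 ↦ ‖z‖ₑ ^ (-(11 / 2) : ℝ)) :=
    (measurable_riesz _).indicator measurableSet_ball.compl
  have hle : ∀ᵐ z : E5, halfKerDiff h z ≤ D.indicator halfKer (z + h) + D.indicator halfKer z +
      ENNReal.ofReal (κ * ‖h‖) * D'.indicator (fun z : E5 ↦ ‖z‖ₑ ^ (-(11 / 2) : ℝ)) z := by
    filter_upwards [ae_ne 0, ae_ne (-h)] with z hz hzh
    have hzh : z + h ≠ 0 := fun h0 ↦ hzh (eq_neg_of_add_eq_zero_left h0)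
    by_cases hz2 : z ∈ D'
    · refine le_trans ?_ le_add_self
      rw [Set.indicator_of_mem hz2, ← ofReal_norm_rpow hz, ← ENNReal.ofReal_mul (by positivity),
        halfKerDiff]
      refine ENNReal.ofReal_le_ofReal ?_
      have hz2 : 2 * ‖h‖ ≤ ‖z‖ := by simpa [D'] using hz2
      have hsub : ‖z‖ - ‖h‖ ≤ ‖z + h‖ := by
        have := norm_sub_le (z + h) h
        rw [add_sub_cancel_right] at this
        linarith
      have hz0 : 0 < ‖z‖ := norm_pos_iff.2 hz
      have := abs_rpow_sub_rpow_le (m := ‖z‖ / 2) (a := ‖z + h‖) (b := ‖z‖) (by positivity)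
        (by linarith) (by linarith)
      refine this.trans ?_
      have e : (‖z‖ / 2) ^ (-(11 / 2) : ℝ) = 2 ^ (11 / 2 : ℝ) * ‖z‖ ^ (-(11 / 2) : ℝ) := by
        rw [Real.div_rpow hz0.le (by norm_num), Real.rpow_neg (by norm_num : (0 : ℝ) ≤ 2),
          div_inv_eq_mul, mul_comm]
      rw [e, hκ]
      have : |‖z + h‖ - ‖z‖| ≤ ‖h‖ := by
        simpa using abs_norm_sub_norm_le (z + h) z
      calc _ ≤ 9 / 2 * (2 ^ (11 / 2 : ℝ) * ‖z‖ ^ (-(11 / 2) : ℝ)) * ‖h‖ := by gcongr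
        _ = _ := by ring
    · refine le_trans ?_ le_self_add
      have hz2 : ‖z‖ < 2 * ‖h‖ := by simpa [D'] using hz2
      have m1 : z ∈ D := by simp only [D, Metric.mem_ball, dist_zero_right]; linarith
      have m2 : z + h ∈ D := by
        simp only [D, Metric.mem_ball, dist_zero_right]
        linarith [norm_add_le z h]
      rw [Set.indicator_of_mem m1, Set.indicator_of_mem m2, halfKer_eq hz, halfKer_eq hzh,
        ← ENNReal.ofReal_add (by positivity) (by positivity), halfKerDiff]
      refine ENNReal.ofReal_le_ofReal ?_
      refine (abs_sub _ _).trans (le_of_eq ?_)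
      rw [abs_of_nonneg (by positivity), abs_of_nonneg (by positivity)]
  have i1 : ∫⁻ z, D.indicator halfKer z ≤ C₁ * 3 * ENNReal.ofReal (‖h‖ ^ (1 / 2 : ℝ)) := by
    rw [lintegral_indicator measurableSet_ball]
    refine (hC₁ (3 * ‖h‖) (by positivity)).trans ?_
    rw [mul_assoc]
    gcongr
    rw [show (3 : ℝ≥0∞) = ENNReal.ofReal 3 by simp, ← ENNReal.ofReal_mul (by norm_num)]
    refine ENNReal.ofReal_le_ofReal ?_
    rw [Real.mul_rpow (by norm_num) hpos.le]
    norm_num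
    refine mul_le_mul_of_nonneg_right ?_ (by positivity)
    calc (3 : ℝ) ^ (1 / 2 : ℝ) ≤ 3 ^ (1 : ℝ) :=
          Real.rpow_le_rpow_of_exponent_le (by norm_num) (by norm_num)
      _ = 3 := by simp
  have i2 : ∫⁻ z, D'.indicator (fun z : E5 ↦ ‖z‖ₑ ^ (-(11 / 2) : ℝ)) z ≤
      C₂ * ENNReal.ofReal (‖h‖ ^ (-(1 / 2) : ℝ)) := by
    rw [lintegral_indicator measurableSet_ball.compl]
    refine (hC₂ (2 * ‖h‖) (by positivity)).trans ?_
    refine mul_le_mul_right (ENNReal.ofReal_le_ofReal ?_) _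
    calc _ = (2 * ‖h‖) ^ (-(1 / 2) : ℝ) := by norm_num
      _ ≤ _ := Real.rpow_le_rpow_of_nonpos hpos (by linarith) (by norm_num)
  calc ∫⁻ z, halfKerDiff h z
      ≤ ∫⁻ z, (D.indicator halfKer (z + h) + D.indicator halfKer z +
        ENNReal.ofReal (κ * ‖h‖) * D'.indicator (fun z : E5 ↦ ‖z‖ₑ ^ (-(11 / 2) : ℝ)) z) :=
        lintegral_mono_ae hle
    _ = (∫⁻ z, D.indicator halfKer z) + (∫⁻ z, D.indicator halfKer z) + ENNReal.ofReal (κ * ‖h‖) *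
        ∫⁻ z, D'.indicator (fun z : E5 ↦ ‖z‖ₑ ^ (-(11 / 2) : ℝ)) z := by
        rw [lintegral_add_right _ (by fun_prop), lintegral_add_right _ hDm,
          lintegral_add_right_eq_self (D.indicator halfKer) h, lintegral_const_mul _ hDm']
    _ ≤ C₁ * 3 * ENNReal.ofReal (‖h‖ ^ (1 / 2 : ℝ)) + C₁ * 3 * ENNReal.ofReal (‖h‖ ^ (1 / 2 : ℝ)) +
        ENNReal.ofReal (κ * ‖h‖) * (C₂ * ENNReal.ofReal (‖h‖ ^ (-(1 / 2) : ℝ))) := by gcongr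
    _ = _ := by
        have e : ENNReal.ofReal (κ * ‖h‖) * (C₂ * ENNReal.ofReal (‖h‖ ^ (-(1 / 2) : ℝ))) =
            ENNReal.ofReal κ * C₂ * ENNReal.ofReal (‖h‖ ^ (1 / 2 : ℝ)) := by
          rw [ENNReal.ofReal_mul (by positivity), show (‖h‖ ^ (1 / 2 : ℝ)) =
            ‖h‖ * ‖h‖ ^ (-(1 / 2) : ℝ) by
              nth_rewrite 2 [← Real.rpow_one ‖h‖]; rw [← Real.rpow_add hpos]; norm_num,
            ENNReal.ofReal_mul hpos.le]
          ring
        rw [e]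
        push_cast
        change _ = (_ + _ + ENNReal.ofReal κ * _) * _
        ring

/-- Young's inequality `L¹ * L² ⊆ L²` for nonnegative functions. -/
lemma lintegral_conv_sq_le {D F : E5 → ℝ≥0∞} (hD : Measurable D) (hF : Measurable F) :
    ∫⁻ x, (∫⁻ z, D (x - z) * F z) ^ 2 ≤ (∫⁻ z, D z) ^ 2 * ∫⁻ z, F z ^ 2 := by
  -- Cauchy–Schwarz with respect to the measure D(x - z) dz.
  have cs : ∀ x, (∫⁻ z, D (x - z) * F z) ^ 2 ≤ (∫⁻ z, D z) * ∫⁻ z, D (x - z) * F z ^ 2 := by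
    intro x
    have hol := ENNReal.lintegral_mul_le_Lp_mul_Lq volume (p := 2) (q := 2)
      ⟨by norm_num, by norm_num, by norm_num⟩
      (f := fun z ↦ D (x - z) ^ (1 / 2 : ℝ)) (g := fun z ↦ D (x - z) ^ (1 / 2 : ℝ) * F z)
      (by fun_prop) (by fun_prop)
    simp only [Pi.mul_apply] at hol
    have e0 : ∀ a : ℝ≥0∞, (a ^ (1 / 2 : ℝ)) ^ (2 : ℝ) = a := fun a ↦ by
      rw [← ENNReal.rpow_mul]; norm_num
    have e1 : ∀ z, D (x - z) ^ (1 / 2 : ℝ) * (D (x - z) ^ (1 / 2 : ℝ) * F z) = D (x - z) * F z := by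
      intro z
      rw [← mul_assoc, ← ENNReal.rpow_add_of_nonneg _ _ (by norm_num) (by norm_num)]
      norm_num
    simp_rw [e1, ENNReal.mul_rpow_of_nonneg _ _ (zero_le_two : (0 : ℝ) ≤ 2), e0] at hol
    rw [lintegral_sub_left_eq_self D x] at hol
    calc (∫⁻ z, D (x - z) * F z) ^ 2 ≤ ((∫⁻ z, D z) ^ (1 / 2 : ℝ) *
          (∫⁻ z, D (x - z) * F z ^ (2 : ℝ)) ^ (1 / 2 : ℝ)) ^ 2 := by gcongr
      _ = _ := by
          rw [mul_pow, ← ENNReal.rpow_two, ← ENNReal.rpow_two, e0, e0]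
          simp_rw [ENNReal.rpow_two]
  calc ∫⁻ x, (∫⁻ z, D (x - z) * F z) ^ 2
      ≤ ∫⁻ x, (∫⁻ z, D z) * ∫⁻ z, D (x - z) * F z ^ 2 := lintegral_mono cs
    _ = (∫⁻ z, D z) * ∫⁻ x, ∫⁻ z, D (x - z) * F z ^ 2 := by
        rw [lintegral_const_mul]
        exact Measurable.lintegral_prod_right'
          (f := fun q : E5 × E5 ↦ D (q.1 - q.2) * F q.2 ^ 2) (by fun_prop)
    _ = (∫⁻ z, D z) * ∫⁻ z, ∫⁻ x, D (x - z) * F z ^ 2 := by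
        rw [lintegral_lintegral_swap (by fun_prop)]
    _ = (∫⁻ z, D z) * ((∫⁻ z, D z) * ∫⁻ z, F z ^ 2) := by
        congr 1
        rw [← lintegral_const_mul _ (by fun_prop)]
        refine lintegral_congr fun z ↦ ?_
        rw [lintegral_mul_const _ (by fun_prop), lintegral_sub_right_eq_self D z]
    _ = _ := by ring

/-- If d is finite, then a and b are infinite together, and the convention that ∞ has real value 0
does no harm. -/
lemma ofReal_abs_toReal_sub_le {a b d : ℝ≥0∞} (h1 : a ≤ b + d) (h2 : b ≤ a + d) :
    ENNReal.ofReal |a.toReal - b.toReal| ≤ d := by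
  rcases eq_or_ne d ∞ with rfl | hd
  · exact le_top
  rcases eq_or_ne a ∞ with rfl | ha
  · have : b = ∞ := by
      by_contra hb
      exact (ENNReal.add_lt_top.2 ⟨lt_top_iff_ne_top.2 hb, lt_top_iff_ne_top.2 hd⟩).not_ge h1
    simp [this]
  rcases eq_or_ne b ∞ with rfl | hb
  · exact absurd h2 (not_le.2
      (ENNReal.add_lt_top.2 ⟨lt_top_iff_ne_top.2 ha, lt_top_iff_ne_top.2 hd⟩))
  lift a to ℝ≥0 using ha
  lift b to ℝ≥0 using hb
  lift d to ℝ≥0 using hd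
  norm_cast at h1 h2
  rw [← NNReal.coe_le_coe] at h1 h2
  push_cast at h1 h2
  refine ENNReal.ofReal_le_of_le_toReal ?_
  simp only [ENNReal.coe_toReal]
  rw [abs_le]
  constructor <;> linarith

/-- Potentials are `1/2`-Hölder continuous in `L²`, with the square root of the Coulomb energy as
Hölder constant. -/
lemma exists_pot_translation_le : ∃ C : ℝ≥0, ∀ f : E5 → ℝ≥0∞, Measurable f → ∀ h : E5,
    (∫⁻ x, ENNReal.ofReal |(pot f (x + h)).toReal - (pot f x).toReal| ^ (2 : ℝ)) ^ (1 / 2 : ℝ) ≤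
      C * ENNReal.ofReal (‖h‖ ^ (1 / 2 : ℝ)) * coul f f ^ (1 / 2 : ℝ) := by
  obtain ⟨c, hc0, hct, hc⟩ := exists_halfPot_comp
  obtain ⟨C, hC⟩ := exists_lintegral_halfKerDiff_le
  refine ⟨C * (c⁻¹ ^ (1 / 2 : ℝ)).toNNReal, fun f hf h ↦ ?_⟩
  obtain ⟨hc1, hc2⟩ := hc f hf
  have hF := measurable_halfPot hf
  have hD := measurable_halfKerDiff h
  -- A translation of the potential acts on one factor `halfKer` only. Its increment is small in L¹,
  -- while `halfPot f` is in L² with the Coulomb energy as squared norm; Young's inequality combines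
  -- the two.
  have hpot : ∀ x, pot f x = c⁻¹ * ∫⁻ z, halfKer (x - z) * halfPot f z := by
    intro x
    rw [hc1 x, ← mul_assoc, ENNReal.inv_mul_cancel hc0 hct, one_mul]
  have hpt : ∀ x, ENNReal.ofReal |(pot f (x + h)).toReal - (pot f x).toReal| ≤
      c⁻¹ * ∫⁻ z, halfKerDiff h (x - z) * halfPot f z := by
    intro x
    have hne : ∀ᵐ z : E5, x - z ≠ 0 ∧ x - z + h ≠ 0 := by
      filter_upwards [ae_ne x, ae_ne (x + h)] with z h1 h2
      exact ⟨sub_ne_zero.2 h1.symm, fun h0 ↦ h2 (by rw [← sub_eq_zero, ← neg_eq_zero, ← h0]; abel)⟩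
    refine ofReal_abs_toReal_sub_le ?_ ?_
    · rw [hpot, hpot, ← mul_add, ← lintegral_add_left (by fun_prop)]
      refine mul_le_mul_right ?_ _
      refine lintegral_mono_ae (hne.mono fun z hz ↦ ?_)
      rw [← add_mul, add_sub_right_comm]
      gcongr
      exact (halfKer_le_add_halfKerDiff hz.1 hz.2).1
    · rw [hpot, hpot, ← mul_add, ← lintegral_add_left (by fun_prop)]
      refine mul_le_mul_right ?_ _
      refine lintegral_mono_ae (hne.mono fun z hz ↦ ?_)
      rw [← add_mul, add_sub_right_comm]
      gcongr
      exact (halfKer_le_add_halfKerDiff hz.1 hz.2).2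
  have key : ∫⁻ x, ENNReal.ofReal |(pot f (x + h)).toReal - (pot f x).toReal| ^ (2 : ℝ) ≤
      c⁻¹ * (C * ENNReal.ofReal (‖h‖ ^ (1 / 2 : ℝ))) ^ 2 * coul f f := by
    calc _ ≤ ∫⁻ x, c⁻¹ ^ 2 * (∫⁻ z, halfKerDiff h (x - z) * halfPot f z) ^ 2 := by
          refine lintegral_mono fun x ↦ ?_
          rw [ENNReal.rpow_two, ← mul_pow]
          gcongr
          exact hpt x
      _ = c⁻¹ ^ 2 * ∫⁻ x, (∫⁻ z, halfKerDiff h (x - z) * halfPot f z) ^ 2 :=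
          lintegral_const_mul' _ _ (by simp [hc0])
      _ ≤ c⁻¹ ^ 2 * ((∫⁻ z, halfKerDiff h z) ^ 2 * ∫⁻ z, halfPot f z ^ 2) := by
          gcongr; exact lintegral_conv_sq_le hD hF
      _ ≤ c⁻¹ ^ 2 * ((C * ENNReal.ofReal (‖h‖ ^ (1 / 2 : ℝ))) ^ 2 * (c * coul f f)) := by
          rw [← hc2 f hf]
          gcongr
          · exact hC h
          · rw [sq]
      _ = (c⁻¹ * c) * (c⁻¹ * (C * ENNReal.ofReal (‖h‖ ^ (1 / 2 : ℝ))) ^ 2 * coul f f) := by ring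
      _ = _ := by rw [ENNReal.inv_mul_cancel hc0 hct, one_mul]
  calc _ ≤ (c⁻¹ * (C * ENNReal.ofReal (‖h‖ ^ (1 / 2 : ℝ))) ^ 2 * coul f f) ^ (1 / 2 : ℝ) := by
        gcongr
    _ = _ := by
        rw [ENNReal.mul_rpow_of_nonneg _ _ (by norm_num), ENNReal.mul_rpow_of_nonneg _ _ (by norm_num),
          ← ENNReal.rpow_two, ← ENNReal.rpow_mul (C * ENNReal.ofReal (‖h‖ ^ (1 / 2 : ℝ)))]
        push_cast
        rw [ENNReal.coe_toNNReal (ENNReal.rpow_ne_top_of_nonneg (by norm_num) (by simpa))]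
        norm_num
        ring

/-! ### Fourier multipliers on `L²` -/

/-- The Fourier multiplier with complex symbol `m`, in the frequency variable of `𝓕`. -/
def fmul (m : E5 → ℂ) (f : L2) : L2 :=
  open Classical in
  if h : MemLp (fun ξ : E5 ↦ m ξ * (𝓕 f : L2) ξ) 2 volume then 𝓕⁻ (h.toLp _) else 0

lemma mult_eq_fmul (m : E5 → ℝ) : mult m = fmul fun ξ ↦ (m ((2 * Real.pi) • ξ) : ℂ) := rfl

lemma fourier_fmul {m : E5 → ℂ} {f : L2} (h : MemLp (fun ξ : E5 ↦ m ξ * (𝓕 f : L2) ξ) 2 volume) :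
    (𝓕 (fmul m f) : L2) =ᵐ[volume] fun ξ ↦ m ξ * (𝓕 f : L2) ξ := by
  rw [fmul, dif_pos h, FourierTransform.fourier_fourierInv_eq]
  exact h.coeFn_toLp

lemma L2_ext_fourier {f g : L2} (h : (𝓕 f : L2) =ᵐ[volume] (𝓕 g : L2)) : f = g := by
  have : (𝓕 f : L2) = 𝓕 g := Lp.ext h
  exact (Lp.fourierTransformₗᵢ E5 ℂ).injective this

lemma fourier_add_ae (f g : L2) :
    (𝓕 (f + g) : L2) =ᵐ[volume] fun ξ ↦ (𝓕 f : L2) ξ + (𝓕 g : L2) ξ := by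
  rw [FourierTransform.fourier_add]; exact Lp.coeFn_add _ _

lemma fourier_sub_ae (f g : L2) :
    (𝓕 (f - g) : L2) =ᵐ[volume] fun ξ ↦ (𝓕 f : L2) ξ - (𝓕 g : L2) ξ := by
  have : (𝓕 (f - g) : L2) = 𝓕 f - 𝓕 g := (Lp.fourierTransformₗᵢ E5 ℂ).map_sub f g
  rw [this]; exact Lp.coeFn_sub _ _

lemma fourier_smul_ae (c : ℂ) (f : L2) :
    (𝓕 (c • f) : L2) =ᵐ[volume] fun ξ ↦ c * (𝓕 f : L2) ξ := by
  rw [FourierTransform.fourier_smul]; exact Lp.coeFn_smul _ _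

lemma fourier_zero_ae : (𝓕 (0 : L2) : L2) =ᵐ[volume] fun _ ↦ 0 := by
  have : (𝓕 (0 : L2) : L2) = 0 := (Lp.fourierTransformₗᵢ E5 ℂ).map_zero
  rw [this]; exact Lp.coeFn_zero _ _ _

/-- The hypothesis already contains the square integrability of the product, because 𝓕 g is in L².
Identities between multipliers are thus checked pointwise on the Fourier side. -/
lemma fmul_eq_of_fourier {m : E5 → ℂ} {f g : L2}
    (h : (𝓕 g : L2) =ᵐ[volume] fun ξ ↦ m ξ * (𝓕 f : L2) ξ) : fmul m f = g :=
  L2_ext_fourier ((fourier_fmul ((memLp_congr_ae h).1 (Lp.memLp _))).trans h.symm)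

lemma memLp_mul_fourier {m : E5 → ℂ} (hm : Measurable m) {C : ℝ} (hC : ∀ ξ, ‖m ξ‖ ≤ C) (f : L2) :
    MemLp (fun ξ : E5 ↦ m ξ * (𝓕 f : L2) ξ) 2 volume := by
  have h := (Lp.memLp (𝓕 f : L2))
  refine MemLp.of_le_mul (c := C) h (hm.aestronglyMeasurable.mul h.1) (.of_forall fun ξ ↦ ?_)
  rw [norm_mul]
  gcongr
  exact hC ξ

lemma enorm_sq_eq_lintegral (f : L2) : ‖f‖ₑ ^ 2 = ∫⁻ x, ‖f x‖ₑ ^ 2 := by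
  rw [Lp.enorm_def, eLpNorm_eq_lintegral_rpow_enorm_toReal (by norm_num) (by norm_num)]
  rw [← ENNReal.rpow_two, ← ENNReal.rpow_mul]
  norm_num

lemma enorm_fourier (f : L2) : ‖(𝓕 f : L2)‖ₑ = ‖f‖ₑ := by
  rw [← ofReal_norm, ← ofReal_norm, Lp.norm_fourier_eq]

lemma enorm_sq_eq_lintegral_fourier (f : L2) : ‖f‖ₑ ^ 2 = ∫⁻ ξ, ‖(𝓕 f : L2) ξ‖ₑ ^ 2 := by
  rw [← enorm_fourier, enorm_sq_eq_lintegral]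

/-- The Fourier multiplier with a bounded measurable symbol as a bounded operator. -/
def fmulL (m : E5 → ℂ) (hm : Measurable m) (C : ℝ) (hC : ∀ ξ, ‖m ξ‖ ≤ C) : L2 →L[ℂ] L2 :=
  LinearMap.mkContinuous
    { toFun := fmul m
      map_add' := fun f g ↦ fmul_eq_of_fourier <| by
        filter_upwards [fourier_add_ae f g, fourier_add_ae (fmul m f) (fmul m g),
          fourier_fmul (memLp_mul_fourier hm hC f),
          fourier_fmul (memLp_mul_fourier hm hC g)] with ξ h1 h2 h3 h4
        rw [h2, h3, h4, h1, mul_add]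
      map_smul' := fun c f ↦ fmul_eq_of_fourier <| by
        filter_upwards [fourier_smul_ae c f, fourier_smul_ae c (fmul m f),
          fourier_fmul (memLp_mul_fourier hm hC f)] with ξ h1 h2 h3
        simp only [RingHom.id_apply]
        rw [h2, h3, h1, mul_left_comm] } C (fun f ↦ by
      have h := fourier_fmul (memLp_mul_fourier hm hC f)
      rw [← Lp.norm_fourier_eq, ← Lp.norm_fourier_eq f]
      refine Lp.norm_le_mul_norm_of_ae_le_mul ?_
      filter_upwards [h] with ξ hξ
      simp only [LinearMap.coe_mk, AddHom.coe_mk]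
      rw [hξ, norm_mul]
      gcongr
      exact hC ξ)

@[simp]
lemma fmulL_apply (m : E5 → ℂ) (hm : Measurable m) (C : ℝ) (hC : ∀ ξ, ‖m ξ‖ ≤ C) (f : L2) :
    fmulL m hm C hC f = fmul m f := rfl

lemma norm_fmul_le {m : E5 → ℂ} (hm : Measurable m) {C : ℝ} (hC0 : 0 ≤ C) (hC : ∀ ξ, ‖m ξ‖ ≤ C)
    (f : L2) : ‖fmul m f‖ ≤ C * ‖f‖ :=
  (fmulL m hm C hC).le_of_opNorm_le (LinearMap.mkContinuous_norm_le _ hC0 _) f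

/-- Dominated convergence for Fourier multipliers. -/
lemma tendsto_fmul {ι : Type*} {l : Filter ι} [l.IsCountablyGenerated] {m : ι → E5 → ℂ}
    {m₀ : E5 → ℂ} {f : L2} {B : E5 → ℝ} (hB : MemLp B 2 volume)
    (hm : ∀ i, Measurable (m i)) (hm₀ : Measurable m₀)
    (hb : ∀ᶠ i in l, ∀ᵐ ξ, ‖m i ξ * (𝓕 f : L2) ξ‖ ≤ B ξ) (hb₀ : ∀ᵐ ξ, ‖m₀ ξ * (𝓕 f : L2) ξ‖ ≤ B ξ)
    (hlim : ∀ᵐ ξ, Tendsto (fun i ↦ m i ξ * (𝓕 f : L2) ξ) l (𝓝 (m₀ ξ * (𝓕 f : L2) ξ))) :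
    Tendsto (fun i ↦ fmul (m i) f) l (𝓝 (fmul m₀ f)) := by
  have meas := (Lp.stronglyMeasurable (𝓕 f : L2)).measurable
  have mem : ∀ m' : E5 → ℂ, Measurable m' → (∀ᵐ ξ, ‖m' ξ * (𝓕 f : L2) ξ‖ ≤ B ξ) →
      MemLp (fun ξ : E5 ↦ m' ξ * (𝓕 f : L2) ξ) 2 volume := by
    intro m' hm' h
    refine MemLp.of_le hB (hm'.mul meas).aestronglyMeasurable (h.mono fun ξ hξ ↦ hξ.trans ?_)
    exact le_abs_self _
  have h₀ := mem m₀ hm₀ hb₀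
  rw [Lp.tendsto_Lp_iff_tendsto_eLpNorm'] at *
  have key : Tendsto (fun i ↦ ∫⁻ ξ, ‖m i ξ * (𝓕 f : L2) ξ - m₀ ξ * (𝓕 f : L2) ξ‖ₑ ^ 2) l
      (𝓝 (∫⁻ _ : E5, 0)) := by
    refine tendsto_lintegral_filter_of_dominated_convergence
      (fun ξ ↦ ENNReal.ofReal (2 * |B ξ|) ^ 2) (.of_forall fun i ↦ ?_) ?_ ?_ ?_
    · exact ((((hm i).mul meas).sub (hm₀.mul meas)).enorm).pow_const 2
    · filter_upwards [hb] with i hi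
      filter_upwards [hi, hb₀] with ξ h1 h2
      gcongr
      rw [← ofReal_norm]
      refine ENNReal.ofReal_le_ofReal ((norm_sub_le _ _).trans ?_)
      linarith [le_abs_self (B ξ)]
    · have hB2 : MemLp (fun ξ ↦ 2 * |B ξ|) 2 (volume : Measure E5) := hB.norm.const_mul 2
      have := hB2.2
      rw [eLpNorm_lt_top_iff_lintegral_rpow_enorm_lt_top (by norm_num) (by norm_num)] at this
      refine ne_of_lt (lt_of_le_of_lt (le_of_eq (lintegral_congr fun ξ ↦ ?_)) this)
      rw [Real.enorm_of_nonneg (by positivity)]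
      simp
    · filter_upwards [hlim] with ξ hξ
      have h1 := (ENNReal.continuous_pow 2).tendsto _ |>.comp
        (hξ.sub_const (m₀ ξ * (𝓕 f : L2) ξ)).enorm
      simpa [Function.comp_def] using h1
  have key2 : Tendsto (fun i ↦ ‖fmul (m i) f - fmul m₀ f‖ₑ ^ 2) l (𝓝 0) := by
    rw [lintegral_zero] at key
    refine key.congr' ?_
    filter_upwards [hb] with i hi
    rw [enorm_sq_eq_lintegral_fourier]
    refine lintegral_congr_ae ?_
    filter_upwards [fourier_sub_ae (fmul (m i) f) (fmul m₀ f), fourier_fmul h₀,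
      fourier_fmul (mem _ (hm i) hi)] with ξ h1 h2 h3
    rw [h1, h2, h3]
  have key3 : Tendsto (fun i ↦ ‖fmul (m i) f - fmul m₀ f‖ₑ) l (𝓝 0) := by
    have h1 := (ENNReal.continuous_rpow_const (y := 1 / 2)).tendsto 0 |>.comp key2
    simp only [Function.comp_def, ENNReal.zero_rpow_of_pos (by norm_num : (0 : ℝ) < 1 / 2)] at h1
    refine h1.congr fun i ↦ ?_
    rw [← ENNReal.rpow_two, ← ENNReal.rpow_mul]
    norm_num
  refine key3.congr fun i ↦ ?_
  rw [Lp.enorm_def]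
  exact eLpNorm_congr_ae (Lp.coeFn_sub _ _)

/-! ### Band-limited functions -/

/-- The indicator function of the closed ball of radius `R`. -/
def ballSymbol (R : ℝ) : E5 → ℂ := (Metric.closedBall (0 : E5) R).indicator 1

lemma measurable_ballSymbol (R : ℝ) : Measurable (ballSymbol R) :=
  measurable_one.indicator measurableSet_closedBall

lemma norm_ballSymbol_le (R : ℝ) (ξ : E5) : ‖ballSymbol R ξ‖ ≤ 1 := by
  unfold ballSymbol
  by_cases h : ξ ∈ Metric.closedBall (0 : E5) R
  · rw [Set.indicator_of_mem h]; simp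
  · rw [Set.indicator_of_notMem h]; simp

/-- The sharp projection to frequencies in the ball of radius `R`. -/
def lowProj (R : ℝ) : L2 →L[ℂ] L2 :=
  fmulL (ballSymbol R) (measurable_ballSymbol R) 1 (norm_ballSymbol_le R)

/-- The functions with frequencies in the ball of radius `R`. -/
def bandLimited (R : ℝ) : Submodule ℂ L2 := (lowProj R - ContinuousLinearMap.id ℂ L2).ker

lemma isClosed_bandLimited (R : ℝ) : IsClosed (bandLimited R : Set L2) :=
  (lowProj R - ContinuousLinearMap.id ℂ L2).isClosed_ker

lemma fourier_lowProj (R : ℝ) (f : L2) :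
    (𝓕 (lowProj R f) : L2) =ᵐ[volume] fun ξ ↦ ballSymbol R ξ * (𝓕 f : L2) ξ :=
  fourier_fmul (memLp_mul_fourier (measurable_ballSymbol R) (norm_ballSymbol_le R) f)

lemma mem_bandLimited_iff {R : ℝ} {f : L2} :
    f ∈ bandLimited R ↔ ∀ᵐ ξ : E5, R < ‖ξ‖ → (𝓕 f : L2) ξ = 0 := by
  have h1 : f ∈ bandLimited R ↔ lowProj R f = f := by
    simp [bandLimited, sub_eq_zero]
  rw [h1]
  constructor
  · intro h
    have := fourier_lowProj R f
    rw [h] at this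
    filter_upwards [this] with ξ hξ hR
    rw [hξ, ballSymbol, Set.indicator_of_notMem (by simpa using hR), zero_mul]
  · intro h
    refine L2_ext_fourier ?_
    filter_upwards [h, fourier_lowProj R f] with ξ h1 h2
    rw [h2]
    by_cases hξ : ‖ξ‖ ≤ R
    · simp [ballSymbol, hξ]
    · rw [h1 (not_le.1 hξ), mul_zero]

lemma lowProj_mem (R : ℝ) (f : L2) : lowProj R f ∈ bandLimited R := by
  rw [mem_bandLimited_iff]
  filter_upwards [fourier_lowProj R f] with ξ h hR
  rw [h, ballSymbol, Set.indicator_of_notMem (by simpa using hR), zero_mul]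

lemma memLp_mul_fourier_of_bandLimited {R : ℝ} {f : L2} (hf : f ∈ bandLimited R) {m : E5 → ℂ}
    (hm : Measurable m) {C : ℝ} (hC : ∀ ξ, ‖ξ‖ ≤ R → ‖m ξ‖ ≤ C) :
    MemLp (fun ξ : E5 ↦ m ξ * (𝓕 f : L2) ξ) 2 volume := by
  have h := (Lp.memLp (𝓕 f : L2))
  refine MemLp.of_le_mul (c := C) h (hm.aestronglyMeasurable.mul h.1) ?_
  filter_upwards [mem_bandLimited_iff.1 hf] with ξ hξ
  rw [norm_mul]
  by_cases hR : ‖ξ‖ ≤ R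
  · gcongr
    exact hC ξ hR
  · rw [hξ (not_le.1 hR)]; simp

lemma fmul_mem_bandLimited {R : ℝ} {f : L2} (hf : f ∈ bandLimited R) (m : E5 → ℂ) :
    fmul m f ∈ bandLimited R := by
  by_cases h : MemLp (fun ξ : E5 ↦ m ξ * (𝓕 f : L2) ξ) 2 volume
  · rw [mem_bandLimited_iff] at hf ⊢
    filter_upwards [hf, fourier_fmul h] with ξ h1 h2 hR
    rw [h2, h1 hR, mul_zero]
  · rw [fmul, dif_neg h]; exact Submodule.zero_mem _

lemma tendsto_lowProj (f : L2) : Tendsto (fun n : ℕ ↦ lowProj n f) atTop (𝓝 f) := by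
  have h1 : fmul (fun _ ↦ 1) f = f := fmul_eq_of_fourier (by simp)
  conv => enter [3, 1]; rw [← h1]
  refine tendsto_fmul (B := fun ξ ↦ ‖(𝓕 f : L2) ξ‖) (Lp.memLp _).norm
    (fun n ↦ measurable_ballSymbol n) measurable_const (.of_forall fun n ↦ .of_forall fun ξ ↦ ?_)
    (.of_forall fun ξ ↦ by simp) (.of_forall fun ξ ↦ ?_)
  · rw [norm_mul]
    exact mul_le_of_le_one_left (norm_nonneg _) (norm_ballSymbol_le _ _)
  · refine tendsto_const_nhds.congr' ?_
    obtain ⟨N, hN⟩ := exists_nat_ge ‖ξ‖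
    filter_upwards [eventually_ge_atTop N] with n hn
    have : ‖ξ‖ ≤ n := hN.trans (by exact_mod_cast hn)
    simp [ballSymbol, this]

/-- Fourier inversion for square integrable functions with integrable Fourier transform. -/
lemma ae_eq_fourierInv {f : L2} (hf : Integrable (𝓕 f : L2)) :
    f =ᵐ[volume] fun x ↦ 𝓕⁻ ((𝓕 f : L2) : E5 → ℂ) x := by
  have hloc : LocallyIntegrable (fun x : E5 ↦ f x - 𝓕⁻ ((𝓕 f : L2) : E5 → ℂ) x) := by
    refine LocallyIntegrable.sub ((Lp.memLp f).locallyIntegrable (by norm_num)) ?_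
    refine Continuous.locallyIntegrable ?_
    exact VectorFourier.fourierIntegral_continuous Real.continuous_fourierChar
      (by simp only [LinearMap.neg_apply]; exact (continuous_inner.neg)) hf
  -- Both sides are tested against smooth functions of compact support: for f by the compatibility
  -- of the L² and the distributional Fourier transform, for the inverse integral by Fubini.
  have := ae_eq_zero_of_integral_contDiff_smul_eq_zero hloc (fun φ hφ hφc ↦ ?_)
  · filter_upwards [this] with x hx
    exact sub_eq_zero.1 hx
  have hΦc : HasCompactSupport fun x ↦ (φ x : ℂ) := hφc.comp_left (g := Complex.ofReal) rfl
  set Φ : 𝓢(E5, ℂ) := hΦc.toSchwartzMap (Complex.ofRealCLM.contDiff.comp hφ) with hΦ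
  have hΦa : ∀ x, Φ x = φ x := fun x ↦ rfl
  have e1 : ∫ x, Φ x • f x = ∫ ξ, (𝓕⁻ Φ : 𝓢(E5, ℂ)) ξ • (𝓕 f : L2) ξ := by
    have h1 := Lp.fourierInv_toTemperedDistribution_eq (𝓕 f : L2)
    rw [FourierTransform.fourierInv_fourier_eq] at h1
    have h2 := congrArg (fun u : 𝓢'(E5, ℂ) ↦ u Φ) h1
    rw [TemperedDistribution.fourierInv_apply, Lp.toTemperedDistribution_apply,
      Lp.toTemperedDistribution_apply] at h2
    exact h2.symm
  have e2 : ∫ ξ, (𝓕⁻ Φ : 𝓢(E5, ℂ)) ξ • (𝓕 f : L2) ξ =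
      ∫ x, Φ x • 𝓕⁻ ((𝓕 f : L2) : E5 → ℂ) x := by
    rw [SchwartzMap.fourierInv_coe]
    have := VectorFourier.integral_fourierIntegral_smul_eq_flip (L := -innerₗ E5)
      (e := Real.fourierChar) (μ := volume) (ν := volume) (f := (Φ : E5 → ℂ))
      (g := ((𝓕 f : L2) : E5 → ℂ)) Real.continuous_fourierChar
      (by simp only [LinearMap.neg_apply]; exact (continuous_inner.neg)) Φ.integrable hf
    have hflip : (-innerₗ E5).flip = -innerₗ E5 := by
      ext x y; simp [real_inner_comm]
    rw [hflip] at this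
    exact this
  have i1 : Integrable fun x ↦ φ x • f x := by
    have := ((Lp.memLp f).locallyIntegrable (by norm_num)).integrable_smul_left_of_hasCompactSupport
      hφ.continuous hφc
    exact this
  have hcont : Continuous (𝓕⁻ ((𝓕 f : L2) : E5 → ℂ)) :=
    VectorFourier.fourierIntegral_continuous Real.continuous_fourierChar
      (by simp only [LinearMap.neg_apply]; exact (continuous_inner.neg)) hf
  have i2 : Integrable fun x ↦ φ x • 𝓕⁻ ((𝓕 f : L2) : E5 → ℂ) x :=
    hcont.locallyIntegrable.integrable_smul_left_of_hasCompactSupport hφ.continuous hφc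
  simp_rw [smul_sub]
  rw [integral_sub i1 i2, sub_eq_zero]
  have e3 := e1.trans e2
  simpa only [hΦa, Complex.real_smul, smul_eq_mul] using e3

/-! ### Bernstein and Sobolev inequalities, translations -/

lemma integrable_fourier_of_bandLimited {R : ℝ} {f : L2} (hf : f ∈ bandLimited R) :
    Integrable (𝓕 f : L2) := by
  have h1 : MemLp (ballSymbol R) 2 volume :=
    memLp_indicator_const (μ := (volume : Measure E5)) 2 measurableSet_closedBall (1 : ℂ)
      (Or.inr measure_closedBall_lt_top.ne)
  have h2 : Integrable fun ξ ↦ ballSymbol R ξ * (𝓕 f : L2) ξ :=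
    h1.integrable_mul (Lp.memLp (𝓕 f : L2))
  refine h2.congr ?_
  filter_upwards [mem_bandLimited_iff.1 hf] with ξ hξ
  by_cases hR : ‖ξ‖ ≤ R
  · simp [ballSymbol, hR]
  · rw [hξ (not_le.1 hR), mul_zero]

lemma ae_enorm_le_lintegral_fourier {f : L2} (hf : Integrable (𝓕 f : L2)) :
    ∀ᵐ x, ‖f x‖ₑ ≤ ∫⁻ ξ, ‖(𝓕 f : L2) ξ‖ₑ := by
  filter_upwards [ae_eq_fourierInv hf] with x hx
  rw [hx, Real.fourierInv_eq]
  refine (enorm_integral_le_lintegral_enorm _).trans (le_of_eq (lintegral_congr fun ξ ↦ ?_))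
  rw [← ofReal_norm, Circle.norm_smul, ofReal_norm]

/-- Bernstein's inequality. -/
lemma exists_bernstein (R : ℝ) : ∃ C : ℝ≥0, ∀ f ∈ bandLimited R, ∀ᵐ x, ‖f x‖ₑ ≤ C * ‖f‖ₑ := by
  refine ⟨(volume (Metric.closedBall (0 : E5) R) ^ (1 / 2 : ℝ)).toNNReal, fun f hf ↦ ?_⟩
  filter_upwards [ae_enorm_le_lintegral_fourier (integrable_fourier_of_bandLimited hf)] with x hx
  refine hx.trans ?_
  rw [ENNReal.coe_toNNReal (ENNReal.rpow_ne_top_of_nonneg (by norm_num)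
    measure_closedBall_lt_top.ne)]
  have hm : Measurable fun ξ ↦ ‖(𝓕 f : L2) ξ‖ₑ :=
    (Lp.stronglyMeasurable (𝓕 f : L2)).measurable.enorm
  have hol := ENNReal.lintegral_mul_le_Lp_mul_Lq (volume : Measure E5) (p := 2) (q := 2)
    ⟨by norm_num, by norm_num, by norm_num⟩
    (f := (Metric.closedBall (0 : E5) R).indicator 1) (g := fun ξ ↦ ‖(𝓕 f : L2) ξ‖ₑ)
    (measurable_one.indicator measurableSet_closedBall).aemeasurable hm.aemeasurable
  have e1 : ∫⁻ ξ, ‖(𝓕 f : L2) ξ‖ₑ = ∫⁻ ξ, ((Metric.closedBall (0 : E5) R).indicator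
      (1 : E5 → ℝ≥0∞) * fun ξ ↦ ‖(𝓕 f : L2) ξ‖ₑ) ξ := by
    refine lintegral_congr_ae ?_
    filter_upwards [mem_bandLimited_iff.1 hf] with ξ hξ
    by_cases hR : ‖ξ‖ ≤ R
    · simp [hR]
    · simp [hξ (not_le.1 hR)]
  have e2 : ∫⁻ ξ, (Metric.closedBall (0 : E5) R).indicator (1 : E5 → ℝ≥0∞) ξ ^ (2 : ℝ) =
      volume (Metric.closedBall (0 : E5) R) := by
    rw [← lintegral_indicator_one measurableSet_closedBall]
    refine lintegral_congr fun ξ ↦ ?_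
    by_cases hR : ‖ξ‖ ≤ R <;> simp [hR]
  have e3 : (∫⁻ ξ, ‖(𝓕 f : L2) ξ‖ₑ ^ (2 : ℝ)) ^ (1 / 2 : ℝ) = ‖f‖ₑ := by
    simp_rw [ENNReal.rpow_two]
    rw [← enorm_sq_eq_lintegral_fourier, ← ENNReal.rpow_two, ← ENNReal.rpow_mul]
    norm_num
  rw [e1]
  rw [e2, e3] at hol
  exact hol

/-- Band-limited functions in `L²` are in `L^p` for all `p ≥ 2`. -/
lemma exists_bernstein_eLpNorm (R : ℝ) : ∃ C : ℝ≥0, ∀ f ∈ bandLimited R, ∀ p : ℝ≥0∞, 2 ≤ p →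
    p ≠ ∞ → eLpNorm f p volume ≤ C * ‖f‖ₑ := by
  obtain ⟨C, hC⟩ := exists_bernstein R
  refine ⟨C + 1, fun f hf p hp hpt ↦ ?_⟩
  have hp2 : 2 ≤ p.toReal := by
    rw [← ENNReal.toReal_ofNat]; exact ENNReal.toReal_mono hpt hp
  have hp0 : p ≠ 0 := by rintro rfl; norm_num at hp2
  rw [eLpNorm_eq_lintegral_rpow_enorm_toReal hp0 hpt]
  set q := p.toReal
  have h1 : ∫⁻ x, ‖f x‖ₑ ^ q ≤ (((C + 1 : ℝ≥0) : ℝ≥0∞) * ‖f‖ₑ) ^ q := by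
    calc ∫⁻ x, ‖f x‖ₑ ^ q ≤ ∫⁻ x, (((C + 1 : ℝ≥0) : ℝ≥0∞) * ‖f‖ₑ) ^ (q - 2) * ‖f x‖ₑ ^ 2 := by
          refine lintegral_mono_ae ?_
          filter_upwards [hC f hf] with x hx
          calc ‖f x‖ₑ ^ q = ‖f x‖ₑ ^ (q - 2) * ‖f x‖ₑ ^ (2 : ℝ) := by
                rw [← ENNReal.rpow_add_of_nonneg _ _ (by linarith) (by norm_num)]; ring_nf
            _ ≤ _ := by
                rw [ENNReal.rpow_two]
                gcongr
                refine hx.trans ?_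
                gcongr
                simp
      _ = (((C + 1 : ℝ≥0) : ℝ≥0∞) * ‖f‖ₑ) ^ (q - 2) * ‖f‖ₑ ^ 2 := by
          rw [lintegral_const_mul'' _
            ((Lp.stronglyMeasurable f).measurable.enorm.pow_const 2).aemeasurable,
            ← enorm_sq_eq_lintegral]
      _ ≤ (((C + 1 : ℝ≥0) : ℝ≥0∞) * ‖f‖ₑ) ^ (q - 2) *
          (((C + 1 : ℝ≥0) : ℝ≥0∞) * ‖f‖ₑ) ^ (2 : ℝ) := by
          rw [ENNReal.rpow_two]
          gcongr
          exact le_mul_of_one_le_left zero_le (by simp)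
      _ = _ := by
          rw [← ENNReal.rpow_add_of_nonneg _ _ (by linarith) (by norm_num)]; ring_nf
  calc _ ≤ ((((C + 1 : ℝ≥0) : ℝ≥0∞) * ‖f‖ₑ) ^ q) ^ (1 / q) := by gcongr
    _ = _ := by
        rw [← ENNReal.rpow_mul, mul_one_div_cancel (by linarith), ENNReal.rpow_one]

/-- Cauchy–Schwarz for |ξ|⁻¹ · |ξ| |f̂| on the ball of frequencies: |ξ|⁻² integrates to R³ in
dimension five, whence R^(3/2). -/
lemma exists_lowProj_sup_le : ∃ C : ℝ≥0, 0 < C ∧ ∀ (f : L2) (R : ℝ), 0 < R →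
    ∀ᵐ x, ‖lowProj R f x‖ₑ ≤ C * ENNReal.ofReal (R ^ (3 / 2 : ℝ)) * gradNormSq f ^ (1 / 2 : ℝ) := by
  obtain ⟨C, hC⟩ := riesz_ball (p := 2) (by norm_num)
  refine ⟨(C * 8) ^ (1 / 2 : ℝ) + 1, by positivity, fun f R hR ↦ ?_⟩
  filter_upwards [ae_enorm_le_lintegral_fourier
    (integrable_fourier_of_bandLimited (lowProj_mem R f))] with x hx
  refine hx.trans ?_
  have hm : Measurable fun ξ ↦ ‖(𝓕 f : L2) ξ‖ₑ :=
    (Lp.stronglyMeasurable (𝓕 f : L2)).measurable.enorm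
  have hol := ENNReal.lintegral_mul_le_Lp_mul_Lq (volume : Measure E5) (p := 2) (q := 2)
    ⟨by norm_num, by norm_num, by norm_num⟩
    (f := (Metric.ball (0 : E5) (2 * R)).indicator fun ξ ↦ ‖ξ‖ₑ ^ (-1 : ℝ))
    (g := fun ξ ↦ ‖ξ‖ₑ * ‖(𝓕 f : L2) ξ‖ₑ)
    ((measurable_riesz _).indicator measurableSet_ball).aemeasurable
    (by fun_prop)
  have e1 : ∫⁻ ξ, ‖(𝓕 (lowProj R f) : L2) ξ‖ₑ ≤
      ∫⁻ ξ, (((Metric.ball (0 : E5) (2 * R)).indicator fun ξ ↦ ‖ξ‖ₑ ^ (-1 : ℝ)) *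
      fun ξ ↦ ‖ξ‖ₑ * ‖(𝓕 f : L2) ξ‖ₑ) ξ := by
    refine lintegral_mono_ae ?_
    filter_upwards [fourier_lowProj R f, ae_ne 0] with ξ hξ h0
    rw [hξ, ballSymbol]
    by_cases hξR : ‖ξ‖ ≤ R
    · have : ξ ∈ Metric.ball (0 : E5) (2 * R) := by simp; linarith
      rw [Pi.mul_apply, Set.indicator_of_mem this, Set.indicator_of_mem (by simpa using hξR),
        ENNReal.rpow_neg_one, ← mul_assoc, ENNReal.inv_mul_cancel (by simpa using h0) (by simp)]
      simp
    · rw [Set.indicator_of_notMem (by simpa using hξR)]; simp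
  have e2 : ∫⁻ ξ, ((Metric.ball (0 : E5) (2 * R)).indicator fun ξ ↦ ‖ξ‖ₑ ^ (-1 : ℝ)) ξ ^ (2 : ℝ) ≤
      C * 8 * ENNReal.ofReal (R ^ (3 : ℝ)) := by
    calc _ = ∫⁻ ξ in Metric.ball (0 : E5) (2 * R), ‖ξ‖ₑ ^ (-2 : ℝ) := by
          rw [← lintegral_indicator measurableSet_ball]
          refine lintegral_congr fun ξ ↦ ?_
          by_cases hξ : ξ ∈ Metric.ball (0 : E5) (2 * R)
          · rw [Set.indicator_of_mem hξ, Set.indicator_of_mem hξ, ← ENNReal.rpow_mul]; norm_num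
          · rw [Set.indicator_of_notMem hξ, Set.indicator_of_notMem hξ]; simp
      _ ≤ C * ENNReal.ofReal ((2 * R) ^ (5 - 2 : ℝ)) := hC _ (by positivity)
      _ = _ := by
          rw [Real.mul_rpow (by norm_num) hR.le, ENNReal.ofReal_mul (by positivity), mul_assoc]
          norm_num
  have e3 : ∫⁻ ξ, (‖ξ‖ₑ * ‖(𝓕 f : L2) ξ‖ₑ) ^ (2 : ℝ) ≤ gradNormSq f := by
    refine lintegral_mono fun ξ ↦ ?_
    rw [ENNReal.rpow_two, mul_pow, ← ofReal_norm, ← ENNReal.ofReal_pow (norm_nonneg _)]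
    gcongr
    rw [norm_smul, Real.norm_of_nonneg Real.two_pi_pos.le]
    refine le_mul_of_one_le_left (norm_nonneg _) ?_
    linarith [Real.pi_gt_three]
  refine e1.trans (hol.trans ?_)
  calc _ ≤ (C * 8 * ENNReal.ofReal (R ^ (3 : ℝ))) ^ (1 / 2 : ℝ) * gradNormSq f ^ (1 / 2 : ℝ) := by
        gcongr
    _ = ((C * 8 : ℝ≥0) : ℝ≥0∞) ^ (1 / 2 : ℝ) * ENNReal.ofReal (R ^ (3 / 2 : ℝ)) *
          gradNormSq f ^ (1 / 2 : ℝ) := by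
        rw [ENNReal.mul_rpow_of_nonneg _ _ (by norm_num),
          ENNReal.ofReal_rpow_of_pos (by positivity), ← Real.rpow_mul hR.le]
        norm_num
    _ ≤ _ := by
        rw [← ENNReal.coe_rpow_of_nonneg _ (by norm_num)]
        gcongr
        simp

/-- At height a, remove frequencies up to the radius R at which the low part is still at most a/2
everywhere. Then |f| > a forces the high part to be at least a/2, and Chebyshev with Plancherel
bounds the measure. The condition |ξ| > R reads a < 2K|ξ|^(3/2). -/
lemma distrib_le {C : ℝ≥0} (hC : ∀ (f : L2) (R : ℝ), 0 < R → ∀ᵐ x, ‖lowProj R f x‖ₑ ≤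
      C * ENNReal.ofReal (R ^ (3 / 2 : ℝ)) * gradNormSq f ^ (1 / 2 : ℝ)) (f : L2) {K : ℝ}
    (hK : 0 < K) (hCK : C * gradNormSq f ^ (1 / 2 : ℝ) ≤ ENNReal.ofReal K) {a : ℝ} (ha : 0 < a) :
    distrib (fun x ↦ ‖f x‖ₑ) a ≤ ENNReal.ofReal (4 * a ^ (-2 : ℝ)) *
      ∫⁻ ξ, {a : ℝ | ENNReal.ofReal a < ENNReal.ofReal (2 * K * ‖ξ‖ ^ (3 / 2 : ℝ))}.indicator 1 a *
        ‖(𝓕 f : L2) ξ‖ₑ ^ 2 := by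
  set R : ℝ := (a / (2 * K)) ^ (2 / 3 : ℝ) with hR
  have hR0 : 0 < R := by positivity
  have hlow : ∀ᵐ x, ‖lowProj R f x‖ₑ ≤ ENNReal.ofReal (a / 2) := by
    filter_upwards [hC f R hR0] with x hx
    refine hx.trans ?_
    have : R ^ (3 / 2 : ℝ) = a / (2 * K) := by
      rw [hR, ← Real.rpow_mul (by positivity)]; norm_num
    rw [this, mul_right_comm]
    calc _ ≤ ENNReal.ofReal K * ENNReal.ofReal (a / (2 * K)) := by gcongr
      _ = _ := by
          rw [← ENNReal.ofReal_mul hK.le]; congr 1; field_simp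
  set g : L2 := f - lowProj R f with hg
  have hgm := (Lp.stronglyMeasurable g).measurable
  have hsub : distrib (fun x ↦ ‖f x‖ₑ) a ≤
      volume {x | ENNReal.ofReal ((a / 2) ^ 2) ≤ ‖g x‖ₑ ^ 2} := by
    refine measure_mono_ae ?_
    filter_upwards [hlow, Lp.coeFn_sub f (lowProj R f)] with x h1 h2 (h3 : ENNReal.ofReal a < _)
    change ENNReal.ofReal ((a / 2) ^ 2) ≤ ‖g x‖ₑ ^ 2
    rw [ENNReal.ofReal_pow (by positivity)]
    gcongr
    by_contra! hcon
    have h4 : f x = lowProj R f x + g x := by rw [hg, h2]; simp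
    have h5 : ‖f x‖ₑ ≤ ENNReal.ofReal (a / 2) + ENNReal.ofReal (a / 2) := by
      rw [h4]; exact (enorm_add_le _ _).trans (add_le_add h1 hcon.le)
    rw [← ENNReal.ofReal_add (by positivity) (by positivity), add_halves] at h5
    exact absurd h3 (not_lt.2 h5)
  have hcheb := meas_ge_le_lintegral_div (μ := (volume : Measure E5)) (f := fun x ↦ ‖g x‖ₑ ^ 2)
    (by fun_prop) (ε := ENNReal.ofReal ((a / 2) ^ 2)) (by positivity) ENNReal.ofReal_ne_top
  refine (hsub.trans hcheb).trans ?_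
  rw [← enorm_sq_eq_lintegral, enorm_sq_eq_lintegral_fourier, ENNReal.div_eq_inv_mul,
    ← ENNReal.ofReal_inv_of_pos (by positivity)]
  have e : ((a / 2) ^ 2)⁻¹ = 4 * a ^ (-2 : ℝ) := by
    rw [Real.rpow_neg ha.le, Real.rpow_two]; field_simp; norm_num
  rw [e]
  refine mul_le_mul_right (lintegral_mono_ae ?_) _
  filter_upwards [fourier_sub_ae f (lowProj R f), fourier_lowProj R f] with ξ h1 h2
  rw [h1, h2]
  by_cases hξ : ‖ξ‖ ≤ R
  · simp [ballSymbol, hξ]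
  · have hlt : R < ‖ξ‖ := not_le.1 hξ
    have : a < 2 * K * ‖ξ‖ ^ (3 / 2 : ℝ) := by
      have h3 : R ^ (3 / 2 : ℝ) < ‖ξ‖ ^ (3 / 2 : ℝ) := Real.rpow_lt_rpow hR0.le hlt (by norm_num)
      have h4 : R ^ (3 / 2 : ℝ) = a / (2 * K) := by
        rw [hR, ← Real.rpow_mul (by positivity)]; norm_num
      rw [h4, div_lt_iff₀ (by positivity)] at h3
      linarith
    have hmem : a ∈ {a : ℝ | ENNReal.ofReal a < ENNReal.ofReal (2 * K * ‖ξ‖ ^ (3 / 2 : ℝ))} :=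
      (ENNReal.ofReal_lt_ofReal_iff (ha.trans this)).2 this
    rw [Set.indicator_of_mem hmem]
    simp [ballSymbol, hξ]

/-- The Sobolev inequality `Ḣ¹(ℝ⁵) ⊆ L^{10/3}(ℝ⁵)`. -/
theorem exists_sobolev : ∃ C : ℝ≥0, ∀ f : L2,
    eLpNorm f (10 / 3) volume ≤ C * gradNormSq f ^ (1 / 2 : ℝ) := by
  obtain ⟨C, hC0, hC⟩ := exists_lowProj_sup_le
  set D : ℝ := (10 * (2 * (C : ℝ)) ^ (4 / 3 : ℝ)) ^ (3 / 10 : ℝ) with hD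
  have hDpos : 0 < D := by positivity
  refine ⟨D.toNNReal, fun f ↦ ?_⟩
  have hDt : ((D.toNNReal : ℝ≥0) : ℝ≥0∞) ≠ 0 := by simpa using hDpos
  rcases eq_or_ne (gradNormSq f) ∞ with ht | ht
  · rw [ht, ENNReal.top_rpow_of_pos (by norm_num), ENNReal.mul_top hDt]; exact le_top
  have hfm := (Lp.stronglyMeasurable (𝓕 f : L2)).measurable
  -- A vanishing gradient is treated apart, since the height dependent cutoff radius needs K > 0.
  rcases eq_or_ne (gradNormSq f) 0 with h0 | h0
  · have hf0 : f = 0 := by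
      refine L2_ext_fourier (EventuallyEq.trans ?_ fourier_zero_ae.symm)
      rw [gradNormSq, lintegral_eq_zero_iff (by fun_prop)] at h0
      filter_upwards [h0, ae_ne 0] with ξ h1 h2
      have hn : 0 < ‖(2 * Real.pi) • ξ‖ := norm_pos_iff.2 (smul_ne_zero Real.two_pi_pos.ne' h2)
      have h3 : 0 < ‖(2 * Real.pi) • ξ‖ ^ 2 := by positivity
      have h4 := mul_eq_zero.1 h1
      rcases h4 with h4 | h4
      · exact absurd (ENNReal.ofReal_eq_zero.1 h4) (not_le.2 h3)
      · simpa using h4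
    rw [hf0, eLpNorm_congr_ae (Lp.coeFn_zero _ _ _)]
    simp
  set G : ℝ := (gradNormSq f).toReal with hG
  have hG0 : 0 < G := ENNReal.toReal_pos h0 ht
  have hGe : gradNormSq f = ENNReal.ofReal G := (ENNReal.ofReal_toReal ht).symm
  obtain ⟨K, hK⟩ : ∃ K : ℝ, K = C * G ^ (1 / 2 : ℝ) := ⟨_, rfl⟩
  have hKpos : 0 < K := by rw [hK]; positivity
  have hCK : C * gradNormSq f ^ (1 / 2 : ℝ) ≤ ENNReal.ofReal K := by
    rw [hGe, ENNReal.ofReal_rpow_of_pos hG0, hK, ENNReal.ofReal_mul (by positivity),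
      ENNReal.ofReal_coe_nnreal]
  -- The layer cake weight a^(7/3) times a⁻² leaves a^(1/3). Fubini integrates it up to 2K|ξ|^(3/2),
  -- which produces |ξ|², the weight of the gradient.
  have hmain : ∫⁻ x, ‖f x‖ₑ ^ (10 / 3 : ℝ) ≤
      ENNReal.ofReal (10 * (2 * K) ^ (4 / 3 : ℝ)) * ENNReal.ofReal G := by
    rw [layercake_rpow (Lp.stronglyMeasurable f).measurable.enorm (by norm_num)]
    set J : ℝ → E5 → ℝ≥0∞ := fun a ξ ↦
      {a : ℝ | ENNReal.ofReal a < ENNReal.ofReal (2 * K * ‖ξ‖ ^ (3 / 2 : ℝ))}.indicator 1 a with hJ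
    have hJm : Measurable fun q : ℝ × E5 ↦ J q.1 q.2 := by
      have : (fun q : ℝ × E5 ↦ J q.1 q.2) = {q : ℝ × E5 | ENNReal.ofReal q.1 <
          ENNReal.ofReal (2 * K * ‖q.2‖ ^ (3 / 2 : ℝ))}.indicator 1 := by
        ext q
        by_cases h : ENNReal.ofReal q.1 < ENNReal.ofReal (2 * K * ‖q.2‖ ^ (3 / 2 : ℝ)) <;>
          simp [hJ, h]
      rw [this]
      exact measurable_one.indicator (measurableSet_lt (by fun_prop) (by fun_prop))
    calc _ ≤ ∫⁻ a in Set.Ioi (0 : ℝ), ∫⁻ ξ, ENNReal.ofReal (40 / 3 * a ^ (1 / 3 : ℝ)) *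
          (J a ξ * ‖(𝓕 f : L2) ξ‖ₑ ^ 2) := by
          refine setLIntegral_mono' measurableSet_Ioi fun a ha ↦ ?_
          have ha : (0 : ℝ) < a := ha
          rw [lintegral_const_mul' _ _ ENNReal.ofReal_ne_top]
          refine (mul_le_mul_right (distrib_le hC f hKpos hCK ha) _).trans (le_of_eq ?_)
          rw [← mul_assoc, ← ENNReal.ofReal_mul (by positivity)]
          congr 2
          rw [mul_mul_mul_comm, ← Real.rpow_add ha]
          norm_num
      _ = ∫⁻ ξ, ∫⁻ a in Set.Ioi (0 : ℝ), ENNReal.ofReal (40 / 3 * a ^ (1 / 3 : ℝ)) *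
          (J a ξ * ‖(𝓕 f : L2) ξ‖ₑ ^ 2) := by
          rw [lintegral_lintegral_swap]
          exact ((by fun_prop : Measurable fun q : ℝ × E5 ↦
            ENNReal.ofReal (40 / 3 * q.1 ^ (1 / 3 : ℝ))).mul
              (hJm.mul (by fun_prop))).aemeasurable
      _ ≤ ∫⁻ ξ, ENNReal.ofReal (10 * (2 * K) ^ (4 / 3 : ℝ)) *
          (ENNReal.ofReal (‖(2 * Real.pi) • ξ‖ ^ 2) * ‖(𝓕 f : L2) ξ‖ₑ ^ 2) := by
          refine lintegral_mono fun ξ ↦ ?_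
          have h1 := rpow_eq_lintegral (p := 4 / 3) (by norm_num)
            (ENNReal.ofReal (2 * K * ‖ξ‖ ^ (3 / 2 : ℝ)))
          have h2 : ∫⁻ a in Set.Ioi (0 : ℝ), ENNReal.ofReal (40 / 3 * a ^ (1 / 3 : ℝ)) *
              (J a ξ * ‖(𝓕 f : L2) ξ‖ₑ ^ 2) = 10 * (ENNReal.ofReal
                (2 * K * ‖ξ‖ ^ (3 / 2 : ℝ)) ^ (4 / 3 : ℝ)) * ‖(𝓕 f : L2) ξ‖ₑ ^ 2 := by
            rw [h1, ← lintegral_const_mul' _ _ (by simp), ← lintegral_mul_const' _ _ (by simp)]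
            refine setLIntegral_congr_fun measurableSet_Ioi fun a ha ↦ ?_
            have ha : (0 : ℝ) < a := ha
            have e : ENNReal.ofReal (40 / 3 * a ^ (1 / 3 : ℝ)) =
                10 * ENNReal.ofReal (4 / 3 * a ^ ((4 / 3 : ℝ) - 1)) := by
              rw [show (10 : ℝ≥0∞) = ENNReal.ofReal 10 by simp, ← ENNReal.ofReal_mul (by norm_num)]
              congr 1
              norm_num
              ring
            rw [e]
            simp only [hJ]
            ring
          rw [h2, ← mul_assoc]
          refine mul_le_mul_left ?_ _
          have h3 : (2 * K * ‖ξ‖ ^ (3 / 2 : ℝ)) ^ (4 / 3 : ℝ) =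
              (2 * K) ^ (4 / 3 : ℝ) * ‖ξ‖ ^ 2 := by
            rw [Real.mul_rpow (by positivity) (by positivity), ← Real.rpow_mul (norm_nonneg _)]
            norm_num
          rw [ENNReal.ofReal_rpow_of_nonneg (by positivity) (by norm_num)]
          rw [h3, show (10 : ℝ≥0∞) = ENNReal.ofReal 10 by simp, ← ENNReal.ofReal_mul (by norm_num),
            ← ENNReal.ofReal_mul (by positivity)]
          refine ENNReal.ofReal_le_ofReal ?_
          rw [← mul_assoc]
          gcongr
          rw [norm_smul, Real.norm_of_nonneg Real.two_pi_pos.le]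
          refine le_mul_of_one_le_left (norm_nonneg _) ?_
          linarith [Real.pi_gt_three]
      _ = _ := by
          rw [lintegral_const_mul' _ _ ENNReal.ofReal_ne_top, ← hGe]; rfl
  rw [eLpNorm_eq_lintegral_rpow_enorm_toReal (by norm_num)
    (ENNReal.div_ne_top (by norm_num) (by norm_num))]
  have htr : (10 / 3 : ℝ≥0∞).toReal = 10 / 3 := by norm_num
  rw [htr]
  calc _ ≤ (ENNReal.ofReal (10 * (2 * K) ^ (4 / 3 : ℝ)) * ENNReal.ofReal G) ^ (1 / (10 / 3) : ℝ) := by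
        gcongr
    _ = _ := by
        rw [hGe, ENNReal.ofReal_rpow_of_pos hG0, ← ENNReal.ofReal_mul (by positivity),
          ENNReal.ofReal_rpow_of_pos (by positivity), ← ENNReal.ofReal_coe_nnreal,
          Real.coe_toNNReal _ hDpos.le, ← ENNReal.ofReal_mul hDpos.le]
        congr 1
        have e : 10 * (2 * K) ^ (4 / 3 : ℝ) * G =
            (10 * (2 * (C : ℝ)) ^ (4 / 3 : ℝ)) * G ^ (5 / 3 : ℝ) := by
          rw [hK, ← mul_assoc 2, Real.mul_rpow (by positivity) (by positivity),
            ← Real.rpow_mul hG0.le, show (5 / 3 : ℝ) = 1 / 2 * (4 / 3) + 1 by norm_num,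
            Real.rpow_add hG0, Real.rpow_one]
          ring
        rw [e, hD, Real.mul_rpow (by positivity) (by positivity), ← Real.rpow_mul hG0.le]
        norm_num

/-- The translation `f ↦ f(· + h)` on `L²`. -/
def shift (h : E5) : L2 →ₗᵢ[ℂ] L2 :=
  Lp.compMeasurePreservingₗᵢ ℂ (fun x ↦ x + h) (measurePreserving_add_right volume h)

lemma shift_ae (h : E5) (f : L2) : shift h f =ᵐ[volume] fun x ↦ f (x + h) :=
  Lp.coeFn_compMeasurePreserving f (measurePreserving_add_right volume h)

/-- The symbol of the translation by `h`. -/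
def shiftSymbol (h ξ : E5) : ℂ := (Real.fourierChar (inner ℝ ξ h) : ℂ)

lemma measurable_shiftSymbol (h : E5) : Measurable (shiftSymbol h) := by
  unfold shiftSymbol
  exact (Continuous.comp (by fun_prop : Continuous ((↑) : Circle → ℂ)) (Real.continuous_fourierChar.comp
    (continuous_id.inner continuous_const))).measurable

lemma norm_shiftSymbol (h ξ : E5) : ‖shiftSymbol h ξ‖ = 1 := Circle.norm_coe _

/-- For band-limited f pointwise Fourier inversion applies; both sides are continuous in f, and
frequency truncations converge to f. -/
lemma shift_eq_fmul (h : E5) (f : L2) : shift h f = fmul (shiftSymbol h) f := by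
  have hm := measurable_shiftSymbol h
  have hn : ∀ ξ, ‖shiftSymbol h ξ‖ ≤ 1 := fun ξ ↦ (norm_shiftSymbol h ξ).le
  have band : ∀ R : ℝ, ∀ f ∈ bandLimited R, shift h f = fmul (shiftSymbol h) f := by
    intro R f hf
    refine Lp.ext ?_
    have h1 := ae_eq_fourierInv (integrable_fourier_of_bandLimited hf)
    have h2 := ae_eq_fourierInv (integrable_fourier_of_bandLimited
      (fmul_mem_bandLimited hf (shiftSymbol h)))
    have h3 := (measurePreserving_add_right volume h).quasiMeasurePreserving.ae h1
    filter_upwards [shift_ae h f, h2, h3] with x e1 e2 e3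
    rw [e1, e2, e3, Real.fourierInv_eq, Real.fourierInv_eq]
    refine integral_congr_ae ?_
    filter_upwards [fourier_fmul (memLp_mul_fourier hm hn f)] with ξ hξ
    rw [hξ, inner_add_right, AddChar.map_add_eq_mul, mul_smul]
    rfl
  have l1 := ((shift h).continuous.tendsto f).comp (tendsto_lowProj f)
  have l2 := ((fmulL (shiftSymbol h) hm 1 hn).continuous.tendsto f).comp (tendsto_lowProj f)
  refine tendsto_nhds_unique l1 (l2.congr fun n ↦ ?_)
  exact (band n _ (lowProj_mem n f)).symm

lemma enorm_shiftSymbol_sub_one_le (h ξ : E5) :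
    ‖shiftSymbol h ξ - 1‖ₑ ≤ ENNReal.ofReal (‖h‖ * ‖(2 * Real.pi) • ξ‖) := by
  rw [← ofReal_norm]
  refine ENNReal.ofReal_le_ofReal ?_
  have h1 : shiftSymbol h ξ = Complex.exp (Complex.I * ((2 * Real.pi * inner ℝ ξ h : ℝ) : ℂ)) := by
    rw [shiftSymbol, Real.fourierChar_apply]
    congr 1
    ring
  rw [h1]
  refine (Real.norm_exp_I_mul_ofReal_sub_one_le).trans ?_
  rw [norm_smul, Real.norm_of_nonneg Real.two_pi_pos.le, norm_mul,
    Real.norm_of_nonneg Real.two_pi_pos.le]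
  calc 2 * Real.pi * ‖inner ℝ ξ h‖ ≤ 2 * Real.pi * (‖ξ‖ * ‖h‖) := by
        gcongr
        exact norm_inner_le_norm ξ h
    _ = _ := by ring

lemma shift_sub_sq_le (h : E5) (f : L2) :
    ∫⁻ x, ‖f (x + h) - f x‖ₑ ^ 2 ≤ ENNReal.ofReal (‖h‖ ^ 2) * gradNormSq f := by
  have e1 : ∫⁻ x, ‖f (x + h) - f x‖ₑ ^ 2 = ‖shift h f - f‖ₑ ^ 2 := by
    rw [enorm_sq_eq_lintegral]
    refine lintegral_congr_ae ?_
    filter_upwards [shift_ae h f, Lp.coeFn_sub (shift h f) f] with x h1 h2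
    rw [h2, Pi.sub_apply, h1]
  have hm := measurable_shiftSymbol h
  have hn : ∀ ξ, ‖shiftSymbol h ξ‖ ≤ 1 := fun ξ ↦ (norm_shiftSymbol h ξ).le
  rw [e1, enorm_sq_eq_lintegral_fourier, gradNormSq,
    ← lintegral_const_mul' _ _ ENNReal.ofReal_ne_top]
  refine lintegral_mono_ae ?_
  filter_upwards [fourier_sub_ae (shift h f) f, fourier_fmul (memLp_mul_fourier hm hn f)]
    with ξ h1 h2
  rw [h1, shift_eq_fmul, h2, ← sub_one_mul, enorm_mul, mul_pow, ← mul_assoc,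
    ← ENNReal.ofReal_mul (by positivity), ← mul_pow ‖h‖, ENNReal.ofReal_pow (by positivity)]
  gcongr
  exact enorm_shiftSymbol_sub_one_le h ξ

/-! ### Subordination and fractional derivatives -/

/-- The integrand is at most t^(-a) near 0 and at most t^(-1-a) near infinity. -/
lemma integrableOn_subordination {a : ℝ} (ha : 0 < a) (ha1 : a < 1) :
    IntegrableOn (fun t : ℝ ↦ t ^ (-1 - a) * (1 - Real.exp (-t))) (Set.Ioi 0) := by
  have hu : Set.Ioi (0 : ℝ) = Set.Ioo 0 1 ∪ Set.Ici 1 := by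
    rw [Set.Ioo_union_Ici_eq_Ioi one_pos]
  have hm : Measurable fun t : ℝ ↦ t ^ (-1 - a) * (1 - Real.exp (-t)) := by fun_prop
  rw [hu]
  refine IntegrableOn.union ?_ ?_
  · refine Integrable.mono' ((intervalIntegral.integrableOn_Ioo_rpow_iff one_pos (s := -a)).2
      (by linarith)) hm.aestronglyMeasurable
      ((ae_restrict_iff' measurableSet_Ioo).2 (.of_forall fun t ht ↦ ?_))
    have ht0 := ht.1
    have h1 : 0 ≤ 1 - Real.exp (-t) := by
      have := Real.exp_le_one_iff.2 (by linarith : -t ≤ 0); linarith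
    have h2 : 1 - Real.exp (-t) ≤ t := by linarith [Real.add_one_le_exp (-t)]
    rw [Real.norm_of_nonneg (by positivity)]
    calc _ ≤ t ^ (-1 - a) * t := by gcongr
      _ = t ^ (-a) := by
          nth_rewrite 2 [← Real.rpow_one t]; rw [← Real.rpow_add ht0]; ring_nf
  · rw [integrableOn_Ici_iff_integrableOn_Ioi]
    refine Integrable.mono' ((integrableOn_Ioi_rpow_iff one_pos (s := -1 - a)).2
      (by linarith)) hm.aestronglyMeasurable
      ((ae_restrict_iff' measurableSet_Ioi).2 (.of_forall fun t ht ↦ ?_))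
    have ht0 : (0 : ℝ) < t := one_pos.trans ht
    have h1 : 0 ≤ 1 - Real.exp (-t) := by
      have := Real.exp_le_one_iff.2 (by linarith : -t ≤ 0); linarith
    rw [Real.norm_of_nonneg (by positivity)]
    refine mul_le_of_le_one_right (by positivity) ?_
    linarith [Real.exp_pos (-t)]

lemma integrableOn_rpow_mul_exp_neg {b : ℝ} (hb : -1 < b) :
    IntegrableOn (fun t : ℝ ↦ t ^ b * Real.exp (-t)) (Set.Ioi 0) := by
  have := Real.GammaIntegral_convergent (s := b + 1) (by linarith)
  refine this.congr_fun (fun t _ ↦ ?_) measurableSet_Ioi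
  simp [mul_comm]

/-- The normalising constant of the subordination formula. -/
def subConst (a : ℝ) : ℝ := ∫ t in Set.Ioi (0 : ℝ), t ^ (-1 - a) * (1 - Real.exp (-t))

lemma subConst_pos {a : ℝ} (ha : 0 < a) (ha1 : a < 1) : 0 < subConst a := by
  have hpos : ∀ t ∈ Set.Ioi (0 : ℝ), 0 < t ^ (-1 - a) * (1 - Real.exp (-t)) := by
    intro t ht
    have ht : (0 : ℝ) < t := ht
    have : Real.exp (-t) < 1 := by rw [← Real.exp_zero]; exact Real.exp_lt_exp.2 (by linarith)
    have h1 : 0 < 1 - Real.exp (-t) := by linarith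
    positivity
  unfold subConst
  rw [setIntegral_pos_iff_support_of_nonneg_ae
    ((ae_restrict_iff' measurableSet_Ioi).2 (.of_forall fun t ht ↦ (hpos t ht).le))
    (integrableOn_subordination ha ha1)]
  refine lt_of_lt_of_le (by simp : (0 : ℝ≥0∞) < volume (Set.Ioi (0 : ℝ))) (measure_mono ?_)
  exact fun t ht ↦ ⟨(hpos t ht).ne', ht⟩

/-- Scaling in t. Used with l = 1 + |η|², it represents ⟨η⟩^(2a) by heat factors, which in turn are
averages of translations. -/
lemma integral_subordination {a : ℝ} {l : ℝ} (hl : 0 < l) :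
    ∫ t in Set.Ioi (0 : ℝ), t ^ (-1 - a) * (1 - Real.exp (-(l * t))) = l ^ a * subConst a := by
  have h := integral_comp_mul_left_Ioi (fun t : ℝ ↦ t ^ (-1 - a) * (1 - Real.exp (-t))) 0 hl
  rw [mul_zero, smul_eq_mul] at h
  have h2 : ∫ t in Set.Ioi (0 : ℝ), (l * t) ^ (-1 - a) * (1 - Real.exp (-(l * t))) =
      l ^ (-1 - a) * ∫ t in Set.Ioi (0 : ℝ), t ^ (-1 - a) * (1 - Real.exp (-(l * t))) := by
    rw [← integral_const_mul]
    refine setIntegral_congr_fun measurableSet_Ioi fun t ht ↦ ?_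
    rw [Real.mul_rpow hl.le (le_of_lt ht), mul_assoc]
  rw [h2] at h
  unfold subConst
  have h3 : l ^ (1 + a) * l ^ (-1 - a) = 1 := by rw [← Real.rpow_add hl]; norm_num
  have h4 : l ^ a = l ^ (1 + a) * l⁻¹ := by
    rw [← Real.rpow_neg_one, ← Real.rpow_add hl]; ring_nf
  rw [h4, mul_assoc, ← h, ← mul_assoc, h3, one_mul]

/-- The Gaussian `exp(-π |y|²)`. -/
def gauss (y : E5) : ℝ := Real.exp (-(Real.pi * ‖y‖ ^ 2))

lemma gauss_pos (y : E5) : 0 < gauss y := Real.exp_pos _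

@[fun_prop]
lemma continuous_gauss : Continuous gauss := by unfold gauss; fun_prop

lemma integrable_exp_neg_mul_norm_sq {b : ℝ} (hb : 0 < b) :
    Integrable fun y : E5 ↦ Real.exp (-(b * ‖y‖ ^ 2)) := by
  have := (GaussianFourier.integrable_cexp_neg_mul_sq_norm_add (V := E5) (b := (b : ℂ))
    (by simpa) 0 0).norm
  refine this.congr (.of_forall fun y ↦ ?_)
  simp only [zero_mul, add_zero]
  rw [Complex.norm_exp]
  congr 1
  norm_cast
  simp

lemma integrable_gauss : Integrable gauss := integrable_exp_neg_mul_norm_sq Real.pi_pos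

lemma integrable_gauss_mul_norm : Integrable fun y ↦ gauss y * ‖y‖ := by
  refine Integrable.mono' (integrable_exp_neg_mul_norm_sq (b := Real.pi / 2) (by positivity))
    (by fun_prop) (.of_forall fun y ↦ ?_)
  have h0 := gauss_pos y
  rw [Real.norm_of_nonneg (by positivity)]
  have h1 : gauss y = Real.exp (-(Real.pi / 2 * ‖y‖ ^ 2)) * Real.exp (-(Real.pi / 2 * ‖y‖ ^ 2)) := by
    rw [← Real.exp_add, gauss]; congr 1; ring
  rw [h1, mul_assoc]
  refine mul_le_of_le_one_right (Real.exp_pos _).le ?_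
  rw [Real.exp_neg, inv_mul_le_iff₀ (Real.exp_pos _), mul_one]
  refine le_trans ?_ (Real.add_one_le_exp _)
  nlinarith [Real.pi_gt_three, sq_nonneg (‖y‖ - 1), norm_nonneg y, sq_nonneg ‖y‖]

/-- A Gaussian average of translations is a heat multiplier. For c = `subLen t` the right side is
exp(-t|η|²) in the angular frequency η = 2πξ. -/
lemma integral_gauss_mul_shiftSymbol (c : ℝ) (ξ : E5) :
    ∫ y, (gauss y : ℂ) * shiftSymbol (c • y) ξ = Real.exp (-(Real.pi * (c ^ 2 * ‖ξ‖ ^ 2))) := by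
  have h := fourier_gaussian_innerProductSpace (b := (Real.pi : ℂ)) (V := E5)
    (by simpa using Real.pi_pos) (-(c • ξ))
  rw [Real.fourier_eq, div_self (by exact_mod_cast Real.pi_ne_zero), Complex.one_cpow, one_mul] at h
  have e1 : ∀ y : E5, (gauss y : ℂ) * shiftSymbol (c • y) ξ =
      Real.fourierChar (-inner ℝ y (-(c • ξ))) • Complex.exp (-(Real.pi : ℂ) * (‖y‖ : ℂ) ^ 2) := by
    intro y
    rw [inner_neg_right, neg_neg, inner_smul_right, shiftSymbol, inner_smul_right, real_inner_comm,
      mul_comm, gauss]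
    simp [Circle.smul_def]
  simp_rw [e1]
  rw [h, norm_neg, norm_smul, Complex.ofReal_exp]
  congr 1
  have : ((‖c‖ * ‖ξ‖ : ℝ) : ℂ) ^ 2 = ((c ^ 2 * ‖ξ‖ ^ 2 : ℝ) : ℂ) := by
    norm_cast; rw [mul_pow, Real.norm_eq_abs, sq_abs]
  rw [this]
  push_cast
  have hpi : (Real.pi : ℂ) ≠ 0 := by exact_mod_cast Real.pi_ne_zero
  field_simp

lemma integrable_gauss_mul_shiftSymbol (c : ℝ) (ξ : E5) :
    Integrable fun y ↦ (gauss y : ℂ) * shiftSymbol (c • y) ξ := by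
  refine Integrable.mono' integrable_gauss ?_ (.of_forall fun y ↦ ?_)
  · refine Continuous.aestronglyMeasurable ?_
    unfold shiftSymbol
    have := Real.continuous_fourierChar
    fun_prop
  · rw [norm_mul, norm_shiftSymbol, mul_one, Complex.norm_real, Real.norm_of_nonneg (gauss_pos y).le]

lemma integral_gauss : ∫ y, gauss y = 1 := by
  have := integral_gauss_mul_shiftSymbol 0 0
  have h2 : ∀ y : E5, shiftSymbol ((0 : ℝ) • y) 0 = 1 := by intro y; simp [shiftSymbol]
  simp_rw [h2, mul_one] at this
  rw [integral_complex_ofReal] at this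
  norm_num at this
  exact_mod_cast this

/-- The length of the translation at time `t` in the subordination formula. -/
def subLen (t : ℝ) : ℝ := 2 * √(Real.pi * t)

@[fun_prop]
lemma continuous_subLen : Continuous subLen := by unfold subLen; fun_prop

lemma subLen_nonneg (t : ℝ) : 0 ≤ subLen t := by unfold subLen; positivity

lemma subLen_sq {t : ℝ} (ht : 0 ≤ t) : subLen t ^ 2 = 4 * Real.pi * t := by
  have := Real.pi_pos
  rw [subLen, mul_pow, Real.sq_sqrt (by positivity)]; ring

/-- The measure `dt dy` on `(0, ∞) × ℝ⁵`. -/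
abbrev subMeasure : Measure (ℝ × E5) :=
  ((volume : Measure ℝ).restrict (Set.Ioi 0)).prod (volume : Measure E5)

/-- The density of the subordination formula. -/
def subDensity (a : ℝ) (q : ℝ × E5) : ℝ := q.1 ^ (-1 - a) * gauss q.2

@[fun_prop]
lemma measurable_subDensity (a : ℝ) : Measurable (subDensity a) := by
  unfold subDensity
  exact (by fun_prop : Measurable fun q : ℝ × E5 ↦ q.1 ^ (-1 - a)).mul
    (continuous_gauss.measurable.comp measurable_snd)

lemma ae_subMeasure_pos : ∀ᵐ q ∂subMeasure, 0 < q.1 :=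
  Measure.quasiMeasurePreserving_fst.ae (ae_restrict_mem measurableSet_Ioi)

lemma integrable_subDensity_one_sub {a : ℝ} (ha : 0 < a) (ha1 : a < 1) :
    Integrable (fun q ↦ subDensity a q * (1 - Real.exp (-q.1))) subMeasure := by
  refine ((integrableOn_subordination ha ha1).mul_prod integrable_gauss).congr
    (.of_forall fun q ↦ ?_)
  simp only [subDensity]; ring

lemma integrable_subDensity_mul_exp {a b : ℝ} (hab : a < b) {φ : E5 → ℝ}
    (hφ : Integrable fun y ↦ gauss y * φ y) :
    Integrable (fun q : ℝ × E5 ↦ subDensity a q * (Real.exp (-q.1) * (q.1 ^ b * φ q.2)))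
      subMeasure := by
  have h1 := (integrableOn_rpow_mul_exp_neg (b := -1 - a + b) (by linarith)).mul_prod hφ
  refine h1.congr ?_
  filter_upwards [ae_subMeasure_pos] with q hq
  simp only [subDensity]
  rw [Real.rpow_add hq]
  ring

/-- The symbol of a fractional derivative as a superposition of 1 - e^(-t) · (translation).
Translations act isometrically on every L^p, so this form of ⟨∇⟩^(2a) can be estimated by difference
quotients outside L². -/
lemma japanese_mul_subConst (a : ℝ) (ξ : E5) :
    ((japanese (2 * a) ((2 * Real.pi) • ξ) * subConst a : ℝ) : ℂ) =
      ∫ t in Set.Ioi (0 : ℝ), ∫ y, (subDensity a (t, y) : ℂ) *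
        (1 - Real.exp (-t) * shiftSymbol (subLen t • y) ξ) := by
  have h1 : ∀ t ∈ Set.Ioi (0 : ℝ), ∫ y, (subDensity a (t, y) : ℂ) *
      (1 - Real.exp (-t) * shiftSymbol (subLen t • y) ξ) =
      ((t ^ (-1 - a) * (1 - Real.exp (-((1 + ‖(2 * Real.pi) • ξ‖ ^ 2) * t))) : ℝ) : ℂ) := by
    intro t ht
    have ht : (0 : ℝ) < t := ht
    have e : ∀ y, (subDensity a (t, y) : ℂ) *
        (1 - Real.exp (-t) * shiftSymbol (subLen t • y) ξ) = (t ^ (-1 - a) : ℝ) * ((gauss y : ℂ) -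
          Real.exp (-t) * ((gauss y : ℂ) * shiftSymbol (subLen t • y) ξ)) := by
      intro y; simp only [subDensity]; push_cast; ring
    have i0 : Integrable fun y ↦ (gauss y : ℂ) := integrable_gauss.ofReal
    have i1 : Integrable fun y ↦ (Real.exp (-t) : ℂ) *
        ((gauss y : ℂ) * shiftSymbol (subLen t • y) ξ) :=
      (integrable_gauss_mul_shiftSymbol _ _).const_mul _
    simp_rw [e]
    rw [integral_const_mul, integral_sub i0 i1, integral_const_mul,
      integral_gauss_mul_shiftSymbol, integral_complex_ofReal, integral_gauss, subLen_sq ht.le]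
    norm_cast
    rw [← Real.exp_add]
    congr 4
    rw [norm_smul, mul_pow, Real.norm_eq_abs, sq_abs]
    ring
  rw [setIntegral_congr_fun measurableSet_Ioi h1, integral_complex_ofReal,
    integral_subordination (by positivity), japanese]
  congr 3
  ring

lemma measurable_shiftSymbol_uncurry :
    Measurable fun q : E5 × (ℝ × E5) ↦ shiftSymbol (subLen q.2.1 • q.2.2) q.1 := by
  unfold shiftSymbol
  have := Real.continuous_fourierChar
  have h2 : Continuous fun q : E5 × (ℝ × E5) ↦
    (Real.fourierChar (inner ℝ q.1 (subLen q.2.1 • q.2.2)) : ℂ) := by fun_prop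
  exact h2.measurable

lemma norm_shiftSymbol_sub_one_le (h ξ : E5) :
    ‖shiftSymbol h ξ - 1‖ ≤ ‖h‖ * ‖(2 * Real.pi) • ξ‖ := by
  have := enorm_shiftSymbol_sub_one_le h ξ
  rw [← ofReal_norm] at this
  exact (ENNReal.ofReal_le_ofReal_iff (by positivity)).1 this

lemma norm_one_sub_exp_mul_le {t : ℝ} (ht : 0 ≤ t) (z : ℂ) :
    ‖1 - Real.exp (-t) * z‖ ≤ (1 - Real.exp (-t)) + Real.exp (-t) * ‖z - 1‖ := by
  have h1 : 0 ≤ 1 - Real.exp (-t) := by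
    have := Real.exp_le_one_iff.2 (by linarith : -t ≤ 0); linarith
  have : 1 - Real.exp (-t) * z = ((1 - Real.exp (-t) : ℝ) : ℂ) - (Real.exp (-t) : ℝ) * (z - 1) := by
    push_cast; ring
  rw [this]
  refine (norm_sub_le _ _).trans (le_of_eq ?_)
  rw [norm_mul, Complex.norm_real, Complex.norm_real, Real.norm_of_nonneg h1,
    Real.norm_of_nonneg (Real.exp_pos _).le]

/-- The subordination formula for the fractional derivative `⟨∇⟩^{2a}` of a band-limited
function. -/
lemma inner_mult_japanese {a : ℝ} (ha : 0 < a) (ha2 : a < 1 / 2) {R : ℝ} {w : L2}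
    (hw : w ∈ bandLimited R) (G : L2) :
    (subConst a : ℂ) * inner ℂ G (mult (japanese (2 * a)) w) =
      ∫ q, (subDensity a q : ℂ) * (inner ℂ G w -
        Real.exp (-q.1) * inner ℂ G (shift (subLen q.1 • q.2) w)) ∂subMeasure := by
  have hjm : Measurable fun ξ : E5 ↦ ((japanese (2 * a) ((2 * Real.pi) • ξ) : ℝ) : ℂ) := by
    unfold japanese; fun_prop
  have hj : MemLp (fun ξ : E5 ↦ ((japanese (2 * a) ((2 * Real.pi) • ξ) : ℝ) : ℂ) *
      (𝓕 w : L2) ξ) 2 volume := by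
    refine memLp_mul_fourier_of_bandLimited hw hjm
      (C := (1 + (2 * Real.pi * R) ^ 2) ^ (2 * a / 2)) fun ξ hξ ↦ ?_
    have := Real.pi_pos
    rw [Complex.norm_real, Real.norm_of_nonneg (by unfold japanese; positivity), japanese,
      norm_smul, Real.norm_of_nonneg (by positivity)]
    gcongr
  have hGm := (Lp.stronglyMeasurable (𝓕 G : L2)).measurable
  have hwm := (Lp.stronglyMeasurable (𝓕 w : L2)).measurable
  set P : E5 → ℂ := fun ξ ↦ inner ℂ ((𝓕 G : L2) ξ) ((𝓕 w : L2) ξ) with hP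
  have hPi : Integrable P := L2.integrable_inner (𝕜 := ℂ) (𝓕 G : L2) (𝓕 w : L2)
  have hPm : Measurable P := by
    simp only [hP, RCLike.inner_apply']
    fun_prop
  have inner_eq : ∀ m : E5 → ℂ, MemLp (fun ξ : E5 ↦ m ξ * (𝓕 w : L2) ξ) 2 volume →
      inner ℂ G (fmul m w) = ∫ ξ, m ξ * P ξ := by
    intro m hm
    rw [← Lp.inner_fourier_eq, L2.inner_def]
    refine integral_congr_ae ?_
    filter_upwards [fourier_fmul hm] with ξ hξ
    simp only [hP, RCLike.inner_apply', hξ]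
    ring
  set f : E5 → ℝ × E5 → ℂ := fun ξ q ↦ (subDensity a q : ℂ) *
    (1 - Real.exp (-q.1) * shiftSymbol (subLen q.1 • q.2) ξ) * P ξ with hf
  have hfm : Measurable (Function.uncurry f) := by
    have h1 := measurable_shiftSymbol_uncurry
    have h2 : Measurable fun z : E5 × (ℝ × E5) ↦ subDensity a z.2 :=
      (measurable_subDensity a).comp measurable_snd
    simp only [hf, Function.uncurry_def]
    refine Measurable.mul (Measurable.mul (Complex.measurable_ofReal.comp h2) ?_) (by fun_prop)
    exact measurable_const.sub (Measurable.mul (by fun_prop) h1)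
  -- The translation symbol differs from 1 by at most |h| |η|, with |h| = 2√(πt)|y| and |η| ≤ 2πR on
  -- the band. The resulting factor t^(1/2) is integrable against t^(-1-a) near 0 since a < 1/2. The
  -- band R serves only to justify Fubini.
  set D : ℝ × E5 → ℝ := fun q ↦ subDensity a q * (1 - Real.exp (-q.1)) +
    (2 * √Real.pi * (2 * Real.pi * R)) *
      (subDensity a q * (Real.exp (-q.1) * (q.1 ^ (1 / 2 : ℝ) * ‖q.2‖))) with hD
  have hDi : Integrable D subMeasure := (integrable_subDensity_one_sub ha (by linarith)).add
    ((integrable_subDensity_mul_exp ha2 integrable_gauss_mul_norm).const_mul _)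
  have hfi : Integrable (Function.uncurry f) (volume.prod subMeasure) := by
    refine Integrable.mono' (hPi.norm.mul_prod hDi) hfm.aestronglyMeasurable ?_
    have hband : ∀ᵐ z ∂((volume : Measure E5).prod subMeasure), R < ‖z.1‖ → (𝓕 w : L2) z.1 = 0 :=
      Measure.quasiMeasurePreserving_fst.ae (mem_bandLimited_iff.1 hw)
    have hpos : ∀ᵐ z ∂((volume : Measure E5).prod subMeasure), 0 < z.2.1 :=
      Measure.quasiMeasurePreserving_snd.ae ae_subMeasure_pos
    filter_upwards [hband, hpos] with ⟨ξ, t, y⟩ h1 ht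
    simp only [Function.uncurry_apply_pair, hf] at h1 ht ⊢
    by_cases hξ : R < ‖ξ‖
    · have : P ξ = 0 := by simp [hP, h1 hξ]
      simp [this]
    have hξ := not_lt.1 hξ
    have hd : 0 ≤ subDensity a (t, y) := by
      have := gauss_pos y; unfold subDensity; positivity
    rw [norm_mul, norm_mul, Complex.norm_real, Real.norm_of_nonneg hd, mul_comm]
    gcongr
    calc _ ≤ subDensity a (t, y) * ((1 - Real.exp (-t)) + Real.exp (-t) *
          (‖subLen t • y‖ * ‖(2 * Real.pi) • ξ‖)) := by
          gcongr
          refine (norm_one_sub_exp_mul_le ht.le _).trans ?_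
          gcongr
          exact norm_shiftSymbol_sub_one_le _ _
      _ ≤ subDensity a (t, y) * ((1 - Real.exp (-t)) + Real.exp (-t) *
          (subLen t * ‖y‖ * (2 * Real.pi * R))) := by
          have := Real.pi_pos
          rw [norm_smul, norm_smul, Real.norm_of_nonneg (subLen_nonneg t),
            Real.norm_of_nonneg (by positivity)]
          have := subLen_nonneg t
          gcongr
      _ = _ := by
          simp only [hD, subLen]
          rw [Real.sqrt_mul Real.pi_pos.le, Real.sqrt_eq_rpow t]
          ring
  have swap := integral_integral_swap hfi
  have lhs : ∫ ξ, ∫ q, f ξ q ∂subMeasure = (subConst a : ℂ) *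
      inner ℂ G (mult (japanese (2 * a)) w) := by
    rw [mult_eq_fmul, inner_eq _ hj, ← integral_const_mul]
    refine integral_congr_ae ?_
    filter_upwards [hfi.prod_right_ae] with ξ hξ
    simp only [Function.uncurry_apply_pair] at hξ
    by_cases hP0 : P ξ = 0
    · simp [hf, hP0]
    have hξ' : Integrable (fun q ↦ (subDensity a q : ℂ) *
        (1 - Real.exp (-q.1) * shiftSymbol (subLen q.1 • q.2) ξ)) subMeasure := by
      refine (hξ.mul_const (P ξ)⁻¹).congr (.of_forall fun q ↦ ?_)
      simp only [hf]
      rw [mul_assoc, mul_inv_cancel₀ hP0, mul_one]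
    simp only [hf]
    rw [integral_mul_const, integral_prod _ hξ', ← japanese_mul_subConst]
    push_cast
    ring
  rw [← lhs, swap]
  refine integral_congr_ae (.of_forall fun q ↦ ?_)
  simp only [hf]
  have hm1 := measurable_shiftSymbol (subLen q.1 • q.2)
  have hn1 : ∀ ξ, ‖shiftSymbol (subLen q.1 • q.2) ξ‖ ≤ 1 := fun ξ ↦ (norm_shiftSymbol _ ξ).le
  have i1 : Integrable fun ξ ↦ shiftSymbol (subLen q.1 • q.2) ξ * P ξ :=
    hPi.bdd_mul hm1.aestronglyMeasurable (.of_forall hn1)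
  rw [shift_eq_fmul, inner_eq _ (memLp_mul_fourier hm1 hn1 w)]
  have e0 : inner ℂ G w = ∫ ξ, P ξ := by rw [← Lp.inner_fourier_eq, L2.inner_def]
  rw [e0, ← integral_const_mul, ← integral_sub hPi (i1.const_mul _), ← integral_const_mul]
  refine integral_congr_ae (.of_forall fun ξ ↦ ?_)
  simp only
  ring

/-! ### Pairing with a fractional derivative -/

lemma lintegral_enorm_mul_le {p q : ℝ} (hpq : p.HolderConjugate q) {f g : E5 → ℂ}
    (hf : AEStronglyMeasurable f volume) (hg : AEStronglyMeasurable g volume) :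
    ∫⁻ x, ‖f x‖ₑ * ‖g x‖ₑ ≤ eLpNorm' f p volume * eLpNorm' g q volume :=
  ENNReal.lintegral_mul_le_Lp_mul_Lq volume hpq hf.enorm hg.enorm

lemma enorm_integral_conj_mul_le {p q : ℝ} (hpq : p.HolderConjugate q) {f g : E5 → ℂ}
    (hf : AEStronglyMeasurable f volume) (hg : AEStronglyMeasurable g volume) :
    ‖∫ x, starRingEnd ℂ (f x) * g x‖ₑ ≤ eLpNorm' f p volume * eLpNorm' g q volume := by
  refine (enorm_integral_le_lintegral_enorm _).trans ?_
  refine le_trans (le_of_eq ?_) (lintegral_enorm_mul_le hpq hf hg)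
  refine lintegral_congr fun x ↦ ?_
  rw [enorm_mul, ← ofReal_norm (starRingEnd ℂ (f x)), RCLike.norm_conj, ofReal_norm]

lemma inner_eq_integral (f g : L2) : inner ℂ f g = ∫ x, starRingEnd ℂ (f x) * g x := by
  rw [L2.inner_def]
  simp only [RCLike.inner_apply']

lemma eLpNorm'_comp_add_right (f : E5 → ℂ) (p : ℝ) (h : E5) :
    eLpNorm' (fun x ↦ f (x + h)) p volume = eLpNorm' f p volume := by
  unfold eLpNorm'
  rw [lintegral_add_right_eq_self (fun x ↦ ‖f x‖ₑ ^ p) h]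

lemma holderConjugate_five : (5 / 4 : ℝ).HolderConjugate 5 := by
  rw [Real.holderConjugate_iff]; norm_num

lemma norm_inner_le_of_eLpNorm' {f g : L2} {a b : ℝ} (ha : 0 ≤ a) (hb : 0 ≤ b)
    (hf : eLpNorm' f (5 / 4) volume ≤ ENNReal.ofReal a)
    (hg : eLpNorm' g 5 volume ≤ ENNReal.ofReal b) : ‖inner ℂ f g‖ ≤ a * b := by
  have h1 := enorm_integral_conj_mul_le holderConjugate_five
    (Lp.aestronglyMeasurable f) (Lp.aestronglyMeasurable g)
  rw [← inner_eq_integral] at h1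
  have h2 := h1.trans (mul_le_mul' hf hg)
  rw [← ENNReal.ofReal_mul ha, ← ofReal_norm] at h2
  exact (ENNReal.ofReal_le_ofReal_iff (by positivity)).1 h2

/-- With τ the translation, ⟨G, w⟩ = ⟨τG, τw⟩, so the increment can be moved from w to G: the
difference equals (1 - e^(-t))⟨G, w⟩ + e^(-t)⟨τG - G, τw⟩. -/
lemma norm_inner_sub_shift_le {G w : L2} {g A n : ℝ} (hg0 : 0 ≤ g) (hA0 : 0 ≤ A) (hn0 : 0 ≤ n)
    (hg : eLpNorm' G (5 / 4) volume ≤ ENNReal.ofReal g)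
    (hA : ∀ h : E5, eLpNorm' (fun x ↦ G (x + h) - G x) (5 / 4) volume ≤
      ENNReal.ofReal (A * ‖h‖ ^ (1 / 2 : ℝ)))
    (hn : eLpNorm' w 5 volume ≤ ENNReal.ofReal n) {t : ℝ} (ht : 0 ≤ t) (h : E5) :
    ‖inner ℂ G w - Real.exp (-t) * inner ℂ G (shift h w)‖ ≤
      (1 - Real.exp (-t)) * (g * n) + Real.exp (-t) * (A * ‖h‖ ^ (1 / 2 : ℝ) * n) := by
  have h1 : 0 ≤ 1 - Real.exp (-t) := by
    have := Real.exp_le_one_iff.2 (by linarith : -t ≤ 0); linarith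
  have e : inner ℂ G w - Real.exp (-t) * inner ℂ G (shift h w) =
      ((1 - Real.exp (-t) : ℝ) : ℂ) * inner ℂ G w +
        (Real.exp (-t) : ℝ) * inner ℂ (shift h G - G) (shift h w) := by
    rw [inner_sub_left, LinearIsometry.inner_map_map]; push_cast; ring
  rw [e]
  refine (norm_add_le _ _).trans ?_
  rw [norm_mul, norm_mul, Complex.norm_real, Complex.norm_real, Real.norm_of_nonneg h1,
    Real.norm_of_nonneg (Real.exp_pos _).le]
  have h2 : eLpNorm' (shift h G - G : L2) (5 / 4) volume ≤
      ENNReal.ofReal (A * ‖h‖ ^ (1 / 2 : ℝ)) := by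
    refine le_trans (le_of_eq (eLpNorm'_congr_ae ?_)) (hA h)
    filter_upwards [Lp.coeFn_sub (shift h G) G, shift_ae h G] with x h1 h2
    rw [h1, Pi.sub_apply, h2]
  have h3 : eLpNorm' (shift h w : L2) 5 volume ≤ ENNReal.ofReal n := by
    rw [eLpNorm'_congr_ae (shift_ae h w), eLpNorm'_comp_add_right]
    exact hn
  gcongr
  · exact norm_inner_le_of_eLpNorm' hg0 hn0 hg hn
  · exact norm_inner_le_of_eLpNorm' (by positivity) hn0 h2 h3

/-- The translation length is of order t^(1/2)|y|, so half a derivative of G gains t^(1/4), which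
beats t^(-1-a) near 0 when a < 1/4. The constant is independent of R. -/
lemma exists_norm_inner_mult_japanese_le {a : ℝ} (ha : 0 < a) (ha4 : a < 1 / 4) :
    ∃ C : ℝ, 0 ≤ C ∧ ∀ (R : ℝ) (w : L2), w ∈ bandLimited R → ∀ (G : L2) (g A n : ℝ),
      0 ≤ g → 0 ≤ A → 0 ≤ n → eLpNorm' G (5 / 4) volume ≤ ENNReal.ofReal g →
      (∀ h : E5, eLpNorm' (fun x ↦ G (x + h) - G x) (5 / 4) volume ≤
        ENNReal.ofReal (A * ‖h‖ ^ (1 / 2 : ℝ))) →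
      eLpNorm' w 5 volume ≤ ENNReal.ofReal n →
      ‖inner ℂ G (mult (japanese (2 * a)) w)‖ ≤ C * (g + A) * n := by
  have hφ : Integrable fun y : E5 ↦ gauss y * (1 + ‖y‖) := by
    refine (integrable_gauss.add integrable_gauss_mul_norm).congr (.of_forall fun y ↦ ?_)
    simp only [Pi.add_apply]; ring
  have i1 := integrable_subDensity_one_sub ha (by linarith)
  have i2 := integrable_subDensity_mul_exp ha4 hφ
  set I1 := ∫ q, subDensity a q * (1 - Real.exp (-q.1)) ∂subMeasure
  set I2 := ∫ q, subDensity a q * (Real.exp (-q.1) * (q.1 ^ (1 / 4 : ℝ) * (1 + ‖q.2‖))) ∂subMeasure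
  set c : ℝ := (2 * √Real.pi) ^ (1 / 2 : ℝ) with hc
  have hS := subConst_pos ha (by linarith)
  have hd : ∀ q : ℝ × E5, 0 < q.1 → 0 ≤ subDensity a q := by
    intro q hq; have := gauss_pos q.2; unfold subDensity; positivity
  have hI1 : 0 ≤ I1 := by
    refine integral_nonneg_of_ae ?_
    filter_upwards [ae_subMeasure_pos] with q hq
    have := Real.exp_le_one_iff.2 (by linarith : -q.1 ≤ 0)
    exact mul_nonneg (hd q hq) (by linarith)
  have hI2 : 0 ≤ I2 := by
    refine integral_nonneg_of_ae ?_
    filter_upwards [ae_subMeasure_pos] with q hq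
    have := hd q hq
    simp only [Pi.zero_apply]
    positivity
  refine ⟨(I1 + c * I2) / subConst a, by positivity, fun R w hw G g A n hg0 hA0 hn0 hg hA hn ↦ ?_⟩
  have key : subConst a * ‖inner ℂ G (mult (japanese (2 * a)) w)‖ ≤
      (g * n) * I1 + (c * A * n) * I2 := by
    have := inner_mult_japanese ha (by linarith) hw G
    have hn' : subConst a * ‖inner ℂ G (mult (japanese (2 * a)) w)‖ =
        ‖(subConst a : ℂ) * inner ℂ G (mult (japanese (2 * a)) w)‖ := by
      rw [norm_mul, Complex.norm_real, Real.norm_of_nonneg hS.le]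
    rw [hn', this, ← integral_const_mul, ← integral_const_mul,
      ← integral_add (i1.const_mul _) (i2.const_mul _)]
    refine norm_integral_le_of_norm_le ((i1.const_mul _).add (i2.const_mul _)) ?_
    filter_upwards [ae_subMeasure_pos] with q hq
    rw [norm_mul, Complex.norm_real, Real.norm_of_nonneg (hd q hq)]
    have h1 := norm_inner_sub_shift_le hg0 hA0 hn0 hg hA hn hq.le (subLen q.1 • q.2)
    have h2 : ‖subLen q.1 • q.2‖ ^ (1 / 2 : ℝ) ≤ c * (q.1 ^ (1 / 4 : ℝ) * (1 + ‖q.2‖)) := by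
      rw [norm_smul, Real.norm_of_nonneg (subLen_nonneg _), subLen, Real.sqrt_mul Real.pi_pos.le,
        ← mul_assoc, Real.mul_rpow (by positivity) (by positivity),
        Real.mul_rpow (by positivity) (by positivity), Real.sqrt_eq_rpow q.1, ← Real.rpow_mul hq.le,
        mul_assoc]
      norm_num only
      gcongr
      -- The crude bound √x ≤ 1 + x makes the Gaussian weight one whose integrability is already
      -- known.
      have : ‖q.2‖ ^ (1 / 2 : ℝ) = √‖q.2‖ := (Real.sqrt_eq_rpow _).symm
      rw [this, Real.sqrt_le_left (by positivity)]
      nlinarith [norm_nonneg q.2]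
    have hd' := hd q hq
    calc _ ≤ subDensity a q * ((1 - Real.exp (-q.1)) * (g * n) + Real.exp (-q.1) *
          (A * (c * (q.1 ^ (1 / 4 : ℝ) * (1 + ‖q.2‖))) * n)) := by
          gcongr
          exact h1.trans (by gcongr)
      _ = _ := by ring
  rw [div_mul_eq_mul_div, div_mul_eq_mul_div, le_div_iff₀ hS, mul_comm]
  refine key.trans ?_
  have : 0 ≤ c := by positivity
  nlinarith [mul_nonneg (mul_nonneg hI1 hA0) hn0, mul_nonneg (mul_nonneg (mul_nonneg this hI2) hg0) hn0]

/-! ### Passage from square integrable functions to L^{5/4} by truncation -/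

/-- Truncation of the real and imaginary part to `[-M, M]`. -/
def clamp (M : ℝ) (z : ℂ) : ℂ := ⟨max (-M) (min M z.re), max (-M) (min M z.im)⟩

lemma norm_le_of_abs_le {z w : ℂ} (h1 : |z.re| ≤ |w.re|) (h2 : |z.im| ≤ |w.im|) : ‖z‖ ≤ ‖w‖ := by
  rw [Complex.norm_eq_sqrt_sq_add_sq, Complex.norm_eq_sqrt_sq_add_sq]
  exact Real.sqrt_le_sqrt (add_le_add (sq_le_sq.2 h1) (sq_le_sq.2 h2))

lemma abs_clamp_sub_le (M x y : ℝ) :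
    |max (-M) (min M x) - max (-M) (min M y)| ≤ |x - y| := by
  refine (abs_max_sub_max_le_max _ _ _ _).trans ?_
  rw [sub_self, abs_zero]
  refine max_le (abs_nonneg _) ?_
  refine (abs_min_sub_min_le_max _ _ _ _).trans ?_
  simp

/-- Truncation is a contraction, hence it does not increase difference quotients. A function which
is only in L^(5/4) can thus be replaced by truncations in L² that satisfy the same hypotheses. -/
lemma norm_clamp_sub_le (M : ℝ) (z w : ℂ) : ‖clamp M z - clamp M w‖ ≤ ‖z - w‖ :=
  norm_le_of_abs_le (abs_clamp_sub_le M _ _) (abs_clamp_sub_le M _ _)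

lemma clamp_zero {M : ℝ} (hM : 0 ≤ M) : clamp M 0 = 0 := by
  apply Complex.ext <;> simp [clamp, hM]

lemma norm_clamp_le {M : ℝ} (hM : 0 ≤ M) (z : ℂ) : ‖clamp M z‖ ≤ ‖z‖ := by
  simpa [clamp_zero hM] using norm_clamp_sub_le M z 0

lemma norm_clamp_le_two_mul {M : ℝ} (hM : 0 ≤ M) (z : ℂ) : ‖clamp M z‖ ≤ 2 * M := by
  refine (Complex.norm_le_abs_re_add_abs_im _).trans ?_
  have : ∀ x : ℝ, |max (-M) (min M x)| ≤ M := fun x ↦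
    abs_le.2 ⟨le_max_left _ _, max_le (by linarith) (min_le_left _ _)⟩
  simp only [clamp]
  linarith [this z.re, this z.im]

lemma clamp_eq_self {M : ℝ} {z : ℂ} (h : ‖z‖ ≤ M) : clamp M z = z := by
  have h1 := abs_le.1 ((Complex.abs_re_le_norm z).trans h)
  have h2 := abs_le.1 ((Complex.abs_im_le_norm z).trans h)
  apply Complex.ext
  · simp only [clamp]; rw [min_eq_right h1.2, max_eq_right h1.1]
  · simp only [clamp]; rw [min_eq_right h2.2, max_eq_right h2.1]

lemma continuous_clamp (M : ℝ) : Continuous (clamp M) := by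
  have : LipschitzWith 1 (clamp M) := LipschitzWith.of_dist_le_mul fun z w ↦ by
    simpa [dist_eq_norm] using norm_clamp_sub_le M z w
  exact this.continuous

lemma eLpNorm'_mono_norm {f g : E5 → ℂ} {p : ℝ} (hp : 0 ≤ p) (h : ∀ x, ‖f x‖ ≤ ‖g x‖) :
    eLpNorm' f p volume ≤ eLpNorm' g p volume :=
  eLpNorm'_mono_ae hp (.of_forall h)

/-- A bounded function in L^(5/4) is in L²: three quarters of the square are estimated by the
height. -/
lemma memLp_clamp {G : E5 → ℂ} (hG : AEStronglyMeasurable G volume)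
    (hg : eLpNorm' G (5 / 4) volume < ∞) {M : ℝ} (hM : 0 ≤ M) :
    MemLp (fun x ↦ clamp M (G x)) 2 volume := by
  have hm := (continuous_clamp M).comp_aestronglyMeasurable hG
  refine ⟨hm, ?_⟩
  have h0 : ∫⁻ x, ‖G x‖ₑ ^ (5 / 4 : ℝ) < ∞ := lintegral_rpow_enorm_lt_top_of_eLpNorm'_lt_top
    (by norm_num) hg
  rw [eLpNorm_lt_top_iff_lintegral_rpow_enorm_lt_top (by norm_num) (by norm_num)]
  refine lt_of_le_of_lt (lintegral_mono (g := fun x ↦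
    ENNReal.ofReal (2 * M) ^ (3 / 4 : ℝ) * ‖G x‖ₑ ^ (5 / 4 : ℝ)) fun x ↦ ?_) ?_
  · have e : ((2 : ℝ≥0∞).toReal) = 3 / 4 + 5 / 4 := by norm_num
    rw [e, ENNReal.rpow_add_of_nonneg _ _ (by norm_num) (by norm_num),
      ← ofReal_norm]
    dsimp only
    rw [← ofReal_norm (G x)]
    gcongr
    · exact norm_clamp_le_two_mul hM _
    · exact norm_clamp_le hM _
  · have ht : ENNReal.ofReal (2 * M) ^ (3 / 4 : ℝ) < ∞ :=
      ENNReal.rpow_lt_top_of_nonneg (by norm_num) ENNReal.ofReal_ne_top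
    rw [lintegral_const_mul' _ _ ht.ne]
    exact ENNReal.mul_lt_top ht h0

/-- A function in `L^{5/4}` with half a derivative in the sense of difference quotients pairs with
`⟨∇⟩^α w` for `α < 1/2`, with a bound by the norm of `w` in `L⁵`. -/
lemma exists_norm_integral_conj_mul_mult_japanese_le {α : ℝ} (hα : 0 < α) (hα2 : α < 1 / 2) :
    ∃ C : ℝ, 0 ≤ C ∧ ∀ (R : ℝ) (w : L2), w ∈ bandLimited R → ∀ (G : E5 → ℂ) (g A n : ℝ),
      AEStronglyMeasurable G volume →
      0 ≤ g → 0 ≤ A → 0 ≤ n → eLpNorm' G (5 / 4) volume ≤ ENNReal.ofReal g →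
      (∀ h : E5, eLpNorm' (fun x ↦ G (x + h) - G x) (5 / 4) volume ≤
        ENNReal.ofReal (A * ‖h‖ ^ (1 / 2 : ℝ))) →
      eLpNorm' w 5 volume ≤ ENNReal.ofReal n →
      Integrable (fun x ↦ starRingEnd ℂ (G x) * mult (japanese α) w x) ∧
      ‖∫ x, starRingEnd ℂ (G x) * mult (japanese α) w x‖ ≤ C * (g + A) * n := by
  obtain ⟨C, hC, H⟩ := exists_norm_inner_mult_japanese_le (a := α / 2) (by linarith) (by linarith)
  have e2 : 2 * (α / 2) = α := by ring
  rw [e2] at H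
  refine ⟨C, hC, fun R w hw G g A n hGm hg0 hA0 hn0 hg hA hn ↦ ?_⟩
  have hgt := hg.trans_lt ENNReal.ofReal_lt_top
  set w' : L2 := mult (japanese α) w
  have hw' : w' ∈ bandLimited R := by
    have hjm : Measurable fun ξ : E5 ↦ ((japanese α ((2 * Real.pi) • ξ) : ℝ) : ℂ) := by
      unfold japanese; fun_prop
    exact fmul_mem_bandLimited hw _
  have hw5 : eLpNorm' w' 5 volume < ∞ := by
    obtain ⟨c, hc⟩ := exists_bernstein_eLpNorm R
    have := hc w' hw' 5 (by norm_num) (by norm_num)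
    rw [eLpNorm_eq_eLpNorm' (by norm_num) (by norm_num)] at this
    norm_num at this
    exact this.trans_lt (ENNReal.mul_lt_top (by simp) (by simp))
  have hint : Integrable fun x ↦ starRingEnd ℂ (G x) * w' x := by
    refine ⟨(Complex.continuous_conj.comp_aestronglyMeasurable hGm).mul
      (Lp.aestronglyMeasurable w'), ?_⟩
    refine lt_of_le_of_lt (le_trans (le_of_eq ?_) (lintegral_enorm_mul_le holderConjugate_five hGm
      (Lp.aestronglyMeasurable w'))) (ENNReal.mul_lt_top hgt hw5)
    refine lintegral_congr fun x ↦ ?_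
    rw [enorm_mul, ← ofReal_norm (starRingEnd ℂ (G x)), RCLike.norm_conj, ofReal_norm]
  refine ⟨hint, ?_⟩
  have hlim : Tendsto (fun k : ℕ ↦ ∫ x, starRingEnd ℂ (clamp k (G x)) * w' x) atTop
      (𝓝 (∫ x, starRingEnd ℂ (G x) * w' x)) := by
    refine tendsto_integral_of_dominated_convergence _ (fun k ↦ ?_) hint.norm
      (fun k ↦ .of_forall fun x ↦ ?_) (.of_forall fun x ↦ ?_)
    · exact (Complex.continuous_conj.comp_aestronglyMeasurable
        ((continuous_clamp k).comp_aestronglyMeasurable hGm)).mul (Lp.aestronglyMeasurable w')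
    · rw [norm_mul, norm_mul, RCLike.norm_conj, RCLike.norm_conj]
      gcongr
      exact norm_clamp_le (by positivity) _
    · refine tendsto_const_nhds.congr' ?_
      filter_upwards [eventually_ge_atTop ⌈‖G x‖⌉₊] with k hk
      rw [clamp_eq_self (Nat.ceil_le.1 hk)]
  refine le_of_tendsto hlim.norm (.of_forall fun k ↦ ?_)
  have hk : (0 : ℝ) ≤ k := by positivity
  have hm := memLp_clamp hGm hgt hk
  have := H R w hw (hm.toLp _) g A n hg0 hA0 hn0 ?_ (fun h ↦ ?_) hn
  · rw [inner_eq_integral] at this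
    refine le_trans (le_of_eq ?_) this
    congr 1
    refine integral_congr_ae ?_
    filter_upwards [hm.coeFn_toLp] with x hx
    rw [hx]
  · rw [eLpNorm'_congr_ae hm.coeFn_toLp]
    exact (eLpNorm'_mono_norm (by norm_num) fun x ↦ norm_clamp_le hk _).trans hg
  · refine le_trans (le_of_eq (eLpNorm'_congr_ae
      (g := fun x ↦ clamp k (G (x + h)) - clamp k (G x)) ?_))
      ((eLpNorm'_mono_norm (by norm_num) fun x ↦ norm_clamp_sub_le k _ _).trans (hA h))
    have := (measurePreserving_add_right (volume : Measure E5) h).quasiMeasurePreserving.ae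
      hm.coeFn_toLp
    filter_upwards [hm.coeFn_toLp, this] with x h1 h2
    rw [h1, h2]

/-! ### The quadrilinear form of the Hartree energy -/

/-- The `L^p` norm of an element of `L²`, for a real exponent. -/
def nrm (p : ℝ) (f : L2) : ℝ≥0∞ := eLpNorm' f p volume

lemma measurable_coe (f : L2) : Measurable f := (Lp.stronglyMeasurable f).measurable

lemma eLpNorm_eq_nrm {p : ℝ≥0∞} (h0 : p ≠ 0) (ht : p ≠ ∞) (f : L2) :
    eLpNorm f p volume = nrm p.toReal f := eLpNorm_eq_eLpNorm' h0 ht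

lemma nrm_two (f : L2) : nrm 2 f = ‖f‖ₑ := by
  rw [Lp.enorm_def, eLpNorm_eq_nrm (by norm_num) (by norm_num)]
  norm_num

lemma nrm_add_le {p : ℝ} (hp : 1 ≤ p) (f g : L2) : nrm p (f + g) ≤ nrm p f + nrm p g := by
  unfold nrm
  rw [eLpNorm'_congr_ae (Lp.coeFn_add f g)]
  exact eLpNorm'_add_le (Lp.aestronglyMeasurable f) (Lp.aestronglyMeasurable g) hp

lemma nrm_smul (p : ℝ) (hp : 0 < p) (r : ℝ) (f : L2) :
    nrm p (r • f) = ‖r‖ₑ * nrm p f := by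
  unfold nrm
  rw [eLpNorm'_congr_ae (Lp.coeFn_smul r f), eLpNorm'_const_smul _ hp]

lemma nrm_neg (p : ℝ) (f : L2) : nrm p (-f) = nrm p f := by
  unfold nrm
  rw [eLpNorm'_congr_ae (Lp.coeFn_neg f), eLpNorm'_neg]

lemma nrm_sub_le {p : ℝ} (hp : 1 ≤ p) (f g : L2) : nrm p (f - g) ≤ nrm p f + nrm p g := by
  rw [sub_eq_add_neg, ← nrm_neg p g]; exact nrm_add_le hp _ _

/-- The Coulomb-type energy of the densities `|a| |b|` and `|c| |d|`. -/
def cquad (a b c d : L2) : ℝ≥0∞ :=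
  coul (fun x ↦ ‖a x‖ₑ * ‖b x‖ₑ) (fun x ↦ ‖c x‖ₑ * ‖d x‖ₑ)

lemma measurable_enorm_mul (a b : L2) : Measurable fun x ↦ ‖a x‖ₑ * ‖b x‖ₑ :=
  (measurable_coe a).enorm.mul (measurable_coe b).enorm

lemma cquad_comm_left (a b c d : L2) : cquad a b c d = cquad b a c d := by
  simp only [cquad, mul_comm]

lemma cquad_swap (a b c d : L2) : cquad a b c d = cquad c d a b :=
  coul_comm (measurable_enorm_mul a b) (measurable_enorm_mul c d)

lemma lintegral_mul_rpow_le {p q r : ℝ} (hp : 0 < p) (hpq : p < q) (h : 1 / p = 1 / q + 1 / r)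
    (f g : L2) : (∫⁻ x, (‖f x‖ₑ * ‖g x‖ₑ) ^ p) ^ (1 / p) ≤ nrm q f * nrm r g :=
  ENNReal.lintegral_Lp_mul_le_Lq_mul_Lr hp hpq h volume (measurable_coe f).enorm.aemeasurable
    (measurable_coe g).enorm.aemeasurable

/-- Hölder inside each density, then Hardy–Littlewood–Sobolev between the two. Each density must lie
in some L^m with m > 1, and the four reciprocals add up to 6/5. -/
lemma exists_cquad_le {p q r s : ℝ} (hp : 0 < p) (hq : 0 < q) (hr : 0 < r) (hs : 0 < s)
    (h1 : 1 / p + 1 / q < 1) (h2 : 1 / r + 1 / s < 1)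
    (h : 1 / p + 1 / q + (1 / r + 1 / s) = 6 / 5) :
    ∃ C : ℝ≥0, ∀ a b c d : L2, cquad a b c d ≤ C * (nrm p a * nrm q b) * (nrm r c * nrm s d) := by
  have key : ∀ x y : ℝ, 0 < x → 0 < y → 1 / x + 1 / y < 1 → 1 < (1 / x + 1 / y)⁻¹ ∧
      (1 / x + 1 / y)⁻¹ < x := by
    intro x y hx hy hxy
    refine ⟨(one_lt_inv₀ (by positivity)).2 hxy, ?_⟩
    rw [inv_lt_comm₀ (by positivity) hx, ← one_div]
    have : 0 < 1 / y := by positivity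
    linarith
  obtain ⟨k1, k2⟩ := key p q hp hq h1
  obtain ⟨k3, k4⟩ := key r s hr hs h2
  obtain ⟨C, hC⟩ := coul_le k1 k3 (by rw [one_div (1 / p + 1 / q)⁻¹, one_div (1 / r + 1 / s)⁻¹, inv_inv, inv_inv]; exact h)
  refine ⟨C, fun a b c d ↦ (hC _ _ (measurable_enorm_mul a b).aemeasurable
    (measurable_enorm_mul c d).aemeasurable).trans ?_⟩
  gcongr
  · exact lintegral_mul_rpow_le (by linarith) k2 (by rw [one_div, inv_inv]) a b
  · exact lintegral_mul_rpow_le (by linarith) k4 (by rw [one_div, inv_inv]) c d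

/-- The real density `Re (ā b)`. -/
def dens (a b : L2) (x : E5) : ℝ := (starRingEnd ℂ (a x) * b x).re

lemma measurable_dens (a b : L2) : Measurable (dens a b) := by
  have := measurable_coe a
  have := measurable_coe b
  unfold dens
  fun_prop

lemma dens_comm (a b : L2) : dens a b = dens b a := by
  ext x; simp only [dens, Complex.mul_re, Complex.conj_re, Complex.conj_im]; ring

lemma enorm_dens_le (a b : L2) (x : E5) : ‖dens a b x‖ₑ ≤ ‖a x‖ₑ * ‖b x‖ₑ := by
  rw [← ofReal_norm, ← ofReal_norm, ← ofReal_norm, ← ENNReal.ofReal_mul (norm_nonneg _)]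
  refine ENNReal.ofReal_le_ofReal ?_
  refine (Complex.abs_re_le_norm _).trans ?_
  rw [norm_mul, RCLike.norm_conj]

lemma dens_self (a : L2) (x : E5) : dens a a x = ‖a x‖ ^ 2 := by
  rw [dens, Complex.conj_mul', ← Complex.ofReal_pow, Complex.ofReal_re]

lemma dens_add_ae (a a' b : L2) : dens (a + a') b =ᵐ[volume] fun x ↦ dens a b x + dens a' b x := by
  filter_upwards [Lp.coeFn_add a a'] with x hx
  simp only [dens, hx, Pi.add_apply, map_add, add_mul, Complex.add_re]

lemma dens_smul_ae (r : ℝ) (a b : L2) : dens (r • a) b =ᵐ[volume] fun x ↦ r * dens a b x := by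
  filter_upwards [Lp.coeFn_smul r a] with x hx
  simp only [dens, hx, Pi.smul_apply, Complex.real_smul, map_mul, Complex.conj_ofReal, mul_assoc,
    Complex.re_ofReal_mul]

/-- `∬ f(x) g(y) |x - y|⁻⁴ dx dy` for real densities. -/
def coulR (f g : E5 → ℝ) : ℝ := ∫ z : E5 × E5, f z.1 * g z.2 * (‖z.1 - z.2‖ ^ 4)⁻¹

/-- At x = 0 the real inverse is 0 while the extended power is ∞; the diagonal is a null set, so
both conventions give the same integrals. -/
lemma enorm_inv_pow_four {x : E5} (hx : x ≠ 0) : ‖(‖x‖ ^ 4)⁻¹‖ₑ = ‖x‖ₑ ^ (-4 : ℝ) := by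
  have h : 0 < ‖x‖ := norm_pos_iff.2 hx
  rw [← ofReal_norm, ← ofReal_norm x, Real.norm_of_nonneg (by positivity),
    ENNReal.ofReal_rpow_of_pos h]
  congr 1
  rw [Real.rpow_neg h.le]
  norm_cast

lemma measurable_coulR_integrand {f g : E5 → ℝ} (hf : Measurable f) (hg : Measurable g) :
    Measurable fun z : E5 × E5 ↦ f z.1 * g z.2 * (‖z.1 - z.2‖ ^ 4)⁻¹ := by fun_prop

lemma lintegral_enorm_coulR {f g : E5 → ℝ} (hf : Measurable f) (hg : Measurable g) :
    ∫⁻ z : E5 × E5, ‖f z.1 * g z.2 * (‖z.1 - z.2‖ ^ 4)⁻¹‖ₑ =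
      coul (fun x ↦ ‖f x‖ₑ) fun x ↦ ‖g x‖ₑ := by
  rw [Measure.volume_eq_prod, lintegral_prod _ (measurable_coulR_integrand hf hg).enorm.aemeasurable]
  refine lintegral_congr fun x ↦ lintegral_congr_ae ?_
  filter_upwards [ae_ne x] with y hy
  rw [enorm_mul, enorm_mul, enorm_inv_pow_four (sub_ne_zero.2 hy.symm)]

lemma integrable_coulR {f g : E5 → ℝ} (hf : Measurable f) (hg : Measurable g)
    (h : coul (fun x ↦ ‖f x‖ₑ) (fun x ↦ ‖g x‖ₑ) < ∞) :
    Integrable fun z : E5 × E5 ↦ f z.1 * g z.2 * (‖z.1 - z.2‖ ^ 4)⁻¹ :=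
  ⟨(measurable_coulR_integrand hf hg).aestronglyMeasurable, by
    rw [hasFiniteIntegral_iff_enorm, lintegral_enorm_coulR hf hg]; exact h⟩

lemma coulR_congr_ae {f f' g g' : E5 → ℝ} (hf : f =ᵐ[volume] f') (hg : g =ᵐ[volume] g') :
    coulR f g = coulR f' g' := by
  refine integral_congr_ae ?_
  have h1 : ∀ᵐ z ∂((volume : Measure E5).prod (volume : Measure E5)), f z.1 = f' z.1 :=
    Measure.quasiMeasurePreserving_fst.ae hf
  have h2 : ∀ᵐ z ∂((volume : Measure E5).prod (volume : Measure E5)), g z.2 = g' z.2 :=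
    Measure.quasiMeasurePreserving_snd.ae hg
  rw [Measure.volume_eq_prod]
  filter_upwards [h1, h2] with z e1 e2
  rw [e1, e2]

lemma coulR_comm (f g : E5 → ℝ) : coulR f g = coulR g f := by
  unfold coulR
  rw [Measure.volume_eq_prod, ← integral_prod_swap]
  refine integral_congr_ae (.of_forall fun z ↦ ?_)
  simp only [Prod.fst_swap, Prod.snd_swap, norm_sub_rev z.2 z.1]
  ring

/-- The quadrilinear form `∬ Re(ā b)(x) Re(c̄ d)(y) |x - y|⁻⁴ dx dy`. -/
def quad (a b c d : L2) : ℝ := coulR (dens a b) (dens c d)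

lemma coul_dens_le (a b c d : L2) :
    coul (fun x ↦ ‖dens a b x‖ₑ) (fun x ↦ ‖dens c d x‖ₑ) ≤ cquad a b c d :=
  coul_mono (enorm_dens_le a b) (enorm_dens_le c d)

lemma integrable_quad {a b c d : L2} (h : cquad a b c d < ∞) :
    Integrable fun z : E5 × E5 ↦ dens a b z.1 * dens c d z.2 * (‖z.1 - z.2‖ ^ 4)⁻¹ :=
  integrable_coulR (measurable_dens a b) (measurable_dens c d) ((coul_dens_le a b c d).trans_lt h)

lemma enorm_quad_le (a b c d : L2) : ‖quad a b c d‖ₑ ≤ cquad a b c d := by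
  refine (enorm_integral_le_lintegral_enorm _).trans ?_
  rw [lintegral_enorm_coulR (measurable_dens a b) (measurable_dens c d)]
  exact coul_dens_le a b c d

lemma quad_comm_left (a b c d : L2) : quad a b c d = quad b a c d := by
  simp only [quad, dens_comm a b]

lemma quad_comm_right (a b c d : L2) : quad a b c d = quad a b d c := by
  simp only [quad, dens_comm c d]

lemma quad_swap (a b c d : L2) : quad a b c d = quad c d a b := coulR_comm _ _

lemma quad_add {a a' b c d : L2} (h : cquad a b c d < ∞) (h' : cquad a' b c d < ∞) :
    quad (a + a') b c d = quad a b c d + quad a' b c d := by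
  rw [quad, coulR_congr_ae (dens_add_ae a a' b) (ae_eq_refl _)]
  simp only [quad, coulR]
  rw [← integral_add (integrable_quad h) (integrable_quad h')]
  refine integral_congr_ae (.of_forall fun z ↦ ?_)
  simp only
  ring

lemma quad_smul (r : ℝ) (a b c d : L2) : quad (r • a) b c d = r * quad a b c d := by
  rw [quad, coulR_congr_ae (dens_smul_ae r a b) (ae_eq_refl _)]
  simp only [quad, coulR]
  rw [← integral_const_mul]
  refine integral_congr_ae (.of_forall fun z ↦ ?_)
  simp only
  ring

lemma cquad_smul (r : ℝ) (a b c d : L2) : cquad (r • a) b c d = ‖r‖ₑ * cquad a b c d := by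
  have h1 : (fun x ↦ ‖(r • a : L2) x‖ₑ * ‖b x‖ₑ) =ᵐ[volume] fun x ↦ ‖r‖ₑ * (‖a x‖ₑ * ‖b x‖ₑ) := by
    filter_upwards [Lp.coeFn_smul r a] with x hx
    rw [hx, Pi.smul_apply, enorm_smul, mul_assoc]
  rw [cquad, coul_congr_ae h1 (ae_eq_refl _)]
  have := coul_const_mul (f := fun x ↦ ‖a x‖ₑ * ‖b x‖ₑ) (g := fun x ↦ ‖c x‖ₑ * ‖d x‖ₑ)
    (a := ‖r‖ₑ) (b := 1) (by simp) (by simp)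
  simpa [cquad] using this

lemma cquad_neg (a b c d : L2) : cquad (-a) b c d = cquad a b c d := by
  have := cquad_smul (-1) a b c d
  simpa using this

lemma quad_neg (a b c d : L2) : quad (-a) b c d = -quad a b c d := by
  have := quad_smul (-1) a b c d
  simpa using this

lemma quad_sub {a a' b c d : L2} (h : cquad a b c d < ∞) (h' : cquad a' b c d < ∞) :
    quad (a - a') b c d = quad a b c d - quad a' b c d := by
  rw [sub_eq_add_neg, quad_add h (by rwa [cquad_neg]), quad_neg, ← sub_eq_add_neg]

lemma quad_self_self (a b : L2) : quad a a b b = (cquad a a b b).toReal := by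
  unfold quad coulR
  have h0 : ∀ z : E5 × E5, 0 ≤ dens a a z.1 * dens b b z.2 * (‖z.1 - z.2‖ ^ 4)⁻¹ := by
    intro z; rw [dens_self, dens_self]; positivity
  rw [integral_eq_lintegral_of_nonneg_ae (.of_forall h0)
    (measurable_coulR_integrand (measurable_dens a a) (measurable_dens b b)).aestronglyMeasurable]
  congr 1
  have := lintegral_enorm_coulR (measurable_dens a a) (measurable_dens b b)
  rw [lintegral_congr fun z ↦ Real.enorm_of_nonneg (h0 z)] at this
  rw [this, cquad]
  congr 1 <;> ext x <;> rw [dens_self, ← ofReal_norm, norm_pow, norm_norm, ← ofReal_norm,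
    ← ENNReal.ofReal_mul (norm_nonneg _), sq]

lemma quad_self_self_nonneg (a b : L2) : 0 ≤ quad a a b b := by
  rw [quad_self_self]; positivity

lemma two_mul_quad_self_le {a b : L2} (ha : cquad a a a a < ∞) (hb : cquad b b b b < ∞) :
    2 * quad a a b b ≤ quad a a a a + quad b b b b := by
  have := two_mul_coul_le (measurable_enorm_mul a a) (measurable_enorm_mul b b)
  simp only [quad_self_self]
  change 2 * cquad a a b b ≤ cquad a a a a + cquad b b b b at this
  rw [← ENNReal.toReal_add ha.ne hb.ne]
  have h2 := ENNReal.toReal_mono (ENNReal.add_lt_top.2 ⟨ha, hb⟩).ne this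
  simpa using h2

/-- Continuity of the quadrilinear form in mixed norms. -/
lemma tendsto_quad {ι : Type*} {l : Filter ι} {p q r s : ℝ} (hp : 1 ≤ p) (hq : 1 ≤ q) (hr : 1 ≤ r)
    (hs : 1 ≤ s) (h1 : 1 / p + 1 / q < 1) (h2 : 1 / r + 1 / s < 1)
    (h : 1 / p + 1 / q + (1 / r + 1 / s) = 6 / 5) {a b c d : ι → L2} {a₀ b₀ c₀ d₀ : L2}
    (ha₀ : nrm p a₀ < ∞) (hb₀ : nrm q b₀ < ∞) (hc₀ : nrm r c₀ < ∞) (hd₀ : nrm s d₀ < ∞)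
    (ha : Tendsto (fun i ↦ nrm p (a i - a₀)) l (𝓝 0))
    (hb : Tendsto (fun i ↦ nrm q (b i - b₀)) l (𝓝 0))
    (hc : Tendsto (fun i ↦ nrm r (c i - c₀)) l (𝓝 0))
    (hd : Tendsto (fun i ↦ nrm s (d i - d₀)) l (𝓝 0)) :
    Tendsto (fun i ↦ quad (a i) (b i) (c i) (d i)) l (𝓝 (quad a₀ b₀ c₀ d₀)) := by
  obtain ⟨C, hC⟩ := exists_cquad_le (by linarith) (by linarith) (by linarith) (by linarith) h1 h2 h
  have bound : ∀ a b c d : L2, nrm p a < ∞ → nrm q b < ∞ → nrm r c < ∞ → nrm s d < ∞ →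
      cquad a b c d < ∞ := fun a b c d ha hb hc hd ↦ (hC a b c d).trans_lt
    (ENNReal.mul_lt_top (ENNReal.mul_lt_top (by simp) (ENNReal.mul_lt_top ha hb))
      (ENNReal.mul_lt_top hc hd))
  have near : ∀ {p : ℝ} (hp : 1 ≤ p) {f : ι → L2} {f₀ : L2}, nrm p f₀ < ∞ →
      Tendsto (fun i ↦ nrm p (f i - f₀)) l (𝓝 0) → ∀ᶠ i in l, nrm p (f i) ≤ 1 + nrm p f₀ := by
    intro p hp f f₀ _ hf
    filter_upwards [hf.eventually_le_const one_pos] with i hi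
    have := nrm_add_le hp (f i - f₀) f₀
    rw [sub_add_cancel] at this
    exact this.trans (by gcongr)
  have fin : ∀ {p : ℝ} {f₀ : L2}, nrm p f₀ < ∞ → 1 + nrm p f₀ < ∞ := fun h ↦
    ENNReal.add_lt_top.2 ⟨by simp, h⟩
  rw [tendsto_iff_edist_tendsto_0]
  set A := 1 + nrm p a₀
  set B := 1 + nrm q b₀
  set C' := 1 + nrm r c₀
  set D := 1 + nrm s d₀
  have hA : A < ∞ := fin ha₀
  have hB : B < ∞ := fin hb₀
  have hC' : C' < ∞ := fin hc₀
  have hD : D < ∞ := fin hd₀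
  have lim : Tendsto (fun i ↦ nrm p (a i - a₀) * (C * B * C' * D) +
      nrm q (b i - b₀) * (C * A * C' * D) + nrm r (c i - c₀) * (C * A * B * D) +
      nrm s (d i - d₀) * (C * A * B * C')) l (𝓝 0) := by
    have t : ∀ {f : ι → ℝ≥0∞} {x y z : ℝ≥0∞}, Tendsto f l (𝓝 0) → x < ∞ → y < ∞ → z < ∞ →
        Tendsto (fun i ↦ f i * (C * x * y * z)) l (𝓝 0) := by
      intro f x y z hf hx hy hz
      have := ENNReal.Tendsto.mul_const (b := C * x * y * z) hf (Or.inr (ENNReal.mul_lt_top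
        (ENNReal.mul_lt_top (ENNReal.mul_lt_top (by simp) hx) hy) hz).ne)
      simpa using this
    simpa using (((t ha hB hC' hD).add (t hb hA hC' hD)).add (t hc hA hB hD)).add (t hd hA hB hC')
  refine tendsto_of_tendsto_of_tendsto_of_le_of_le' tendsto_const_nhds lim
    (.of_forall fun _ ↦ zero_le) ?_
  filter_upwards [near hp ha₀ ha, near hq hb₀ hb, near hr hc₀ hc, near hs hd₀ hd] with i ia ib ic id
  have fa := ia.trans_lt hA
  have fb := ib.trans_lt hB
  have fc := ic.trans_lt hC'
  have fd := id.trans_lt hD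
  have la : nrm p a₀ ≤ A := le_add_self
  have lb : nrm q b₀ ≤ B := le_add_self
  have lc : nrm r c₀ ≤ C' := le_add_self
  -- Telescoping: the slots are replaced one at a time. The symmetries of the form bring each slot
  -- into first position, where additivity is available.
  have e : quad (a i) (b i) (c i) (d i) - quad a₀ b₀ c₀ d₀ =
      quad (a i - a₀) (b i) (c i) (d i) + quad a₀ (b i - b₀) (c i) (d i) +
      quad a₀ b₀ (c i - c₀) (d i) + quad a₀ b₀ c₀ (d i - d₀) := by
    have e1 := quad_sub (bound _ _ _ _ fa fb fc fd) (bound _ _ _ _ ha₀ fb fc fd)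
    have e2 := quad_sub (a := b i) (a' := b₀) (b := a₀) (c := c i) (d := d i)
      (by rw [cquad_comm_left]; exact bound _ _ _ _ ha₀ fb fc fd)
      (by rw [cquad_comm_left]; exact bound _ _ _ _ ha₀ hb₀ fc fd)
    have e3 := quad_sub (a := c i) (a' := c₀) (b := d i) (c := a₀) (d := b₀)
      (by rw [cquad_swap]; exact bound _ _ _ _ ha₀ hb₀ fc fd)
      (by rw [cquad_swap]; exact bound _ _ _ _ ha₀ hb₀ hc₀ fd)
    have e4 := quad_sub (a := d i) (a' := d₀) (b := c₀) (c := a₀) (d := b₀)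
      (by rw [cquad_comm_left, cquad_swap]; exact bound _ _ _ _ ha₀ hb₀ hc₀ fd)
      (by rw [cquad_comm_left, cquad_swap]; exact bound _ _ _ _ ha₀ hb₀ hc₀ hd₀)
    rw [quad_comm_left _ a₀, quad_comm_left _ a₀, quad_comm_left _ a₀] at e2
    rw [quad_swap _ _ a₀, quad_swap _ _ a₀, quad_swap _ _ a₀] at e3
    rw [quad_comm_left _ c₀, quad_swap c₀, quad_comm_left _ c₀, quad_swap c₀, quad_comm_left _ c₀,
      quad_swap c₀] at e4
    linarith
  rw [edist_eq_enorm_sub, e]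
  refine (enorm_add_le _ _).trans (add_le_add ((enorm_add_le _ _).trans (add_le_add
    ((enorm_add_le _ _).trans (add_le_add ?_ ?_)) ?_)) ?_)
  all_goals refine (enorm_quad_le _ _ _ _).trans ((hC _ _ _ _).trans ?_)
  · calc _ ≤ C * (nrm p (a i - a₀) * B) * (C' * D) := by gcongr
      _ = _ := by ring
  · calc _ ≤ C * (A * nrm q (b i - b₀)) * (C' * D) := by gcongr
      _ = _ := by ring
  · calc _ ≤ C * (A * B) * (nrm r (c i - c₀) * D) := by gcongr
      _ = _ := by ring
  · calc _ ≤ C * (A * B) * (C' * nrm s (d i - d₀)) := by gcongr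
      _ = _ := by ring

/-! ### Bounds for the quadrilinear form -/

/-- The potential `|x|⁻⁴ ∗ |v|²`. -/
def potv (v : L2) : E5 → ℝ≥0∞ := pot fun y ↦ ‖v y‖ₑ * ‖v y‖ₑ

lemma measurable_potv (v : L2) : Measurable (potv v) := measurable_pot (measurable_enorm_mul v v)

lemma cquad_eq_potv (a b v : L2) : cquad a b v v = ∫⁻ x, ‖a x‖ₑ * ‖b x‖ₑ * potv v x :=
  coul_eq_pot (measurable_enorm_mul v v)

lemma integral_sq_eq_potv (v : L2) (x : E5) :
    ∫ y, ‖v y‖ ^ 2 / ‖x - y‖ ^ 4 = (potv v x).toReal := by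
  have hm := measurable_coe v
  rw [integral_eq_lintegral_of_nonneg_ae (.of_forall fun y ↦ by positivity)
    (by fun_prop : Measurable fun y : E5 ↦ ‖v y‖ ^ 2 / ‖x - y‖ ^ 4).aestronglyMeasurable]
  congr 1
  refine lintegral_congr_ae ?_
  filter_upwards [ae_ne x] with y hy
  rw [div_eq_mul_inv, ENNReal.ofReal_mul (by positivity), ← enorm_inv_pow_four (sub_ne_zero.2 hy.symm),
    Real.enorm_of_nonneg (by positivity : 0 ≤ (‖x - y‖ ^ 4)⁻¹), ← ofReal_norm,
    ← ENNReal.ofReal_mul (norm_nonneg _), sq]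

lemma hartree_eq (v : L2) (x : E5) : hartree v x = ((potv v x).toReal : ℂ) * v x := by
  rw [hartree, integral_sq_eq_potv]

lemma measurable_hartree (v : L2) : Measurable (hartree v) := by
  have h1 := measurable_coe v
  have h2 := (measurable_potv v).ennreal_toReal
  have : hartree v = fun x ↦ ((potv v x).toReal : ℂ) * v x := funext (hartree_eq v)
  rw [this]
  exact (Complex.measurable_ofReal.comp h2).mul h1

lemma quad_eq_integral {a b v : L2} (h : cquad a b v v < ∞) :
    quad a b v v = ∫ x, dens a b x * (potv v x).toReal := by
  have := integrable_quad h
  rw [quad, coulR, Measure.volume_eq_prod, integral_prod _ (by rwa [← Measure.volume_eq_prod])]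
  refine integral_congr_ae (.of_forall fun x ↦ ?_)
  simp only
  rw [← integral_sq_eq_potv, ← integral_const_mul]
  refine integral_congr_ae (.of_forall fun y ↦ ?_)
  simp only [dens_self]
  ring

lemma quad_eq_re_integral_hartree {v w : L2} (h : cquad v w v v < ∞)
    (hi : Integrable fun x ↦ starRingEnd ℂ (hartree v x) * w x) :
    quad v w v v = (∫ x, starRingEnd ℂ (hartree v x) * w x).re := by
  rw [quad_eq_integral h]
  change _ = RCLike.re (∫ x, starRingEnd ℂ (hartree v x) * w x)
  rw [← integral_re hi]
  refine integral_congr_ae (.of_forall fun x ↦ ?_)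
  simp only [hartree_eq, dens, map_mul, Complex.conj_ofReal, mul_assoc]
  rw [mul_comm]
  exact (Complex.re_ofReal_mul _ _).symm

lemma exists_nrm_sobolev : ∃ C : ℝ≥0, ∀ f : L2,
    nrm (10 / 3) f ≤ C * gradNormSq f ^ (1 / 2 : ℝ) := by
  obtain ⟨C, hC⟩ := exists_sobolev
  refine ⟨C, fun f ↦ ?_⟩
  have := hC f
  rw [eLpNorm_eq_nrm (by norm_num) (ENNReal.div_ne_top (by norm_num) (by norm_num))] at this
  simpa using this

/-- Interpolation halfway: 2/5 = (1/2)(1/2) + (1/2)(3/10). -/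
lemma nrm_five_halves_le (f : L2) :
    nrm (5 / 2) f ≤ nrm 2 f ^ (1 / 2 : ℝ) * nrm (10 / 3) f ^ (1 / 2 : ℝ) := by
  have hm := (measurable_coe f).enorm
  have h := ENNReal.lintegral_mul_norm_pow_le (μ := (volume : Measure E5))
    (hm.pow_const (2 : ℝ)).aemeasurable (hm.pow_const (10 / 3 : ℝ)).aemeasurable
    (p := 5 / 8) (q := 3 / 8) (by norm_num) (by norm_num) (by norm_num)
  have e : ∀ x, (‖f x‖ₑ ^ (2 : ℝ)) ^ (5 / 8 : ℝ) * (‖f x‖ₑ ^ (10 / 3 : ℝ)) ^ (3 / 8 : ℝ) =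
      ‖f x‖ₑ ^ (5 / 2 : ℝ) := by
    intro x
    rw [← ENNReal.rpow_mul, ← ENNReal.rpow_mul, ← ENNReal.rpow_add_of_nonneg _ _ (by norm_num)
      (by norm_num)]
    norm_num
  simp_rw [e] at h
  unfold nrm eLpNorm'
  refine (ENNReal.rpow_le_rpow h (by norm_num : (0 : ℝ) ≤ 1 / (5 / 2))).trans (le_of_eq ?_)
  rw [ENNReal.mul_rpow_of_nonneg _ _ (by norm_num)]
  simp only [← ENNReal.rpow_mul]
  norm_num

lemma exists_nrm_potv_le : ∃ C : ℝ≥0, ∀ v : L2,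
    (∫⁻ x, potv v x ^ (5 / 2 : ℝ)) ^ (2 / 5 : ℝ) ≤ C * cquad v v v v ^ (1 / 2 : ℝ) := by
  obtain ⟨C, hC⟩ := exists_pot_le
  exact ⟨C, fun v ↦ hC _ (measurable_enorm_mul v v)⟩

lemma ae_potv_lt_top {v : L2} (hv : cquad v v v v < ∞) : ∀ᵐ x, potv v x < ∞ := by
  obtain ⟨C, hC⟩ := exists_nrm_potv_le
  have h1 : ∫⁻ x, potv v x ^ (5 / 2 : ℝ) < ∞ := by
    have h2 : (∫⁻ x, potv v x ^ (5 / 2 : ℝ)) ^ (2 / 5 : ℝ) < ∞ := (hC v).trans_lt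
      (ENNReal.mul_lt_top (by simp) (ENNReal.rpow_lt_top_of_nonneg (by norm_num) hv.ne))
    exact (ENNReal.rpow_lt_top_iff_of_pos (by norm_num)).1 h2
  filter_upwards [ae_lt_top ((measurable_potv v).pow_const _) h1.ne] with x hx
  exact (ENNReal.rpow_lt_top_iff_of_pos (by norm_num)).1 hx

/-- The form is controlled by the square root of the potential energy of the last two slots. -/
lemma exists_cquad_le_potential : ∃ C : ℝ≥0, ∀ (p q : ℝ), 5 / 3 < p → 1 / p + 1 / q = 3 / 5 →
    ∀ a b v : L2, cquad a b v v ≤ C * cquad v v v v ^ (1 / 2 : ℝ) * (nrm p a * nrm q b) := by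
  obtain ⟨C, hC⟩ := exists_nrm_potv_le
  refine ⟨C, fun p q hp hpq a b v ↦ ?_⟩
  rw [cquad_eq_potv]
  have h := ENNReal.lintegral_mul_le_Lp_mul_Lq volume (p := 5 / 3) (q := 5 / 2)
    (by rw [Real.holderConjugate_iff]; norm_num) (measurable_enorm_mul a b).aemeasurable
    (measurable_potv v).aemeasurable
  refine h.trans ?_
  rw [mul_comm]
  refine mul_le_mul' ?_ ?_
  · have := hC v
    norm_num at this ⊢
    exact this
  · exact lintegral_mul_rpow_le (by norm_num) hp (by rw [hpq]; norm_num) a b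

lemma nrm_lt_top_of_bandLimited {R : ℝ} {f : L2} (hf : f ∈ bandLimited R) {p : ℝ} (hp : 2 ≤ p) :
    nrm p f < ∞ := by
  obtain ⟨C, hC⟩ := exists_bernstein_eLpNorm R
  have h2 : (2 : ℝ≥0∞) ≤ ENNReal.ofReal p := by
    rw [← ENNReal.ofReal_ofNat]; exact ENNReal.ofReal_le_ofReal hp
  have := hC f hf (ENNReal.ofReal p) h2 ENNReal.ofReal_ne_top
  rw [eLpNorm_eq_nrm (by simp; linarith) ENNReal.ofReal_ne_top,
    ENNReal.toReal_ofReal (by linarith)] at this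
  exact this.trans_lt (ENNReal.mul_lt_top (by simp) (by simp))

lemma exists_nrm_bernstein (R : ℝ) : ∃ C : ℝ≥0, ∀ f ∈ bandLimited R, ∀ p : ℝ, 2 ≤ p →
    nrm p f ≤ C * ‖f‖ₑ := by
  obtain ⟨C, hC⟩ := exists_bernstein_eLpNorm R
  refine ⟨C, fun f hf p hp ↦ ?_⟩
  have h2 : (2 : ℝ≥0∞) ≤ ENNReal.ofReal p := by
    rw [← ENNReal.ofReal_ofNat]; exact ENNReal.ofReal_le_ofReal hp
  have := hC f hf (ENNReal.ofReal p) h2 ENNReal.ofReal_ne_top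
  rwa [eLpNorm_eq_nrm (by simp; linarith) ENNReal.ofReal_ne_top,
    ENNReal.toReal_ofReal (by linarith)] at this

lemma holder_four_fifths {p q : ℝ} (hp : 5 / 4 < p) (hpq : 1 / p + 1 / q = 4 / 5)
    {f g : E5 → ℂ} (hf : Measurable f) (hg : Measurable g) :
    eLpNorm' (fun x ↦ f x * g x) (5 / 4) volume ≤ eLpNorm' f p volume * eLpNorm' g q volume := by
  have := ENNReal.lintegral_Lp_mul_le_Lq_mul_Lr (p := 5 / 4) (q := p) (r := q) (by norm_num) hp
    (by rw [hpq]; norm_num) volume hf.enorm.aemeasurable hg.enorm.aemeasurable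
  unfold eLpNorm'
  simp only [enorm_mul]
  exact this

lemma nrm_shift (p : ℝ) (h : E5) (f : L2) : nrm p (shift h f) = nrm p f := by
  rw [nrm, eLpNorm'_congr_ae (shift_ae h f), eLpNorm'_comp_add_right]; rfl

/-- Interpolation between a full derivative in L², giving |h| ‖∇v‖, and the Sobolev bound in
L^(10/3) without decay in h. Half a derivative is left in L^(5/2). -/
lemma exists_nrm_shift_sub_le : ∃ C : ℝ≥0, ∀ (v : L2) (h : E5),
    nrm (5 / 2) (shift h v - v) ≤ C * ENNReal.ofReal (‖h‖ ^ (1 / 2 : ℝ)) *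
      gradNormSq v ^ (1 / 2 : ℝ) := by
  obtain ⟨C, hC⟩ := exists_nrm_sobolev
  refine ⟨(2 * C) ^ (1 / 2 : ℝ), fun v h ↦ ?_⟩
  set X := gradNormSq v ^ (1 / 2 : ℝ) with hX
  have h1 : nrm 2 (shift h v - v) ≤ ENNReal.ofReal ‖h‖ * X := by
    have h2 := shift_sub_sq_le h v
    have e : nrm 2 (shift h v - v) =
        (∫⁻ x, ‖v (x + h) - v x‖ₑ ^ 2) ^ (1 / 2 : ℝ) := by
      unfold nrm eLpNorm'
      congr 1
      refine lintegral_congr_ae ?_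
      filter_upwards [shift_ae h v, Lp.coeFn_sub (shift h v) v] with x h1 h2
      rw [h2, Pi.sub_apply, h1]
      norm_cast
    rw [e]
    refine (ENNReal.rpow_le_rpow h2 (by norm_num)).trans (le_of_eq ?_)
    rw [ENNReal.mul_rpow_of_nonneg _ _ (by norm_num),
      ENNReal.ofReal_rpow_of_nonneg (by positivity) (by norm_num), ← Real.sqrt_eq_rpow,
      Real.sqrt_sq (norm_nonneg _)]
  have h2 : nrm (10 / 3) (shift h v - v) ≤ 2 * C * X := by
    refine (nrm_sub_le (by norm_num) _ _).trans ?_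
    rw [nrm_shift, ← two_mul, mul_assoc]
    gcongr
    exact hC v
  refine (nrm_five_halves_le _).trans ?_
  calc _ ≤ (ENNReal.ofReal ‖h‖ * X) ^ (1 / 2 : ℝ) * (2 * C * X) ^ (1 / 2 : ℝ) := by gcongr
    _ = ENNReal.ofReal ‖h‖ ^ (1 / 2 : ℝ) * (2 * C) ^ (1 / 2 : ℝ) *
        (X ^ (1 / 2 : ℝ) * X ^ (1 / 2 : ℝ)) := by
        rw [ENNReal.mul_rpow_of_nonneg _ _ (by norm_num),
          ENNReal.mul_rpow_of_nonneg _ _ (by norm_num)]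
        ring
    _ = _ := by
        rw [← ENNReal.rpow_add_of_nonneg _ _ (by norm_num) (by norm_num),
          ENNReal.ofReal_rpow_of_nonneg (norm_nonneg _) (by norm_num)]
        norm_num
        rw [ENNReal.coe_rpow_of_nonneg _ (by norm_num)]
        push_cast
        ring

/-- Half a derivative of the Hartree nonlinearity. -/
lemma exists_hartree_translation_le : ∃ C : ℝ≥0, ∀ v : L2, cquad v v v v < ∞ →
    eLpNorm' (hartree v) (5 / 4) volume ≤ C * cquad v v v v ^ (1 / 2 : ℝ) * nrm (5 / 2) v ∧
    ∀ h : E5, eLpNorm' (fun x ↦ hartree v (x + h) - hartree v x) (5 / 4) volume ≤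
      C * cquad v v v v ^ (1 / 2 : ℝ) * gradNormSq v ^ (1 / 2 : ℝ) *
        ENNReal.ofReal (‖h‖ ^ (1 / 2 : ℝ)) := by
  obtain ⟨C₁, hC₁⟩ := exists_nrm_potv_le
  obtain ⟨C₂, hC₂⟩ := exists_pot_translation_le
  obtain ⟨C₃, hC₃⟩ := exists_nrm_sobolev
  obtain ⟨C₄, hC₄⟩ := exists_nrm_shift_sub_le
  refine ⟨C₁ + C₂ * C₃ + C₁ * C₄, fun v hv ↦ ?_⟩
  set p : E5 → ℂ := fun x ↦ ((potv v x).toReal : ℂ) with hp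
  have hpm : Measurable p := Complex.measurable_ofReal.comp (measurable_potv v).ennreal_toReal
  have hvm := measurable_coe v
  have hp1 : eLpNorm' p (5 / 2) volume ≤ C₁ * cquad v v v v ^ (1 / 2 : ℝ) := by
    refine le_trans ?_ (hC₁ v)
    unfold eLpNorm'
    norm_num
    gcongr with x
    simp only [hp]
    rw [← ofReal_norm, Complex.norm_real, Real.norm_of_nonneg ENNReal.toReal_nonneg]
    exact ENNReal.ofReal_toReal_le
  have he : hartree v = fun x ↦ p x * v x := funext (hartree_eq v)
  constructor
  · rw [he]
    refine (holder_four_fifths (p := 5 / 2) (q := 5 / 2) (by norm_num) (by norm_num) hpm hvm).trans ?_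
    change _ * nrm (5 / 2) v ≤ _
    gcongr
    refine hp1.trans ?_
    gcongr
    rw [add_assoc]
    exact le_self_add
  · intro h
    -- Discrete product rule. The increment of the potential in L² meets v in L^(10/3); the
    -- potential in L^(5/2) meets the increment of v in L^(5/2). Both products are in L^(5/4).
    have e : (fun x ↦ hartree v (x + h) - hartree v x) =
        (fun x ↦ (p (x + h) - p x) * v (x + h)) + fun x ↦ p x * (v (x + h) - v x) := by
      ext x; simp only [he, Pi.add_apply]; ring
    have hvh : Measurable fun x ↦ v (x + h) := hvm.comp (measurable_id.add_const h)
    have hph : Measurable fun x ↦ p (x + h) := hpm.comp (measurable_id.add_const h)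
    rw [e]
    refine (eLpNorm'_add_le ((hph.sub hpm).mul hvh).aestronglyMeasurable
      (hpm.mul (hvh.sub hvm)).aestronglyMeasurable (by norm_num)).trans ?_
    have a1 := holder_four_fifths (p := 2) (q := 10 / 3) (by norm_num) (by norm_num)
      (hph.sub hpm) hvh
    have a2 := holder_four_fifths (p := 5 / 2) (q := 5 / 2) (by norm_num) (by norm_num)
      hpm (hvh.sub hvm)
    have b1 : eLpNorm' (fun x ↦ p (x + h) - p x) 2 volume ≤
        C₂ * ENNReal.ofReal (‖h‖ ^ (1 / 2 : ℝ)) * cquad v v v v ^ (1 / 2 : ℝ) := by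
      refine le_trans (le_of_eq ?_) (hC₂ _ (measurable_enorm_mul v v) h)
      unfold eLpNorm'
      congr 1
      refine lintegral_congr fun x ↦ ?_
      simp only [hp]
      rw [← Complex.ofReal_sub, ← ofReal_norm, Complex.norm_real, Real.norm_eq_abs]
      rfl
    have b2 : eLpNorm' (fun x ↦ v (x + h)) (10 / 3) volume ≤ C₃ * gradNormSq v ^ (1 / 2 : ℝ) := by
      rw [eLpNorm'_comp_add_right]; exact hC₃ v
    have b3 : eLpNorm' (fun x ↦ v (x + h) - v x) (5 / 2) volume ≤
        C₄ * ENNReal.ofReal (‖h‖ ^ (1 / 2 : ℝ)) * gradNormSq v ^ (1 / 2 : ℝ) := by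
      refine le_trans (le_of_eq (eLpNorm'_congr_ae ?_)) (hC₄ v h)
      filter_upwards [shift_ae h v, Lp.coeFn_sub (shift h v) v] with x h1 h2
      rw [h2, Pi.sub_apply, h1]
    refine (add_le_add (a1.trans (mul_le_mul' b1 b2)) (a2.trans (mul_le_mul' hp1 b3))).trans ?_
    calc _ = (C₂ * C₃ + C₁ * C₄ : ℝ≥0∞) * cquad v v v v ^ (1 / 2 : ℝ) *
          gradNormSq v ^ (1 / 2 : ℝ) * ENNReal.ofReal (‖h‖ ^ (1 / 2 : ℝ)) := by ring
      _ ≤ _ := by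
          push_cast
          gcongr
          exact le_add_self

/-- The term with the derivative of the random linear evolution. -/
lemma exists_quad_japanese_le {α : ℝ} (hα : 0 < α) (hα2 : α < 1 / 2) :
    ∃ C : ℝ≥0, ∀ (R : ℝ) (w : L2), w ∈ bandLimited R → ∀ v : L2, cquad v v v v < ∞ →
      gradNormSq v < ∞ →
      ‖quad v (mult (japanese α) w) v v‖ₑ ≤ C * cquad v v v v ^ (1 / 2 : ℝ) *
        (‖v‖ₑ + gradNormSq v ^ (1 / 2 : ℝ)) * nrm 5 w := by
  obtain ⟨C, hC0, hC⟩ := exists_norm_integral_conj_mul_mult_japanese_le hα hα2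
  obtain ⟨D, hD⟩ := exists_hartree_translation_le
  obtain ⟨S, hS⟩ := exists_nrm_sobolev
  obtain ⟨E, hE⟩ := exists_cquad_le_potential
  refine ⟨C.toNNReal * D * (1 + S + 1), fun R w hw v hΦ hv ↦ ?_⟩
  set Φ := cquad v v v v ^ (1 / 2 : ℝ)
  set X := gradNormSq v ^ (1 / 2 : ℝ)
  have hΦt : Φ < ∞ := ENNReal.rpow_lt_top_of_nonneg (by norm_num) hΦ.ne
  have hXt : X < ∞ := ENNReal.rpow_lt_top_of_nonneg (by norm_num) hv.ne
  -- Both factors of the interpolation inequality are dominated by the sum, which keeps the bound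
  -- linear in ‖v‖ and ‖∇v‖.
  have hN : nrm (5 / 2) v ≤ ‖v‖ₑ + S * X := by
    refine (nrm_five_halves_le v).trans ?_
    rw [nrm_two]
    calc _ ≤ (‖v‖ₑ + S * X) ^ (1 / 2 : ℝ) * (‖v‖ₑ + S * X) ^ (1 / 2 : ℝ) := by
          gcongr
          · exact le_self_add
          · exact (hS v).trans le_add_self
      _ = _ := by
          rw [← ENNReal.rpow_add_of_nonneg _ _ (by norm_num) (by norm_num)]
          norm_num
  have hNt : nrm (5 / 2) v < ∞ := hN.trans_lt
    (ENNReal.add_lt_top.2 ⟨by simp, ENNReal.mul_lt_top (by simp) hXt⟩)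
  have hgt : D * Φ * nrm (5 / 2) v < ∞ :=
    ENNReal.mul_lt_top (ENNReal.mul_lt_top (by simp) hΦt) hNt
  have hAt : D * Φ * X < ∞ := ENNReal.mul_lt_top (ENNReal.mul_lt_top (by simp) hΦt) hXt
  have hnt : nrm 5 w < ∞ := nrm_lt_top_of_bandLimited hw (by norm_num)
  obtain ⟨hi, hb⟩ := hC R w hw (hartree v) (D * Φ * nrm (5 / 2) v).toReal (D * Φ * X).toReal
    (nrm 5 w).toReal (measurable_hartree v).aestronglyMeasurable (by positivity) (by positivity)
    (by positivity) (by rw [ENNReal.ofReal_toReal hgt.ne]; exact (hD v hΦ).1)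
    (fun h ↦ by
      rw [ENNReal.ofReal_mul (by positivity), ENNReal.ofReal_toReal hAt.ne]
      exact (hD v hΦ).2 h)
    (by rw [ENNReal.ofReal_toReal hnt.ne]; rfl)
  have hw' : mult (japanese α) w ∈ bandLimited R := fmul_mem_bandLimited hw _
  have hc : cquad v (mult (japanese α) w) v v < ∞ := by
    refine (hE (10 / 3) (10 / 3) (by norm_num) (by norm_num) _ _ _).trans_lt ?_
    exact ENNReal.mul_lt_top (ENNReal.mul_lt_top (by simp) hΦt) (ENNReal.mul_lt_top
      ((hS v).trans_lt (ENNReal.mul_lt_top (by simp) hXt))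
      (nrm_lt_top_of_bandLimited hw' (by norm_num)))
  rw [quad_eq_re_integral_hartree hc hi]
  calc _ ≤ ‖∫ x, starRingEnd ℂ (hartree v x) * mult (japanese α) w x‖ₑ := by
        rw [← ofReal_norm, ← ofReal_norm]
        exact ENNReal.ofReal_le_ofReal (Complex.abs_re_le_norm _)
    _ ≤ ENNReal.ofReal (C * ((D * Φ * nrm (5 / 2) v).toReal + (D * Φ * X).toReal) *
        (nrm 5 w).toReal) := by
        rw [← ofReal_norm]
        exact ENNReal.ofReal_le_ofReal hb
    _ = ENNReal.ofReal C * (D * Φ * nrm (5 / 2) v + D * Φ * X) * nrm 5 w := by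
        rw [ENNReal.ofReal_mul (by positivity), ENNReal.ofReal_mul hC0,
          ENNReal.ofReal_add (by positivity) (by positivity), ENNReal.ofReal_toReal hgt.ne,
          ENNReal.ofReal_toReal hAt.ne, ENNReal.ofReal_toReal hnt.ne]
    _ ≤ ENNReal.ofReal C * (D * Φ * (‖v‖ₑ + S * X) + D * Φ * X) * nrm 5 w := by gcongr
    _ = ENNReal.ofReal C * D * Φ * (‖v‖ₑ + (S + 1) * X) * nrm 5 w := by ring
    _ ≤ ENNReal.ofReal C * D * Φ * ((1 + S + 1) * (‖v‖ₑ + X)) * nrm 5 w := by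
        gcongr
        rw [mul_add]
        gcongr
        · refine le_mul_of_one_le_left zero_le ?_
          rw [add_assoc]; exact le_self_add
        · exact le_add_self
    _ = _ := by
        push_cast
        rw [ENNReal.ofReal]
        ring

/-! ### The linear wave propagators -/

/-- The modulus of the angular frequency. -/
def freq (ξ : E5) : ℝ := ‖(2 * Real.pi) • ξ‖

@[fun_prop]
lemma continuous_freq : Continuous freq := by unfold freq; fun_prop

@[fun_prop]
lemma measurable_freq : Measurable freq := continuous_freq.measurable

lemma freq_nonneg (ξ : E5) : 0 ≤ freq ξ := norm_nonneg _

/-- The symbol of `cos(t|∇|)`. -/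
def symCos (t : ℝ) (ξ : E5) : ℂ := (Real.cos (t * freq ξ) : ℂ)

/-- The symbol of `sin(t|∇|)`. -/
def symSin (t : ℝ) (ξ : E5) : ℂ := (Real.sin (t * freq ξ) : ℂ)

/-- The symbol of `sin(t|∇|)/|∇|`. -/
def symQ (t : ℝ) (ξ : E5) : ℂ := ((Real.sin (t * freq ξ) / freq ξ : ℝ) : ℂ)

lemma measurable_symCos (t : ℝ) : Measurable (symCos t) := by unfold symCos; fun_prop

lemma measurable_symSin (t : ℝ) : Measurable (symSin t) := by unfold symSin; fun_prop

lemma measurable_symQ (t : ℝ) : Measurable (symQ t) := by unfold symQ; fun_prop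

lemma norm_symCos_le (t : ℝ) (ξ : E5) : ‖symCos t ξ‖ ≤ 1 := by
  rw [symCos, Complex.norm_real]; exact Real.abs_cos_le_one _

lemma norm_symSin_le (t : ℝ) (ξ : E5) : ‖symSin t ξ‖ ≤ 1 := by
  rw [symSin, Complex.norm_real]; exact Real.abs_sin_le_one _

/-- The sine is 1-Lipschitz and the factor |η| cancels against the denominator. At frequency 0 the
quotient is 0 by convention, and the bound still holds. -/
lemma norm_symQ_sub_le (t t' : ℝ) (ξ : E5) : ‖symQ t ξ - symQ t' ξ‖ ≤ |t - t'| := by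
  rw [symQ, symQ, ← Complex.ofReal_sub, Complex.norm_real, ← sub_div, norm_div, Real.norm_eq_abs]
  refine div_le_of_le_mul₀ (norm_nonneg _) (abs_nonneg _) ?_
  have h1 : |Real.sin (t * freq ξ) - Real.sin (t' * freq ξ)| ≤ |t * freq ξ - t' * freq ξ| := by
    have := Real.lipschitzWith_sin.dist_le_mul (t * freq ξ) (t' * freq ξ)
    simpa [Real.dist_eq] using this
  refine h1.trans (le_of_eq ?_)
  rw [← sub_mul, abs_mul, Real.norm_eq_abs]

lemma norm_symQ_le (t : ℝ) (ξ : E5) : ‖symQ t ξ‖ ≤ |t| := by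
  have := norm_symQ_sub_le t 0 ξ
  simpa [symQ] using this

lemma hasDerivAt_symQ (t : ℝ) (ξ : E5) (hξ : freq ξ ≠ 0) :
    HasDerivAt (fun t ↦ symQ t ξ) (symCos t ξ) t := by
  have h1 : HasDerivAt (fun t : ℝ ↦ Real.sin (t * freq ξ) / freq ξ) (Real.cos (t * freq ξ)) t := by
    have := ((Real.hasDerivAt_sin (t * freq ξ)).comp t
      ((hasDerivAt_id t).mul_const (freq ξ))).div_const (freq ξ)
    simpa [hξ] using this
  exact h1.ofReal_comp

lemma ae_freq_ne_zero : ∀ᵐ ξ, freq ξ ≠ 0 := by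
  filter_upwards [ae_ne 0] with ξ hξ
  simp [freq, hξ, Real.pi_ne_zero]

/-- `cos(t|∇|)`. -/
def waveCos (t : ℝ) : L2 →L[ℂ] L2 := fmulL (symCos t) (measurable_symCos t) 1 (norm_symCos_le t)

/-- `sin(t|∇|)`. -/
def waveSin (t : ℝ) : L2 →L[ℂ] L2 := fmulL (symSin t) (measurable_symSin t) 1 (norm_symSin_le t)

/-- `sin(t|∇|)/|∇|` as a bounded operator. -/
def waveQ (t : ℝ) : L2 →L[ℂ] L2 := fmulL (symQ t) (measurable_symQ t) |t| (norm_symQ_le t)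

lemma Q_eq (t : ℝ) (f : L2) : Q t f = waveQ t f := rfl

lemma mult_cos_eq (t : ℝ) (f : L2) : mult (fun η ↦ Real.cos (t * ‖η‖)) f = waveCos t f := rfl

lemma norm_waveCos_le (t : ℝ) (f : L2) : ‖waveCos t f‖ ≤ ‖f‖ := by
  have h := norm_fmul_le (measurable_symCos t) zero_le_one (norm_symCos_le t) f
  rw [one_mul] at h
  exact h

lemma norm_waveSin_le (t : ℝ) (f : L2) : ‖waveSin t f‖ ≤ ‖f‖ := by
  have h := norm_fmul_le (measurable_symSin t) zero_le_one (norm_symSin_le t) f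
  rw [one_mul] at h
  exact h

lemma norm_waveQ_le (t : ℝ) (f : L2) : ‖waveQ t f‖ ≤ |t| * ‖f‖ :=
  norm_fmul_le (measurable_symQ t) (abs_nonneg t) (norm_symQ_le t) f

lemma fmul_smul_sub {m₁ m₂ : E5 → ℂ} (h₁ : Measurable m₁) (h₂ : Measurable m₂) {C₁ C₂ : ℝ}
    (hC₁ : ∀ ξ, ‖m₁ ξ‖ ≤ C₁) (hC₂ : ∀ ξ, ‖m₂ ξ‖ ≤ C₂) (c : ℝ) (f : L2) :
    fmul (fun ξ ↦ (c : ℂ) * (m₁ ξ - m₂ ξ)) f = c • (fmul m₁ f - fmul m₂ f) := by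
  refine fmul_eq_of_fourier ?_
  have hs : c • (fmul m₁ f - fmul m₂ f) = (c : ℂ) • (fmul m₁ f - fmul m₂ f) :=
    RCLike.real_smul_eq_coe_smul (K := ℂ) _ _
  rw [hs]
  filter_upwards [fourier_smul_ae c (fmul m₁ f - fmul m₂ f), fourier_sub_ae (fmul m₁ f) (fmul m₂ f),
    fourier_fmul (memLp_mul_fourier h₁ hC₁ f), fourier_fmul (memLp_mul_fourier h₂ hC₂ f)]
    with ξ e1 e2 e3 e4
  rw [e1, e2, e3, e4]
  ring

lemma norm_waveQ_sub_le (t t' : ℝ) (f : L2) : ‖waveQ t f - waveQ t' f‖ ≤ |t - t'| * ‖f‖ := by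
  have h := fmul_smul_sub (measurable_symQ t) (measurable_symQ t') (norm_symQ_le t)
    (norm_symQ_le t') 1 f
  rw [one_smul] at h
  change ‖fmul (symQ t) f - fmul (symQ t') f‖ ≤ _
  rw [← h]
  refine norm_fmul_le ?_ (abs_nonneg _) (fun ξ ↦ ?_) f
  · have := measurable_symQ t
    have := measurable_symQ t'
    fun_prop
  · simpa using norm_symQ_sub_le t t' ξ

/-- The symbols of the difference quotients are bounded by 1 and converge off frequency 0, so
dominated convergence applies for every f in L², with no gain or loss of regularity. -/
lemma hasDerivAt_waveQ (t : ℝ) (f : L2) : HasDerivAt (fun t ↦ waveQ t f) (waveCos t f) t := by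
  rw [hasDerivAt_iff_tendsto_slope]
  have e : slope (fun t ↦ waveQ t f) t = fun y ↦
      fmul (fun ξ ↦ (((y - t)⁻¹ : ℝ) : ℂ) * (symQ y ξ - symQ t ξ)) f := by
    ext1 y
    rw [fmul_smul_sub (measurable_symQ y) (measurable_symQ t) (norm_symQ_le y) (norm_symQ_le t)]
    rfl
  rw [e]
  refine tendsto_fmul (B := fun ξ ↦ ‖(𝓕 f : L2) ξ‖) (Lp.memLp _).norm (fun y ↦ ?_)
    (measurable_symCos t) (.of_forall fun y ↦ .of_forall fun ξ ↦ ?_) (.of_forall fun ξ ↦ ?_) ?_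
  · have := measurable_symQ t
    have := measurable_symQ y
    fun_prop
  · rw [norm_mul]
    refine mul_le_of_le_one_left (norm_nonneg _) ?_
    rw [norm_mul, Complex.norm_real, norm_inv, Real.norm_eq_abs]
    exact inv_mul_le_one_of_le₀ (norm_symQ_sub_le y t ξ) (abs_nonneg _)
  · rw [norm_mul]
    exact mul_le_of_le_one_left (norm_nonneg _) (norm_symCos_le t ξ)
  · filter_upwards [ae_freq_ne_zero] with ξ hξ
    refine Tendsto.mul_const _ ?_
    have := hasDerivAt_iff_tendsto_slope.1 (hasDerivAt_symQ t ξ hξ)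
    refine this.congr fun y ↦ ?_
    rw [slope_def_module, Complex.real_smul]

lemma continuous_fmul_of_bounded {m : ℝ → E5 → ℂ} (hm : ∀ t, Measurable (m t))
    (hb : ∀ t ξ, ‖m t ξ‖ ≤ 1) (hc : ∀ ξ, Continuous fun t ↦ m t ξ) (f : L2) :
    Continuous fun t ↦ fmul (m t) f := by
  refine continuous_iff_continuousAt.2 fun t ↦ ?_
  have h : ∀ t ξ, ‖m t ξ * (𝓕 f : L2) ξ‖ ≤ ‖(𝓕 f : L2) ξ‖ := fun t ξ ↦ by
    rw [norm_mul]; exact mul_le_of_le_one_left (norm_nonneg _) (hb t ξ)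
  exact tendsto_fmul (B := fun ξ ↦ ‖(𝓕 f : L2) ξ‖) (Lp.memLp _).norm hm (hm t)
    (.of_forall fun y ↦ .of_forall (h y)) (.of_forall (h t))
    (.of_forall fun ξ ↦ ((hc ξ).tendsto t).mul_const _)

lemma continuous_waveCos (f : L2) : Continuous fun t ↦ waveCos t f :=
  continuous_fmul_of_bounded measurable_symCos norm_symCos_le
    (fun ξ ↦ by unfold symCos; fun_prop) f

lemma continuous_waveSin (f : L2) : Continuous fun t ↦ waveSin t f :=
  continuous_fmul_of_bounded measurable_symSin norm_symSin_le
    (fun ξ ↦ by unfold symSin; fun_prop) f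

lemma continuous_uncurry_of_bounded (A : ℝ → L2 →L[ℂ] L2) (hA : ∀ t f, ‖A t f‖ ≤ ‖f‖)
    (hc : ∀ f, Continuous fun t ↦ A t f) : Continuous fun p : ℝ × L2 ↦ A p.1 p.2 := by
  refine continuous_prod_of_continuous_lipschitzWith' _ 1 (fun t ↦ ?_) hc
  refine LipschitzWith.of_dist_le_mul fun f g ↦ ?_
  rw [dist_eq_norm, dist_eq_norm, ← map_sub, NNReal.coe_one, one_mul]
  exact hA t _

section Duhamel

variable {μ : Measure ℝ} {N : ℝ → L2}

lemma aestronglyMeasurable_wave {A : ℝ → L2 →L[ℂ] L2} (hA : ∀ t f, ‖A t f‖ ≤ ‖f‖)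
    (hc : ∀ f, Continuous fun t ↦ A t f) (hN : AEStronglyMeasurable N μ) (t : ℝ) :
    AEStronglyMeasurable (fun r ↦ A (t - r) (N r)) μ :=
  (continuous_uncurry_of_bounded A hA hc).comp_aestronglyMeasurable
    ((continuous_const.sub continuous_id).aestronglyMeasurable.prodMk hN)

lemma integrable_wave {A : ℝ → L2 →L[ℂ] L2} (hA : ∀ t f, ‖A t f‖ ≤ ‖f‖)
    (hc : ∀ f, Continuous fun t ↦ A t f) (hN : Integrable N μ) (t : ℝ) :
    Integrable (fun r ↦ A (t - r) (N r)) μ :=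
  hN.norm.mono' (aestronglyMeasurable_wave hA hc hN.1 t) (.of_forall fun _ ↦ hA _ _)

/-- `Q(t)` for positive times, continued by `0`. -/
def waveQpos (t : ℝ) : L2 →L[ℂ] L2 := waveQ (max t 0)

lemma norm_waveQpos_sub_le (t t' : ℝ) (f : L2) :
    ‖waveQpos t f - waveQpos t' f‖ ≤ |t - t'| * ‖f‖ := by
  refine (norm_waveQ_sub_le _ _ f).trans ?_
  refine mul_le_mul_of_nonneg_right ?_ (norm_nonneg _)
  refine (abs_max_sub_max_le_max t 0 t' 0).trans ?_
  simp

lemma waveQpos_of_nonpos {t : ℝ} (ht : t ≤ 0) (f : L2) : waveQpos t f = 0 := by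
  have := norm_waveQ_le 0 f
  rw [waveQpos, max_eq_right ht]
  simpa using this

lemma waveQpos_of_nonneg {t : ℝ} (ht : 0 ≤ t) : waveQpos t = waveQ t := by
  rw [waveQpos, max_eq_left ht]

lemma hasDerivAt_waveQpos {t : ℝ} (ht : t ≠ 0) (f : L2) :
    HasDerivAt (fun t ↦ waveQpos t f) (if 0 < t then waveCos t f else 0) t := by
  rcases lt_or_gt_of_ne ht with h | h
  · rw [if_neg h.not_gt]
    refine (hasDerivAt_const t (0 : L2)).congr_of_eventuallyEq ?_
    filter_upwards [Iio_mem_nhds h] with s hs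
    exact waveQpos_of_nonpos (le_of_lt hs) f
  · rw [if_pos h]
    refine (hasDerivAt_waveQ t f).congr_of_eventuallyEq ?_
    filter_upwards [Ioi_mem_nhds h] with s hs
    rw [waveQpos_of_nonneg (le_of_lt hs)]

lemma aestronglyMeasurable_waveQpos (hN : AEStronglyMeasurable N μ) (t : ℝ) :
    AEStronglyMeasurable (fun r ↦ waveQpos (t - r) (N r)) μ := by
  have h1 : LipschitzWith 1 waveQpos := LipschitzWith.of_dist_le_mul fun s s' ↦ by
    rw [dist_eq_norm, dist_eq_norm, NNReal.coe_one, one_mul, Real.norm_eq_abs]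
    exact ContinuousLinearMap.opNorm_le_bound _ (abs_nonneg _) (norm_waveQpos_sub_le s s')
  have h2 : Continuous fun r ↦ waveQpos (t - r) := h1.continuous.comp (by fun_prop)
  exact (by fun_prop : Continuous fun p : (L2 →L[ℂ] L2) × L2 ↦ p.1 p.2).comp_aestronglyMeasurable
    (h2.aestronglyMeasurable.prodMk hN)

/-- The time derivative of Duhamel's integral. -/
lemma hasDerivAt_duhamel [NullSingletonClass μ] (hN : Integrable N μ) (hμ : ∀ᵐ r ∂μ, 0 ≤ r) (t : ℝ) :
    HasDerivAt (fun t ↦ ∫ r, waveQpos (t - r) (N r) ∂μ)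
      (∫ r in Set.Iio t, waveCos (t - r) (N r) ∂μ) t := by
  have h1 : ∀ᵐ r ∂μ, r ≠ t := by simp [ae_iff, measure_singleton]
  have hF'm : AEStronglyMeasurable
      ((Set.Iio t).indicator fun r ↦ waveCos (t - r) (N r)) μ :=
    (aestronglyMeasurable_wave norm_waveCos_le continuous_waveCos hN.1 t).indicator measurableSet_Iio
  -- Continuing Q by 0 fixes the domain of integration. The integrand is Lipschitz in t with
  -- constant ‖N r‖ and differentiable except at r = t, which is a null set.
  have key := hasDerivAt_integral_of_dominated_loc_of_lip (μ := μ) (𝕜 := ℝ)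
    (F := fun t r ↦ waveQpos (t - r) (N r))
    (F' := (Set.Iio t).indicator fun r ↦ waveCos (t - r) (N r)) (x₀ := t) (s := Set.univ)
    (bound := fun r ↦ ‖N r‖) univ_mem
    (.of_forall fun s ↦ aestronglyMeasurable_waveQpos hN.1 s) ?_ hF'm ?_ hN.norm ?_
  · have h3 := key.2
    rwa [integral_indicator measurableSet_Iio] at h3
  · refine (hN.norm.const_mul |t|).mono' (aestronglyMeasurable_waveQpos hN.1 t) ?_
    filter_upwards [hμ] with r hr
    rcases le_or_gt (t - r) 0 with h | h
    · rw [waveQpos_of_nonpos h, norm_zero]; positivity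
    · refine (norm_waveQ_le _ _).trans ?_
      refine mul_le_mul_of_nonneg_right ?_ (norm_nonneg _)
      rw [max_eq_left h.le, abs_of_pos h, abs_of_nonneg (by linarith)]
      linarith
  · refine .of_forall fun r ↦ LipschitzOnWith.of_dist_le_mul fun x _ y _ ↦ ?_
    rw [dist_eq_norm, dist_eq_norm]
    refine (norm_waveQpos_sub_le _ _ _).trans (le_of_eq ?_)
    rw [sub_sub_sub_cancel_right, mul_comm, Real.norm_eq_abs]
    simp
  · filter_upwards [h1] with r hr
    have h2 := (hasDerivAt_waveQpos (sub_ne_zero.2 hr.symm) (N r)).scomp t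
      ((hasDerivAt_id t).sub_const r)
    rw [one_smul] at h2
    refine h2.congr_deriv ?_
    by_cases h : r < t
    · rw [Set.indicator_of_mem (Set.mem_Iio.2 h), if_pos (by linarith)]
    · rw [Set.indicator_of_notMem (by simpa using h), if_neg (by linarith [not_lt.1 h])]

end Duhamel

/-! ### Self-adjointness and the addition formula of the propagators -/

lemma real_inner_eq_re (f g : L2) : inner ℝ f g = (inner ℂ f g).re := by
  rw [L2.inner_def, L2.inner_def]
  change _ = RCLike.re (∫ x, inner ℂ (f x) (g x))
  rw [← integral_re (L2.integrable_inner (𝕜 := ℂ) f g)]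
  refine integral_congr_ae (.of_forall fun x ↦ ?_)
  simp [mul_comm]

lemma real_inner_eq_integral_dens (f g : L2) : inner ℝ f g = ∫ x, dens f g x := by
  rw [L2.inner_def]
  refine integral_congr_ae (.of_forall fun x ↦ ?_)
  simp [dens]
  ring

lemma inner_fmul_left {m : E5 → ℂ} (hm : Measurable m) {C : ℝ} (hC : ∀ ξ, ‖m ξ‖ ≤ C) (f g : L2) :
    inner ℂ (fmul m f) g = inner ℂ f (fmul (fun ξ ↦ starRingEnd ℂ (m ξ)) g) := by
  rw [← Lp.inner_fourier_eq, ← Lp.inner_fourier_eq f, L2.inner_def, L2.inner_def]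
  refine integral_congr_ae ?_
  have hm' : Measurable fun ξ ↦ starRingEnd ℂ (m ξ) := by fun_prop
  filter_upwards [fourier_fmul (memLp_mul_fourier hm hC f),
    fourier_fmul (memLp_mul_fourier (C := C) hm' (fun ξ ↦ by rw [RCLike.norm_conj]; exact hC ξ) g)]
    with ξ h1 h2
  rw [h1, h2]
  simp only [RCLike.inner_apply', map_mul]
  ring

lemma waveCos_neg (t : ℝ) : waveCos (-t) = waveCos t := by
  ext1 f
  change fmul (symCos (-t)) f = fmul (symCos t) f
  congr 1
  ext ξ
  simp [symCos]

lemma inner_waveCos_left (t : ℝ) (f g : L2) :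
    inner ℝ (waveCos t f) g = inner ℝ f (waveCos t g) := by
  rw [real_inner_eq_re, real_inner_eq_re]
  congr 1
  refine (inner_fmul_left (measurable_symCos t) (norm_symCos_le t) f g).trans ?_
  congr 2
  ext ξ
  exact Complex.conj_ofReal _

lemma inner_waveSin_left (t : ℝ) (f g : L2) :
    inner ℝ (waveSin t f) g = inner ℝ f (waveSin t g) := by
  rw [real_inner_eq_re, real_inner_eq_re]
  congr 1
  refine (inner_fmul_left (measurable_symSin t) (norm_symSin_le t) f g).trans ?_
  congr 2
  ext ξ
  exact Complex.conj_ofReal _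

lemma fourier_waveCos (t : ℝ) (f : L2) :
    (𝓕 (waveCos t f) : L2) =ᵐ[volume] fun ξ ↦ symCos t ξ * (𝓕 f : L2) ξ :=
  fourier_fmul (memLp_mul_fourier (measurable_symCos t) (norm_symCos_le t) f)

lemma fourier_waveSin (t : ℝ) (f : L2) :
    (𝓕 (waveSin t f) : L2) =ᵐ[volume] fun ξ ↦ symSin t ξ * (𝓕 f : L2) ξ :=
  fourier_fmul (memLp_mul_fourier (measurable_symSin t) (norm_symSin_le t) f)

lemma fourier_waveQ (t : ℝ) (f : L2) :
    (𝓕 (waveQ t f) : L2) =ᵐ[volume] fun ξ ↦ symQ t ξ * (𝓕 f : L2) ξ :=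
  fourier_fmul (memLp_mul_fourier (measurable_symQ t) (norm_symQ_le t) f)

lemma waveCos_mul_add_waveSin_mul (a b : ℝ) (f : L2) :
    waveCos a (waveCos b f) + waveSin a (waveSin b f) = waveCos (a - b) f := by
  refine L2_ext_fourier ?_
  filter_upwards [fourier_add_ae (waveCos a (waveCos b f)) (waveSin a (waveSin b f)),
    fourier_waveCos a (waveCos b f), fourier_waveCos b f, fourier_waveSin a (waveSin b f),
    fourier_waveSin b f, fourier_waveCos (a - b) f] with ξ h1 h2 h3 h4 h5 h6
  rw [h1, h2, h3, h4, h5, h6, symCos, symCos, symSin, symSin, symCos, sub_mul, Real.cos_sub]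
  push_cast
  ring

lemma inner_waveCos_add_inner_waveSin (a b : ℝ) (f g : L2) :
    inner ℝ (waveCos a f) (waveCos b g) + inner ℝ (waveSin a f) (waveSin b g) =
      inner ℝ f (waveCos (a - b) g) := by
  rw [inner_waveCos_left, inner_waveSin_left, ← inner_add_right, waveCos_mul_add_waveSin_mul]

attribute [irreducible] waveCos waveSin waveQ waveQpos

/-! ### The energy identity for the linear wave equation -/

/-- The integral of a symmetric kernel is twice the integral over a triangle. -/
lemma integral_integral_eq_two_mul {μ : Measure ℝ} [SFinite μ] [NullSingletonClass μ]
    {K : ℝ → ℝ → ℝ} (hK : Integrable (Function.uncurry K) (μ.prod μ))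
    (hs : ∀ r r', K r r' = K r' r) :
    ∫ r, ∫ r', K r r' ∂μ ∂μ = 2 * ∫ r, ∫ r' in Set.Iio r, K r r' ∂μ ∂μ := by
  set A : Set (ℝ × ℝ) := {z | z.2 < z.1} with hA
  have hAm : MeasurableSet A := measurableSet_lt measurable_snd measurable_fst
  set B : Set (ℝ × ℝ) := {z | z.1 < z.2} with hB
  have hBm : MeasurableSet B := measurableSet_lt measurable_fst measurable_snd
  have iA : Integrable (A.indicator (Function.uncurry K)) (μ.prod μ) := hK.indicator hAm
  have iB : Integrable (B.indicator (Function.uncurry K)) (μ.prod μ) := hK.indicator hBm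
  have eA : ∀ r, ∫ r', A.indicator (Function.uncurry K) (r, r') ∂μ =
      ∫ r' in Set.Iio r, K r r' ∂μ := fun r ↦ by
    rw [← integral_indicator measurableSet_Iio]
    refine integral_congr_ae (.of_forall fun r' ↦ ?_)
    by_cases h : r' < r <;> simp [Set.indicator, hA, h]
  have eB : ∀ r, ∫ r', B.indicator (Function.uncurry K) (r, r') ∂μ =
      ∫ r' in Set.Ioi r, K r r' ∂μ := fun r ↦ by
    rw [← integral_indicator measurableSet_Ioi]
    refine integral_congr_ae (.of_forall fun r' ↦ ?_)
    by_cases h : r < r' <;> simp [Set.indicator, hB, h]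
  have iA' := iA.integral_prod_left
  have iB' := iB.integral_prod_left
  simp only [eA] at iA'
  simp only [eB] at iB'
  have swap : ∫ r, ∫ r' in Set.Ioi r, K r r' ∂μ ∂μ = ∫ r, ∫ r' in Set.Iio r, K r r' ∂μ ∂μ := by
    simp only [← eA, ← eB]
    rw [integral_integral_swap (f := fun r r' ↦ B.indicator (Function.uncurry K) (r, r')) iB]
    refine integral_congr_ae (.of_forall fun r ↦ integral_congr_ae (.of_forall fun r' ↦ ?_))
    by_cases h : r' < r <;> simp [Set.indicator, hA, hB, h, hs r r']
  calc _ = ∫ r, ((∫ r' in Set.Iio r, K r r' ∂μ) + ∫ r' in Set.Ioi r, K r r' ∂μ) ∂μ := by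
        refine integral_congr_ae ?_
        filter_upwards [hK.prod_right_ae] with r hr
        have hr : Integrable (K r) μ := hr
        rw [← setIntegral_union (by simp) measurableSet_Ioi hr.integrableOn
          hr.integrableOn, ← setIntegral_univ]
        refine setIntegral_congr_set ?_
        have h1 : ∀ᵐ x ∂μ, x ≠ r := by simp [ae_iff, measure_singleton]
        filter_upwards [h1] with x hx
        refine propext ?_
        exact ⟨fun _ ↦ lt_or_gt_of_ne hx, fun _ ↦ trivial⟩
    _ = _ := by rw [integral_add iA' iB', swap, two_mul]

section Duhamel

variable {μ : Measure ℝ} {N : ℝ → L2}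

lemma norm_sq_integral_eq {μ : Measure ℝ} {F : ℝ → L2} (hF : Integrable F μ) :
    Integrable (fun r ↦ ∫ r', (inner ℝ (F r) (F r') : ℝ) ∂μ) μ ∧
    ‖∫ r, F r ∂μ‖ ^ 2 = ∫ r, ∫ r', (inner ℝ (F r) (F r') : ℝ) ∂μ ∂μ := by
  have e : ∀ r, ∫ r', (inner ℝ (F r) (F r') : ℝ) ∂μ = inner ℝ (∫ r, F r ∂μ) (F r) := fun r ↦ by
    rw [integral_inner hF, real_inner_comm]
  simp only [e]
  refine ⟨Integrable.const_inner _ hF, ?_⟩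
  rw [integral_inner hF, real_inner_self_eq_norm_sq]

/-- Expanding both squares, cos cos + sin sin leaves the kernel ⟨N(r), cos((r - r')|∇|) N(r')⟩,
which no longer depends on τ and is symmetric. Hence the double integral is twice that over r' < r.
This yields the energy identity without differentiating a source that is only integrable in time. -/
lemma norm_sq_add_norm_sq_eq [SFinite μ] [NullSingletonClass μ] (hN : Integrable N μ) (τ : ℝ) :
    ‖∫ r, waveCos (τ - r) (N r) ∂μ‖ ^ 2 + ‖∫ r, waveSin (τ - r) (N r) ∂μ‖ ^ 2 =
      2 * ∫ r, inner ℝ (N r) (∫ r' in Set.Iio r, waveCos (r - r') (N r') ∂μ) ∂μ := by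
  have hc := integrable_wave norm_waveCos_le continuous_waveCos hN
  have hs := integrable_wave norm_waveSin_le continuous_waveSin hN τ
  obtain ⟨i1, e1⟩ := norm_sq_integral_eq (hc τ)
  obtain ⟨i2, e2⟩ := norm_sq_integral_eq hs
  set K : ℝ → ℝ → ℝ := fun r r' ↦ inner ℝ (N r) (waveCos (r - r') (N r')) with hK
  have hKi : Integrable (Function.uncurry K) (μ.prod μ) := by
    refine (hN.norm.mul_prod hN.norm).mono' ?_ (.of_forall fun z ↦ ?_)
    · have h1 : AEStronglyMeasurable (fun z : ℝ × ℝ ↦ N z.1) (μ.prod μ) := hN.1.comp_fst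
      have h2 : AEStronglyMeasurable (fun z : ℝ × ℝ ↦ N z.2) (μ.prod μ) := hN.1.comp_snd
      have h4 : AEStronglyMeasurable (fun z : ℝ × ℝ ↦ (z.1 - z.2, N z.2)) (μ.prod μ) :=
        (by fun_prop : Continuous fun z : ℝ × ℝ ↦ z.1 - z.2).aestronglyMeasurable.prodMk h2
      have h3 : AEStronglyMeasurable (fun z : ℝ × ℝ ↦ waveCos (z.1 - z.2) (N z.2)) (μ.prod μ) :=
        Continuous.comp_aestronglyMeasurable (g := fun p : ℝ × L2 ↦ waveCos p.1 p.2)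
          (continuous_uncurry_of_bounded _ norm_waveCos_le continuous_waveCos) h4
      exact h1.inner h3
    · refine (norm_inner_le_norm _ _).trans ?_
      gcongr
      exact norm_waveCos_le _ _
  have hsym : ∀ r r', K r r' = K r' r := by
    intro r r'
    simp only [hK]
    rw [← inner_waveCos_left, real_inner_comm, ← waveCos_neg, neg_sub]
  have key : ∫ r, ∫ r', K r r' ∂μ ∂μ = _ := integral_integral_eq_two_mul hKi hsym
  rw [e1, e2, ← integral_add i1 i2]
  calc _ = ∫ r, ∫ r', K r r' ∂μ ∂μ := by
        refine integral_congr_ae (.of_forall fun r ↦ ?_)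
        simp only
        rw [← integral_add ((hc τ).const_inner _) (hs.const_inner _)]
        refine integral_congr_ae (.of_forall fun r' ↦ ?_)
        simp only [hK]
        rw [inner_waveCos_add_inner_waveSin, ← waveCos_neg]
        congr 3
        ring
    _ = _ := by
        rw [key]
        congr 1
        refine integral_congr_ae (.of_forall fun r ↦ ?_)
        simp only [hK]
        rw [integral_inner (hc r).integrableOn]

/-- The gradient of Duhamel's integral. -/
lemma gradNormSq_duhamel (hN : Integrable N μ) {τ : ℝ}
    (hQ : Integrable (fun r ↦ waveQ (τ - r) (N r)) μ) :
    gradNormSq (∫ r, waveQ (τ - r) (N r) ∂μ) = ‖∫ r, waveSin (τ - r) (N r) ∂μ‖ₑ ^ 2 := by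
  have hs := integrable_wave norm_waveSin_le continuous_waveSin hN τ
  set v := ∫ r, waveQ (τ - r) (N r) ∂μ
  set s := ∫ r, waveSin (τ - r) (N r) ∂μ
  -- The unbounded operator |∇| cannot be pulled into the Bochner integral directly; its restriction
  -- to frequencies up to n is bounded and can. Every frequency is reached by some n.
  have key : ∀ n : ℕ, ∀ᵐ ξ, ballSymbol n ξ * freq ξ * (𝓕 v : L2) ξ =
      ballSymbol n ξ * (𝓕 s : L2) ξ := by
    intro n
    have hm : Measurable fun ξ ↦ ballSymbol n ξ * (freq ξ : ℂ) :=
      (measurable_ballSymbol n).mul (Complex.measurable_ofReal.comp measurable_freq)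
    have hb : ∀ ξ, ‖ballSymbol n ξ * (freq ξ : ℂ)‖ ≤ 2 * Real.pi * n := by
      intro ξ
      have hpi := Real.pi_pos
      by_cases h : ξ ∈ Metric.closedBall (0 : E5) n
      · rw [ballSymbol, Set.indicator_of_mem h, Pi.one_apply, one_mul, Complex.norm_real,
          Real.norm_of_nonneg (freq_nonneg ξ), freq, norm_smul, Real.norm_of_nonneg (by positivity)]
        gcongr
        simpa using h
      · rw [ballSymbol, Set.indicator_of_notMem h, zero_mul, norm_zero]
        positivity
    have e : fmulL _ hm _ hb v = lowProj n s := by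
      rw [← ContinuousLinearMap.integral_comp_comm _ hQ,
        ← ContinuousLinearMap.integral_comp_comm _ hs]
      refine integral_congr_ae (.of_forall fun r ↦ ?_)
      refine fmul_eq_of_fourier ?_
      filter_upwards [fourier_lowProj n (waveSin (τ - r) (N r)), fourier_waveSin (τ - r) (N r),
        fourier_waveQ (τ - r) (N r), ae_freq_ne_zero] with ξ h1 h2 h3 h4
      rw [h1, h2, h3, symQ, symSin]
      have : (freq ξ : ℂ) ≠ 0 := by exact_mod_cast h4
      push_cast
      field_simp
    have e' : fmul (fun ξ ↦ ballSymbol n ξ * (freq ξ : ℂ)) v = lowProj n s := e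
    filter_upwards [fourier_lowProj n s, fourier_fmul (memLp_mul_fourier hm hb v)] with ξ h1 h2
    rw [← h1, ← e', h2]
  rw [enorm_sq_eq_lintegral_fourier]
  refine lintegral_congr_ae ?_
  filter_upwards [ae_all_iff.2 key] with ξ h
  obtain ⟨n, hn⟩ := exists_nat_ge ‖ξ‖
  have h1 := h n
  rw [ballSymbol, Set.indicator_of_mem (by simpa using hn), Pi.one_apply, one_mul, one_mul] at h1
  rw [← h1, enorm_mul, mul_pow, ← ofReal_norm (freq ξ : ℂ), Complex.norm_real,
    ← ENNReal.ofReal_pow (norm_nonneg _), Real.norm_of_nonneg (freq_nonneg ξ)]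
  rfl

end Duhamel

/-- The energy identity for Duhamel's formula with a source in `L¹([0,T]; L²)`. -/
theorem linear_energy_identity {T : ℝ} (hT : 0 < T) {N v v' : ℝ → L2}
    (hN : IntegrableOn N (Set.Icc 0 T))
    (hv : ∀ t ∈ Set.Icc 0 T, HasDerivWithinAt v (v' t) (Set.Icc 0 T) t)
    (hd : ∀ t ∈ Set.Icc 0 T, v t = -∫ r in (0 : ℝ)..t, Q (t - r) (N r)) {τ : ℝ}
    (hτ : τ ∈ Set.Icc 0 T) :
    gradNormSq (v τ) < ∞ ∧ ‖v' τ‖ ^ 2 + (gradNormSq (v τ)).toReal =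
      -2 * ∫ r in Set.Ioo 0 τ, inner ℝ (v' r) (N r) := by
  set μ := (volume : Measure ℝ).restrict (Set.Ioo 0 T) with hμ
  have hNμ : Integrable N μ := hN.mono_set Set.Ioo_subset_Icc_self
  have hμ0 : ∀ᵐ r ∂μ, 0 ≤ r := by
    filter_upwards [ae_restrict_mem measurableSet_Ioo] with r hr using hr.1.le
  have hres : ∀ t ∈ Set.Icc 0 T, μ.restrict (Set.Iio t) = volume.restrict (Set.Ioo 0 t) := by
    intro t ht
    rw [hμ, Measure.restrict_restrict measurableSet_Iio]
    congr 1
    ext r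
    simp only [Set.mem_inter_iff, Set.mem_Iio, Set.mem_Ioo]
    constructor
    · rintro ⟨h1, h2, -⟩; exact ⟨h2, h1⟩
    · rintro ⟨h1, h2⟩; exact ⟨h2, h1, h2.trans_le ht.2⟩
  have hvQ : ∀ t ∈ Set.Icc 0 T, v t = -∫ r in Set.Ioo 0 t, waveQ (t - r) (N r) := by
    intro t ht
    rw [hd t ht, intervalIntegral.integral_of_le ht.1, ← integral_Ioc_eq_integral_Ioo]
    simp only [Q_eq]
  have hvpos : ∀ t ∈ Set.Icc 0 T, v t = -∫ r, waveQpos (t - r) (N r) ∂μ := by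
    intro t ht
    rw [hvQ t ht, hμ]
    congr 1
    rw [setIntegral_eq_of_subset_of_forall_sdiff_eq_zero (s := Set.Ioo 0 t) (t := Set.Ioo 0 T)
      measurableSet_Ioo (Set.Ioo_subset_Ioo_right ht.2) (fun r hr ↦ ?_)]
    · refine setIntegral_congr_fun measurableSet_Ioo fun r hr ↦ ?_
      rw [waveQpos_of_nonneg (by linarith [hr.2])]
    · refine waveQpos_of_nonpos ?_ _
      have : ¬ r < t := fun h ↦ hr.2 ⟨hr.1.1, h⟩
      linarith [not_lt.1 this]
  -- The given derivative is identified by uniqueness of one-sided derivatives on the interval.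
  have hv' : ∀ t ∈ Set.Icc 0 T, v' t = -∫ r in Set.Ioo 0 t, waveCos (t - r) (N r) := by
    intro t ht
    have h1 := (hasDerivAt_duhamel hNμ hμ0 t).neg
    rw [hres t ht] at h1
    have h2 := (h1.hasDerivWithinAt (s := Set.Icc 0 T)).congr hvpos (hvpos t ht)
    exact (uniqueDiffOn_Icc hT t ht).eq_deriv _ (hv t ht) h2
  set ν := (volume : Measure ℝ).restrict (Set.Ioo 0 τ) with hν
  have hNν : Integrable N ν := hN.mono_set
    (Set.Ioo_subset_Icc_self.trans (Set.Icc_subset_Icc_right hτ.2))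
  have hQi : Integrable (fun r ↦ waveQ (τ - r) (N r)) ν := by
    refine (hNν.norm.const_mul τ).mono' ?_ ?_
    · refine (aestronglyMeasurable_waveQpos hNν.1 τ).congr ?_
      filter_upwards [ae_restrict_mem measurableSet_Ioo] with r hr
      rw [waveQpos_of_nonneg (by linarith [hr.2])]
    · filter_upwards [ae_restrict_mem measurableSet_Ioo] with r hr
      refine (norm_waveQ_le _ _).trans ?_
      refine mul_le_mul_of_nonneg_right ?_ (norm_nonneg _)
      rw [abs_of_nonneg (by linarith [hr.2])]
      linarith [hr.1]
  have hg : gradNormSq (v τ) = ‖∫ r, waveSin (τ - r) (N r) ∂ν‖ₑ ^ 2 := by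
    rw [← gradNormSq_duhamel hNν hQi, hvQ τ hτ]
    have hn : ∀ f : L2, gradNormSq (-f) = gradNormSq f := by
      intro f
      refine lintegral_congr_ae ?_
      filter_upwards [fourier_smul_ae (-1) f] with ξ h
      rw [neg_one_smul] at h
      rw [h, neg_one_mul, enorm_neg]
    exact hn _
  refine ⟨by rw [hg]; exact ENNReal.pow_lt_top (by simp), ?_⟩
  have e1 : (gradNormSq (v τ)).toReal = ‖∫ r, waveSin (τ - r) (N r) ∂ν‖ ^ 2 := by
    rw [hg, ENNReal.toReal_pow, toReal_enorm]
  rw [e1, hv' τ hτ, norm_neg, norm_sq_add_norm_sq_eq hNν τ, neg_mul, ← mul_neg, ← integral_neg]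
  congr 1
  refine setIntegral_congr_fun measurableSet_Ioo fun r hr ↦ ?_
  rw [hv' r ⟨hr.1.le, hr.2.le.trans hτ.2⟩, inner_neg_left, neg_neg, real_inner_comm]
  congr 2
  rw [hν, Measure.restrict_restrict measurableSet_Iio]
  congr 1
  ext x
  simp only [Set.mem_inter_iff, Set.mem_Iio, Set.mem_Ioo]
  constructor
  · rintro ⟨h1, h2, -⟩; exact ⟨h2, h1⟩
  · rintro ⟨h1, h2⟩; exact ⟨h2, h1, h2.trans hr.2⟩

/-! ### Expansion and convexity of the potential energy -/

/-- The functions in `L² ∩ L^{10/3}`. -/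
def sobX : Submodule ℝ L2 where
  carrier := {f | nrm (10 / 3) f < ∞}
  zero_mem' := by
    have h := nrm_smul (10 / 3) (by norm_num) 0 (0 : L2)
    simp only [zero_smul, enorm_zero, zero_mul] at h
    simp [h]
  add_mem' := fun {f g} hf hg ↦
    (nrm_add_le (by norm_num) f g).trans_lt (ENNReal.add_lt_top.2 ⟨hf, hg⟩)
  smul_mem' := fun r f hf ↦ by
    simp only [Set.mem_ofPred_eq, nrm_smul (10 / 3) (by norm_num)]
    exact ENNReal.mul_lt_top (by simp) hf

lemma mem_sobX_of_bandLimited {R : ℝ} {f : L2} (hf : f ∈ bandLimited R) : f ∈ sobX :=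
  nrm_lt_top_of_bandLimited hf (by norm_num)

lemma mem_sobX_of_gradNormSq {f : L2} (hf : gradNormSq f < ∞) : f ∈ sobX := by
  obtain ⟨C, hC⟩ := exists_nrm_sobolev
  exact (hC f).trans_lt (ENNReal.mul_lt_top (by simp)
    (ENNReal.rpow_lt_top_of_nonneg (by norm_num) hf.ne))

lemma cquad_lt_top {a b c d : L2} (ha : a ∈ sobX) (hb : b ∈ sobX) (hc : c ∈ sobX)
    (hd : d ∈ sobX) : cquad a b c d < ∞ := by
  obtain ⟨C, hC⟩ := exists_cquad_le (p := 10 / 3) (q := 10 / 3) (r := 10 / 3) (s := 10 / 3)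
    (by norm_num) (by norm_num) (by norm_num) (by norm_num) (by norm_num) (by norm_num)
    (by norm_num)
  exact (hC a b c d).trans_lt (ENNReal.mul_lt_top (ENNReal.mul_lt_top (by simp)
    (ENNReal.mul_lt_top ha hb)) (ENNReal.mul_lt_top hc hd))

section Multilinear

variable {a a' b c d : L2}

lemma quad_add₁ (ha : a ∈ sobX) (ha' : a' ∈ sobX) (hb : b ∈ sobX) (hc : c ∈ sobX) (hd : d ∈ sobX) :
    quad (a + a') b c d = quad a b c d + quad a' b c d :=
  quad_add (cquad_lt_top ha hb hc hd) (cquad_lt_top ha' hb hc hd)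

lemma quad_add₂ (ha : a ∈ sobX) (ha' : a' ∈ sobX) (hb : b ∈ sobX) (hc : c ∈ sobX) (hd : d ∈ sobX) :
    quad b (a + a') c d = quad b a c d + quad b a' c d := by
  rw [quad_comm_left, quad_add₁ ha ha' hb hc hd, quad_comm_left, quad_comm_left a']

lemma quad_add₃ (ha : a ∈ sobX) (ha' : a' ∈ sobX) (hb : b ∈ sobX) (hc : c ∈ sobX) (hd : d ∈ sobX) :
    quad b c (a + a') d = quad b c a d + quad b c a' d := by
  rw [quad_swap, quad_add₁ ha ha' hd hb hc, quad_swap, quad_swap a']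

lemma quad_add₄ (ha : a ∈ sobX) (ha' : a' ∈ sobX) (hb : b ∈ sobX) (hc : c ∈ sobX) (hd : d ∈ sobX) :
    quad b c d (a + a') = quad b c d a + quad b c d a' := by
  rw [quad_comm_right, quad_add₃ ha ha' hb hc hd, quad_comm_right, quad_comm_right b c a']

lemma quad_sub₁ (ha : a ∈ sobX) (ha' : a' ∈ sobX) (hb : b ∈ sobX) (hc : c ∈ sobX) (hd : d ∈ sobX) :
    quad (a - a') b c d = quad a b c d - quad a' b c d :=
  quad_sub (cquad_lt_top ha hb hc hd) (cquad_lt_top ha' hb hc hd)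

lemma quad_sub₂ (ha : a ∈ sobX) (ha' : a' ∈ sobX) (hb : b ∈ sobX) (hc : c ∈ sobX) (hd : d ∈ sobX) :
    quad b (a - a') c d = quad b a c d - quad b a' c d := by
  rw [quad_comm_left, quad_sub₁ ha ha' hb hc hd, quad_comm_left, quad_comm_left a']

lemma quad_smul₂ (r : ℝ) : quad a (r • b) c d = r * quad a b c d := by
  rw [quad_comm_left, quad_smul, quad_comm_left]

end Multilinear

/-- Convexity of the potential energy. -/
lemma quad_sub_quad_le {a b : L2} (ha : a ∈ sobX) (hb : b ∈ sobX) :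
    quad b b b b - quad a a a a ≤ 4 * quad (b - a) b b b := by
  have h1 := two_mul_quad_self_le (cquad_lt_top ha ha ha ha) (cquad_lt_top hb hb hb hb)
  have hd : b - a ∈ sobX := sobX.sub_mem hb ha
  -- The last summand is a pairing of nonnegative densities and may be dropped. Together with
  -- 2Q(a,a,b,b) ≤ Q(a,a,a,a) + Q(b,b,b,b) this is the tangent inequality at b.
  have e1 : quad a a b b = quad b b b b - 2 * quad (b - a) b b b + quad (b - a) (b - a) b b := by
    rw [quad_sub₂ hb ha hd hb hb, quad_sub₁ hb ha hb hb hb, quad_sub₁ hb ha ha hb hb,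
      quad_comm_left b a]
    ring
  have h2 := quad_self_self_nonneg (b - a) b
  linarith

/-- The terms of `⟨w, 𝒩(v + Ψ)⟩` which are not of third order in `v`. -/
def remainder (v Ψ w : L2) : ℝ :=
  quad w Ψ v v + 2 * quad w v v Ψ + 2 * quad w Ψ v Ψ + quad w v Ψ Ψ + quad w Ψ Ψ Ψ

lemma quad_expand {v Ψ w : L2} (hv : v ∈ sobX) (hΨ : Ψ ∈ sobX) (hw : w ∈ sobX) :
    quad w (v + Ψ) (v + Ψ) (v + Ψ) = quad w v v v + remainder v Ψ w := by
  have hu : v + Ψ ∈ sobX := sobX.add_mem hv hΨ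
  rw [quad_add₂ hv hΨ hw hu hu, quad_add₃ hv hΨ hw hv hu, quad_add₃ hv hΨ hw hΨ hu,
    quad_add₄ hv hΨ hw hv hv, quad_add₄ hv hΨ hw hv hΨ, quad_add₄ hv hΨ hw hΨ hv,
    quad_add₄ hv hΨ hw hΨ hΨ, quad_comm_right w v Ψ v, quad_comm_right w Ψ Ψ v, remainder]
  ring

lemma hartreeL2_ae {u : L2} (h : MemLp (hartree u) 2 (volume : Measure E5)) :
    hartreeL2 u =ᵐ[volume] hartree u := by
  rw [hartreeL2, dif_pos h]
  exact h.coeFn_toLp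

/-- Here w is only in L², so the multilinear bounds in L^(10/3) do not apply to it; absolute
convergence comes from the square integrability of 𝒩(u). -/
lemma inner_hartreeL2 {u : L2} (hu : u ∈ sobX)
    (h : MemLp (hartree u) 2 (volume : Measure E5)) (w : L2) :
    inner ℝ w (hartreeL2 u) = quad w u u u := by
  have hΦ := cquad_lt_top hu hu hu hu
  have hae := hartreeL2_ae h
  have hc : cquad w u u u < ∞ := by
    rw [cquad_eq_potv]
    have e : ∫⁻ x, ‖w x‖ₑ * ‖u x‖ₑ * potv u x = ∫⁻ x, ‖w x‖ₑ * ‖hartreeL2 u x‖ₑ := by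
      refine lintegral_congr_ae ?_
      filter_upwards [hae, ae_potv_lt_top hΦ] with x h1 h2
      rw [h1, hartree_eq, enorm_mul, ← ofReal_norm ((potv u x).toReal : ℂ), Complex.norm_real,
        Real.norm_of_nonneg ENNReal.toReal_nonneg, ENNReal.ofReal_toReal h2.ne]
      ring
    rw [e]
    refine (lintegral_enorm_mul_le (p := 2) (q := 2) (by rw [Real.holderConjugate_iff]; norm_num)
      (Lp.aestronglyMeasurable w) (Lp.aestronglyMeasurable _)).trans_lt ?_
    change nrm 2 w * nrm 2 (hartreeL2 u) < ∞
    rw [nrm_two, nrm_two]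
    exact ENNReal.mul_lt_top (by simp) (by simp)
  rw [quad_eq_integral hc, real_inner_eq_integral_dens]
  refine integral_congr_ae ?_
  filter_upwards [hae] with x hx
  rw [dens, hx, hartree_eq, dens, ← mul_assoc, mul_comm _ ((potv u x).toReal : ℂ), mul_assoc,
    Complex.re_ofReal_mul, mul_comm]

/-- Bounds for the remainder which are linear in the `L²` norm of `w`. -/
lemma exists_remainder_le : ∃ C : ℝ≥0, ∀ v Ψ w : L2, ∀ M : ℝ≥0∞, nrm (10 / 3) v ≤ M →
    nrm (10 / 3) Ψ ≤ M → nrm 10 Ψ ≤ M → ‖remainder v Ψ w‖ₑ ≤ C * M ^ 3 * ‖w‖ₑ := by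
  obtain ⟨C₁, h₁⟩ := exists_cquad_le (p := 2) (q := 10) (r := 10 / 3) (s := 10 / 3)
    (by norm_num) (by norm_num) (by norm_num) (by norm_num) (by norm_num) (by norm_num)
    (by norm_num)
  obtain ⟨C₂, h₂⟩ := exists_cquad_le (p := 2) (q := 10 / 3) (r := 10 / 3) (s := 10)
    (by norm_num) (by norm_num) (by norm_num) (by norm_num) (by norm_num) (by norm_num)
    (by norm_num)
  refine ⟨4 * C₁ + 3 * C₂, fun v Ψ w M hv hΨ hΨ' ↦ ?_⟩
  have b₁ : ∀ c d : L2, nrm (10 / 3) c ≤ M → nrm (10 / 3) d ≤ M →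
      ‖quad w Ψ c d‖ₑ ≤ C₁ * M ^ 3 * ‖w‖ₑ := fun c d hc hd ↦ by
    refine (enorm_quad_le _ _ _ _).trans ((h₁ _ _ _ _).trans ?_)
    rw [nrm_two]
    calc _ ≤ C₁ * (‖w‖ₑ * M) * (M * M) := by gcongr
      _ = _ := by ring
  have b₂ : ∀ b : L2, nrm (10 / 3) b ≤ M →
      ‖quad w v b Ψ‖ₑ ≤ C₂ * M ^ 3 * ‖w‖ₑ := fun b hb ↦ by
    refine (enorm_quad_le _ _ _ _).trans ((h₂ _ _ _ _).trans ?_)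
    rw [nrm_two]
    calc _ ≤ C₂ * (‖w‖ₑ * M) * (M * M) := by gcongr
      _ = _ := by ring
  have two : ‖(2 : ℝ)‖ₑ = 2 := by rw [Real.enorm_of_nonneg (by norm_num)]; norm_num
  unfold remainder
  refine (enorm_add_le _ _).trans ((add_le_add ((enorm_add_le _ _).trans (add_le_add
    ((enorm_add_le _ _).trans (add_le_add ((enorm_add_le _ _).trans (add_le_add
    (b₁ _ _ hv hv) ?_)) ?_)) (b₂ _ hΨ))) (b₁ _ _ hΨ hΨ)).trans (b := C₁ * M ^ 3 * ‖w‖ₑ +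
      2 * (C₂ * M ^ 3 * ‖w‖ₑ) + 2 * (C₁ * M ^ 3 * ‖w‖ₑ) + C₂ * M ^ 3 * ‖w‖ₑ +
      C₁ * M ^ 3 * ‖w‖ₑ) (le_of_eq ?_))
  · rw [enorm_mul, two]; gcongr; exact b₂ _ hv
  · rw [enorm_mul, two]; gcongr; exact b₁ _ _ hv hΨ
  · push_cast; ring

/-! ### Time dependence -/

lemma tendsto_nrm_two {ι : Type*} {l : Filter ι} {f : ι → L2} {f₀ : L2}
    (h : Tendsto f l (𝓝 f₀)) : Tendsto (fun i ↦ nrm 2 (f i - f₀)) l (𝓝 0) := by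
  simp only [nrm_two, ← edist_eq_enorm_sub]
  exact tendsto_iff_edist_tendsto_0.1 h

lemma tendsto_nrm_of_bandLimited {ι : Type*} {l : Filter ι} {f : ι → L2} {f₀ : L2} {R : ℝ}
    (h : Tendsto f l (𝓝 f₀)) (hf : ∀ᶠ i in l, f i ∈ bandLimited R) (hf₀ : f₀ ∈ bandLimited R)
    {p : ℝ} (hp : 2 ≤ p) : Tendsto (fun i ↦ nrm p (f i - f₀)) l (𝓝 0) := by
  obtain ⟨C, hC⟩ := exists_nrm_bernstein R
  have h1 := ENNReal.Tendsto.const_mul (a := (C : ℝ≥0∞)) (tendsto_iff_edist_tendsto_0.1 h)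
    (Or.inr (by simp))
  rw [mul_zero] at h1
  refine tendsto_of_tendsto_of_tendsto_of_le_of_le' tendsto_const_nhds h1
    (.of_forall fun _ ↦ zero_le) (hf.mono fun i hi ↦ ?_)
  rw [edist_eq_enorm_sub]
  exact hC _ ((bandLimited R).sub_mem hi hf₀) p hp

lemma nrm_two_lt_top (f : L2) : nrm 2 f < ∞ := by rw [nrm_two]; simp

section Limits

variable {ι : Type*} {l : Filter ι} {a b c d : ι → L2} {a₀ b₀ c₀ d₀ : L2}

lemma tendsto_quad_sobolev (ha₀ : a₀ ∈ sobX) (hb₀ : b₀ ∈ sobX) (hc₀ : c₀ ∈ sobX) (hd₀ : d₀ ∈ sobX)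
    (ha : Tendsto (fun i ↦ nrm (10 / 3) (a i - a₀)) l (𝓝 0))
    (hb : Tendsto (fun i ↦ nrm (10 / 3) (b i - b₀)) l (𝓝 0))
    (hc : Tendsto (fun i ↦ nrm (10 / 3) (c i - c₀)) l (𝓝 0))
    (hd : Tendsto (fun i ↦ nrm (10 / 3) (d i - d₀)) l (𝓝 0)) :
    Tendsto (fun i ↦ quad (a i) (b i) (c i) (d i)) l (𝓝 (quad a₀ b₀ c₀ d₀)) :=
  tendsto_quad (by norm_num) (by norm_num) (by norm_num) (by norm_num) (by norm_num) (by norm_num)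
    (by norm_num) ha₀ hb₀ hc₀ hd₀ ha hb hc hd

lemma tendsto_quad_two_ten (hb₀ : nrm 10 b₀ < ∞) (hc₀ : c₀ ∈ sobX) (hd₀ : d₀ ∈ sobX)
    (ha : Tendsto a l (𝓝 a₀))
    (hb : Tendsto (fun i ↦ nrm 10 (b i - b₀)) l (𝓝 0))
    (hc : Tendsto (fun i ↦ nrm (10 / 3) (c i - c₀)) l (𝓝 0))
    (hd : Tendsto (fun i ↦ nrm (10 / 3) (d i - d₀)) l (𝓝 0)) :
    Tendsto (fun i ↦ quad (a i) (b i) (c i) (d i)) l (𝓝 (quad a₀ b₀ c₀ d₀)) :=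
  tendsto_quad (by norm_num) (by norm_num) (by norm_num) (by norm_num) (by norm_num) (by norm_num)
    (by norm_num) (nrm_two_lt_top a₀) hb₀ hc₀ hd₀ (tendsto_nrm_two ha) hb hc hd

lemma tendsto_quad_two_sobolev (hb₀ : b₀ ∈ sobX) (hc₀ : c₀ ∈ sobX) (hd₀ : nrm 10 d₀ < ∞)
    (ha : Tendsto a l (𝓝 a₀))
    (hb : Tendsto (fun i ↦ nrm (10 / 3) (b i - b₀)) l (𝓝 0))
    (hc : Tendsto (fun i ↦ nrm (10 / 3) (c i - c₀)) l (𝓝 0))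
    (hd : Tendsto (fun i ↦ nrm 10 (d i - d₀)) l (𝓝 0)) :
    Tendsto (fun i ↦ quad (a i) (b i) (c i) (d i)) l (𝓝 (quad a₀ b₀ c₀ d₀)) :=
  tendsto_quad (by norm_num) (by norm_num) (by norm_num) (by norm_num) (by norm_num) (by norm_num)
    (by norm_num) (nrm_two_lt_top a₀) hb₀ hc₀ hd₀ (tendsto_nrm_two ha) hb hc hd

lemma tendsto_remainder {v Ψ w : ι → L2} {v₀ Ψ₀ w₀ : L2} (hv₀ : v₀ ∈ sobX) (hΨ₀ : Ψ₀ ∈ sobX)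
    (hΨ₁ : nrm 10 Ψ₀ < ∞) (hv : Tendsto (fun i ↦ nrm (10 / 3) (v i - v₀)) l (𝓝 0))
    (hΨ : Tendsto (fun i ↦ nrm (10 / 3) (Ψ i - Ψ₀)) l (𝓝 0))
    (hΨ' : Tendsto (fun i ↦ nrm 10 (Ψ i - Ψ₀)) l (𝓝 0)) (hw : Tendsto w l (𝓝 w₀)) :
    Tendsto (fun i ↦ remainder (v i) (Ψ i) (w i)) l (𝓝 (remainder v₀ Ψ₀ w₀)) :=
  ((((tendsto_quad_two_ten hΨ₁ hv₀ hv₀ hw hΨ' hv hv).add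
    ((tendsto_quad_two_sobolev hv₀ hv₀ hΨ₁ hw hv hv hΨ').const_mul 2)).add
    ((tendsto_quad_two_ten hΨ₁ hv₀ hΨ₀ hw hΨ' hv hΨ).const_mul 2)).add
    (tendsto_quad_two_sobolev hv₀ hΨ₀ hΨ₁ hw hv hΨ hΨ')).add
    (tendsto_quad_two_ten hΨ₁ hΨ₀ hΨ₀ hw hΨ' hΨ hΨ)

end Limits

/-- A continuously differentiable curve of functions whose frequencies are in a fixed ball. -/
structure IsPerturbation (R T : ℝ) (Ψ Ψd : ℝ → L2) : Prop where
  band : ∀ t ∈ Set.Icc 0 T, Ψ t ∈ bandLimited R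
  band_deriv : ∀ t ∈ Set.Icc 0 T, Ψd t ∈ bandLimited R
  deriv : ∀ t ∈ Set.Icc 0 T, HasDerivWithinAt Ψ (Ψd t) (Set.Icc 0 T) t
  continuous_deriv : ContinuousOn Ψd (Set.Icc 0 T)

lemma gradNormSq_le_sobolevNormSq (f : L2) : gradNormSq f ≤ sobolevNormSq 1 f := by
  refine lintegral_mono fun ξ ↦ ?_
  gcongr
  rw [japanese, ← Real.sqrt_eq_rpow]
  exact Real.le_sqrt_of_sq_le (by linarith)

lemma sobolevNormSq_one (f : L2) : sobolevNormSq 1 f = ‖f‖ₑ ^ 2 + gradNormSq f := by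
  rw [enorm_sq_eq_lintegral_fourier, sobolevNormSq, gradNormSq, ← lintegral_add_left]
  · refine lintegral_congr fun ξ ↦ ?_
    rw [japanese, ← Real.sqrt_eq_rpow, Real.sq_sqrt (by positivity),
      ENNReal.ofReal_add zero_le_one (by positivity), add_mul, ENNReal.ofReal_one, one_mul]
  · exact (measurable_coe _).enorm.pow_const _

/-- A continuous curve in `H¹` which is continuously differentiable in `L²`. -/
structure IsEnergyCurve (T : ℝ) (v v' : ℝ → L2) : Prop where
  mem : ∀ t ∈ Set.Icc 0 T, v t ∈ sobX
  tendsto : ∀ t ∈ Set.Icc 0 T,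
    Tendsto (fun s ↦ nrm (10 / 3) (v s - v t)) (𝓝[Set.Icc 0 T] t) (𝓝 0)
  deriv : ∀ t ∈ Set.Icc 0 T, HasDerivWithinAt v (v' t) (Set.Icc 0 T) t
  continuous_deriv : ContinuousOn v' (Set.Icc 0 T)

lemma IsSolution.isEnergyCurve {T : ℝ} {f v v' : ℝ → L2} (h : IsSolution T f v v') :
    IsEnergyCurve T v v' where
  mem t ht := mem_sobX_of_gradNormSq ((gradNormSq_le_sobolevNormSq _).trans_lt (h.mem_H1 t ht))
  deriv := h.hasDeriv
  continuous_deriv := h.continuous_deriv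
  tendsto t ht := by
    obtain ⟨C, hC⟩ := exists_nrm_sobolev
    have h1 := ENNReal.Tendsto.const_mul (a := (C : ℝ≥0∞))
      ((h.continuous_H1 t ht).ennrpow_const (1 / 2)) (Or.inr (by simp))
    rw [ENNReal.zero_rpow_of_pos (by norm_num), mul_zero] at h1
    refine tendsto_of_tendsto_of_tendsto_of_le_of_le tendsto_const_nhds h1
      (fun _ ↦ zero_le) fun s ↦ (hC _).trans ?_
    gcongr
    exact gradNormSq_le_sobolevNormSq _

section Curves

variable {R T : ℝ} {Ψ Ψd v v' : ℝ → L2}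

lemma IsPerturbation.mem (h : IsPerturbation R T Ψ Ψd) {t : ℝ} (ht : t ∈ Set.Icc 0 T) :
    Ψ t ∈ sobX := mem_sobX_of_bandLimited (h.band t ht)

lemma IsPerturbation.mem_deriv (h : IsPerturbation R T Ψ Ψd) {t : ℝ} (ht : t ∈ Set.Icc 0 T) :
    Ψd t ∈ sobX := mem_sobX_of_bandLimited (h.band_deriv t ht)

lemma IsPerturbation.nrm_lt_top (h : IsPerturbation R T Ψ Ψd) {t : ℝ} (ht : t ∈ Set.Icc 0 T)
    {p : ℝ} (hp : 2 ≤ p) : nrm p (Ψ t) < ∞ := nrm_lt_top_of_bandLimited (h.band t ht) hp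

lemma IsPerturbation.tendsto (h : IsPerturbation R T Ψ Ψd) {t : ℝ} (ht : t ∈ Set.Icc 0 T)
    {p : ℝ} (hp : 2 ≤ p) : Tendsto (fun s ↦ nrm p (Ψ s - Ψ t)) (𝓝[Set.Icc 0 T] t) (𝓝 0) :=
  tendsto_nrm_of_bandLimited (h.deriv t ht).continuousWithinAt
    (eventually_mem_nhdsWithin.mono h.band) (h.band t ht) hp

lemma IsPerturbation.tendsto_deriv (h : IsPerturbation R T Ψ Ψd) {t : ℝ} (ht : t ∈ Set.Icc 0 T)
    {p : ℝ} (hp : 2 ≤ p) : Tendsto (fun s ↦ nrm p (Ψd s - Ψd t)) (𝓝[Set.Icc 0 T] t) (𝓝 0) :=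
  tendsto_nrm_of_bandLimited (h.continuous_deriv t ht)
    (eventually_mem_nhdsWithin.mono h.band_deriv) (h.band_deriv t ht) hp

lemma IsPerturbation.tendsto_slope (h : IsPerturbation R T Ψ Ψd) {t : ℝ} (ht : t ∈ Set.Icc 0 T)
    {p : ℝ} (hp : 2 ≤ p) :
    Tendsto (fun s ↦ nrm p (slope Ψ t s - Ψd t)) (𝓝[Set.Icc 0 T \ {t}] t) (𝓝 0) := by
  refine tendsto_nrm_of_bandLimited (hasDerivWithinAt_iff_tendsto_slope.1 (h.deriv t ht))
    ?_ (h.band_deriv t ht) hp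
  filter_upwards [eventually_mem_nhdsWithin] with s hs
  exact (bandLimited R).smul_of_tower_mem _
    ((bandLimited R).sub_mem (h.band s hs.1) (h.band t ht))

/-- The derivative of the form which is trilinear in the solution. -/
lemma hasDerivWithinAt_quad (hv : IsEnergyCurve T v v') (hΨ : IsPerturbation R T Ψ Ψd) {t : ℝ}
    (ht : t ∈ Set.Icc 0 T) :
    HasDerivWithinAt (fun t ↦ quad (v t) (Ψ t) (v t) (v t))
      (quad (v' t) (Ψ t) (v t) (v t) + quad (v t) (Ψd t) (v t) (v t) +
        2 * quad (v' t) (v t) (v t) (Ψ t)) (Set.Icc 0 T) t := by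
  rw [hasDerivWithinAt_iff_tendsto_slope]
  have mono : 𝓝[Set.Icc 0 T \ {t}] t ≤ 𝓝[Set.Icc 0 T] t := nhdsWithin_mono t Set.sdiff_subset
  have hvt := hv.mem t ht
  have hΨt := hΨ.mem ht
  have h10 := hΨ.nrm_lt_top ht (p := 10) (by norm_num)
  have tv := (hv.tendsto t ht).mono_left mono
  have tΨ := (hΨ.tendsto ht (p := 10 / 3) (by norm_num)).mono_left mono
  have tΨ' := (hΨ.tendsto ht (p := 10) (by norm_num)).mono_left mono
  have tw := hasDerivWithinAt_iff_tendsto_slope.1 (hv.deriv t ht)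
  have tψ := hΨ.tendsto_slope ht (p := 10 / 3) (by norm_num)
  have c : ∀ (f : L2) (p : ℝ), 0 < p →
      Tendsto (fun _ : ℝ ↦ nrm p (f - f)) (𝓝[Set.Icc 0 T \ {t}] t) (𝓝 0) := by
    intro f p hp
    have h := nrm_smul p hp 0 (0 : L2)
    simp only [zero_smul, enorm_zero, zero_mul] at h
    simp only [sub_self, h]
    exact tendsto_const_nhds
  -- One limit for each slot that is varied. The difference quotients of v converge only in L² and
  -- are therefore always paired with a factor Ψ in L^10; those of Ψ converge in L^(10/3) by the
  -- band limitation.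
  have l1 := tendsto_quad_two_ten h10 hvt hvt tw tΨ' tv tv
  have l2 := tendsto_quad_sobolev hvt (hΨ.mem_deriv ht) hvt hvt (c (v t) _ (by norm_num)) tψ tv tv
  have l3 := tendsto_quad_two_sobolev hvt hvt h10 tw tv (c (v t) _ (by norm_num))
    (c (Ψ t) 10 (by norm_num))
  have l4 := tendsto_quad_two_sobolev hvt hvt h10 tw (c (v t) _ (by norm_num))
    (c (v t) _ (by norm_num)) (c (Ψ t) 10 (by norm_num))
  have l := ((l1.add l2).add l3).add l4
  rw [add_assoc, ← two_mul] at l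
  refine l.congr' ?_
  filter_upwards [eventually_mem_nhdsWithin] with s hs
  have hvs := hv.mem s hs.1
  have hΨs := hΨ.mem hs.1
  have e : ∀ f : ℝ → L2, slope f t s = (s - t)⁻¹ • (f s - f t) := fun f ↦ rfl
  rw [slope_def_field, e, e, quad_smul, quad_smul₂, quad_smul, quad_smul,
    quad_sub₁ hvs hvt hΨs hvs hvs, quad_sub₂ hΨs hΨt hvt hvs hvs,
    quad_sub₁ hvs hvt hvs hvt hΨt, quad_sub₁ hvs hvt hvt hvt hΨt,
    quad_comm_right (v s) (v s), quad_swap (v s) (v s), quad_comm_left (Ψ t),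
    quad_comm_right (v t) (v s), quad_swap (v t) (v s), quad_comm_left (Ψ t),
    quad_comm_right (v s) (v t), quad_swap (v s) (v t), quad_comm_left (Ψ t),
    quad_comm_right (v t) (v t) (v t), quad_swap (v t) (v t), quad_comm_left (Ψ t),
    quad_comm_right (v t) (Ψ t) (v t) (v s)]
  ring

end Curves

/-! ### The energy inequality -/

/-- A one-sided fundamental theorem of calculus for difference quotients with an integrable
majorant. -/
lemma sub_le_integral_of_tendsto {Φ : ℝ → ℝ} (hΦ : Continuous Φ) {τ : ℝ} (hτ : 0 ≤ τ)
    {h : ℕ → ℝ} (hpos : ∀ n, 0 < h n) (hlim : Tendsto h atTop (𝓝 0)) {D : ℕ → ℝ → ℝ} {D₀ G : ℝ → ℝ}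
    (hD : ∀ n, AEStronglyMeasurable (D n) (volume.restrict (Set.Ioc 0 τ)))
    (hG : IntegrableOn G (Set.Ioc 0 τ))
    (hb : ∀ n, ∀ᵐ t ∂volume.restrict (Set.Ioc 0 τ), ‖D n t‖ ≤ G t)
    (hl : ∀ᵐ t ∂volume.restrict (Set.Ioc 0 τ), Tendsto (fun n ↦ D n t) atTop (𝓝 (D₀ t)))
    (hle : ∀ n, ∀ᵐ t ∂volume.restrict (Set.Ioc 0 τ), Φ t - Φ (t - h n) ≤ h n * D n t) :
    Φ τ - Φ 0 ≤ ∫ t in Set.Ioc 0 τ, D₀ t := by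
  have hint := tendsto_integral_of_dominated_convergence G hD hG hb hl
  set H : ℝ → ℝ := fun x ↦ ∫ t in (0 : ℝ)..x, Φ t with hH
  have hder : ∀ x, HasDerivAt H (Φ x) x := fun x ↦ hΦ.integral_hasStrictDerivAt 0 x |>.hasDerivAt
  have hneg : Tendsto (fun n ↦ -h n) atTop (𝓝[≠] 0) := by
    refine tendsto_nhdsWithin_iff.2 ⟨by simpa using hlim.neg, .of_forall fun n ↦ ?_⟩
    simpa using (hpos n).ne'
  have hs : ∀ x, Tendsto (fun n ↦ (H x - H (x - h n)) / h n) atTop (𝓝 (Φ x)) := fun x ↦ by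
    have := (hasDerivAt_iff_tendsto_slope_zero.1 (hder x)).comp hneg
    refine this.congr fun n ↦ ?_
    have := (hpos n).ne'
    simp only [Function.comp_apply, smul_eq_mul, ← sub_eq_add_neg]
    field_simp
    ring
  refine le_of_tendsto_of_tendsto ((hs τ).sub (hs 0)) hint (.of_forall fun n ↦ ?_)
  have hn := hpos n
  have hii : ∀ a b : ℝ, IntervalIntegrable Φ volume a b := fun a b ↦ hΦ.intervalIntegrable a b
  have hshift : IntegrableOn (fun t ↦ Φ (t - h n)) (Set.Ioc 0 τ) :=
    ((hΦ.comp (continuous_id.sub continuous_const)).integrableOn_Icc).mono_set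
      Set.Ioc_subset_Icc_self
  have hΦi : IntegrableOn Φ (Set.Ioc 0 τ) :=
    hΦ.integrableOn_Icc.mono_set Set.Ioc_subset_Icc_self
  have hDi : IntegrableOn (D n) (Set.Ioc 0 τ) := hG.mono' (hD n) (hb n)
  have h1 : ∫ t in Set.Ioc 0 τ, (Φ t - Φ (t - h n)) ≤ ∫ t in Set.Ioc 0 τ, h n * D n t :=
    integral_mono_ae (hΦi.sub hshift) (hDi.const_mul _) (hle n)
  -- Integrating the increments over [0, τ] telescopes to integrals of Φ over intervals of length h
  -- at the two ends, which are difference quotients of the primitive H at τ and at 0.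
  rw [integral_sub hΦi hshift, integral_const_mul, ← intervalIntegral.integral_of_le hτ,
    ← intervalIntegral.integral_of_le hτ, intervalIntegral.integral_comp_sub_right] at h1
  have e1 : ∫ t in (0 - h n)..(τ - h n), Φ t = H (τ - h n) - H (0 - h n) :=
    (intervalIntegral.integral_interval_sub_left (hii _ _) (hii _ _)).symm
  have e2 : H 0 = 0 := intervalIntegral.integral_same
  rw [e1] at h1
  simp only
  rw [← sub_div, div_le_iff₀ hn, mul_comm, e2]
  refine le_trans (le_of_eq ?_) h1
  simp only [hH]
  ring

lemma quad_zero_left (b c d : L2) : quad 0 b c d = 0 := by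
  have := quad_smul 0 (0 : L2) b c d
  simpa using this

section Energy

variable {R T : ℝ} {Ψ Ψd v v' : ℝ → L2}

lemma IsEnergyCurve.exists_lipschitz (hT : 0 ≤ T) (hv : IsEnergyCurve T v v') : ∃ M : ℝ, 0 ≤ M ∧
    (∀ t ∈ Set.Icc 0 T, ‖v' t‖ ≤ M) ∧
    ∀ t ∈ Set.Icc 0 T, ∀ s ∈ Set.Icc 0 T, ‖v t - v s‖ ≤ M * |t - s| := by
  obtain ⟨M, hM⟩ := isCompact_Icc.exists_bound_of_continuousOn hv.continuous_deriv
  refine ⟨M, (norm_nonneg _).trans (hM 0 ⟨le_rfl, hT⟩), hM, fun t ht s hs ↦ ?_⟩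
  exact (convex_Icc 0 T).norm_image_sub_le_of_norm_hasDerivWithin_le hv.deriv hM hs ht

lemma IsPerturbation.exists_nrm_le (h : IsPerturbation R T Ψ Ψd) : ∃ M : ℝ≥0, ∀ t ∈ Set.Icc 0 T,
    ∀ p : ℝ, 2 ≤ p → nrm p (Ψ t) ≤ M := by
  obtain ⟨C, hC⟩ := exists_nrm_bernstein R
  obtain ⟨M, hM⟩ := isCompact_Icc.exists_bound_of_continuousOn
    (fun t ht ↦ (h.deriv t ht).continuousWithinAt : ContinuousOn Ψ (Set.Icc 0 T))
  refine ⟨C * M.toNNReal, fun t ht p hp ↦ (hC _ (h.band t ht) p hp).trans ?_⟩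
  push_cast
  gcongr
  rw [← ofReal_norm]
  exact ENNReal.ofReal_le_ofReal (hM t ht)

/-- A qualitative bound which depends on the solution: the linear energy identity with ‖v'‖ bounded
and the source integrable. It only provides majorants for dominated convergence. -/
lemma IsSolution.exists_nrm_le (hT : 0 < T) (h : IsSolution T Ψ v v') : ∃ M : ℝ≥0,
    ∀ t ∈ Set.Icc 0 T, nrm (10 / 3) (v t) ≤ M := by
  obtain ⟨C, hC⟩ := exists_nrm_sobolev
  obtain ⟨M, hM0, hM, -⟩ := h.isEnergyCurve.exists_lipschitz hT.le
  set N : ℝ → L2 := fun t ↦ hartreeL2 (v t + Ψ t)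
  have hNi : IntegrableOn N (Set.Icc 0 T) := h.integrable_nonlinearity
  set B := 2 * (M * ∫ r in Set.Icc 0 T, ‖N r‖)
  refine ⟨C * (B.toNNReal) ^ (1 / 2 : ℝ), fun t ht ↦ (hC _).trans ?_⟩
  obtain ⟨h1, h2⟩ := linear_energy_identity hT hNi h.hasDeriv h.duhamel ht
  have h3 : |∫ r in Set.Ioo 0 t, inner ℝ (v' r) (N r)| ≤ M * ∫ r in Set.Icc 0 T, ‖N r‖ := by
    rw [← Real.norm_eq_abs, ← integral_const_mul]
    have hsub : Set.Ioo 0 t ⊆ Set.Icc 0 T :=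
      Set.Ioo_subset_Icc_self.trans (Set.Icc_subset_Icc_right ht.2)
    have hi : Integrable (fun r ↦ M * ‖N r‖) (volume.restrict (Set.Ioo 0 t)) :=
      (hNi.norm.const_mul M).mono_measure (Measure.restrict_mono_set _ hsub)
    refine (norm_integral_le_of_norm_le hi ?_).trans ?_
    · filter_upwards [ae_restrict_mem measurableSet_Ioo] with r hr
      refine (norm_inner_le_norm _ _).trans ?_
      exact mul_le_mul_of_nonneg_right (hM r (hsub hr)) (norm_nonneg _)
    · exact setIntegral_mono_set (hNi.norm.const_mul M)
        (.of_forall fun r ↦ by simp only [Pi.zero_apply]; positivity)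
        (LE.le.eventuallyLE hsub)
  have h4 : (gradNormSq (v t)).toReal ≤ B := by
    have := (abs_le.1 h3).1
    have h5 := sq_nonneg ‖v' t‖
    simp only [B]
    linarith
  rw [ENNReal.coe_mul, ENNReal.coe_rpow_of_nonneg _ (by norm_num)]
  gcongr
  rw [← ENNReal.ofReal_toReal h1.ne]
  exact ENNReal.ofReal_le_ofReal h4

lemma continuousOn_remainder {s : Set ℝ} (hs : s ⊆ Set.Icc 0 T) (hv : IsEnergyCurve T v v')
    (hΨ : IsPerturbation R T Ψ Ψd) {w : ℝ → L2} (hw : ContinuousOn w s) :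
    ContinuousOn (fun t ↦ remainder (v t) (Ψ t) (w t)) s := fun t ht ↦
  tendsto_remainder (hv.mem t (hs ht)) (hΨ.mem (hs ht)) (hΨ.nrm_lt_top (hs ht) (by norm_num))
    ((hv.tendsto t (hs ht)).mono_left (nhdsWithin_mono t hs))
    ((hΨ.tendsto (hs ht) (by norm_num)).mono_left (nhdsWithin_mono t hs))
    ((hΨ.tendsto (hs ht) (by norm_num)).mono_left (nhdsWithin_mono t hs)) (hw t ht)

/-- The right side makes sense and is continuous for w merely in L². This permits replacing w by the
limit v' of difference quotients. -/
lemma inner_nonlinearity_eq {v Ψ w : L2} (hv : v ∈ sobX) (hΨ : Ψ ∈ sobX) (hw : w ∈ sobX)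
    (h : MemLp (hartree (v + Ψ : L2)) 2 (volume : Measure E5)) :
    quad w v v v = inner ℝ w (hartreeL2 (v + Ψ)) - remainder v Ψ w := by
  rw [inner_hartreeL2 (sobX.add_mem hv hΨ) h, quad_expand hv hΨ hw]
  ring

/-- The potential energy is controlled by the work of the nonlinearity. -/
lemma potential_le (hT : 0 < T) (hsol : IsSolution T Ψ v v') (hΨ : IsPerturbation R T Ψ Ψd) {τ : ℝ}
    (hτ : τ ∈ Set.Icc 0 T) : quad (v τ) (v τ) (v τ) (v τ) / 4 ≤
      ∫ t in Set.Ioc 0 τ, (inner ℝ (v' t) (hartreeL2 (v t + Ψ t)) -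
        remainder (v t) (Ψ t) (v' t)) := by
  have hv := hsol.isEnergyCurve
  have hsub : Set.Ioc 0 τ ⊆ Set.Icc 0 T :=
    Set.Ioc_subset_Icc_self.trans (Set.Icc_subset_Icc_right hτ.2)
  obtain ⟨M, hM0, hM, hL⟩ := hv.exists_lipschitz hT.le
  obtain ⟨M₁, hM₁⟩ := hsol.exists_nrm_le hT
  obtain ⟨M₂, hM₂⟩ := hΨ.exists_nrm_le
  obtain ⟨C, hC⟩ := exists_remainder_le
  set N : ℝ → L2 := fun t ↦ hartreeL2 (v t + Ψ t) with hN
  have hNi : IntegrableOn N (Set.Ioc 0 τ) := hsol.integrable_nonlinearity.mono_set hsub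
  set K : ℝ := C * (M₁ + M₂) ^ 3 with hK
  have hR : ∀ t ∈ Set.Icc 0 T, ∀ w, |remainder (v t) (Ψ t) w| ≤ K * ‖w‖ := by
    intro t ht w
    have := hC (v t) (Ψ t) w (M₁ + M₂) ((hM₁ t ht).trans le_self_add)
      ((hM₂ t ht _ (by norm_num)).trans le_add_self) ((hM₂ t ht _ (by norm_num)).trans le_add_self)
    have e : (C * (M₁ + M₂) ^ 3 * ‖w‖ₑ : ℝ≥0∞) = ENNReal.ofReal (K * ‖w‖) := by
      rw [ENNReal.ofReal_mul (by positivity), ofReal_norm, hK]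
      congr 1
      rw [← NNReal.coe_add, ← NNReal.coe_pow, ← NNReal.coe_mul, ENNReal.ofReal_coe_nnreal]
      push_cast
      rfl
    rw [e, ← ofReal_norm] at this
    exact (ENNReal.ofReal_le_ofReal_iff (by positivity)).1 this
  -- extension of the curve to the whole line
  set pr : ℝ → ℝ := fun t ↦ max 0 (min t T) with hpr
  have hprm : ∀ t, pr t ∈ Set.Icc 0 T := fun t ↦ ⟨le_max_left _ _, max_le hT.le (min_le_right _ _)⟩
  have hpre : ∀ t ∈ Set.Icc 0 T, pr t = t := fun t ht ↦ by
    simp only [hpr]; rw [min_eq_left ht.2, max_eq_right ht.1]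
  have hprc : Continuous pr := by simp only [hpr]; fun_prop
  have hprt : ∀ t, Tendsto pr (𝓝 t) (𝓝[Set.Icc 0 T] (pr t)) := fun t ↦
    tendsto_nhdsWithin_iff.2 ⟨hprc.tendsto t, .of_forall hprm⟩
  have hprl : ∀ t s, |pr t - pr s| ≤ |t - s| := fun t s ↦ by
    refine (abs_max_sub_max_le_max 0 (min t T) 0 (min s T)).trans ?_
    rw [sub_self, abs_zero, max_eq_right (abs_nonneg _)]
    refine (abs_min_sub_min_le_max t T s T).trans ?_
    simp
  set vb : ℝ → L2 := fun t ↦ v (pr t) with hvb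
  have hvbc : Continuous vb := continuous_iff_continuousAt.2 fun t ↦
    ((hv.deriv _ (hprm t)).continuousWithinAt.tendsto.comp (hprt t))
  set Φ : ℝ → ℝ := fun t ↦ quad (vb t) (vb t) (vb t) (vb t) / 4 with hΦ
  have hΦc : Continuous Φ := continuous_iff_continuousAt.2 fun t ↦ by
    have h1 := (hv.tendsto _ (hprm t)).comp (hprt t)
    have h2 := hv.mem _ (hprm t)
    exact (tendsto_quad_sobolev h2 h2 h2 h2 h1 h1 h1 h1).div_const 4
  set h : ℕ → ℝ := fun n ↦ 1 / ((n : ℝ) + 1) with hh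
  have hpos : ∀ n, 0 < h n := fun n ↦ by simp only [hh]; positivity
  have hlim : Tendsto h atTop (𝓝 0) := tendsto_one_div_add_atTop_nhds_zero_nat
  -- Backward difference quotients: the tangent inequality is applied at the current time t, where
  -- 𝒩(v + Ψ)(t) is known to be in L².
  set w : ℕ → ℝ → L2 := fun n t ↦ (h n)⁻¹ • (vb t - vb (t - h n)) with hw
  have hwc : ∀ n, Continuous (w n) := fun n ↦ by
    have h1 : Continuous fun t ↦ vb (t - h n) := hvbc.comp (by fun_prop)
    exact (hvbc.sub h1).const_smul (h n)⁻¹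
  have hwX : ∀ n t, w n t ∈ sobX := fun n t ↦
    sobX.smul_mem _ (sobX.sub_mem (hv.mem _ (hprm _)) (hv.mem _ (hprm _)))
  have hwb : ∀ n t, ‖w n t‖ ≤ M := fun n t ↦ by
    have h1 := hL _ (hprm t) _ (hprm (t - h n))
    have h2 := hprl t (t - h n)
    rw [sub_sub_cancel, abs_of_pos (hpos n)] at h2
    simp only [hw]
    rw [norm_smul, norm_inv, Real.norm_of_nonneg (hpos n).le, inv_mul_le_iff₀ (hpos n), mul_comm]
    exact h1.trans (mul_le_mul_of_nonneg_left h2 hM0)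
  have hmem : ∀ᵐ t ∂volume.restrict (Set.Ioc 0 τ),
      MemLp (hartree (v t + Ψ t : L2)) 2 (volume : Measure E5) :=
    ae_restrict_of_ae_restrict_of_subset hsub hsol.memLp_nonlinearity
  have hin : ∀ᵐ t ∂volume.restrict (Set.Ioc 0 τ), t ∈ Set.Ioc 0 τ :=
    ae_restrict_mem measurableSet_Ioc
  have key := sub_le_integral_of_tendsto hΦc hτ.1 hpos hlim
    (D := fun n t ↦ inner ℝ (w n t) (N t) - remainder (v t) (Ψ t) (w n t))
    (D₀ := fun t ↦ inner ℝ (v' t) (N t) - remainder (v t) (Ψ t) (v' t))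
    (G := fun t ↦ M * ‖N t‖ + K * M) (fun n ↦ ?_) ?_ (fun n ↦ ?_) ?_ (fun n ↦ ?_)
  · have e0 : Φ 0 = 0 := by
      simp only [hΦ, hvb, hpre 0 ⟨le_rfl, hT.le⟩, hsol.initial.1, quad_zero_left, zero_div]
    have e1 : Φ τ = quad (v τ) (v τ) (v τ) (v τ) / 4 := by simp only [hΦ, hvb, hpre τ hτ]
    rw [e0, e1, sub_zero] at key
    exact key
  · refine AEStronglyMeasurable.sub ((hwc n).aestronglyMeasurable.inner hNi.1) ?_
    exact (continuousOn_remainder hsub hv hΨ (hwc n).continuousOn).aestronglyMeasurable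
      measurableSet_Ioc
  · exact (hNi.norm.const_mul M).add (integrable_const _)
  · filter_upwards [hin] with t ht
    refine (norm_sub_le _ _).trans (add_le_add ((norm_inner_le_norm _ _).trans ?_) ?_)
    · exact mul_le_mul_of_nonneg_right (hwb n t) (norm_nonneg _)
    · exact (hR t (hsub ht) _).trans (mul_le_mul_of_nonneg_left (hwb n t) (by positivity))
  · filter_upwards [hin] with t ht
    have htT := hsub ht
    have hwl : Tendsto (fun n ↦ w n t) atTop (𝓝 (v' t)) := by
      have h1 := hasDerivWithinAt_iff_tendsto_slope.1 (hv.deriv t htT)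
      have h2 : Tendsto (fun n ↦ t - h n) atTop (𝓝[Set.Icc 0 T \ {t}] t) := by
        refine tendsto_nhdsWithin_iff.2 ⟨by simpa using tendsto_const_nhds.sub hlim, ?_⟩
        filter_upwards [hlim.eventually_lt_const ht.1] with n hn
        exact ⟨⟨by linarith, by linarith [htT.2, hpos n]⟩, by simpa using (hpos n).ne'⟩
      refine (h1.comp h2).congr' ?_
      filter_upwards [hlim.eventually_lt_const ht.1] with n hn
      simp only [Function.comp_apply, hw, hvb, hpre t htT,
        hpre (t - h n) ⟨by linarith, by linarith [htT.2, hpos n]⟩, slope, vsub_eq_sub]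
      rw [sub_sub_cancel_left, inv_neg, neg_smul, ← smul_neg, neg_sub]
    refine (hwl.inner tendsto_const_nhds).sub ?_
    have c : ∀ (f : L2) (p : ℝ), 0 < p → Tendsto (fun _ : ℕ ↦ nrm p (f - f)) atTop (𝓝 0) := by
      intro f p hp
      have h := nrm_smul p hp 0 (0 : L2)
      simp only [zero_smul, enorm_zero, zero_mul] at h
      simp only [sub_self, h]
      exact tendsto_const_nhds
    exact tendsto_remainder (v := fun _ ↦ v t) (Ψ := fun _ ↦ Ψ t) (hv.mem t htT) (hΨ.mem htT)
      (hΨ.nrm_lt_top htT (by norm_num)) (c _ _ (by norm_num)) (c _ _ (by norm_num))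
      (c _ _ (by norm_num)) hwl
  · filter_upwards [hin, hmem] with t ht hm
    have htT := hsub ht
    -- Convexity gives one inequality without requiring a derivative of the potential energy, and an
    -- upper bound is all that is needed. The factor 4 cancels the 1/4 in the energy.
    have h1 := quad_sub_quad_le (hv.mem _ (hprm (t - h n))) (hv.mem _ htT)
    have h2 := inner_nonlinearity_eq (hv.mem _ htT) (hΨ.mem htT) (hwX n t) hm
    have h3 : h n * quad (w n t) (v t) (v t) (v t) =
        quad (v t - v (pr (t - h n))) (v t) (v t) (v t) := by
      simp only [hw, quad_smul, hvb, hpre t htT]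
      rw [mul_inv_cancel_left₀ (hpos n).ne']
    simp only [hN]
    rw [← h2, h3]
    simp only [hΦ, hvb, hpre t htT]
    linarith

/-- The energy inequality. -/
theorem energy_le (hT : 0 < T) (hsol : IsSolution T Ψ v v') (hΨ : IsPerturbation R T Ψ Ψd) {τ : ℝ}
    (hτ : τ ∈ Set.Icc 0 T) :
    (‖v' τ‖ ^ 2 + (gradNormSq (v τ)).toReal) / 2 + quad (v τ) (v τ) (v τ) (v τ) / 4 ≤
      -quad (v τ) (Ψ τ) (v τ) (v τ) + ∫ t in Set.Ioc 0 τ, (quad (v t) (Ψd t) (v t) (v t) -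
        (2 * quad (v' t) (Ψ t) (v t) (Ψ t) + quad (v' t) (v t) (Ψ t) (Ψ t) +
          quad (v' t) (Ψ t) (Ψ t) (Ψ t))) := by
  have hv := hsol.isEnergyCurve
  have hsub : Set.Icc 0 τ ⊆ Set.Icc 0 T := Set.Icc_subset_Icc_right hτ.2
  obtain ⟨h1, h2⟩ := linear_energy_identity hT hsol.integrable_nonlinearity hsol.hasDeriv
    hsol.duhamel hτ
  have h3 := potential_le hT hsol hΨ hτ
  obtain ⟨M, hM0, hM, -⟩ := hv.exists_lipschitz hT.le
  have hNi : IntegrableOn (fun t ↦ hartreeL2 (v t + Ψ t)) (Set.Ioc 0 τ) :=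
    hsol.integrable_nonlinearity.mono_set (Set.Ioc_subset_Icc_self.trans hsub)
  have hv'c : ContinuousOn v' (Set.Icc 0 τ) := hv.continuous_deriv.mono hsub
  have i1 : IntegrableOn (fun t ↦ (inner ℝ (v' t) (hartreeL2 (v t + Ψ t)) : ℝ))
      (Set.Ioc 0 τ) := by
    refine (hNi.norm.const_mul M).mono' (((hv'c.mono
      Set.Ioc_subset_Icc_self).aestronglyMeasurable measurableSet_Ioc).inner hNi.1) ?_
    filter_upwards [ae_restrict_mem measurableSet_Ioc] with t ht
    exact (norm_inner_le_norm _ _).trans (mul_le_mul_of_nonneg_right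
      (hM t (hsub (Set.Ioc_subset_Icc_self ht))) (norm_nonneg _))
  have i2 : IntegrableOn (fun t ↦ remainder (v t) (Ψ t) (v' t)) (Set.Ioc 0 τ) :=
    (continuousOn_remainder hsub hv hΨ hv'c).integrableOn_Icc.mono_set Set.Ioc_subset_Icc_self
  -- continuity of the terms
  have t10 : ∀ t ∈ Set.Icc 0 T, nrm 10 (Ψ t) < ∞ := fun t ht ↦ hΨ.nrm_lt_top ht (by norm_num)
  have c1 : ContinuousOn (fun t ↦ quad (v' t) (Ψ t) (v t) (v t)) (Set.Icc 0 T) := fun t ht ↦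
    tendsto_quad_two_ten (t10 t ht) (hv.mem t ht) (hv.mem t ht) (hv.continuous_deriv t ht)
      (hΨ.tendsto ht (by norm_num)) (hv.tendsto t ht) (hv.tendsto t ht)
  have c2 : ContinuousOn (fun t ↦ quad (v t) (Ψd t) (v t) (v t)) (Set.Icc 0 T) := fun t ht ↦
    tendsto_quad_sobolev (hv.mem t ht) (hΨ.mem_deriv ht) (hv.mem t ht) (hv.mem t ht)
      (hv.tendsto t ht) (hΨ.tendsto_deriv ht (by norm_num)) (hv.tendsto t ht) (hv.tendsto t ht)
  have c3 : ContinuousOn (fun t ↦ quad (v' t) (v t) (v t) (Ψ t)) (Set.Icc 0 T) := fun t ht ↦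
    tendsto_quad_two_sobolev (hv.mem t ht) (hv.mem t ht) (t10 t ht) (hv.continuous_deriv t ht)
      (hv.tendsto t ht) (hv.tendsto t ht) (hΨ.tendsto ht (by norm_num))
  -- Integration by parts in time: it trades the terms with one Ψ and the derivative v' for a
  -- boundary term, which vanishes at time 0, and for a term with the derivative of Ψ.
  have hF := intervalIntegral.integral_eq_sub_of_hasDeriv_right_of_le hτ.1
    (f := fun t ↦ quad (v t) (Ψ t) (v t) (v t))
    (fun t ht ↦ ((hasDerivWithinAt_quad hv hΨ (hsub ht)).mono hsub).continuousWithinAt)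
    (fun t ht ↦ ((hasDerivWithinAt_quad hv hΨ
      (hsub (Set.Ioo_subset_Icc_self ht))).hasDerivAt
        (Icc_mem_nhds ht.1 (ht.2.trans_le hτ.2))).hasDerivWithinAt)
    ((((c1.add c2).add (c3.const_mul 2)).mono hsub).intervalIntegrable_of_Icc hτ.1)
  simp only [hsol.initial.1, quad_zero_left, sub_zero] at hF
  rw [intervalIntegral.integral_of_le hτ.1] at hF
  have i3 : IntegrableOn (fun t ↦ quad (v' t) (Ψ t) (v t) (v t) + quad (v t) (Ψd t) (v t) (v t) +
      2 * quad (v' t) (v t) (v t) (Ψ t)) (Set.Ioc 0 τ) :=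
    (((c1.add c2).add (c3.const_mul 2)).mono hsub).integrableOn_Icc.mono_set
      Set.Ioc_subset_Icc_self
  rw [integral_sub i1 i2] at h3
  rw [← integral_Ioc_eq_integral_Ioo] at h2
  have e : ∫ t in Set.Ioc 0 τ, (quad (v t) (Ψd t) (v t) (v t) -
        (2 * quad (v' t) (Ψ t) (v t) (Ψ t) + quad (v' t) (v t) (Ψ t) (Ψ t) +
          quad (v' t) (Ψ t) (Ψ t) (Ψ t))) =
      (∫ t in Set.Ioc 0 τ, (quad (v' t) (Ψ t) (v t) (v t) + quad (v t) (Ψd t) (v t) (v t) +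
        2 * quad (v' t) (v t) (v t) (Ψ t))) -
        ∫ t in Set.Ioc 0 τ, remainder (v t) (Ψ t) (v' t) := by
    rw [← integral_sub i3 i2]
    refine integral_congr_ae (.of_forall fun t ↦ ?_)
    simp only [remainder]
    ring
  rw [e, hF]
  linarith

end Energy

/-! ### The multilinear estimates in terms of the energy -/

/-- Bounds for the position (in `L²`), and for the energy of a state `(v, v')`. -/
structure IsEnergyBound (V F : ℝ) (v v' : L2) : Prop where
  nonneg : 0 ≤ V
  nonneg' : 0 ≤ F
  norm_le : ‖v‖ ≤ V
  norm_deriv_le : ‖v'‖ ≤ F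
  grad_le : gradNormSq v ≤ ENNReal.ofReal (F ^ 2)
  potential_le : cquad v v v v ≤ ENNReal.ofReal (F ^ 2)

lemma rpow_half_le_ofReal {x : ℝ≥0∞} {F : ℝ} (hF : 0 ≤ F) (h : x ≤ ENNReal.ofReal (F ^ 2)) :
    x ^ (1 / 2 : ℝ) ≤ ENNReal.ofReal F := by
  calc x ^ (1 / 2 : ℝ) ≤ ENNReal.ofReal (F ^ 2) ^ (1 / 2 : ℝ) := by gcongr
    _ = ENNReal.ofReal F := by
      rw [ENNReal.ofReal_rpow_of_nonneg (by positivity) (by norm_num), ← Real.sqrt_eq_rpow,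
        Real.sqrt_sq hF]

lemma abs_le_of_enorm_le {q x : ℝ} (hx : 0 ≤ x) {C : ℝ≥0} (h : ‖q‖ₑ ≤ C * ENNReal.ofReal x) :
    |q| ≤ C * x := by
  have e : (C : ℝ≥0∞) * ENNReal.ofReal x = ENNReal.ofReal (C * x) := by
    rw [ENNReal.ofReal_mul C.coe_nonneg, ENNReal.ofReal_coe_nnreal]
  rw [e, ← ofReal_norm, Real.norm_eq_abs, ENNReal.ofReal_le_ofReal_iff (by positivity)] at h
  exact h

section EnergyBound

variable {V F : ℝ} {v v' : L2}

lemma IsEnergyBound.nrm_two_le (h : IsEnergyBound V F v v') : nrm 2 v ≤ ENNReal.ofReal V := by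
  rw [nrm_two, ← ofReal_norm]
  exact ENNReal.ofReal_le_ofReal h.norm_le

lemma IsEnergyBound.nrm_two_deriv_le (h : IsEnergyBound V F v v') :
    nrm 2 v' ≤ ENNReal.ofReal F := by
  rw [nrm_two, ← ofReal_norm]
  exact ENNReal.ofReal_le_ofReal h.norm_deriv_le

lemma exists_nrm_sobolev_energy : ∃ C : ℝ≥0, ∀ V F v v', IsEnergyBound V F v v' →
    nrm (10 / 3) v ≤ C * ENNReal.ofReal F := by
  obtain ⟨C, hC⟩ := exists_nrm_sobolev
  refine ⟨C, fun V F v v' h ↦ (hC v).trans ?_⟩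
  gcongr
  exact rpow_half_le_ofReal h.nonneg' h.grad_le

/-- The boundary term: potential in L^(5/2), w in L⁵ and v in L^(5/2), the last interpolated between
L² and the energy. The power of F is only 3/2, which is what allows absorption. -/
lemma exists_abs_quad_five_le : ∃ C : ℝ, 0 ≤ C ∧ ∀ V F v v', IsEnergyBound V F v v' →
    ∀ (w : L2) (p : ℝ), 0 ≤ p → nrm 5 w ≤ ENNReal.ofReal p →
    |quad v w v v| ≤ C * (F * √(V * F) * p) := by
  obtain ⟨S, hS⟩ := exists_nrm_sobolev_energy
  obtain ⟨C, hC⟩ := exists_cquad_le_potential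
  refine ⟨(C * S ^ (1 / 2 : ℝ) : ℝ≥0), NNReal.coe_nonneg _, fun V F v v' h w p hp hw ↦
    abs_le_of_enorm_le (by have := h.nonneg'; positivity) ?_⟩
  have hF := h.nonneg'
  refine (enorm_quad_le _ _ _ _).trans ((hC (5 / 2) 5 (by norm_num) (by norm_num) _ _ _).trans ?_)
  have h1 : nrm (5 / 2) v ≤ ENNReal.ofReal V ^ (1 / 2 : ℝ) *
      (S * ENNReal.ofReal F) ^ (1 / 2 : ℝ) := by
    refine (nrm_five_halves_le v).trans ?_
    gcongr
    · exact h.nrm_two_le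
    · exact hS _ _ _ _ h
  have e : ENNReal.ofReal (F * √(V * F) * p) = ENNReal.ofReal F *
      (ENNReal.ofReal V ^ (1 / 2 : ℝ) * ENNReal.ofReal F ^ (1 / 2 : ℝ)) * ENNReal.ofReal p := by
    rw [ENNReal.ofReal_mul (by positivity), ENNReal.ofReal_mul hF, Real.sqrt_eq_rpow,
      Real.mul_rpow h.nonneg hF, ENNReal.ofReal_mul (Real.rpow_nonneg h.nonneg _),
      ENNReal.ofReal_rpow_of_nonneg h.nonneg (by norm_num),
      ENNReal.ofReal_rpow_of_nonneg hF (by norm_num)]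
  calc _ ≤ C * ENNReal.ofReal F * ((ENNReal.ofReal V ^ (1 / 2 : ℝ) *
        (S * ENNReal.ofReal F) ^ (1 / 2 : ℝ)) * ENNReal.ofReal p) := by
        gcongr
        exact rpow_half_le_ofReal hF h.potential_le
    _ = _ := by
      rw [e, ENNReal.mul_rpow_of_nonneg _ _ (by norm_num), ENNReal.coe_mul,
        ENNReal.coe_rpow_of_nonneg _ (by norm_num)]
      ring

/-- Serves the time derivative of the stochastic convolution. The root of the potential energy and
the Sobolev norm of v contribute one F each, so the bound is linear in the energy. -/
lemma exists_abs_quad_sobolev_le : ∃ C : ℝ, 0 ≤ C ∧ ∀ V F v v', IsEnergyBound V F v v' →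
    ∀ (w : L2) (p : ℝ), 0 ≤ p → nrm (10 / 3) w ≤ ENNReal.ofReal p →
    |quad v w v v| ≤ C * (F ^ 2 * p) := by
  obtain ⟨S, hS⟩ := exists_nrm_sobolev_energy
  obtain ⟨C, hC⟩ := exists_cquad_le_potential
  refine ⟨(C * S : ℝ≥0), NNReal.coe_nonneg _, fun V F v v' h w p hp hw ↦
    abs_le_of_enorm_le (by positivity) ?_⟩
  have hF := h.nonneg'
  refine (enorm_quad_le _ _ _ _).trans ((hC (10 / 3) (10 / 3) (by norm_num) (by norm_num)
    _ _ _).trans ?_)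
  calc _ ≤ C * ENNReal.ofReal F * ((S * ENNReal.ofReal F) * ENNReal.ofReal p) := by
        gcongr
        · exact rpow_half_le_ofReal hF h.potential_le
        · exact hS _ _ _ _ h
    _ = _ := by
      rw [ENNReal.ofReal_mul (by positivity), ENNReal.ofReal_pow hF, ENNReal.coe_mul]
      ring

/-- Here v' in L² and v in L^(10/3) give one factor F each, and w in L⁵ supplies the rest: 1/2 +
3/10 + 2/5 = 6/5. -/
lemma exists_abs_quad_quadratic_le : ∃ C : ℝ, 0 ≤ C ∧ ∀ V F v v', IsEnergyBound V F v v' →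
    ∀ (w : L2) (p : ℝ), 0 ≤ p → nrm 5 w ≤ ENNReal.ofReal p →
    |2 * quad v' w v w + quad v' v w w| ≤ C * (F ^ 2 * p ^ 2) := by
  obtain ⟨S, hS⟩ := exists_nrm_sobolev_energy
  obtain ⟨C₁, hC₁⟩ := exists_cquad_le (p := 2) (q := 5) (r := 10 / 3) (s := 5) (by norm_num)
    (by norm_num) (by norm_num) (by norm_num) (by norm_num) (by norm_num) (by norm_num)
  obtain ⟨C₂, hC₂⟩ := exists_cquad_le (p := 2) (q := 10 / 3) (r := 5) (s := 5) (by norm_num)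
    (by norm_num) (by norm_num) (by norm_num) (by norm_num) (by norm_num) (by norm_num)
  refine ⟨2 * (C₁ * S : ℝ≥0) + (C₂ * S : ℝ≥0), by positivity, fun V F v v' h w p hp hw ↦ ?_⟩
  have hF := h.nonneg'
  have hx : ENNReal.ofReal (F ^ 2 * p ^ 2) = ENNReal.ofReal F ^ 2 * ENNReal.ofReal p ^ 2 := by
    rw [ENNReal.ofReal_mul (by positivity), ENNReal.ofReal_pow hF, ENNReal.ofReal_pow hp]
  have h1 : |quad v' w v w| ≤ (C₁ * S : ℝ≥0) * (F ^ 2 * p ^ 2) := by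
    refine abs_le_of_enorm_le (by positivity)
      ((enorm_quad_le _ _ _ _).trans ((hC₁ _ _ _ _).trans ?_))
    calc _ ≤ C₁ * (ENNReal.ofReal F * ENNReal.ofReal p) *
          ((S * ENNReal.ofReal F) * ENNReal.ofReal p) := by
          gcongr
          · exact h.nrm_two_deriv_le
          · exact hS _ _ _ _ h
      _ = _ := by rw [hx, ENNReal.coe_mul]; ring
  have h2 : |quad v' v w w| ≤ (C₂ * S : ℝ≥0) * (F ^ 2 * p ^ 2) := by
    refine abs_le_of_enorm_le (by positivity)
      ((enorm_quad_le _ _ _ _).trans ((hC₂ _ _ _ _).trans ?_))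
    calc _ ≤ C₂ * (ENNReal.ofReal F * (S * ENNReal.ofReal F)) *
          (ENNReal.ofReal p * ENNReal.ofReal p) := by
          gcongr
          · exact h.nrm_two_deriv_le
          · exact hS _ _ _ _ h
      _ = _ := by rw [hx, ENNReal.coe_mul]; ring
  have h3 := abs_add_le (2 * quad v' w v w) (quad v' v w w)
  rw [abs_mul, abs_two] at h3
  linarith

lemma exists_abs_quad_cubic_le : ∃ C : ℝ, 0 ≤ C ∧ ∀ V F v v', IsEnergyBound V F v v' →
    ∀ (w : L2) (p : ℝ), 0 ≤ p → nrm (30 / 7) w ≤ ENNReal.ofReal p →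
    |quad v' w w w| ≤ C * (F * p ^ 3) := by
  obtain ⟨C, hC⟩ := exists_cquad_le (p := 2) (q := 30 / 7) (r := 30 / 7) (s := 30 / 7) (by norm_num)
    (by norm_num) (by norm_num) (by norm_num) (by norm_num) (by norm_num) (by norm_num)
  refine ⟨C, NNReal.coe_nonneg _, fun V F v v' h w p hp hw ↦ ?_⟩
  have hF := h.nonneg'
  refine abs_le_of_enorm_le (by positivity)
    ((enorm_quad_le _ _ _ _).trans ((hC _ _ _ _).trans ?_))
  calc _ ≤ C * (ENNReal.ofReal F * ENNReal.ofReal p) *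
        (ENNReal.ofReal p * ENNReal.ofReal p) := by
        gcongr
        exact h.nrm_two_deriv_le
    _ = _ := by
      rw [ENNReal.ofReal_mul hF, ENNReal.ofReal_pow hp]
      ring

lemma exists_abs_quad_japanese_le {α : ℝ} (hα : 0 < α) (hα2 : α < 1 / 2) :
    ∃ C : ℝ, 0 ≤ C ∧ ∀ V F v v', IsEnergyBound V F v v' →
    ∀ (R : ℝ), ∀ w ∈ bandLimited R, ∀ p : ℝ, 0 ≤ p → nrm 5 w ≤ ENNReal.ofReal p →
    |quad v (mult (japanese α) w) v v| ≤ C * (F * (V + F) * p) := by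
  obtain ⟨C, hC⟩ := exists_quad_japanese_le hα hα2
  refine ⟨C, NNReal.coe_nonneg _, fun V F v v' h R w hw p hp hwp ↦ ?_⟩
  have hF := h.nonneg'
  have hV := h.nonneg
  refine abs_le_of_enorm_le (by positivity) ((hC R w hw v
    (h.potential_le.trans_lt ENNReal.ofReal_lt_top) (h.grad_le.trans_lt ENNReal.ofReal_lt_top)).trans
    ?_)
  calc _ ≤ C * ENNReal.ofReal F * (ENNReal.ofReal V + ENNReal.ofReal F) * ENNReal.ofReal p := by
        gcongr
        · exact rpow_half_le_ofReal hF h.potential_le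
        · rw [← ofReal_norm]; exact ENNReal.ofReal_le_ofReal h.norm_le
        · exact rpow_half_le_ofReal hF h.grad_le
    _ = _ := by
      rw [ENNReal.ofReal_mul (by positivity), ENNReal.ofReal_mul hF, ENNReal.ofReal_add hV hF]
      ring

end EnergyBound

/-! ### Grönwall's inequality in integral form -/

/-- Integrating factor: the right side Z of the hypothesis, times exp(-∫ b), is nonincreasing
because Y ≤ Z. -/
lemma le_mul_exp_of_le_integral {Y b : ℝ → ℝ} (hY : Continuous Y) (hb : Continuous b) {A T : ℝ}
    (hb0 : ∀ t, 0 ≤ b t)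
    (h : ∀ τ ∈ Set.Icc 0 T, Y τ ≤ A + ∫ t in (0 : ℝ)..τ, b t * Y t) {τ : ℝ} (hτ : τ ∈ Set.Icc 0 T) :
    Y τ ≤ A * Real.exp (∫ t in (0 : ℝ)..τ, b t) := by
  set B : ℝ → ℝ := fun τ ↦ ∫ t in (0 : ℝ)..τ, b t with hB
  set Z : ℝ → ℝ := fun τ ↦ A + ∫ t in (0 : ℝ)..τ, b t * Y t with hZ
  have dB : ∀ t, HasDerivAt B (b t) t := fun t ↦ (hb.integral_hasStrictDerivAt 0 t).hasDerivAt
  have dZ : ∀ t, HasDerivAt Z (b t * Y t) t := fun t ↦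
    (((hb.mul hY).integral_hasStrictDerivAt 0 t).hasDerivAt).const_add A
  have dW : ∀ t, HasDerivAt (fun t ↦ Z t * Real.exp (-B t))
      (b t * Y t * Real.exp (-B t) + Z t * (Real.exp (-B t) * -b t)) t := fun t ↦
    (dZ t).mul ((dB t).neg.exp)
  have anti : AntitoneOn (fun t ↦ Z t * Real.exp (-B t)) (Set.Icc 0 T) := by
    refine antitoneOn_of_deriv_nonpos (convex_Icc 0 T)
      (fun t _ ↦ (dW t).continuousAt.continuousWithinAt)
      (fun t _ ↦ (dW t).differentiableAt.differentiableWithinAt) fun t ht ↦ ?_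
    rw [(dW t).deriv]
    have h1 := h t (interior_subset ht)
    have h2 : 0 ≤ b t * Real.exp (-B t) := mul_nonneg (hb0 t) (Real.exp_pos _).le
    have h3 : b t * Y t * Real.exp (-B t) + Z t * (Real.exp (-B t) * -b t) =
      (b t * Real.exp (-B t)) * (Y t - Z t) := by ring
    rw [h3]
    exact mul_nonpos_of_nonneg_of_nonpos h2 (sub_nonpos.2 h1)
  have h0 := anti ⟨le_rfl, hτ.1.trans hτ.2⟩ hτ hτ.1
  simp only [hZ, hB, intervalIntegral.integral_same, neg_zero, Real.exp_zero, mul_one,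
    add_zero] at h0
  refine (h τ hτ).trans ?_
  rw [Real.exp_neg, ← div_eq_mul_inv, div_le_iff₀ (Real.exp_pos _)] at h0
  exact h0

lemma le_mul_exp_of_le_integral_Icc {Y b : ℝ → ℝ} {A T : ℝ} (hY : ContinuousOn Y (Set.Icc 0 T))
    (hb : ContinuousOn b (Set.Icc 0 T)) (hb0 : ∀ t ∈ Set.Icc 0 T, 0 ≤ b t)
    (h : ∀ τ ∈ Set.Icc 0 T, Y τ ≤ A + ∫ t in Set.Ioc 0 τ, b t * Y t) {τ : ℝ}
    (hτ : τ ∈ Set.Icc 0 T) :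
    Y τ ≤ A * Real.exp (∫ t in Set.Ioc 0 τ, b t) := by
  have hT : 0 ≤ T := hτ.1.trans hτ.2
  set Y' : ℝ → ℝ := Set.IccExtend hT ((Set.Icc 0 T).domRestrict Y)
  set b' : ℝ → ℝ := Set.IccExtend hT ((Set.Icc 0 T).domRestrict b)
  have eY : ∀ t ∈ Set.Icc 0 T, Y' t = Y t := fun t ht ↦ by
    simp only [Y', Set.IccExtend_of_mem hT _ ht, Set.domRestrict_apply]
  have eb : ∀ t ∈ Set.Icc 0 T, b' t = b t := fun t ht ↦ by
    simp only [b', Set.IccExtend_of_mem hT _ ht, Set.domRestrict_apply]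
  have hsub : ∀ τ ∈ Set.Icc 0 T, Set.Ioc 0 τ ⊆ Set.Icc 0 T := fun τ hτ ↦
    Set.Ioc_subset_Icc_self.trans (Set.Icc_subset_Icc_right hτ.2)
  have key := le_mul_exp_of_le_integral (Y := Y') (b := b') (A := A) (T := T)
    (continuousOn_iff_continuous_domRestrict.1 hY).Icc_extend'
    (continuousOn_iff_continuous_domRestrict.1 hb).Icc_extend'
    (fun t ↦ hb0 _ (Set.projIcc 0 T hT t).2) (fun τ hτ ↦ by
      rw [eY τ hτ, intervalIntegral.integral_of_le hτ.1]
      refine (h τ hτ).trans_eq ?_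
      congr 1
      refine setIntegral_congr_fun measurableSet_Ioc fun t ht ↦ ?_
      simp only [eY t (hsub τ hτ ht), eb t (hsub τ hτ ht)]) hτ
  rw [eY τ hτ, intervalIntegral.integral_of_le hτ.1,
    setIntegral_congr_fun measurableSet_Ioc fun t ht ↦ eb t (hsub τ hτ ht)] at key
  exact key

/-! ### Mixed norms of curves -/

lemma abs_toReal_nrm_sub_le {p : ℝ} (hp : 1 ≤ p) {f g : L2} (hf : nrm p f < ∞) (hg : nrm p g < ∞) :
    |(nrm p f).toReal - (nrm p g).toReal| ≤ (nrm p (f - g)).toReal := by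
  have hfg : nrm p (f - g) < ∞ := (nrm_sub_le hp f g).trans_lt (ENNReal.add_lt_top.2 ⟨hf, hg⟩)
  have h1 : nrm p f ≤ nrm p (f - g) + nrm p g := by simpa using nrm_add_le hp (f - g) g
  have h2 : nrm p g ≤ nrm p (f - g) + nrm p f := by
    have := nrm_sub_le hp f (f - g)
    rw [sub_sub_cancel] at this
    exact this.trans_eq (add_comm _ _)
  have h3 := ENNReal.toReal_mono (ENNReal.add_lt_top.2 ⟨hfg, hg⟩).ne h1
  have h4 := ENNReal.toReal_mono (ENNReal.add_lt_top.2 ⟨hfg, hf⟩).ne h2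
  rw [ENNReal.toReal_add hfg.ne hg.ne] at h3
  rw [ENNReal.toReal_add hfg.ne hf.ne] at h4
  rw [abs_sub_le_iff]
  constructor <;> linarith

lemma continuousOn_nrm {R p : ℝ} (hp : 2 ≤ p) {f : ℝ → L2} {s : Set ℝ} (hf : ContinuousOn f s)
    (hb : ∀ t ∈ s, f t ∈ bandLimited R) : ContinuousOn (fun t ↦ (nrm p (f t)).toReal) s := by
  intro t ht
  have h1 := tendsto_nrm_of_bandLimited (hf t ht) (eventually_mem_nhdsWithin.mono hb) (hb t ht) hp
  have h2 := (ENNReal.tendsto_toReal ENNReal.zero_ne_top).comp h1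
  refine tendsto_iff_norm_sub_tendsto_zero.2 ?_
  refine squeeze_zero' (.of_forall fun _ ↦ norm_nonneg _) ?_ h2
  filter_upwards [eventually_mem_nhdsWithin] with r hr
  exact abs_toReal_nrm_sub_le (by linarith) (nrm_lt_top_of_bandLimited (hb r hr) hp)
    (nrm_lt_top_of_bandLimited (hb t ht) hp)

lemma ae_nrm_le_mixedNorm {r : ℝ≥0∞} (h0 : r ≠ 0) (ht : r ≠ ∞) (T : ℝ) (f : ℝ → L2) :
    ∀ᵐ t ∂volume.restrict (Set.Icc 0 T), nrm r.toReal (f t) ≤ mixedNorm ∞ r T f := by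
  have := enorm_ae_le_eLpNormEssSup (fun t ↦ eLpNorm (f t) r (volume : Measure E5))
    (volume.restrict (Set.Icc 0 T))
  filter_upwards [this] with t h
  rw [← eLpNorm_eq_nrm h0 ht]
  rw [mixedNorm, eLpNorm_exponent_top]
  exact h

lemma mixedNorm_pow (n : ℕ) (hn : n ≠ 0) {r : ℝ≥0∞} (h0 : r ≠ 0) (ht : r ≠ ∞) (T : ℝ)
    (f : ℝ → L2) :
    mixedNorm n r T f ^ n = ∫⁻ t in Set.Icc 0 T, nrm r.toReal (f t) ^ n := by
  have hn' : (n : ℝ≥0∞) ≠ 0 := by exact_mod_cast hn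
  rw [mixedNorm, eLpNorm_eq_lintegral_rpow_enorm_toReal hn' (ENNReal.natCast_ne_top n),
    ENNReal.toReal_natCast, ← ENNReal.rpow_natCast, ← ENNReal.rpow_mul, one_div,
    inv_mul_cancel₀ (by exact_mod_cast hn), ENNReal.rpow_one]
  refine lintegral_congr fun t ↦ ?_
  rw [ENNReal.rpow_natCast, enorm_eq_self, eLpNorm_eq_nrm h0 ht]

lemma setIntegral_pow_nrm_le {R p : ℝ} {n : ℕ} {f : ℝ → L2} {T K τ : ℝ} (hp : 2 ≤ p) (hK : 0 ≤ K)
    (hf : ContinuousOn f (Set.Icc 0 T)) (hb : ∀ t ∈ Set.Icc 0 T, f t ∈ bandLimited R)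
    (h : ∫⁻ t in Set.Icc 0 T, nrm p (f t) ^ n ≤ ENNReal.ofReal K) (hτ : τ ≤ T) :
    ∫ t in Set.Ioc 0 τ, (nrm p (f t)).toReal ^ n ≤ K := by
  have hsub : Set.Ioc 0 τ ⊆ Set.Icc 0 T :=
    Set.Ioc_subset_Icc_self.trans (Set.Icc_subset_Icc_right hτ)
  have hc : ContinuousOn (fun t ↦ (nrm p (f t)).toReal ^ n) (Set.Icc 0 T) :=
    (continuousOn_nrm hp hf hb).pow n
  rw [integral_eq_lintegral_of_nonneg_ae (.of_forall fun t ↦ by positivity)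
    ((hc.mono hsub).aestronglyMeasurable measurableSet_Ioc)]
  refine ENNReal.toReal_le_of_le_ofReal hK (le_trans ?_ h)
  refine (lintegral_mono_set hsub).trans (lintegral_mono fun t ↦ ?_)
  rw [ENNReal.ofReal_pow ENNReal.toReal_nonneg]
  gcongr
  exact ENNReal.ofReal_toReal_le

/-- The continuous function max(f, c) equals c almost everywhere, hence everywhere. This turns
essential suprema in time into bounds at each time, as the boundary term requires. -/
lemma forall_le_of_ae_le {f : ℝ → ℝ} {T c : ℝ} (hT : 0 < T) (hf : ContinuousOn f (Set.Icc 0 T))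
    (h : ∀ᵐ t ∂volume.restrict (Set.Icc 0 T), f t ≤ c) : ∀ t ∈ Set.Icc 0 T, f t ≤ c := by
  have := Measure.eqOn_Icc_of_ae_eq volume hT.ne (f := fun t ↦ max (f t) c) (g := fun _ ↦ c)
    (h.mono fun t ht ↦ max_eq_right ht) (hf.sup continuousOn_const) continuousOn_const
  exact fun t ht ↦ max_eq_right_iff.1 (this ht)

/-! ### The energy of a solution -/

/-- The (real valued) energy. -/
def realEnergy (v v' : L2) : ℝ := (‖v'‖ ^ 2 + (gradNormSq v).toReal) / 2 + quad v v v v / 4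

lemma realEnergy_nonneg (v v' : L2) : 0 ≤ realEnergy v v' := by
  have := quad_self_self_nonneg v v
  unfold realEnergy
  positivity

lemma ofReal_quad_self {v : L2} (hv : v ∈ sobX) :
    ENNReal.ofReal (quad v v v v) = cquad v v v v := by
  rw [quad_self_self, ENNReal.ofReal_toReal]
  exact (cquad_lt_top hv hv hv hv).ne

lemma lintegral_enorm_sq (g : L2) : ∫⁻ x : E5, ‖g x‖ₑ ^ 2 = ENNReal.ofReal (‖g‖ ^ 2) := by
  rw [← enorm_sq_eq_lintegral, ENNReal.ofReal_pow (norm_nonneg _), ofReal_norm]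

lemma energy_eq {v v' : L2} (hv : gradNormSq v < ∞) :
    energy v v' = ENNReal.ofReal (realEnergy v v') := by
  have h1 : ∫⁻ x : E5, ∫⁻ y : E5, ‖v x‖ₑ ^ 2 * ‖v y‖ₑ ^ 2 / ‖x - y‖ₑ ^ 4 =
      ENNReal.ofReal (quad v v v v) := by
    rw [ofReal_quad_self (mem_sobX_of_gradNormSq hv), cquad, coul]
    refine lintegral_congr fun x ↦ lintegral_congr fun y ↦ ?_
    rw [← pow_two, ← pow_two, div_eq_mul_inv, ENNReal.rpow_neg, ENNReal.rpow_ofNat]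
  have h2 := quad_self_self_nonneg v v
  rw [energy, h1, lintegral_enorm_sq, realEnergy, ENNReal.ofReal_add (by positivity) (by positivity),
    ENNReal.ofReal_div_of_pos (by norm_num), ENNReal.ofReal_div_of_pos (by norm_num),
    ENNReal.ofReal_add (by positivity) (by positivity), ENNReal.ofReal_toReal hv.ne]
  norm_num

lemma energySpaceNormSq_le {v v' : L2} (hv : gradNormSq v < ∞) :
    energySpaceNormSq v v' ≤ ENNReal.ofReal (‖v‖ ^ 2 + 2 * realEnergy v v') := by
  have h2 := quad_self_self_nonneg v v
  rw [energySpaceNormSq, sobolevNormSq_one, lintegral_enorm_sq, ← ofReal_norm,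
    ← ENNReal.ofReal_pow (norm_nonneg _), ← ENNReal.ofReal_toReal hv.ne,
    ← ENNReal.ofReal_add (by positivity) (by positivity),
    ← ENNReal.ofReal_add (by positivity) (by positivity)]
  refine ENNReal.ofReal_le_ofReal ?_
  unfold realEnergy
  linarith

/-- With F = 2√E one has F² = 4E, which dominates the kinetic, gradient and potential terms
separately; the factor 4 is dictated by the 1/4 of the potential energy. -/
lemma isEnergyBound_realEnergy {v v' : L2} (hv : gradNormSq v < ∞) :
    IsEnergyBound ‖v‖ (2 * √(realEnergy v v')) v v' := by
  have h0 := realEnergy_nonneg v v'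
  have h2 := quad_self_self_nonneg v v
  have hF : (2 * √(realEnergy v v')) ^ 2 = 4 * realEnergy v v' := by
    rw [mul_pow, Real.sq_sqrt h0]; norm_num
  have h3 : 0 ≤ (gradNormSq v).toReal := ENNReal.toReal_nonneg
  refine ⟨norm_nonneg _, by positivity, le_rfl, ?_, ?_, ?_⟩
  · refine abs_le_of_sq_le_sq' ?_ (by positivity) |>.2
    rw [hF, realEnergy]
    nlinarith [sq_nonneg ‖v'‖]
  · rw [hF, ← ENNReal.ofReal_toReal hv.ne]
    refine ENNReal.ofReal_le_ofReal ?_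
    rw [realEnergy]
    nlinarith [sq_nonneg ‖v'‖]
  · rw [hF, ← ofReal_quad_self (mem_sobX_of_gradNormSq hv)]
    refine ENNReal.ofReal_le_ofReal ?_
    rw [realEnergy]
    nlinarith [sq_nonneg ‖v'‖]

section Solution

variable {T : ℝ} {Ψ v v' : ℝ → L2}

lemma IsSolution.gradNormSq_lt_top (h : IsSolution T Ψ v v') {t : ℝ} (ht : t ∈ Set.Icc 0 T) :
    gradNormSq (v t) < ∞ := (gradNormSq_le_sobolevNormSq _).trans_lt (h.mem_H1 t ht)

/-- The quadratic part of the energy is, by the linear energy identity, a primitive of an integrable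
function; the quartic part is continuous by multilinearity. -/
lemma IsSolution.continuousOn_realEnergy (hT : 0 < T) (h : IsSolution T Ψ v v') :
    ContinuousOn (fun t ↦ realEnergy (v t) (v' t)) (Set.Icc 0 T) := by
  have hv := h.isEnergyCurve
  obtain ⟨M, hM0, hM, -⟩ := hv.exists_lipschitz hT.le
  have hNi := h.integrable_nonlinearity
  have i1 : IntegrableOn (fun t ↦ (inner ℝ (v' t) (hartreeL2 (v t + Ψ t)) : ℝ)) (Set.Icc 0 T) := by
    refine (hNi.norm.const_mul M).mono'
      ((hv.continuous_deriv.aestronglyMeasurable measurableSet_Icc).inner hNi.1) ?_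
    filter_upwards [ae_restrict_mem measurableSet_Icc] with t ht
    exact (norm_inner_le_norm _ _).trans (mul_le_mul_of_nonneg_right (hM t ht) (norm_nonneg _))
  have c1 : ContinuousOn (fun t ↦ ‖v' t‖ ^ 2 + (gradNormSq (v t)).toReal) (Set.Icc 0 T) := by
    refine ((intervalIntegral.continuousOn_primitive i1).const_mul (-2)).congr fun t ht ↦ ?_
    simp only
    rw [(linear_energy_identity hT hNi h.hasDeriv h.duhamel ht).2, integral_Ioc_eq_integral_Ioo]
  have c2 : ContinuousOn (fun t ↦ quad (v t) (v t) (v t) (v t)) (Set.Icc 0 T) := fun t ht ↦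
    tendsto_quad_sobolev (hv.mem t ht) (hv.mem t ht) (hv.mem t ht) (hv.mem t ht)
      (hv.tendsto t ht) (hv.tendsto t ht) (hv.tendsto t ht) (hv.tendsto t ht)
  exact (c1.div_const 2).add (c2.div_const 4)

/-- The energy does not control the L² norm. This bound, from d/dt ‖v‖² = 2⟨v, v'⟩, closes the
Grönwall argument for the sum of both. -/
lemma IsSolution.norm_sq_le (h : IsSolution T Ψ v v') {τ : ℝ} (hτ : τ ∈ Set.Icc 0 T) :
    ‖v τ‖ ^ 2 ≤ ∫ t in Set.Ioc 0 τ, (‖v t‖ ^ 2 + ‖v' t‖ ^ 2) := by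
  have hsub : Set.Icc 0 τ ⊆ Set.Icc 0 T := Set.Icc_subset_Icc_right hτ.2
  have hvc : ContinuousOn v (Set.Icc 0 τ) :=
    fun t ht ↦ ((h.hasDeriv t (hsub ht)).mono hsub).continuousWithinAt
  have hv'c : ContinuousOn v' (Set.Icc 0 τ) := h.continuous_deriv.mono hsub
  have c1 : ContinuousOn (fun t ↦ 2 * inner ℝ (v t) (v' t)) (Set.Icc 0 τ) :=
    (hvc.inner (𝕜 := ℝ) hv'c).const_mul 2
  have hF := intervalIntegral.integral_eq_sub_of_hasDeriv_right_of_le hτ.1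
    (f := fun t ↦ ‖v t‖ ^ 2) (f' := fun t ↦ 2 * inner ℝ (v t) (v' t)) (hvc.norm.pow 2)
    (fun t ht ↦ (((h.hasDeriv t (hsub (Set.Ioo_subset_Icc_self ht))).hasDerivAt
        (Icc_mem_nhds ht.1 (ht.2.trans_le hτ.2))).norm_sq).hasDerivWithinAt)
    (c1.intervalIntegrable_of_Icc hτ.1)
  rw [h.initial.1, norm_zero, zero_pow (by norm_num), sub_zero,
    intervalIntegral.integral_of_le hτ.1] at hF
  rw [← hF]
  refine integral_mono (c1.integrableOn_Icc.mono_set Set.Ioc_subset_Icc_self)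
    (((hvc.norm.pow 2).add (hv'c.norm.pow 2)).integrableOn_Icc.mono_set
      Set.Ioc_subset_Icc_self) fun t ↦ ?_
  have h1 := real_inner_le_norm (v t) (v' t)
  have h2 := two_mul_le_add_sq ‖v t‖ ‖v' t‖
  simp only
  linarith

end Solution

/-! ### The uniform energy bound -/

/-- Young's inequality twice, each time losing F²/16; together F²/8 = y/2, which is absorbed on the
left of the energy inequality. What remains is a multiple of V², controlled by a time integral. -/
lemma young_five {F V C K y : ℝ} (hF : 0 ≤ F) (hV : 0 ≤ V) (hK : 0 ≤ K)
    (hy : F ^ 2 = 4 * y) : C * (F * √(V * F) * √K) ≤ y / 2 + 64 * C ^ 4 * K ^ 2 * V ^ 2 := by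
  have h1 : √(V * F) ^ 2 = V * F := Real.sq_sqrt (by positivity)
  have h2 : √K ^ 2 = K := Real.sq_sqrt hK
  set X := √(V * F)
  set k := √K
  have h3 : C * (F * X * k) ≤ F ^ 2 / 16 + 4 * (C * X * k) ^ 2 := by
    nlinarith [sq_nonneg (F / 4 - 2 * (C * X * k))]
  have h4 : 4 * (C * X * k) ^ 2 = F * (4 * C ^ 2 * K * V) := by
    rw [mul_pow, mul_pow, h1, h2]; ring
  have h5 : F * (4 * C ^ 2 * K * V) ≤ F ^ 2 / 16 + 4 * (4 * C ^ 2 * K * V) ^ 2 := by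
    nlinarith [sq_nonneg (F / 4 - 2 * (4 * C ^ 2 * K * V))]
  have h6 : 4 * (4 * C ^ 2 * K * V) ^ 2 = 64 * C ^ 4 * K ^ 2 * V ^ 2 := by ring
  linarith

/-- All terms are linear in y + V² except F r³, which is split as F² + r⁶. The part r⁶ is integrable
in time by the L⁶ norm of the perturbation. -/
lemma forcing_le {F V C K D r y : ℝ} (hC : 0 ≤ C) (hK : 0 ≤ K) (hD : 0 ≤ D)
    (hy : F ^ 2 = 4 * y) :
    C * (F * (V + F) * K) + C * (F ^ 2 * D) + C * (F ^ 2 * √K ^ 2) + C * (F * r ^ 3) ≤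
      4 * C * (3 * K + 1 + D) * (y + V ^ 2) + C * r ^ 6 := by
  rw [Real.sq_sqrt hK]
  have h1 : F * (V + F) ≤ 2 * (F ^ 2 + V ^ 2) := by nlinarith [sq_nonneg (F - V)]
  have h2 : F * r ^ 3 ≤ F ^ 2 + r ^ 6 := by nlinarith [sq_nonneg (F - r ^ 3), sq_nonneg F]
  have h3 := mul_le_mul_of_nonneg_right h1 hK
  have h4 : 0 ≤ V ^ 2 * D := by positivity
  have h5 : 0 ≤ V ^ 2 * K := by positivity
  have h6 : F * (V + F) * K + F ^ 2 * D + F ^ 2 * K + F * r ^ 3 ≤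
      (3 * K + 1 + D) * (F ^ 2 + V ^ 2) + r ^ 6 := by nlinarith [sq_nonneg V]
  have h7 : (3 * K + 1 + D) * (F ^ 2 + V ^ 2) ≤ (3 * K + 1 + D) * (4 * (y + V ^ 2)) := by
    refine mul_le_mul_of_nonneg_left ?_ (by positivity)
    nlinarith [sq_nonneg V]
  have h8 := mul_le_mul_of_nonneg_left (h6.trans (add_le_add_left h7 _)) hC
  linarith

/-- The terms of the energy inequality which involve the perturbation. -/
lemma exists_abs_forcing_le {α : ℝ} (hα : 0 < α) (hα2 : α < 1 / 2) : ∃ C : ℝ, 0 ≤ C ∧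
    ∀ (R K D r : ℝ) (v v' Ψ w Ψ' : L2), gradNormSq v < ∞ → 0 ≤ K → 0 ≤ D → 0 ≤ r →
    nrm 5 Ψ ≤ ENNReal.ofReal √K →
    -quad v Ψ v v ≤ realEnergy v v' / 2 + 64 * C ^ 4 * K ^ 2 * ‖v‖ ^ 2 ∧
    (w ∈ bandLimited R → Ψ' ∈ bandLimited R →
      nrm 5 w ≤ ENNReal.ofReal K → nrm (10 / 3) Ψ' ≤ ENNReal.ofReal D →
      nrm (30 / 7) Ψ ≤ ENNReal.ofReal r →
      |quad v (mult (japanese α) w + Ψ') v v - (2 * quad v' Ψ v Ψ + quad v' v Ψ Ψ +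
        quad v' Ψ Ψ Ψ)| ≤
        4 * C * (3 * K + 1 + D) * (realEnergy v v' + ‖v‖ ^ 2) + C * r ^ 6) := by
  obtain ⟨C₁, hC₁, q1⟩ := exists_abs_quad_five_le
  obtain ⟨C₂, hC₂, q2⟩ := exists_abs_quad_sobolev_le
  obtain ⟨C₃, hC₃, q3⟩ := exists_abs_quad_quadratic_le
  obtain ⟨C₄, hC₄, q4⟩ := exists_abs_quad_cubic_le
  obtain ⟨C₅, hC₅, q5⟩ := exists_abs_quad_japanese_le hα hα2
  obtain ⟨C, hC, l1, l2, l3, l4, l5⟩ : ∃ C : ℝ, 0 ≤ C ∧ C₁ ≤ C ∧ C₂ ≤ C ∧ C₃ ≤ C ∧ C₄ ≤ C ∧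
      C₅ ≤ C := by
    refine ⟨C₁ + C₂ + C₃ + C₄ + C₅, ?_, ?_, ?_, ?_, ?_, ?_⟩ <;> linarith
  refine ⟨C, hC, fun R K D r v v' Ψ w Ψ' hv hK hD hr h5 ↦ ?_⟩
  have hF : (2 * √(realEnergy v v')) ^ 2 = 4 * realEnergy v v' := by
    rw [mul_pow, Real.sq_sqrt (realEnergy_nonneg v v')]; norm_num
  have b := isEnergyBound_realEnergy (v' := v') hv
  have hFt := b.nonneg'
  have hVt := b.nonneg
  refine ⟨?_, fun hw hΨ' hwK hD' hr' ↦ ?_⟩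
  · exact (neg_le_abs _).trans ((q1 _ _ _ _ b Ψ √K (Real.sqrt_nonneg _) h5).trans
      ((mul_le_mul_of_nonneg_right l1 (by positivity)).trans
      (young_five hFt (norm_nonneg _) hK hF)))
  have hvX := mem_sobX_of_gradNormSq hv
  have p1 := (q5 _ _ _ _ b R _ hw K hK hwK).trans (mul_le_mul_of_nonneg_right l5 (by positivity))
  have p2 := (q2 _ _ _ _ b Ψ' D hD hD').trans (mul_le_mul_of_nonneg_right l2 (by positivity))
  have p3 := (q3 _ _ _ _ b Ψ √K (Real.sqrt_nonneg _) h5).trans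
    (mul_le_mul_of_nonneg_right l3 (by positivity))
  have p4 := (q4 _ _ _ _ b Ψ r hr hr').trans (mul_le_mul_of_nonneg_right l4 (by positivity))
  have p5 := forcing_le (V := ‖v‖) (D := D) (r := r) hC hK hD hF
  have hwX : mult (japanese α) w ∈ sobX :=
    mem_sobX_of_bandLimited (R := R) (fmul_mem_bandLimited hw _)
  rw [quad_add₂ hwX (mem_sobX_of_bandLimited hΨ') hvX hvX hvX]
  refine le_trans ?_ p5
  have n1 := abs_le.1 p1
  have n2 := abs_le.1 p2
  have n3 := abs_le.1 p3
  have n4 := abs_le.1 p4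
  rw [abs_le]
  constructor <;> linarith [n1.1, n1.2, n2.1, n2.2, n3.1, n3.2, n4.1, n4.2]

/-- The bound of the energy for the equation perturbed by a band limited function whose time
derivative is `⟨∇⟩^α w + Ψ'`. The bound does not depend on the size of the frequency band. -/
theorem exists_energy_bound {α : ℝ} (hα : 0 < α) (hα2 : α < 1 / 2) :
    ∃ C : ℝ → ℝ → ℝ, (∀ K T, 0 < C K T) ∧ ∀ (R K T : ℝ), 0 < K → 0 < T →
      ∀ Ψ w Ψ' : ℝ → L2, IsPerturbation R T Ψ (fun t ↦ mult (japanese α) (w t) + Ψ' t) →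
      (∀ t ∈ Set.Icc 0 T, w t ∈ bandLimited R) → (∀ t ∈ Set.Icc 0 T, Ψ' t ∈ bandLimited R) →
      ContinuousOn Ψ' (Set.Icc 0 T) →
      normZ T Ψ < ENNReal.ofReal K → mixedNorm ∞ 5 T w < ENNReal.ofReal K →
      mixedNorm 10 (10 / 3) T Ψ' < ENNReal.ofReal K →
      ∀ v v' : ℝ → L2, IsSolution T Ψ v v' →
        (∀ t ∈ Set.Icc 0 T, energy (v t) (v' t) ≤ ENNReal.ofReal (C K T)) ∧
        (⨆ t ∈ Set.Icc 0 T, energySpaceNormSq (v t) (v' t)) ≤ ENNReal.ofReal (C K T) := by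
  obtain ⟨C, hC, hq⟩ := exists_abs_forcing_le hα hα2
  -- Moving y/2 to the left doubles all other terms. The first summand is the coefficient 128C⁴K² +
  -- 1 of ‖v‖² times the 4 from ‖v‖² ≤ ∫ 4Y. The second is twice the constant part of the forcing
  -- coefficient. Absolute values of K and T keep the bound positive for all real arguments.
  set β : ℝ → ℝ := fun K ↦ 4 * (128 * C ^ 4 * K ^ 2 + 1) + 8 * C * (3 * K + 1) with hβ
  set A : ℝ → ℝ → ℝ := fun K T ↦
    2 * C * |K| * Real.exp (β |K| * |T| + 8 * C * (|T| + |K| ^ 10)) with hA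
  have hA0 : ∀ K T, 0 ≤ A K T := fun K T ↦ by simp only [hA]; positivity
  -- The factor 2 comes from ‖v‖² + 2E ≤ 2Y; the summand 1 gives strict positivity.
  refine ⟨fun K T ↦ 1 + 2 * A K T, fun K T ↦ by linarith [hA0 K T], ?_⟩
  intro R K T hK hT Ψ w Ψ' hΨ hw hΨ' hΨ'c hZ hW hD v v' hsol
  have hv := hsol.isEnergyCurve
  have hΨc : ContinuousOn Ψ (Set.Icc 0 T) := fun t ht ↦ (hΨ.deriv t ht).continuousWithinAt
  -- the assumed bounds
  have c5 := continuousOn_nrm (p := 5) (by norm_num) hΨc hΨ.band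
  have c30 := continuousOn_nrm (p := 30 / 7) (by norm_num) hΨc hΨ.band
  have cD := continuousOn_nrm (p := 10 / 3) (by norm_num) hΨ'c hΨ'
  have t30 : ((30 / 7 : ℝ≥0∞)).toReal = 30 / 7 := by norm_num
  have t10 : ((10 / 3 : ℝ≥0∞)).toReal = 10 / 3 := by norm_num
  have t5 : ((5 : ℝ≥0∞)).toReal = 5 := by norm_num
  have b5 : ∀ t ∈ Set.Icc 0 T, (nrm 5 (Ψ t)).toReal ≤ √K := by
    refine forall_le_of_ae_le hT c5 ?_
    have h1 : mixedNorm ∞ 5 T Ψ ^ 2 ≤ ENNReal.ofReal K := (le_add_self.trans_lt hZ).le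
    filter_upwards [ae_nrm_le_mixedNorm (r := 5) (by norm_num) (by norm_num) T Ψ] with t ht
    rw [t5] at ht
    refine Real.le_sqrt_of_sq_le ?_
    rw [← ENNReal.toReal_pow]
    exact ENNReal.toReal_le_of_le_ofReal hK.le (le_trans (by gcongr) h1)
  have b5' : ∀ t ∈ Set.Icc 0 T, nrm 5 (Ψ t) ≤ ENNReal.ofReal √K := fun t ht ↦ by
    rw [← ENNReal.ofReal_toReal (hΨ.nrm_lt_top ht (by norm_num)).ne]
    exact ENNReal.ofReal_le_ofReal (b5 t ht)
  -- For w a bound at almost every time suffices, because w occurs only under the time integral.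
  have bW : ∀ᵐ t ∂volume.restrict (Set.Icc 0 T), nrm 5 (w t) ≤ ENNReal.ofReal K := by
    filter_upwards [ae_nrm_le_mixedNorm (r := 5) (by norm_num) (by norm_num) T w] with t ht
    rw [t5] at ht
    exact ht.trans hW.le
  have b30 : ∀ τ ≤ T, ∫ t in Set.Ioc 0 τ, (nrm (30 / 7) (Ψ t)).toReal ^ 6 ≤ K := fun τ hτ ↦ by
    refine setIntegral_pow_nrm_le (by norm_num) hK.le hΨc hΨ.band ?_ hτ
    have := mixedNorm_pow 6 (by norm_num) (r := 30 / 7) (by norm_num)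
      (ENNReal.div_ne_top (by norm_num) (by norm_num)) T Ψ
    rw [t30] at this
    rw [← this]
    exact (le_self_add.trans_lt (le_self_add.trans_lt hZ)).le
  have bD : ∀ τ ≤ T, ∫ t in Set.Ioc 0 τ, (nrm (10 / 3) (Ψ' t)).toReal ^ 10 ≤ K ^ 10 :=
    fun τ hτ ↦ by
    refine setIntegral_pow_nrm_le (by norm_num) (by positivity) hΨ'c hΨ' ?_ hτ
    have := mixedNorm_pow 10 (by norm_num) (r := 10 / 3) (by norm_num)
      (ENNReal.div_ne_top (by norm_num) (by norm_num)) T Ψ'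
    rw [t10] at this
    rw [← this, ENNReal.ofReal_pow hK.le]
    gcongr
    exact hD.le
  -- the Grönwall argument
  set y : ℝ → ℝ := fun t ↦ realEnergy (v t) (v' t) with hy
  set D : ℝ → ℝ := fun t ↦ (nrm (10 / 3) (Ψ' t)).toReal with hDdef
  set r : ℝ → ℝ := fun t ↦ (nrm (30 / 7) (Ψ t)).toReal with hr
  have y0 : ∀ t, 0 ≤ y t := fun t ↦ realEnergy_nonneg _ _
  have hF : ∀ t, (2 * √(y t)) ^ 2 = 4 * y t := fun t ↦ by
    rw [mul_pow, Real.sq_sqrt (y0 t)]; norm_num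
  have cy : ContinuousOn y (Set.Icc 0 T) := hsol.continuousOn_realEnergy hT
  have cv : ContinuousOn (fun t ↦ ‖v t‖ ^ 2) (Set.Icc 0 T) :=
    (show ContinuousOn v (Set.Icc 0 T) from
      fun t ht ↦ (hv.deriv t ht).continuousWithinAt).norm.pow 2
  set Y : ℝ → ℝ := fun t ↦ y t + ‖v t‖ ^ 2 with hY
  have cY : ContinuousOn Y (Set.Icc 0 T) := cy.add cv
  set b : ℝ → ℝ := fun t ↦ β K + 8 * C * D t with hb
  have hβ0 : 0 ≤ β K := by simp only [hβ]; positivity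
  have cb : ContinuousOn b (Set.Icc 0 T) := continuousOn_const.add (cD.const_mul _)
  have hIoc : ∀ τ ∈ Set.Icc 0 T, Set.Ioc 0 τ ⊆ Set.Icc 0 T := fun τ hτ ↦
    Set.Ioc_subset_Icc_self.trans (Set.Icc_subset_Icc_right hτ.2)
  have int : ∀ {g : ℝ → ℝ}, ContinuousOn g (Set.Icc 0 T) → ∀ τ ∈ Set.Icc 0 T,
      IntegrableOn g (Set.Ioc 0 τ) := fun hg τ hτ ↦ hg.integrableOn_Icc.mono_set (hIoc τ hτ)
  have main : ∀ τ ∈ Set.Icc 0 T, Y τ ≤ 2 * C * K + ∫ t in Set.Ioc 0 τ, b t * Y t := by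
    intro τ hτ
    have hE := energy_le hT hsol hΨ hτ
    change y τ ≤ _ at hE
    have e1 : -quad (v τ) (Ψ τ) (v τ) (v τ) ≤ y τ / 2 + 64 * C ^ 4 * K ^ 2 * ‖v τ‖ ^ 2 :=
      (hq R K 0 0 (v τ) (v' τ) (Ψ τ) 0 0 (hsol.gradNormSq_lt_top hτ) hK.le le_rfl le_rfl
        (b5' τ hτ)).1
    have c1 : ContinuousOn (fun t ↦ 4 * C * (3 * K + 1 + D t) * Y t) (Set.Icc 0 T) :=
      (continuousOn_const.mul (continuousOn_const.add cD)).mul cY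
    have c2 : ContinuousOn (fun t ↦ C * r t ^ 6) (Set.Icc 0 T) := (c30.pow 6).const_mul C
    have c12 : ContinuousOn (fun t ↦ 4 * C * (3 * K + 1 + D t) * Y t + C * r t ^ 6) (Set.Icc 0 T) :=
      c1.add c2
    have e2 : ∫ t in Set.Ioc 0 τ, (quad (v t) (mult (japanese α) (w t) + Ψ' t) (v t) (v t) -
        (2 * quad (v' t) (Ψ t) (v t) (Ψ t) + quad (v' t) (v t) (Ψ t) (Ψ t) +
          quad (v' t) (Ψ t) (Ψ t) (Ψ t))) ≤
        ∫ t in Set.Ioc 0 τ, (4 * C * (3 * K + 1 + D t) * Y t + C * r t ^ 6) := by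
      refine (Real.le_norm_self _).trans (norm_integral_le_of_norm_le (int c12 τ hτ) ?_)
      filter_upwards [ae_restrict_of_ae_restrict_of_subset (hIoc τ hτ) bW,
        ae_restrict_mem measurableSet_Ioc] with t htW ht
      have ht' := hIoc τ hτ ht
      exact (hq R K (D t) (r t) (v t) (v' t) (Ψ t) (w t) (Ψ' t) (hsol.gradNormSq_lt_top ht') hK.le
        ENNReal.toReal_nonneg ENNReal.toReal_nonneg (b5' t ht')).2 (hw t ht') (hΨ' t ht') htW
        (ENNReal.ofReal_toReal (nrm_lt_top_of_bandLimited (hΨ' t ht') (by norm_num)).ne).ge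
        (ENNReal.ofReal_toReal (hΨ.nrm_lt_top ht' (by norm_num)).ne).ge
    have e3 : ‖v τ‖ ^ 2 ≤ ∫ t in Set.Ioc 0 τ, 4 * Y t := by
      refine (hsol.norm_sq_le hτ).trans (integral_mono_of_nonneg (.of_forall fun t ↦ ?_)
        ((int cY τ hτ).const_mul 4) ?_)
      · simp only [Pi.zero_apply]; positivity
      · filter_upwards [ae_restrict_mem measurableSet_Ioc] with t ht
        have bt := isEnergyBound_realEnergy (v' := v' t) (hsol.gradNormSq_lt_top (hIoc τ hτ ht))
        have h1 := pow_le_pow_left₀ (norm_nonneg _) bt.norm_deriv_le 2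
        rw [show realEnergy (v t) (v' t) = y t from rfl, hF] at h1
        simp only [hY]
        nlinarith [sq_nonneg ‖v t‖]
    have e4 : ∫ t in Set.Ioc 0 τ, (4 * C * (3 * K + 1 + D t) * Y t + C * r t ^ 6) ≤
        (∫ t in Set.Ioc 0 τ, 4 * C * (3 * K + 1 + D t) * Y t) + C * K := by
      rw [integral_add (int c1 τ hτ) (int c2 τ hτ), integral_const_mul C]
      have := mul_le_mul_of_nonneg_left (b30 τ hτ.2) hC
      linarith
    have e5 : ∫ t in Set.Ioc 0 τ, b t * Y t = (128 * C ^ 4 * K ^ 2 + 1) *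
        (∫ t in Set.Ioc 0 τ, 4 * Y t) + 2 * ∫ t in Set.Ioc 0 τ, 4 * C * (3 * K + 1 + D t) * Y t := by
      rw [← integral_const_mul, ← integral_const_mul,
        ← integral_add (((int cY τ hτ).const_mul 4).const_mul _) ((int c1 τ hτ).const_mul _)]
      refine integral_congr_ae (.of_forall fun t ↦ ?_)
      simp only [hb, hβ]
      ring
    have e6 := mul_le_mul_of_nonneg_left e3 (show 0 ≤ 128 * C ^ 4 * K ^ 2 + 1 by positivity)
    rw [e5]
    change y τ + ‖v τ‖ ^ 2 ≤ _
    linarith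
  have fin : ∀ τ ∈ Set.Icc 0 T, Y τ ≤ A K T := by
    intro τ hτ
    refine (le_mul_exp_of_le_integral_Icc cY cb (fun t _ ↦ ?_) main hτ).trans ?_
    · have : 0 ≤ D t := ENNReal.toReal_nonneg
      positivity
    · simp only [hA, abs_of_pos hK, abs_of_pos hT]
      refine mul_le_mul_of_nonneg_left (Real.exp_le_exp.2 ?_) (by positivity)
      have hvol : volume.real (Set.Ioc 0 τ) = τ := by simp [hτ.1]
      have cD10 : ContinuousOn (fun t ↦ D t ^ 10) (Set.Icc 0 T) := cD.pow 10
      -- Since D ≤ 1 + D^10, the assumed L^10 norm in time bounds the integral of D.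
      have h1 : ∫ t in Set.Ioc 0 τ, D t ≤ T + K ^ 10 := by
        calc ∫ t in Set.Ioc 0 τ, D t ≤ ∫ t in Set.Ioc 0 τ, (1 + D t ^ 10) := by
              refine integral_mono (int cD τ hτ)
                (int (continuousOn_const.add (cD.pow 10)) τ hτ) fun t ↦ ?_
              have h0 : 0 ≤ D t := ENNReal.toReal_nonneg
              rcases le_total (D t) 1 with h | h
              · have : 0 ≤ D t ^ 10 := by positivity
                simp only
                linarith
              · have := le_self_pow₀ h (n := 10) (by norm_num)
                simp only
                linarith
          _ ≤ T + K ^ 10 := by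
              rw [integral_add (int continuousOn_const τ hτ) (int cD10 τ hτ)]
              have h3 : ∫ _ in Set.Ioc 0 τ, (1 : ℝ) = τ := by simp [hτ.1]
              rw [h3]
              exact add_le_add hτ.2 (bD τ hτ.2)
      rw [integral_add (int continuousOn_const τ hτ) (int (cD.const_mul _) τ hτ),
        integral_const_mul, setIntegral_const, hvol, smul_eq_mul]
      refine add_le_add ?_ (mul_le_mul_of_nonneg_left h1 (by positivity))
      rw [mul_comm]
      exact mul_le_mul_of_nonneg_left hτ.2 hβ0
  refine ⟨fun t ht ↦ ?_, iSup₂_le fun t ht ↦ ?_⟩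
  · rw [energy_eq (hsol.gradNormSq_lt_top ht)]
    refine ENNReal.ofReal_le_ofReal ?_
    have h1 := fin t ht
    have h2 := hA0 K T
    have h3 := sq_nonneg ‖v t‖
    simp only [hY, hy] at h1
    linarith
  · refine (energySpaceNormSq_le (hsol.gradNormSq_lt_top ht)).trans (ENNReal.ofReal_le_ofReal ?_)
    have h1 := fin t ht
    have h3 := sq_nonneg ‖v t‖
    simp only [hY, hy] at h1
    linarith

/-! ### Band limitation of the truncated data -/

section Cutoff

variable {χ : E5 → ℝ} {N : ℝ}

/-- The symbol of the Littlewood–Paley projection in the frequency variable of `𝓕`. -/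
def cutSymbol (χ : E5 → ℝ) (N : ℝ) (ξ : E5) : ℂ := (χ (N⁻¹ • (2 * Real.pi) • ξ) : ℂ)

lemma norm_scaled_frequency (hN : 0 < N) (ξ : E5) :
    ‖N⁻¹ • (2 * Real.pi) • ξ‖ = N⁻¹ * (2 * Real.pi * ‖ξ‖) := by
  rw [norm_smul, norm_smul, Real.norm_of_nonneg (by positivity),
    Real.norm_of_nonneg (by positivity)]

lemma IsCutoff.cutSymbol_eq_zero (hχ : IsCutoff χ) (hN : 0 < N) {ξ : E5}
    (h : N < Real.pi * ‖ξ‖) : cutSymbol χ N ξ = 0 := by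
  rw [cutSymbol, hχ.eq_zero, Complex.ofReal_zero]
  rw [norm_scaled_frequency hN, inv_mul_eq_div, lt_div_iff₀ hN]
  linarith

lemma IsCutoff.cutSymbol_eq_one (hχ : IsCutoff χ) (hN : 0 < N) {ξ : E5}
    (h : 2 * Real.pi * ‖ξ‖ ≤ N) : cutSymbol χ N ξ = 1 := by
  rw [cutSymbol, hχ.eq_one, Complex.ofReal_one]
  rw [norm_scaled_frequency hN, inv_mul_eq_div, div_le_iff₀ hN]
  linarith

lemma IsCutoff.contDiff_cutSymbol (hχ : IsCutoff χ) : ContDiff ℝ (⊤ : ℕ∞) (cutSymbol χ N) := by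
  have := hχ.smooth
  unfold cutSymbol
  exact Complex.ofRealCLM.contDiff.comp (this.comp (by fun_prop))

lemma IsCutoff.hasCompactSupport_cutSymbol (hχ : IsCutoff χ) (hN : 0 < N) :
    HasCompactSupport (cutSymbol χ N) := by
  refine HasCompactSupport.intro (isCompact_closedBall (0 : E5) (N / Real.pi)) fun ξ hξ ↦ ?_
  refine hχ.cutSymbol_eq_zero hN ?_
  rw [mem_closedBall_zero_iff, not_le, div_lt_iff₀ Real.pi_pos] at hξ
  linarith

lemma IsCutoff.lowFreq_mem (hχ : IsCutoff χ) (hN : 0 < N) (f : L2) :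
    lowFreq χ N f ∈ bandLimited N := by
  have h0 : lowFreq χ N f = fmul (cutSymbol χ N) f := rfl
  rw [h0]
  by_cases h : MemLp (fun ξ : E5 ↦ cutSymbol χ N ξ * (𝓕 f : L2) ξ) 2 volume
  · rw [mem_bandLimited_iff]
    filter_upwards [fourier_fmul h] with ξ h1 hξ
    rw [h1, hχ.cutSymbol_eq_zero hN (by nlinarith [Real.pi_gt_three]), zero_mul]
  · rw [fmul, dif_neg h]; exact (bandLimited N).zero_mem

lemma toTemperedDistribution_injective :
    Function.Injective fun f : L2 ↦ (f : 𝓢'(E5, ℂ)) := by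
  have h := Lp.ker_toTemperedDistributionCLM_eq_bot (E := E5) (F := ℂ) (μ := volume) (p := 2)
  exact LinearMap.ker_eq_bot.1 h

/-- A square integrable function which is fixed, as a distribution, by a smooth multiplier has no
frequencies where the multiplier vanishes. -/
lemma fourier_eq_of_multiplier_eq {θ : E5 → ℂ} (hθ : θ.HasTemperateGrowth)
    (hθ' : MemLp θ ∞ volume) {f : L2}
    (h : TemperedDistribution.fourierMultiplierCLM ℂ θ (f : 𝓢'(E5, ℂ)) = (f : 𝓢'(E5, ℂ))) :
    (𝓕 f : L2) =ᵐ[volume] fun ξ ↦ θ ξ * (𝓕 f : L2) ξ := by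
  rw [TemperedDistribution.fourierMultiplierCLM_apply, Lp.fourier_toTemperedDistribution_eq,
    ← Lp.toTemperedDistribution_smul_eq (p := ∞) (r := 2) hθ hθ',
    Lp.fourierInv_toTemperedDistribution_eq] at h
  have h1 := congrArg (fun g : L2 ↦ (𝓕 g : L2)) (toTemperedDistribution_injective h)
  simp only [FourierTransform.fourier_fourierInv_eq] at h1
  filter_upwards [Lp.coeFn_lpSMul (r := 2) (hθ'.toLp _) (𝓕 f : L2), hθ'.coeFn_toLp] with ξ h2 h3
  rw [h1] at h2
  exact h2.trans (by rw [Pi.smul_apply', h3, smul_eq_mul])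

/-- The cutoff θ at scale 2N is 1 on the support of the cutoff at scale N, so as a multiplier it
fixes the truncated distribution; an L² representative must then have its frequencies in the support
of θ. In the variable of 𝓕 that support lies in the ball of radius 2N/π < N. -/
lemma IsCutoff.truncatedDatum_mem (hχ : IsCutoff χ) (hN : 0 < N) (ψ : 𝓢(E5, ℝ))
    (g : (Fin 5 → ℤ) → ℂ) (u : 𝓢'(E5, ℂ)) : truncatedDatum χ ψ N g u ∈ bandLimited N := by
  set m : (Fin 5 → ℤ) → E5 → ℂ := fun n ξ ↦ ((χ (N⁻¹ • (2 * Real.pi) • ξ) *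
      ψ ((2 * Real.pi) • ξ - latticePoint n) : ℝ) : ℂ) with hm
  set D : 𝓢'(E5, ℂ) := ∑ᶠ n, g n • TemperedDistribution.fourierMultiplierCLM ℂ (m n) u with hD
  change l2Rep D ∈ _
  have h2N : 0 < 2 * N := by positivity
  set θ := cutSymbol χ (2 * N) with hθ
  have gθ : θ.HasTemperateGrowth :=
    (hχ.hasCompactSupport_cutSymbol h2N).hasTemperateGrowth hχ.contDiff_cutSymbol
  have hmn : ∀ n, m n = fun ξ ↦ cutSymbol χ N ξ *
      (ψ ((2 * Real.pi) • ξ - latticePoint n) : ℂ) := fun n ↦ by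
    ext ξ
    simp only [hm, cutSymbol, Complex.ofReal_mul]
  have gm : ∀ n, (m n).HasTemperateGrowth := fun n ↦ by
    rw [hmn]
    refine HasCompactSupport.hasTemperateGrowth
      ((hχ.hasCompactSupport_cutSymbol hN).mul_right) (hχ.contDiff_cutSymbol.mul ?_)
    exact Complex.ofRealCLM.contDiff.comp ((ψ.smooth ⊤).comp (by fun_prop))
  have hmθ : ∀ n, m n * θ = m n := fun n ↦ by
    ext ξ
    rw [Pi.mul_apply, hmn]
    simp only
    by_cases h : N < Real.pi * ‖ξ‖
    · rw [hχ.cutSymbol_eq_zero hN h]; simp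
    · rw [hθ, hχ.cutSymbol_eq_one h2N (by linarith), mul_one]
  have hDθ : TemperedDistribution.fourierMultiplierCLM ℂ θ D = D := by
    -- If infinitely many terms were nonzero, the formal sum would be 0 by convention, and the claim
    -- would be trivial.
    by_cases hfin : (Function.support fun n ↦
        g n • TemperedDistribution.fourierMultiplierCLM ℂ (m n) u).Finite
    · rw [hD, finsum_eq_sum _ hfin, map_sum]
      refine Finset.sum_congr rfl fun n _ ↦ ?_
      rw [map_smul, TemperedDistribution.fourierMultiplierCLM_fourierMultiplierCLM_apply (gm n) gθ,
        hmθ]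
    · rw [hD, finsum_of_infinite_support hfin, map_zero]
  unfold l2Rep
  split_ifs with h
  · have hf := h.choose_spec
    set f := h.choose
    have hθ' : MemLp θ ∞ volume := hχ.contDiff_cutSymbol.continuous.memLp_of_hasCompactSupport
      (hχ.hasCompactSupport_cutSymbol h2N)
    rw [mem_bandLimited_iff]
    filter_upwards [fourier_eq_of_multiplier_eq gθ hθ' (f := f) (by rw [← hf]; exact hDθ)]
      with ξ h1 hξ
    rw [h1, hθ, hχ.cutSymbol_eq_zero h2N (by nlinarith [Real.pi_gt_three]), zero_mul]
  · exact (bandLimited N).zero_mem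

end Cutoff

/-! ### The linear evolution of band-limited data -/

section Wave

variable {R : ℝ} {f f₀ f₁ : L2}

lemma memLp_freq_mul (hf : f ∈ bandLimited R) :
    MemLp (fun ξ : E5 ↦ (freq ξ : ℂ) * (𝓕 f : L2) ξ) 2 volume := by
  refine memLp_mul_fourier_of_bandLimited hf (by fun_prop) (C := 2 * Real.pi * R) fun ξ hξ ↦ ?_
  rw [Complex.norm_real, Real.norm_of_nonneg (freq_nonneg ξ), freq, norm_smul,
    Real.norm_of_nonneg (by positivity)]
  gcongr

lemma hasDerivAt_symCos (t : ℝ) (ξ : E5) :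
    HasDerivAt (fun t ↦ symCos t ξ) (-(symSin t ξ * freq ξ)) t := by
  have h1 : HasDerivAt (fun t : ℝ ↦ Real.cos (t * freq ξ)) (-(Real.sin (t * freq ξ) * freq ξ)) t := by
    have := (Real.hasDerivAt_cos (t * freq ξ)).comp t ((hasDerivAt_id t).mul_const (freq ξ))
    simpa [Function.comp_def] using this
  have := h1.ofReal_comp
  simpa [symSin, symCos] using this

lemma norm_symCos_sub_le (t t' : ℝ) (ξ : E5) : ‖symCos t ξ - symCos t' ξ‖ ≤ |t - t'| * freq ξ := by
  rw [symCos, symCos, ← Complex.ofReal_sub, Complex.norm_real, Real.norm_eq_abs]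
  have := Real.lipschitzWith_cos.dist_le_mul (t * freq ξ) (t' * freq ξ)
  rw [Real.dist_eq, Real.dist_eq, ← sub_mul, abs_mul, abs_of_nonneg (freq_nonneg ξ)] at this
  simpa using this

/-- The difference quotients of the symbol are bounded by |η|. The band limitation makes |η| f̂
square integrable, so dominated convergence applies. -/
lemma hasDerivAt_waveCos (hf : f ∈ bandLimited R) (t : ℝ) :
    HasDerivAt (fun t ↦ waveCos t f) (-waveSin t (fmul (fun ξ ↦ (freq ξ : ℂ)) f)) t := by
  have hfr := memLp_freq_mul hf
  have e0 : fmul (fun ξ ↦ -(symSin t ξ * freq ξ)) f =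
      -waveSin t (fmul (fun ξ ↦ (freq ξ : ℂ)) f) := by
    refine fmul_eq_of_fourier ?_
    rw [← neg_one_smul ℂ]
    filter_upwards [fourier_smul_ae (-1) (waveSin t (fmul (fun ξ ↦ (freq ξ : ℂ)) f)),
      fourier_waveSin t (fmul (fun ξ ↦ (freq ξ : ℂ)) f), fourier_fmul hfr] with ξ h1 h2 h3
    rw [h1, h2, h3]
    ring
  rw [← e0, hasDerivAt_iff_tendsto_slope]
  have e : slope (fun t ↦ waveCos t f) t = fun y ↦
      fmul (fun ξ ↦ (((y - t)⁻¹ : ℝ) : ℂ) * (symCos y ξ - symCos t ξ)) f := by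
    ext1 y
    rw [fmul_smul_sub (measurable_symCos y) (measurable_symCos t) (norm_symCos_le y)
      (norm_symCos_le t), slope_def_module]
    simp only [waveCos, fmulL_apply]
  rw [e]
  have hms := measurable_symSin t
  refine tendsto_fmul (B := fun ξ ↦ ‖(freq ξ : ℂ) * (𝓕 f : L2) ξ‖) hfr.norm (fun y ↦ ?_)
    (by fun_prop) (.of_forall fun y ↦ .of_forall fun ξ ↦ ?_) (.of_forall fun ξ ↦ ?_) ?_
  · have := measurable_symCos t
    have := measurable_symCos y
    fun_prop
  · rw [norm_mul _ ((𝓕 f : L2) ξ), norm_mul _ ((𝓕 f : L2) ξ)]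
    refine mul_le_mul_of_nonneg_right ?_ (norm_nonneg _)
    rw [norm_mul, Complex.norm_real, Complex.norm_real, norm_inv, Real.norm_eq_abs,
      Real.norm_of_nonneg (freq_nonneg ξ)]
    exact inv_mul_le_of_le_mul₀ (abs_nonneg _) (freq_nonneg ξ) (norm_symCos_sub_le y t ξ)
  · rw [norm_mul, norm_mul, norm_neg, norm_mul]
    refine mul_le_mul_of_nonneg_right ?_ (norm_nonneg _)
    exact mul_le_of_le_one_left (norm_nonneg _) (norm_symSin_le t ξ)
  · refine .of_forall fun ξ ↦ Tendsto.mul_const _ ?_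
    have := hasDerivAt_iff_tendsto_slope.1 (hasDerivAt_symCos t ξ)
    refine this.congr fun y ↦ ?_
    rw [slope_def_module, Complex.real_smul]

lemma S_eq (t : ℝ) (f₀ f₁ : L2) : S t f₀ f₁ = waveCos t f₀ + waveQ t f₁ := by
  rw [S, Q_eq, mult_cos_eq]

/-- The time derivative of the linear evolution. -/
def waveDeriv (t : ℝ) (f₀ f₁ : L2) : L2 :=
  -waveSin t (fmul (fun ξ ↦ (freq ξ : ℂ)) f₀) + waveCos t f₁

lemma hasDerivAt_S (h₀ : f₀ ∈ bandLimited R) (t : ℝ) :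
    HasDerivAt (fun t ↦ S t f₀ f₁) (waveDeriv t f₀ f₁) t := by
  simp only [S_eq]
  exact (hasDerivAt_waveCos h₀ t).add (hasDerivAt_waveQ t f₁)

lemma continuous_waveDeriv (f₀ f₁ : L2) : Continuous fun t ↦ waveDeriv t f₀ f₁ :=
  (continuous_waveSin _).neg.add (continuous_waveCos _)

lemma S_mem_bandLimited (h₀ : f₀ ∈ bandLimited R) (h₁ : f₁ ∈ bandLimited R) (t : ℝ) :
    S t f₀ f₁ ∈ bandLimited R :=
  (bandLimited R).add_mem (fmul_mem_bandLimited h₀ _) (fmul_mem_bandLimited h₁ _)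

lemma Stilde_mem_bandLimited (h₀ : f₀ ∈ bandLimited R) (h₁ : f₁ ∈ bandLimited R) (t : ℝ) :
    Stilde t f₀ f₁ ∈ bandLimited R :=
  (bandLimited R).add_mem (fmul_mem_bandLimited h₀ _) (fmul_mem_bandLimited h₁ _)

lemma mult_mem_bandLimited (hf : f ∈ bandLimited R) (m : E5 → ℝ) : mult m f ∈ bandLimited R :=
  fmul_mem_bandLimited hf _

lemma japanese_pos (σ : ℝ) (η : E5) : 0 < japanese σ η := by unfold japanese; positivity

lemma continuous_japanese (σ : ℝ) : Continuous (japanese σ) := by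
  unfold japanese
  exact (by fun_prop : Continuous fun η : E5 ↦ 1 + ‖η‖ ^ 2).rpow_const
    fun η ↦ Or.inl (by positivity)

lemma fourier_mult_of_bandLimited (hf : f ∈ bandLimited R) {m : E5 → ℝ} (hm : Continuous m) :
    (𝓕 (mult m f) : L2) =ᵐ[volume] fun ξ ↦ (m ((2 * Real.pi) • ξ) : ℂ) * (𝓕 f : L2) ξ := by
  have hc : Continuous fun ξ : E5 ↦ ((m ((2 * Real.pi) • ξ) : ℝ) : ℂ) := by fun_prop
  obtain ⟨C, hC⟩ := (isCompact_closedBall (0 : E5) R).exists_bound_of_continuousOn hc.continuousOn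
  exact fourier_fmul (memLp_mul_fourier_of_bandLimited hf hc.measurable (C := C)
    fun ξ hξ ↦ hC ξ (by simpa using hξ))

/-- `∂ₜ S = ⟨∇⟩ S̃` on band-limited data. -/
lemma mult_japanese_Stilde (h₀ : f₀ ∈ bandLimited R) (h₁ : f₁ ∈ bandLimited R) {α σ : ℝ}
    (h : α + σ = 1) (t : ℝ) :
    mult (japanese α) (mult (japanese σ) (Stilde t f₀ f₁)) = waveDeriv t f₀ f₁ := by
  have hS := Stilde_mem_bandLimited h₀ h₁ t
  have hj : ∀ η, japanese 1 η ≠ 0 := fun η ↦ (japanese_pos 1 η).ne'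
  have hjc := continuous_japanese 1
  refine L2_ext_fourier ?_
  unfold waveDeriv
  rw [← neg_one_smul ℂ (waveSin t _)]
  filter_upwards [fourier_mult_of_bandLimited (mult_mem_bandLimited hS (japanese σ))
      (continuous_japanese α), fourier_mult_of_bandLimited hS (continuous_japanese σ),
    fourier_add_ae (mult (fun η ↦ -(‖η‖ / japanese 1 η * Real.sin (t * ‖η‖))) f₀)
      (mult (fun η ↦ Real.cos (t * ‖η‖) / japanese 1 η) f₁),
    fourier_mult_of_bandLimited h₀ (m := fun η ↦ -(‖η‖ / japanese 1 η * Real.sin (t * ‖η‖)))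
      (((continuous_norm.div hjc hj).mul (by fun_prop)).neg),
    fourier_mult_of_bandLimited h₁ (m := fun η ↦ Real.cos (t * ‖η‖) / japanese 1 η)
      ((by fun_prop : Continuous fun η : E5 ↦ Real.cos (t * ‖η‖)).div hjc hj),
    fourier_add_ae ((-1 : ℂ) • waveSin t (fmul (fun ξ ↦ (freq ξ : ℂ)) f₀)) (waveCos t f₁),
    fourier_smul_ae (-1) (waveSin t (fmul (fun ξ ↦ (freq ξ : ℂ)) f₀)),
    fourier_waveSin t (fmul (fun ξ ↦ (freq ξ : ℂ)) f₀), fourier_fmul (memLp_freq_mul h₀),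
    fourier_waveCos t f₁] with ξ k1 k2 k3 k4 k5 k6 k7 k8 k9 k10
  rw [k1, k2, Stilde, k3, k4, k5, k6, k7, k8, k9, k10, symSin, symCos, freq]
  set η : E5 := (2 * Real.pi) • ξ
  have hprod : (japanese α η : ℂ) * japanese σ η = japanese 1 η := by
    rw [← Complex.ofReal_mul, japanese, japanese, japanese, ← Real.rpow_add (by positivity),
      ← add_div, h]
  have hj' : (japanese 1 η : ℂ) ≠ 0 := Complex.ofReal_ne_zero.2 (hj η)
  rw [← mul_assoc, hprod]
  push_cast
  field_simp

/-- The perturbation of the equation by a linear wave and a band-limited forcing. -/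
lemma isPerturbation_S_add {T α σ : ℝ} (h₀ : f₀ ∈ bandLimited R) (h₁ : f₁ ∈ bandLimited R)
    (h : α + σ = 1) {Ψ Ψ' : ℝ → L2} (hΨ : ∀ t ∈ Set.Icc 0 T, Ψ t ∈ bandLimited R)
    (hΨ' : ∀ t ∈ Set.Icc 0 T, Ψ' t ∈ bandLimited R)
    (hd : ∀ t ∈ Set.Icc 0 T, HasDerivWithinAt Ψ (Ψ' t) (Set.Icc 0 T) t)
    (hc : ContinuousOn Ψ' (Set.Icc 0 T)) :
    IsPerturbation R T (fun t ↦ S t f₀ f₁ + Ψ t)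
      (fun t ↦ mult (japanese α) (mult (japanese σ) (Stilde t f₀ f₁)) + Ψ' t) where
  band t ht := (bandLimited R).add_mem (S_mem_bandLimited h₀ h₁ t) (hΨ t ht)
  band_deriv t ht := (bandLimited R).add_mem
    (mult_mem_bandLimited (mult_mem_bandLimited (Stilde_mem_bandLimited h₀ h₁ t) _) _) (hΨ' t ht)
  deriv t ht := by
    rw [mult_japanese_Stilde h₀ h₁ h]
    exact (hasDerivAt_S h₀ t).hasDerivWithinAt.add (hd t ht)
  continuous_deriv := by
    simp only [mult_japanese_Stilde h₀ h₁ h]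
    exact (continuous_waveDeriv f₀ f₁).continuousOn.add hc

end Wave

/-! ### Band limitation of the stochastic convolution -/

section Stochastic

variable {Ω : Type*} [MeasurableSpace Ω] {P : Measure Ω} {R : ℝ}

/-- The band-limited functions form the kernel of a bounded operator A, and A X = A(X - Yₙ) tends to
0 in mean square. -/
lemma ae_mem_bandLimited_of_tendsto {X : Ω → L2} (hX : AEStronglyMeasurable X P)
    {Y : ℕ → Ω → L2} (hY : ∀ n, ∀ᵐ ω ∂P, Y n ω ∈ bandLimited R)
    (h : Tendsto (fun n ↦ eLpNorm (fun ω ↦ X ω - Y n ω) 2 P) atTop (𝓝 0)) :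
    ∀ᵐ ω ∂P, X ω ∈ bandLimited R := by
  set A := lowProj R - ContinuousLinearMap.id ℂ L2 with hA
  have h1 : ∀ n, eLpNorm (fun ω ↦ A (X ω)) 2 P ≤
      ENNReal.ofReal ‖A‖ * eLpNorm (fun ω ↦ X ω - Y n ω) 2 P := fun n ↦ by
    refine eLpNorm_le_mul_eLpNorm_of_ae_le_mul ?_ 2
    filter_upwards [hY n] with ω hω
    have h2 : A (Y n ω) = 0 := hω
    have h3 : A (X ω) = A (X ω - Y n ω) := by rw [map_sub, h2, sub_zero]
    rw [h3]
    exact A.le_opNorm _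
  have h2 : eLpNorm (fun ω ↦ A (X ω)) 2 P ≤ 0 := by
    have := ENNReal.Tendsto.const_mul (a := ENNReal.ofReal ‖A‖) h (Or.inr ENNReal.ofReal_ne_top)
    rw [mul_zero] at this
    exact ge_of_tendsto' this h1
  have h3 := (eLpNorm_eq_zero_iff (A.continuous.comp_aestronglyMeasurable hX) (by norm_num)).1
    (le_antisymm h2 zero_le)
  filter_upwards [h3] with ω hω
  exact hω

lemma IsWienerIntegral.ae_mem_bandLimited {B : ℝ≥0 → Ω → ℝ} {G : ℝ → L2} {t : ℝ} {I : Ω → L2}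
    (h : IsWienerIntegral P B G t I) (hG : ∀ r, G r ∈ bandLimited R) :
    ∀ᵐ ω ∂P, I ω ∈ bandLimited R :=
  ae_mem_bandLimited_of_tendsto h.1 (fun _ ↦ .of_forall fun _ ↦
    (bandLimited R).sum_mem fun _ _ ↦ (bandLimited R).smul_of_tower_mem _ (hG _)) h.2

lemma mem_bandLimited_of_hasDerivWithinAt {f : ℝ → L2} {f' : L2} {t : ℝ} (ht : 0 ≤ t)
    (hf : ∀ r, 0 ≤ r → f r ∈ bandLimited R) (h : HasDerivWithinAt f f' (Set.Ici 0) t) :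
    f' ∈ bandLimited R := by
  have h1 := h.mono (Set.Ioi_subset_Ici ht)
  rw [hasDerivWithinAt_iff_tendsto_slope' (by simp)] at h1
  refine (isClosed_bandLimited R).mem_of_tendsto h1 ?_
  filter_upwards [eventually_mem_nhdsWithin] with r hr
  exact (bandLimited R).smul_of_tower_mem _
    ((bandLimited R).sub_mem (hf r (ht.trans (le_of_lt hr))) (hf t ht))

/-- Band limitation passes from the Riemann sums to the Wiener integrals, to the series and, by
closedness of the subspace, to path limits and derivatives. -/
lemma IsStochasticConvolution.ae_mem_bandLimited {β : ℕ → ℝ≥0 → Ω → ℝ} {h : ℕ → L2}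
    {Ψ Ψ' : ℝ → Ω → L2} (hΨ : IsStochasticConvolution P β h Ψ Ψ')
    (hh : ∀ k, h k ∈ bandLimited R) :
    ∀ᵐ ω ∂P, ∀ t, 0 ≤ t → Ψ t ω ∈ bandLimited R ∧ Ψ' t ω ∈ bandLimited R := by
  obtain ⟨I, hI, hs⟩ := hΨ.series
  have h1 : ∀ t, 0 ≤ t → ∀ᵐ ω ∂P, Ψ t ω ∈ bandLimited R := fun t ht ↦ by
    refine ae_mem_bandLimited_of_tendsto (hΨ.measurable t ht) (fun n ↦ ?_) (hs t ht)
    have h2 : ∀ᵐ ω ∂P, ∀ k, I k t ω ∈ bandLimited R := ae_all_iff.2 fun k ↦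
      (hI k t ht).ae_mem_bandLimited fun r ↦ mult_mem_bandLimited (hh k) _
    filter_upwards [h2] with ω hω
    exact (bandLimited R).sum_mem fun k _ ↦ hω k
  -- The exceptional null set depends on the time. Rational times give a common one, and continuity
  -- of the paths extends the property to all times.
  have h2 : ∀ᵐ ω ∂P, ∀ q : ℚ, 0 ≤ (q : ℝ) → Ψ q ω ∈ bandLimited R := by
    refine ae_all_iff.2 fun q ↦ ?_
    by_cases hq : 0 ≤ (q : ℝ)
    · filter_upwards [h1 q hq] with ω hω _ using hω
    · exact .of_forall fun ω h0 ↦ absurd h0 hq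
  filter_upwards [h2, hΨ.paths] with ω hω hp
  have h3 : ∀ t, 0 ≤ t → Ψ t ω ∈ bandLimited R := fun t ht ↦ by
    obtain ⟨u, -, hu, hlim⟩ := Real.exists_seq_rat_strictAnti_tendsto t
    have hlim' : Tendsto (fun n ↦ (u n : ℝ)) atTop (𝓝[Set.Ici 0] t) :=
      tendsto_nhdsWithin_iff.2 ⟨hlim, .of_forall fun n ↦ ht.trans (hu n).le⟩
    exact (isClosed_bandLimited R).mem_of_tendsto ((hp.1 t ht).continuousWithinAt.tendsto.comp hlim')
      (.of_forall fun n ↦ hω _ (ht.trans (hu n).le))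
  exact fun t ht ↦ ⟨h3 t ht, mem_bandLimited_of_hasDerivWithinAt ht h3 (hp.1 t ht)⟩

end Stochastic

end HartreeWave

end


/-! ### The uniform energy bound for the truncated equations -/

theorem proposition4p6 (s δ : ℝ) (hs : 1 / 2 < s) (hs1 : s < 1) (hδ : 0 < δ)
    (hδs : 1 / 2 + δ < s) :
    ∃ C : ℝ → ℝ → ℝ, (∀ K T, 0 < C K T) ∧
      ∀ (Ω : Type*) [MeasurableSpace Ω] (P : Measure Ω) [IsProbabilityMeasure P]
        -- the cutoffs of the Littlewood–Paley and of the uniform decomposition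
        (χ : E5 → ℝ) (_ : IsCutoff χ) (ψ : 𝓢(E5, ℝ)) (_ : IsUniformBump ψ)
        -- the noise
        (e : HilbertBasis ℕ ℝ L2R) (β : ℕ → ℝ≥0 → Ω → ℝ) (_ : IsBrownianFamily P β)
        (φ : L2R →L[ℝ] L2R) (_ : IsHilbertSchmidtH1 e φ)
        -- the initial data `(u₀, u₁) ∈ H^s × H^(s-1)` and the random coefficients
        (u₀ u₁ : 𝓢'(E5, ℂ)) (_ : IsRealDistribution u₀) (_ : IsRealDistribution u₁)
        (_ : TemperedDistribution.MemSobolev s 2 u₀)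
        (_ : TemperedDistribution.MemSobolev (s - 1) 2 u₁)
        (g : (Fin 5 → ℤ) → Fin 2 → Ω → ℂ) (_ : IsRandomCoeff P β g)
        -- the dyadic number `N = 2 ^ k` and the stochastic convolution `Ψ_N`
        (k : ℕ) (N : ℝ) (_ : N = 2 ^ k) (Ψ Ψ' : ℝ → Ω → L2)
        (_ : IsStochasticConvolution P β (fun j ↦ lowFreq χ N (complexify (φ (e j)))) Ψ Ψ'),
        ∀ᵐ ω ∂P,
          let u₀N : L2 := truncatedDatum χ ψ N (fun n ↦ g n 0 ω) u₀
          let u₁N : L2 := truncatedDatum χ ψ N (fun n ↦ g n 1 ω) u₁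
          let Ψtilde : ℝ → L2 := fun t ↦ S t u₀N u₁N + Ψ t ω
          let ztilde : ℝ → L2 := fun t ↦ Stilde t u₀N u₁N
          ∀ K T : ℝ, 0 < K → 0 < T →
            normZ T Ψtilde < ENNReal.ofReal K →
            normY s δ T ztilde < ENNReal.ofReal K →
            mixedNorm 10 (10 / 3) T (fun t ↦ Ψ' t ω) < ENNReal.ofReal K →
            ∀ v v' : ℝ → L2, IsSolution T Ψtilde v v' →
              (∀ t ∈ Set.Icc 0 T, energy (v t) (v' t) ≤ ENNReal.ofReal (C K T)) ∧
              (⨆ t ∈ Set.Icc 0 T, energySpaceNormSq (v t) (v' t)) ≤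
                ENNReal.ofReal (C K T) := by
  -- Of the full derivative in ∂ₜS = ⟨∇⟩S̃ the Y norm covers s - δ; the remainder α is below 1/2
  -- exactly because s - δ > 1/2.
  obtain ⟨C, hC0, hC⟩ := exists_energy_bound (α := 1 - (s - δ)) (by linarith) (by linarith)
  refine ⟨C, hC0, ?_⟩
  intro Ω _ P _ χ hχ ψ _ e β _ φ _ u₀ u₁ _ _ _ _ g _ k N hNk Ψ Ψ' hΨ
  have hN : 0 < N := by rw [hNk]; positivity
  -- The almost sure event consists of band limitation and C¹ paths only, so it does not depend on
  -- K, T or the solution. The number N enters merely as the band radius, on which the constant does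
  -- not depend.
  filter_upwards [hΨ.ae_mem_bandLimited (fun j ↦ hχ.lowFreq_mem hN _), hΨ.paths] with ω hω hp
  intro u₀N u₁N Ψtilde ztilde K T hK hT hZ hY hD v v' hsol
  have h₀ : u₀N ∈ bandLimited N := hχ.truncatedDatum_mem hN ψ _ u₀
  have h₁ : u₁N ∈ bandLimited N := hχ.truncatedDatum_mem hN ψ _ u₁
  refine hC N K T hK hT Ψtilde (fun t ↦ mult (japanese (s - δ)) (ztilde t)) (fun t ↦ Ψ' t ω) ?_
    (fun t _ ↦ mult_mem_bandLimited (Stilde_mem_bandLimited h₀ h₁ t) _)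
    (fun t ht ↦ (hω t ht.1).2) (hp.2.mono Set.Icc_subset_Ici_self) hZ
    (le_add_self.trans_lt hY) hD v v' hsol
  exact isPerturbation_S_add h₀ h₁ (sub_add_cancel 1 (s - δ)) (fun t ht ↦ (hω t ht.1).1)
    (fun t ht ↦ (hω t ht.1).2)
    (fun t ht ↦ (hp.1 t ht.1).mono Set.Icc_subset_Ici_self)
    (hp.2.mono Set.Icc_subset_Ici_self)
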